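/- **Setting.** All forests are ordered, with nodes labelled by symbols of a finite alphabet $\Sigma$; $|F|$ is the number of nodes of $F$. The edit distance $\mathsf{ed}(F_1,F_2)$ is the minimum total number of operations (relabelling a node; removing a node, its children taking its place) performed on $F_1$ and $F_2$ that makes them identical, and $\mathsf{sim}(F_1,F_2)=|F_1|+|F_2|-\mathsf{ed}(F_1,F_2)$. Let $\eta(u,v)=2$ if $u,v$ have the same label and $1$ otherwise. In the depth-first traversal of a forest each node is written down when it is entered and when it is left; $\mathsf l(v)$ is the first position of $v$ in this sequence and $\mathsf r(v)$ is one plus the second. For a fixed tree $T_2$ let $T_2[i,j)$ ($1\le i\le j\le 2|T_2|+1$) be the forest obtained from $T_2$ by removing all nodes $v$ except those with $i\le \mathsf l(v)$ and $\mathsf r(v)\le j$. For a forest $G$, $S(G)$ is the $(2|T_2|+1)\times(2|T_2|+1)$ matrix with entries $\mathsf{sim}(G,T_2[i,j))$ if $i\le j$ and $-\infty$ if $i>j$. For a tree $T$, the restricted similarity matrix $\hat S(T)$ has the entries $$\hat s_{i,j}(T)=\max_{v\in T_2[i,j)}\bigl\{\mathsf{sim}(T-\mathsf{root}(T),\ \mathsf{sub}(v)-v)+\eta(\mathsf{root}(T),v)\bigr\},$$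 and $-\infty$ if $i>j$ or $T_2[i,j)=\emptyset$. Let $F$ be a forest and $F'$ a synchronous subforest of $F$: $F'$ consists of the subtrees of a block of consecutive children of a node $u_k$ of $F$ (or of the virtual root $u_0$ of $F$); the block may be empty. Let $u_0\to u_1\to\dots\to u_k$ be the path from the virtual root of $F$ to $u_k$. **Computation model.** A random access machine (arithmetic, comparison, indirect addressing), all of whose words are bounded by a polynomial in $|F|+|T_2|+|\Sigma|$, with additional unit-cost operations on $(2|T_2|+1)\times(2|T_2|+1)$ matrices: create the all-$(-\infty)$ matrix; copy a matrix; from $A$ produce $\mathsf{rangemax}(A,i',j',x)$, which replaces $a_{ij}$ by $\max(a_{ij},x)$ for all $i\le i'$, $j\ge j'$; query $A_{ij}$; query $\min\{j: A_{ij}\ge x\}$ for given $i,x$; query $\max\{i: A_{ij}\ge x\}$ for given $j,x$ (the last two queries may return any index if the set is empty). Matrices can be accessed only through these operations. A matrix is known (computed) if it is stored as such a matrix. **Lemma.** There are a single deterministic program and absolute constants $C,c$ such that for all $F,F',T_2$ as above and every $1\le x\le k$ the following holds. Given random access to $F$ (traversal sequence with labels, the positions of $F'$ and of $u_1,\dots,u_k$)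 and to $T_2$, and given the matrices $S(F')$ and $\hat S(\mathsf{sub}(u_y))$ for all $x<y\le k$, the program computes $\hat S(\mathsf{sub}(u_x))$ in time at most $$C\,|T_2|\,(|F|-|F'|)^2\,(\lfloor\log_2|T_2|\rfloor+1)^{c},$$ that is, in $\tilde O(|T_2|(|F|-|F'|)^2)$ time. -/

import Mathlib

namespace TED

/-! ### Ordered labelled forests -/

/-- Ordered forests with node labels in `α`: the empty forest, or a leftmost tree (root label
and forest of the children's subtrees) followed by the remaining trees. -/
inductive Forest (α : Type) : Type
  | nil : Forest α
  | cons (label : α) (kids : Forest α) (rest : Forest α) : Forest α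

/-- Ordered labelled rooted trees. -/
structure OTree (α : Type) : Type where
  label : α
  kids : Forest α

namespace Forest

variable {α : Type}

/-- The number of nodes. -/
def size : Forest α → ℕ
  | nil => 0
  | cons _ c r => c.size + r.size + 1

/-- Concatenation from left to right. -/
def append : Forest α → Forest α → Forest α
  | nil, g => g
  | cons a c r, g => cons a c (r.append g)

instance : Append (Forest α) := ⟨append⟩

/-- One edit operation: relabel a node, or remove a node, its children taking its place. -/
inductive Edit : Forest α → Forest α → Prop
  | relabel (a b : α) (c r : Forest α) : Edit (cons a c r) (cons b c r)
  | delete (a : α) (c r : Forest α) : Edit (cons a c r) (c ++ r)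
  | kids {c c' : Forest α} (a : α) (r : Forest α) (h : Edit c c') : Edit (cons a c r) (cons a c' r)
  | rest {r r' : Forest α} (a : α) (c : Forest α) (h : Edit r r') : Edit (cons a c r) (cons a c r')

/-- `EditSeq k f g`: some sequence of exactly `k` operations turns `f` into `g`. -/
inductive EditSeq : ℕ → Forest α → Forest α → Prop
  | refl (f : Forest α) : EditSeq 0 f f
  | step {k : ℕ} {f g h : Forest α} (e : Edit f g) (s : EditSeq k g h) : EditSeq (k + 1) f h

/-- The (unweighted) edit distance: the least total number of operations on `f` and on `g` that
makes the two forests identical. -/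
noncomputable def ed (f g : Forest α) : ℕ :=
  sInf {n | ∃ (p q : ℕ) (h : Forest α), EditSeq p f h ∧ EditSeq q g h ∧ n = p + q}

theorem size_append (f g : Forest α) : (f ++ g).size = f.size + g.size := by
  induction f with
  | nil => show g.size = 0 + g.size; omega
  | cons a c r _ ih =>
    show c.size + (r ++ g).size + 1 = c.size + r.size + 1 + g.size
    omega

theorem editSeq_nil (n : ℕ) : ∀ f : Forest α, f.size = n → EditSeq n f nil := by
  induction n with
  | zero =>
    intro f hf
    cases f with
    | nil => exact .refl _
    | cons a c r => simp [size] at hf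
  | succ n ih =>
    intro f hf
    cases f with
    | nil => simp [size] at hf
    | cons a c r =>
      refine .step (.delete a c r) (ih _ ?_)
      rw [size_append]
      simp only [size] at hf
      omega

/-- The subtraction in the definition of the similarity is never truncated. -/
theorem ed_le (f g : Forest α) : ed f g ≤ f.size + g.size :=
  Nat.sInf_le ⟨_, _, nil, editSeq_nil _ f rfl, editSeq_nil _ g rfl, rfl⟩

/-- The similarity of two forests. -/
noncomputable def sim (f g : Forest α) : ℕ := f.size + g.size - ed f g

end Forest

variable {α : Type}

/-- The tree as a forest with a single tree. -/
def OTree.toForest (T : OTree α) : Forest α := .cons T.label T.kids .nil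

/-- The number of nodes of a tree. -/
def OTree.size (T : OTree α) : ℕ := T.toForest.size

/-- `η(a, b)` is `2` for equal symbols and `1` for different ones. -/
def eta [DecidableEq α] (a b : α) : ℕ := if a = b then 2 else 1

/-! ### Positions in the bi-order traversal sequence

The `2 * size` positions of the traversal are numbered from `0`. A node `u` is named by
`l(u)`, the position at which it is entered; `r(u)` is one plus the position at which it is left. -/

/-- An occurrence of a node in a forest: its position `l` and its subtree. -/
structure Node (α : Type) : Type where
  l : ℕ
  sub : OTree α

/-- One plus the position at which the node is left. -/
def Node.r (v : Node α) : ℕ := v.l + 2 * v.sub.kids.size + 2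

namespace Forest

/-- The nodes of a forest, in preorder, when its traversal starts at position `o`. -/
def nodes (o : ℕ) : Forest α → List (Node α)
  | nil => []
  | cons a c r => ⟨o, ⟨a, c⟩⟩ :: (c.nodes (o + 1) ++ r.nodes (o + 2 * c.size + 2))

/-- The subforest of all nodes `u` with `i ≤ l(u)` and `r(u) ≤ j` of a forest whose traversal
starts at position `o`; the other nodes are removed. -/
def keep (i j o : ℕ) : Forest α → Forest α
  | nil => nil
  | cons a c r =>
    if i ≤ o ∧ o + 2 * c.size + 2 ≤ j then
      cons a (c.keep i j (o + 1)) (r.keep i j (o + 2 * c.size + 2))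
    else c.keep i j (o + 1) ++ r.keep i j (o + 2 * c.size + 2)

/-- The subforest `f[i, j)`. -/
def slice (f : Forest α) (i j : ℕ) : Forest α := f.keep i j 0

/-- For each traversal position, the other position of the same node
(the traversal starting at `o`). -/
def partners (o : ℕ) : Forest α → List ℕ
  | nil => []
  | cons _ c r =>
    (o + 2 * c.size + 1) :: (c.partners (o + 1) ++ o :: r.partners (o + 2 * c.size + 2))

/-- For each traversal position, the label of the node at that position. -/
def labels : Forest α → List α
  | nil => []
  | cons a c r => a :: (c.labels ++ a :: r.labels)

end Forest

/-! ### Similarity matrices with respect to a fixed tree `T₂` -/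

/-- `D × D` matrices with entries in `ℕ ∪ {-∞}`; rows and columns are numbered from `0`. -/
abbrev Mat (D : ℕ) : Type := Matrix (Fin D) (Fin D) (WithBot ℕ)

/-- The matrix all of whose entries are `-∞`. -/
def Mat.bot (D : ℕ) : Mat D := fun _ _ => ⊥

/-- The dimension of the similarity matrices. -/
def matDim (T₂ : OTree α) : ℕ := 2 * T₂.size + 1

/-- The similarity matrix `S(f)`. -/
noncomputable def simMat (T₂ : OTree α) (f : Forest α) : Mat (matDim T₂) := fun i j =>
  if i ≤ j then ((f.sim (T₂.toForest.slice i j) : ℕ) : WithBot ℕ) else ⊥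

/-- The restricted similarity matrix `Ŝ(T)`: the `(i, j)` entry is the maximum, over the nodes
`v` of `T₂[i, j)`, of `sim(T - root(T), sub(v) - v) + η(root(T), v)`. It is `-∞` if there is no
such `v`, in particular if `i > j`. -/
noncomputable def restrictedSimMat [DecidableEq α] (T₂ : OTree α) (T : OTree α) :
    Mat (matDim T₂) := fun i j =>
  (((T₂.toForest.nodes 0).filter (fun v => (i : ℕ) ≤ v.l ∧ v.r ≤ (j : ℕ))).map
    (fun v => T.kids.sim v.sub.kids + eta T.label v.sub.label)).maximum

/-! ### A forest `F`, a synchronous subforest `F'`, and the spine between them -/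

/-- A spine node `u_i` with the forests `l_i` and `r_i` of the subtrees of its left and right
siblings. -/
structure Frame (α : Type) : Type where
  left : Forest α
  label : α
  right : Forest α

/-- The forest in which the given frames enclose each other, the first one outermost, and the
innermost spine node has the children forest `X`. -/
def plug : List (Frame α) → Forest α → Forest α
  | [], X => X
  | fr :: s, X => fr.left ++ Forest.cons fr.label (plug s X) fr.right

/-- The subtrees of the spine nodes, from the outermost to the innermost one. -/
def spineTrees : List (Frame α) → Forest α → List (OTree α)
  | [], _ => []
  | fr :: s, X => ⟨fr.label, plug s X⟩ :: spineTrees s X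

/-- The positions `l(u)` of the spine nodes (the traversal starting at `o`). -/
def spinePos (o : ℕ) : List (Frame α) → List ℕ
  | [] => []
  | fr :: s => (o + 2 * fr.left.size) :: spinePos (o + 2 * fr.left.size + 1) s

/-- The position at which the traversal of the children of the innermost spine node starts. -/
def holePos (o : ℕ) : List (Frame α) → ℕ
  | [] => o
  | fr :: s => holePos (o + 2 * fr.left.size + 1) s

/-- A forest `F` with an occurrence of a subforest `F'` that consists of the subtrees of
consecutive children of a node `u_k` (of the virtual root, if there are no frames). The frames
are those of the nodes `u_1, …, u_k` on the path from the virtual root to `u_k`; `left` and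
`right` are `l_{k+1}` and `r_{k+1}`. -/
structure SyncPair (α : Type) : Type where
  frames : List (Frame α)
  left : Forest α
  inner : Forest α
  right : Forest α

namespace SyncPair

/-- The children forest of `u_k`. -/
def bottom (I : SyncPair α) : Forest α := I.left ++ (I.inner ++ I.right)

/-- The forest `F`. -/
def whole (I : SyncPair α) : Forest α := plug I.frames I.bottom

/-- The subtree `sub(u_y)` for `1 ≤ y ≤ k`, and `none` for other `y`. -/
def sub? (I : SyncPair α) : ℕ → Option (OTree α)
  | 0 => none
  | y + 1 => (spineTrees I.frames I.bottom)[y]?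

/-- The first position of `F'` in `F`. -/
def innerStart (I : SyncPair α) : ℕ := holePos 0 I.frames + 2 * I.left.size

/-- One plus the last position of `F'` in `F`. -/
def innerEnd (I : SyncPair α) : ℕ := I.innerStart + 2 * I.inner.size

end SyncPair

/-! ### A random access machine with matrices under range operations and range queries

Words are natural numbers below a bound `B`. There are registers, a random access memory,
read-only input arrays, and a store of matrices that are named by words and can be accessed only
through the range operations and range queries. Each instruction takes one unit of time. -/

/-- Arithmetic of words: natural number operations, with truncated subtraction. -/
inductive BinOp : Type
  | add | sub | mul | div | mod

/-- The value of an arithmetic operation. -/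
def BinOp.eval : BinOp → ℕ → ℕ → ℕ
  | .add, a, b => a + b
  | .sub, a, b => a - b
  | .mul, a, b => a * b
  | .div, a, b => a / b
  | .mod, a, b => a % b

/-- Instructions. All natural number arguments are register numbers, except the constant `v` of
`const`, the target of a jump, and the number `q` of an input array. -/
inductive Instr : Type
  | const (dst v : ℕ)
  | arith (op : BinOp) (dst a b : ℕ)
  | load (dst addr : ℕ)
  | store (addr src : ℕ)
  | read (dst q addr : ℕ)
  | jump (target : ℕ)
  | jumpLt (a b target : ℕ)
  | matBot (h : ℕ)
  | matCopy (h h' : ℕ)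
  | matRangeMax (h h' i j x : ℕ)
  | matGet (dst h i j : ℕ)
  | matMinCol (dst h i x : ℕ)
  | matMaxRow (dst h j x : ℕ)
  | halt

/-- The word that stands for an element of `ℕ ∪ {-∞}`. -/
def encode : WithBot ℕ → ℕ
  | ⊥ => 0
  | (v : ℕ) => v + 1

/-- The element of `ℕ ∪ {-∞}` that a word stands for. -/
def decode : ℕ → WithBot ℕ
  | 0 => ⊥
  | v + 1 => (v : ℕ)

/-- `rangemax(A, i', j', x)`. -/
def rangeMax {D : ℕ} (A : Mat D) (i' j' : Fin D) (x : WithBot ℕ) : Mat D := fun i j =>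
  if i ≤ i' ∧ j' ≤ j then max (A i j) x else A i j

/-- `j` is an admissible answer to the query `mincol(A, i, x)`: the least column of row `i` with
an entry at least `x`, or any column if there is none. -/
def IsMinCol {D : ℕ} (A : Mat D) (i : Fin D) (x : ℕ) (j : Fin D) : Prop :=
  (∃ j', (x : WithBot ℕ) ≤ A i j') → IsLeast {j' | (x : WithBot ℕ) ≤ A i j'} j

/-- `i` is an admissible answer to the query `maxrow(A, j, x)`: the greatest row of column `j`
with an entry at least `x`, or any row if there is none. -/
def IsMaxRow {D : ℕ} (A : Mat D) (j : Fin D) (x : ℕ) (i : Fin D) : Prop :=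
  (∃ i', (x : WithBot ℕ) ≤ A i' j) → IsGreatest {i' | (x : WithBot ℕ) ≤ A i' j} i

/-- A configuration of the machine. -/
structure Config (D : ℕ) : Type where
  pc : ℕ
  reg : ℕ → ℕ
  mem : ℕ → ℕ
  mat : ℕ → Mat D

namespace Config

variable {D : ℕ}

/-- Go to the next instruction. -/
def next (s : Config D) : Config D := { s with pc := s.pc + 1 }

/-- Write a register and go to the next instruction. -/
def setReg (s : Config D) (k v : ℕ) : Config D :=
  { s.next with reg := Function.update s.reg k v }

/-- Write a memory cell and go to the next instruction. -/
def setMem (s : Config D) (k v : ℕ) : Config D :=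
  { s.next with mem := Function.update s.mem k v }

/-- Write a matrix and go to the next instruction. -/
def setMat (s : Config D) (k : ℕ) (A : Mat D) : Config D :=
  { s.next with mat := Function.update s.mat k A }

end Config

/-- `Effect B inp c s s'`: executing the instruction `c` in configuration `s` can lead to `s'`.
There is no successor if a word might not be below the bound `B`, or if a matrix index is out of
range. -/
def Effect {D : ℕ} (B : ℕ) (inp : ℕ → ℕ → ℕ) (c : Instr) (s s' : Config D) : Prop :=
  match c with
  | .const dst v => v < B ∧ s' = s.setReg dst v
  | .arith op dst a b =>
    op.eval (s.reg a) (s.reg b) < B ∧ s' = s.setReg dst (op.eval (s.reg a) (s.reg b))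
  | .load dst addr => s' = s.setReg dst (s.mem (s.reg addr))
  | .store addr src => s' = s.setMem (s.reg addr) (s.reg src)
  | .read dst q addr => inp q (s.reg addr) < B ∧ s' = s.setReg dst (inp q (s.reg addr))
  | .jump target => s' = { s with pc := target }
  | .jumpLt a b target => s' = if s.reg a < s.reg b then { s with pc := target } else s.next
  | .matBot h => s' = s.setMat (s.reg h) (Mat.bot D)
  | .matCopy h h' => s' = s.setMat (s.reg h) (s.mat (s.reg h'))
  | .matRangeMax h h' i j x => ∃ i' j' : Fin D, (i' : ℕ) = s.reg i ∧ (j' : ℕ) = s.reg j ∧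
    s' = s.setMat (s.reg h) (rangeMax (s.mat (s.reg h')) i' j' (decode (s.reg x)))
  | .matGet dst h i j => ∃ i' j' : Fin D, (i' : ℕ) = s.reg i ∧ (j' : ℕ) = s.reg j ∧
    encode (s.mat (s.reg h) i' j') < B ∧ s' = s.setReg dst (encode (s.mat (s.reg h) i' j'))
  | .matMinCol dst h i x => ∃ i' j' : Fin D, (i' : ℕ) = s.reg i ∧
    IsMinCol (s.mat (s.reg h)) i' (s.reg x) j' ∧ D ≤ B ∧ s' = s.setReg dst j'
  | .matMaxRow dst h j x => ∃ i' j' : Fin D, (j' : ℕ) = s.reg j ∧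
    IsMaxRow (s.mat (s.reg h)) j' (s.reg x) i' ∧ D ≤ B ∧ s' = s.setReg dst i'
  | .halt => False

/-- One step of the program `P` (a finite list of instructions) on the input arrays `inp`. -/
def Step {D : ℕ} (B : ℕ) (inp : ℕ → ℕ → ℕ) (P : List Instr) (s s' : Config D) : Prop :=
  ∃ c, P[s.pc]? = some c ∧ Effect B inp c s s'

/-- Whatever admissible answers the range queries give, the program started in `s` executes a
`halt` instruction after at most `t` steps, never gets stuck before, and satisfies `post` then. -/
def HaltsWithin {D : ℕ} (B : ℕ) (inp : ℕ → ℕ → ℕ) (P : List Instr) (post : Config D → Prop) :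
    ℕ → Config D → Prop
  | 0, s => P[s.pc]? = some .halt ∧ post s
  | t + 1, s => (P[s.pc]? = some .halt ∧ post s) ∨
      ((∃ s', Step B inp P s s') ∧ ∀ s', Step B inp P s s' → HaltsWithin B inp P post t s')

/-! ### The computational problem -/

/-- The input arrays. Array `0`: the numbers `|F|`, `|T₂|`, `k`, `x`, and the positions in `F`
where `F'` starts and ends. Array `1`: the positions `l(u_1), …, l(u_k)`. Arrays `2`, `3`: for
each position of the traversal of `F`, the other position of the same node, and its label.
Arrays `4`, `5`: the same for `T₂`. -/
def inputs {σ : ℕ} (I : SyncPair (Fin σ)) (T₂ : OTree (Fin σ)) (x : ℕ) : ℕ → ℕ → ℕ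
  | 0 => fun a => [I.whole.size, T₂.size, I.frames.length, x, I.innerStart, I.innerEnd].getD a 0
  | 1 => fun a => (spinePos 0 I.frames).getD a 0
  | 2 => fun a => (I.whole.partners 0).getD a 0
  | 3 => fun a => (I.whole.labels.map Fin.val).getD a 0
  | 4 => fun a => (T₂.toForest.partners 0).getD a 0
  | 5 => fun a => (T₂.toForest.labels.map Fin.val).getD a 0
  | _ => fun _ => 0

/-- The matrices that are known at the beginning: `S(F')` under the name `0`, and
`Ŝ(sub(u_y))` under the name `y` for `x < y ≤ k`. All others are `-∞`. -/
noncomputable def knownMats {σ : ℕ} (I : SyncPair (Fin σ)) (T₂ : OTree (Fin σ)) (x : ℕ) (h : ℕ) :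
    Mat (matDim T₂) :=
  if h = 0 then simMat T₂ I.inner
  else if x < h then
    match I.sub? h with
    | some T => restrictedSimMat T₂ T
    | none => Mat.bot _
  else Mat.bot _

/-- The initial configuration. -/
noncomputable def initial {σ : ℕ} (I : SyncPair (Fin σ)) (T₂ : OTree (Fin σ)) (x : ℕ) :
    Config (matDim T₂) where
  pc := 0
  reg := fun _ => 0
  mem := fun _ => 0
  mat := knownMats I T₂ x

end TED

open TED

set_option linter.constructorNameAsVariable false

/-! Write n = |T₂|, m = |F| - |F'| and X for the forest below u_x, and call u_{x+1}, …, u_k the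
spine nodes. An entry of Ŝ(sub(u_x)) is a maximum, over the nodes v of a slice of T₂, of sim(X,
sub(v) - v) + η(u_x, v). So it suffices to find sim(X, sub(v) - v) for every node v and to issue one
range-maximum operation per node. Similarity is treated throughout as the largest weight of an
alignment, a structure-preserving matching in which a pair (u, v) weighs η(u, v)
(`Forest.align_iff`).

An optimal alignment of X with sub(v) - v is of one of two kinds (`Hole.decompose`). If no spine
node is matched, it splits into alignments of the part of X to the left of F', of F' itself, and of
the part to the right, with three consecutive slices of T₂. Otherwise there is an outermost matched
spine node u_y. Its subtree acts as a single unit whose value comes from Ŝ(sub(u_y)), and the rest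
of the alignment involves only nodes outside F', which have at most 2m positions.

For the second kind a table V p i j is computed, where p is a position of T₂ and i, j number the
positions of X outside F'. A spine node contributes the entry of its restricted matrix for the tree
at p, that is, the best match of the spine node inside this tree. The table never exceeds the weight
of a genuine alignment (`Fits.sound`), is exact on each side of F' (`Fits.complete_side`), and
dominates all alignments with a matched spine node (`Fits.spine_le`).

The recursion for V cuts the range at some k between the first tree of the forest in T₂ and the
remaining trees, a max-plus product that would naively cost a factor m. Both factors are monotone
and are bounded by twice the sizes of the tree and of the remaining forest. So it is enough to try
the cuts at which one factor takes a new value, and the factor with fewer such records may be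
chosen. A merge then costs m² times the smaller of the two sizes, and the small-to-large argument
bounds the total by m² n log n (`Forest.mergeWork_le`, `Forest.sum_mergeAt`).

For the first kind one computes, for every start in T₂ and every weight s, the least end of a slice
with which the left part has similarity at least s, and similarly the greatest start for the right
part (`Fits.end_iff`). Widening the middle slice does no harm, so for each v it suffices to maximise
s + s' + sim(F', T₂[i, j)) over the O(m²) pairs of weights, where the last term is read from S(F')
(`Fits.best_eq`).

The program is written in a small loop language with three-dimensional arrays and compiled to the
machine (`Cmd.comp_correct`). The commands are verified by specifications that also carry a time
bound (`Spec`). Entry queries and range maxima are the only matrix operations used. The two queries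
that may answer arbitrarily do not occur, so the compiled program runs deterministically. Words stay
polynomially bounded because stored values are below a bound W linear in the input, and an
expression of size z evaluates below W ^ z. -/

namespace TED.Loop

/-! ### A loop language with three-dimensional arrays, compiled to the machine -/

/-- Variables. -/
inductive Var : Type
  | n2 | x | A | B | lo | H | M1 | M | K | D | t | p | c | q | u | al | b | be | val | cnt | prev
  | m | k | ga | best | sd | ix | i | d | pp | e | a | hi
  deriving DecidableEq

/-- Names of arrays. -/
inductive Arr : Type
  | V | T | BP | CN | C | Lb | S | LA | RB
  deriving DecidableEq

/-- The register of a variable. -/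
def Var.code : Var → ℕ
  | n2 => 1 | x => 2 | A => 3 | B => 4 | lo => 5 | H => 6 | M1 => 7 | M => 8 | K => 9 | D => 10
  | t => 11 | p => 12 | c => 13 | q => 14 | u => 15 | al => 16 | b => 17 | be => 18 | val => 19
  | cnt => 20 | prev => 21 | m => 22 | k => 23 | ga => 24 | best => 25 | sd => 26 | ix => 27
  | i => 28 | d => 29 | pp => 30 | e => 31 | a => 32 | hi => 33

/-- The number of an array. -/
def Arr.code : Arr → ℕ
  | V => 0 | T => 1 | BP => 2 | CN => 3 | C => 4 | Lb => 5 | S => 6 | LA => 7 | RB => 8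

/-- The variable with a register. -/
def Var.decode : ℕ → Var
  | 1 => n2 | 2 => x | 3 => A | 4 => B | 5 => lo | 6 => H | 7 => M1 | 8 => M | 9 => K | 10 => D
  | 11 => t | 12 => p | 13 => c | 14 => q | 15 => u | 16 => al | 17 => b | 18 => be | 19 => val
  | 20 => cnt | 21 => prev | 22 => m | 23 => k | 24 => ga | 25 => best | 26 => sd | 27 => ix
  | 28 => i | 29 => d | 30 => pp | 31 => e | 32 => a | _ => hi

theorem Var.code_injective : Function.Injective Var.code :=
  Function.LeftInverse.injective (g := Var.decode) (fun v => by cases v <;> rfl)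

theorem Var.code_pos (v : Var) : 0 < v.code := by cases v <;> decide

theorem Var.code_lt (v : Var) : v.code < 64 := by cases v <;> decide

theorem Arr.code_lt (q : Arr) : q.code < 16 := by cases q <;> decide

theorem Arr.code_injective : Function.Injective Arr.code := by
  intro a b h
  cases a <;> cases b <;> first | rfl | (exact absurd h (by decide))

/-- Expressions. -/
inductive Expr : Type
  | lit (v : ℕ)
  | var (x : Var)
  | op (o : BinOp) (a b : Expr)
  | get (q : Arr) (i j k : Expr)
  | inp (q : ℕ) (i : Expr)
  | mget (h i j : Expr)

/-- Commands. A loop `loop i n c` runs `c` for `i = 0, …, n - 1`. -/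
inductive Cmd : Type
  | skip
  | assign (x : Var) (e : Expr)
  | store (q : Arr) (i j k e : Expr)
  | rmax (h i j e : Expr)
  | seq (c d : Cmd)
  | ite (a b : Expr) (c d : Cmd)
  | loop (i n : Var) (c : Cmd)

/-- The state of a program of the loop language. -/
structure St (D : ℕ) : Type where
  var : Var → ℕ
  arr : Arr → ℕ → ℕ → ℕ → ℕ
  mat : ℕ → Mat D

/-- The input arrays, the bound `N` for array indices and the bound `W` for values. -/
structure Env : Type where
  inp : ℕ → ℕ → ℕ
  N : ℕ
  W : ℕ

variable {D : ℕ}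

/-- Update of a function of three arguments. -/
def update3 (f : ℕ → ℕ → ℕ → ℕ) (a b c v : ℕ) : ℕ → ℕ → ℕ → ℕ := fun a' b' c' =>
  if a' = a ∧ b' = b ∧ c' = c then v else f a' b' c'

/-- The word for a matrix entry, `0` outside of the matrix. -/
def entry (A : Mat D) (i j : ℕ) : ℕ :=
  if h : i < D ∧ j < D then encode (A ⟨i, h.1⟩ ⟨j, h.2⟩) else 0

/-- `rangeMax` with unbounded indices. -/
def rangeMaxN (A : Mat D) (i' j' : ℕ) (v : ℕ) : Mat D := fun i j =>
  if (i : ℕ) ≤ i' ∧ j' ≤ (j : ℕ) then max (A i j) (decode v) else A i j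

namespace Expr

def eval (E : Env) (s : St D) : Expr → ℕ
  | lit v => v
  | var x => s.var x
  | op o a b => o.eval (a.eval E s) (b.eval E s)
  | get q i j k => s.arr q (i.eval E s) (j.eval E s) (k.eval E s)
  | inp q i => E.inp q (i.eval E s)
  | mget h i j => entry (s.mat (h.eval E s)) (i.eval E s) (j.eval E s)

/-- Array indices must be below `N` because only then do different cells have different addresses.
Matrix indices must be in range because the machine gets stuck otherwise. -/
def safe (E : Env) (s : St D) : Expr → Prop
  | lit _ => True
  | var _ => True
  | op _ a b => a.safe E s ∧ b.safe E s
  | get _ i j k => i.safe E s ∧ j.safe E s ∧ k.safe E s ∧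
      i.eval E s < E.N ∧ j.eval E s < E.N ∧ k.eval E s < E.N
  | inp _ i => i.safe E s
  | mget h i j => h.safe E s ∧ i.safe E s ∧ j.safe E s ∧ i.eval E s < D ∧ j.eval E s < D

/-- The number of machine instructions. -/
def len : Expr → ℕ
  | lit _ => 1
  | var _ => 2
  | op _ a b => a.len + b.len + 1
  | get _ i j k => i.len + j.len + k.len + 9
  | inp _ i => i.len + 1
  | mget h i j => h.len + i.len + j.len + 1

/-- The value and all intermediate results are below the power `W ^ e.sz`. -/
def sz : Expr → ℕ
  | lit v => v + 1
  | var _ => 1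
  | op _ a b => a.sz + b.sz
  | get _ i j k => i.sz + j.sz + k.sz + 4
  | inp _ i => i.sz + 1
  | mget h i j => h.sz + i.sz + j.sz

/-- The result is left in register `t`, and operands use `t + 1`, `t + 2`, …, so registers below `t`
survive. Register `0` permanently holds `N`. In the absence of a move instruction a variable is
fetched by adding it to zero. -/
def comp (t : ℕ) : Expr → List Instr
  | lit v => [.const t v]
  | var x => [.const t 0, .arith .add t t x.code]
  | op o a b => a.comp t ++ (b.comp (t + 1) ++ [.arith o t t (t + 1)])
  | get q i j k => i.comp t ++ (j.comp (t + 1) ++ (k.comp (t + 2) ++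
      [.arith .mul t t 0, .arith .add t t (t + 1), .arith .mul t t 0, .arith .add t t (t + 2),
       .const (t + 1) 16, .arith .mul t t (t + 1), .const (t + 1) q.code, .arith .add t t (t + 1),
       .load t t]))
  | inp q i => i.comp t ++ [.read t q t]
  | mget h i j => h.comp t ++ (i.comp (t + 1) ++ (j.comp (t + 2) ++
      [.matGet t t (t + 1) (t + 2)]))

theorem length_comp (e : Expr) : ∀ t, (e.comp t).length = e.len := by
  induction e <;> intro t <;> simp_all [comp, len] <;> omega

end Expr

namespace St

def setVar (s : St D) (x : Var) (v : ℕ) : St D := { s with var := Function.update s.var x v }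

def setArr (s : St D) (q : Arr) (i j k v : ℕ) : St D :=
  { s with arr := Function.update s.arr q (update3 (s.arr q) i j k v) }

def setMat (s : St D) (h : ℕ) (A : Mat D) : St D := { s with mat := Function.update s.mat h A }

end St

namespace Cmd

def run (E : Env) : Cmd → St D → St D
  | skip, s => s
  | assign x e, s => s.setVar x (e.eval E s)
  | store q i j k e, s => s.setArr q (i.eval E s) (j.eval E s) (k.eval E s) (e.eval E s)
  | rmax h i j e, s =>
      s.setMat (h.eval E s) (rangeMaxN (s.mat (h.eval E s)) (i.eval E s) (j.eval E s) (e.eval E s))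
  | seq c d, s => d.run E (c.run E s)
  | ite a b c d, s => if a.eval E s < b.eval E s then c.run E s else d.run E s
  | loop i n c, s =>
      Nat.rec (s.setVar i 0) (fun t s' => (c.run E s').setVar i (t + 1)) (s.var n)

/-- The state before the iteration `t` of a loop. -/
def iter (E : Env) (i : Var) (c : Cmd) (s : St D) : ℕ → St D
  | 0 => s.setVar i 0
  | t + 1 => (c.run E (iter E i c s t)).setVar i (t + 1)

theorem run_loop (E : Env) (i n : Var) (c : Cmd) (s : St D) :
    (loop i n c).run E s = iter E i c s (s.var n) := by
  simp only [run]
  induction s.var n with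
  | zero => rfl
  | succ t ih => simp only [iter, ih]

def safe (E : Env) : Cmd → St D → Prop
  | skip, _ => True
  | assign _ e, s => e.safe E s ∧ e.eval E s < E.W
  | store _ i j k e, s => i.safe E s ∧ j.safe E s ∧ k.safe E s ∧ e.safe E s ∧
      i.eval E s < E.N ∧ j.eval E s < E.N ∧ k.eval E s < E.N ∧ e.eval E s < E.W
  | rmax h i j e, s => h.safe E s ∧ i.safe E s ∧ j.safe E s ∧ e.safe E s ∧
      i.eval E s < D ∧ j.eval E s < D ∧ e.eval E s < E.W
  | seq c d, s => c.safe E s ∧ d.safe E (c.run E s)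
  | ite a b c d, s => a.safe E s ∧ b.safe E s ∧
      (a.eval E s < b.eval E s → c.safe E s) ∧ (¬ a.eval E s < b.eval E s → d.safe E s)
  | loop i n c, s => ∀ t < s.var n, c.safe E (iter E i c s t)

/-- The number of machine instructions executed. -/
def cost (E : Env) : Cmd → St D → ℕ
  | skip, _ => 0
  | assign _ e, _ => e.len + 2
  | store _ i j k e, _ => i.len + j.len + k.len + e.len + 9
  | rmax h i j e, _ => h.len + i.len + j.len + e.len + 1
  | seq c d, s => c.cost E s + d.cost E (c.run E s)
  | ite a b c d, s => a.len + b.len + 2 +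
      if a.eval E s < b.eval E s then c.cost E s else d.cost E s
  | loop i n c, s => ∑ t ∈ Finset.range (s.var n), (c.cost E (iter E i c s t) + 4) + 3

/-- The variables that are assigned. -/
def mods : Cmd → List Var
  | skip => []
  | assign x _ => [x]
  | store .. => []
  | rmax .. => []
  | seq c d => c.mods ++ d.mods
  | ite _ _ c d => c.mods ++ d.mods
  | loop i _ c => i :: c.mods

/-- The arrays that are written. -/
def amods : Cmd → List Arr
  | skip => []
  | assign .. => []
  | store q .. => [q]
  | rmax .. => []
  | seq c d => c.amods ++ d.amods
  | ite _ _ c d => c.amods ++ d.amods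
  | loop _ _ c => c.amods

/-- Whether some matrix is written. -/
def hasRmax : Cmd → Bool
  | skip => false
  | assign .. => false
  | store .. => false
  | rmax .. => true
  | seq c d => c.hasRmax || d.hasRmax
  | ite _ _ c d => c.hasRmax || d.hasRmax
  | loop _ _ c => c.hasRmax

/-- No loop changes its counter or its bound in its body. -/
def wf : Cmd → Prop
  | skip => True
  | assign .. => True
  | store .. => True
  | rmax .. => True
  | seq c d => c.wf ∧ d.wf
  | ite _ _ c d => c.wf ∧ d.wf
  | loop i n c => c.wf ∧ i ∉ c.mods ∧ n ∉ c.mods ∧ i ≠ n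

/-- A bound for the sizes of the expressions. -/
def sz : Cmd → ℕ
  | skip => 0
  | assign _ e => e.sz
  | store _ i j k e => i.sz + j.sz + k.sz + e.sz + 4
  | rmax h i j e => h.sz + i.sz + j.sz + e.sz
  | seq c d => c.sz + d.sz
  | ite a b c d => a.sz + b.sz + c.sz + d.sz
  | loop _ _ c => c.sz + 1

/-- The length of the code, from which jump targets are computed. For commands without loops it also
bounds the running time. -/
def clen : Cmd → ℕ
  | skip => 0
  | assign _ e => e.len + 2
  | store _ i j k e => i.len + j.len + k.len + e.len + 9
  | rmax h i j e => h.len + i.len + j.len + e.len + 1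
  | seq c d => c.clen + d.clen
  | ite a b c d => a.len + b.len + d.clen + c.clen + 2
  | loop _ _ c => c.clen + 6

/-- Jumps are absolute, hence the parameter `o`, the position of the first instruction. The only
conditional jump tests `<`, so a conditional has its second branch first, and a loop test skips over
the jump that leaves the loop. -/
def comp (o : ℕ) : Cmd → List Instr
  | skip => []
  | assign x e => e.comp 64 ++ [.const 65 0, .arith .add x.code 64 65]
  | store q i j k e => i.comp 64 ++ (j.comp 65 ++ (k.comp 66 ++ (e.comp 67 ++
      [.arith .mul 64 64 0, .arith .add 64 64 65, .arith .mul 64 64 0, .arith .add 64 64 66,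
       .const 65 16, .arith .mul 64 64 65, .const 65 q.code, .arith .add 64 64 65,
       .store 64 67])))
  | rmax h i j e => h.comp 64 ++ (i.comp 65 ++ (j.comp 66 ++ (e.comp 67 ++
      [.matRangeMax 64 64 65 66 67])))
  | seq c d => c.comp o ++ d.comp (o + c.clen)
  | ite a b c d => a.comp 64 ++ (b.comp 65 ++
      (.jumpLt 64 65 (o + a.len + b.len + d.clen + 2) ::
      (d.comp (o + a.len + b.len + 1) ++
      (.jump (o + a.len + b.len + d.clen + c.clen + 2) ::
      c.comp (o + a.len + b.len + d.clen + 2)))))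
  | loop i n c => .const i.code 0 :: .jumpLt i.code n.code (o + 3) :: .jump (o + c.clen + 6) ::
      (c.comp (o + 3) ++ [.const 64 1, .arith .add i.code i.code 64, .jump (o + 1)])

theorem length_comp (c : Cmd) : ∀ o, (c.comp o).length = c.clen := by
  induction c <;> intro o <;> simp_all [comp, clen, Expr.length_comp] <;> omega

/-- A syntactic frame property. Together with the two analogues for arrays and matrices it lets
facts about the state be carried past a command by a decidable check of the names it writes. -/
theorem run_var (E : Env) (c : Cmd) (y : Var) (hy : y ∉ c.mods) :
    ∀ s : St D, (c.run E s).var y = s.var y := by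
  induction c with
  | skip => intro s; rfl
  | assign x e =>
    intro s
    simp only [mods, List.mem_singleton] at hy
    simp [run, St.setVar, Function.update_of_ne hy]
  | store => intro s; rfl
  | rmax => intro s; rfl
  | seq c d ihc ihd =>
    intro s
    simp only [mods, List.mem_append, not_or] at hy
    simp only [run]
    rw [ihd hy.2, ihc hy.1]
  | ite a b c d ihc ihd =>
    intro s
    simp only [mods, List.mem_append, not_or] at hy
    simp only [run]
    split
    · exact ihc hy.1 s
    · exact ihd hy.2 s
  | loop i n c ih =>
    intro s
    simp only [mods, List.mem_cons, not_or] at hy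
    rw [run_loop]
    induction s.var n with
    | zero => simp [iter, St.setVar, Function.update_of_ne hy.1]
    | succ t iht => simp [iter, St.setVar, Function.update_of_ne hy.1, ih hy.2, iht]

theorem run_arr (E : Env) (c : Cmd) (q : Arr) (hq : q ∉ c.amods) :
    ∀ s : St D, (c.run E s).arr q = s.arr q := by
  induction c with
  | skip => intro s; rfl
  | assign x e => intro s; rfl
  | store =>
    intro s
    simp only [amods, List.mem_singleton] at hq
    simp [run, St.setArr, Function.update_of_ne hq]
  | rmax => intro s; rfl
  | seq c d ihc ihd =>
    intro s
    simp only [amods, List.mem_append, not_or] at hq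
    simp only [run]
    rw [ihd hq.2, ihc hq.1]
  | ite a b c d ihc ihd =>
    intro s
    simp only [amods, List.mem_append, not_or] at hq
    simp only [run]
    split
    · exact ihc hq.1 s
    · exact ihd hq.2 s
  | loop i n c ih =>
    intro s
    rw [run_loop]
    induction s.var n with
    | zero => simp [iter, St.setVar]
    | succ t iht => simp [iter, St.setVar, ih hq, iht]

theorem run_mat (E : Env) (c : Cmd) (hc : c.hasRmax = false) :
    ∀ s : St D, (c.run E s).mat = s.mat := by
  induction c with
  | skip => intro s; rfl
  | assign x e => intro s; rfl
  | store => intro s; rfl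
  | rmax => simp [hasRmax] at hc
  | seq c d ihc ihd =>
    intro s
    simp only [hasRmax, Bool.or_eq_false_iff] at hc
    simp only [run]
    rw [ihd hc.2, ihc hc.1]
  | ite a b c d ihc ihd =>
    intro s
    simp only [hasRmax, Bool.or_eq_false_iff] at hc
    simp only [run]
    split
    · exact ihc hc.1 s
    · exact ihd hc.2 s
  | loop i n c ih =>
    intro s
    rw [run_loop]
    induction s.var n with
    | zero => simp [iter, St.setVar]
    | succ t iht => simp [iter, St.setVar, ih hc, iht]

theorem iter_var (E : Env) (i : Var) (c : Cmd) (s : St D) (t : ℕ) :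
    (iter E i c s t).var i = t := by
  cases t <;> simp [iter, St.setVar]

theorem iter_var_of_ne (E : Env) (i y : Var) (c : Cmd) (hy : y ∉ c.mods) (h : y ≠ i) (s : St D)
    (t : ℕ) : (iter E i c s t).var y = s.var y := by
  induction t with
  | zero => simp [iter, St.setVar, Function.update_of_ne h]
  | succ t iht => simp [iter, St.setVar, Function.update_of_ne h, run_var E c y hy, iht]

end Cmd

/-- All values of the state are below the bound. -/
structure Bounded (W : ℕ) (s : St D) : Prop where
  var : ∀ x, s.var x < W
  arr : ∀ q a b c, s.arr q a b c < W
  mat : ∀ h i j, encode (s.mat h i j) < W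

theorem encode_decode (v : ℕ) : encode (decode v) = v := by cases v <;> rfl

theorem encode_max (a b : WithBot ℕ) : encode (max a b) = max (encode a) (encode b) := by
  induction a using WithBot.recBotCoe with
  | bot => simp [encode]
  | coe a =>
    induction b using WithBot.recBotCoe with
    | bot => simp [encode]
    | coe b => rw [← WithBot.coe_max]; simp [encode]

theorem Bounded.setVar {W : ℕ} {s : St D} (h : Bounded W s) (x : Var) {v : ℕ} (hv : v < W) :
    Bounded W (s.setVar x v) where
  var y := by
    by_cases hy : y = x
    · subst hy; simpa [St.setVar] using hv
    · simpa [St.setVar, Function.update_of_ne hy] using h.var y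
  arr := h.arr
  mat := h.mat

/-- Safety bounds every value that is written. A loop counter never exceeds the value of its bound
variable, which is itself below `W`. -/
theorem Cmd.bounded_run (E : Env) (c : Cmd) (hw : c.wf) : ∀ s : St D, Bounded E.W s → c.safe E s →
    Bounded E.W (c.run E s) := by
  induction c with
  | skip => intro s h _; exact h
  | assign x e => intro s h hs; exact h.setVar x hs.2
  | store q i j k e =>
    intro s h hs
    refine ⟨h.var, fun q' a b c => ?_, h.mat⟩
    have := h.arr
    by_cases hq : q' = q
    · subst hq
      simp only [run, St.setArr, Function.update_self, update3]
      split
      · exact hs.2.2.2.2.2.2.2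
      · exact this ..
    · simp only [run, St.setArr, Function.update_of_ne hq]
      exact this ..
  | rmax m i j e =>
    intro s h hs
    refine ⟨h.var, h.arr, fun m' a b => ?_⟩
    by_cases hm : m' = m.eval E s
    · subst hm
      simp only [run, St.setMat, Function.update_self, rangeMaxN]
      split
      · rw [encode_max, encode_decode]
        exact max_lt (h.mat ..) hs.2.2.2.2.2.2
      · exact h.mat ..
    · simp only [run, St.setMat, Function.update_of_ne hm]
      exact h.mat ..
  | seq c d ihc ihd => intro s h hs; exact ihd hw.2 _ (ihc hw.1 _ h hs.1) hs.2
  | ite a b c d ihc ihd =>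
    intro s h hs
    simp only [run]
    split
    · rename_i hh; exact ihc hw.1 s h (hs.2.2.1 hh)
    · rename_i hh; exact ihd hw.2 s h (hs.2.2.2 hh)
  | loop i n c ih =>
    intro s h hs
    have hn := h.var n
    rw [run_loop]
    have : ∀ t ≤ s.var n, Bounded E.W (iter E i c s t) := by
      intro t
      induction t with
      | zero => intro _; exact h.setVar i (by omega)
      | succ t iht =>
        intro ht
        exact (ih hw.1 _ (iht (by omega)) (hs t (by omega))).setVar i (by omega)
    exact this _ le_rfl

end TED.Loop

namespace TED.Loop

variable {D : ℕ}

/-! ### Correctness of the compilation -/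

theorem haltsWithin_mono {B : ℕ} {inp : ℕ → ℕ → ℕ} {P : List Instr} {post : Config D → Prop}
    {t u : ℕ} (h : t ≤ u) : ∀ {s : Config D}, HaltsWithin B inp P post t s →
      HaltsWithin B inp P post u s := by
  induction t generalizing u with
  | zero =>
    intro s hs
    cases u with
    | zero => exact hs
    | succ u => exact .inl hs
  | succ t ih =>
    intro s hs
    obtain ⟨u, rfl⟩ : ∃ v, u = v + 1 := ⟨u - 1, by omega⟩
    rcases hs with hs | ⟨h1, h2⟩
    · exact .inl hs
    · exact .inr ⟨h1, fun s' hs' => ih (by omega) (h2 s' hs')⟩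

/-- The machine inevitably gets from `s` to `s'` in `n` steps. -/
def Reaches (B : ℕ) (inp : ℕ → ℕ → ℕ) (P : List Instr) (n : ℕ) (s s' : Config D) : Prop :=
  ∀ (post : Config D → Prop) (t : ℕ), HaltsWithin B inp P post t s' →
    HaltsWithin B inp P post (t + n) s

section Reaches

variable {B : ℕ} {inp : ℕ → ℕ → ℕ} {P : List Instr}

theorem Reaches.refl (s : Config D) : Reaches B inp P 0 s s := fun _ _ h => h

theorem Reaches.trans {n m : ℕ} {s s' s'' : Config D} (h : Reaches B inp P n s s')
    (h' : Reaches B inp P m s' s'') : Reaches B inp P (n + m) s s'' := fun post t ht => by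
  have := h post _ (h' post t ht)
  rwa [add_assoc, add_comm m n] at this

/-- Every instruction emitted by the compiler inside a command has exactly one possible successor,
so the universal quantifier over successors in `HaltsWithin` is harmless. -/
theorem Reaches.of_effect {s s' : Config D} {c : Instr} (hc : P[s.pc]? = some c)
    (he : ∀ s'', Effect B inp c s s'' ↔ s'' = s') : Reaches B inp P 1 s s' := by
  intro post t ht
  refine .inr ⟨⟨s', c, hc, (he s').2 rfl⟩, ?_⟩
  rintro s'' ⟨c', hc', h'⟩
  rw [hc] at hc'
  obtain rfl := Option.some.inj hc'
  rw [he] at h'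
  exact h' ▸ ht

theorem reaches_const {s : Config D} {dst v : ℕ} (hc : P[s.pc]? = some (.const dst v))
    (hv : v < B) : Reaches B inp P 1 s (s.setReg dst v) :=
  .of_effect hc fun _ => by simp [Effect, hv]

theorem reaches_arith {s : Config D} {o : BinOp} {dst a b : ℕ}
    (hc : P[s.pc]? = some (.arith o dst a b)) (hv : o.eval (s.reg a) (s.reg b) < B) :
    Reaches B inp P 1 s (s.setReg dst (o.eval (s.reg a) (s.reg b))) :=
  .of_effect hc fun _ => by simp [Effect, hv]

theorem reaches_load {s : Config D} {dst a : ℕ} (hc : P[s.pc]? = some (.load dst a)) :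
    Reaches B inp P 1 s (s.setReg dst (s.mem (s.reg a))) :=
  .of_effect hc fun _ => by simp [Effect]

theorem reaches_store {s : Config D} {a b : ℕ} (hc : P[s.pc]? = some (.store a b)) :
    Reaches B inp P 1 s (s.setMem (s.reg a) (s.reg b)) :=
  .of_effect hc fun _ => by simp [Effect]

theorem reaches_read {s : Config D} {dst q a : ℕ} (hc : P[s.pc]? = some (.read dst q a))
    (hv : inp q (s.reg a) < B) : Reaches B inp P 1 s (s.setReg dst (inp q (s.reg a))) :=
  .of_effect hc fun _ => by simp [Effect, hv]

theorem reaches_jump {s : Config D} {a : ℕ} (hc : P[s.pc]? = some (.jump a)) :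
    Reaches B inp P 1 s { s with pc := a } :=
  .of_effect hc fun _ => by simp [Effect]

theorem reaches_jumpLt {s : Config D} {a b u : ℕ} (hc : P[s.pc]? = some (.jumpLt a b u)) :
    Reaches B inp P 1 s (if s.reg a < s.reg b then { s with pc := u } else s.next) :=
  .of_effect hc fun _ => by simp [Effect]

theorem reaches_matGet {s : Config D} {dst h i j : ℕ} (hc : P[s.pc]? = some (.matGet dst h i j))
    (hi : s.reg i < D) (hj : s.reg j < D)
    (hv : entry (s.mat (s.reg h)) (s.reg i) (s.reg j) < B) :
    Reaches B inp P 1 s (s.setReg dst (entry (s.mat (s.reg h)) (s.reg i) (s.reg j))) := by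
  refine .of_effect hc fun s'' => ?_
  simp only [entry, hi, hj, and_self, dite_true] at hv ⊢
  constructor
  · rintro ⟨i', j', h1, h2, -, rfl⟩
    obtain rfl : i' = ⟨_, hi⟩ := Fin.ext h1
    obtain rfl : j' = ⟨_, hj⟩ := Fin.ext h2
    rfl
  · rintro rfl
    exact ⟨⟨_, hi⟩, ⟨_, hj⟩, rfl, rfl, hv, rfl⟩

theorem reaches_matRangeMax {s : Config D} {h i j x : ℕ}
    (hc : P[s.pc]? = some (.matRangeMax h h i j x)) (hi : s.reg i < D) (hj : s.reg j < D) :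
    Reaches B inp P 1 s (s.setMat (s.reg h)
      (rangeMaxN (s.mat (s.reg h)) (s.reg i) (s.reg j) (s.reg x))) := by
  refine .of_effect hc fun s'' => ?_
  have key : rangeMax (s.mat (s.reg h)) ⟨_, hi⟩ ⟨_, hj⟩ (decode (s.reg x)) =
      rangeMaxN (s.mat (s.reg h)) (s.reg i) (s.reg j) (s.reg x) := by
    funext a b
    simp only [rangeMax, rangeMaxN, Fin.le_def]
  constructor
  · rintro ⟨i', j', h1, h2, rfl⟩
    obtain rfl : i' = ⟨_, hi⟩ := Fin.ext h1
    obtain rfl : j' = ⟨_, hj⟩ := Fin.ext h2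
    rw [key]
  · rintro rfl
    exact ⟨⟨_, hi⟩, ⟨_, hj⟩, rfl, rfl, by rw [key]⟩

end Reaches

/-- The instructions `code` stand in `P` from position `o` on. -/
def CodeAt (P : List Instr) (o : ℕ) (code : List Instr) : Prop :=
  ∀ k c, code[k]? = some c → P[o + k]? = some c

theorem CodeAt.left {P : List Instr} {o : ℕ} {l l' : List Instr} (h : CodeAt P o (l ++ l')) :
    CodeAt P o l := fun k c hk => h k c (by
  rw [List.getElem?_append_left (List.getElem?_eq_some_iff.1 hk).1, hk])

theorem CodeAt.right {P : List Instr} {o : ℕ} {l l' : List Instr} (h : CodeAt P o (l ++ l')) :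
    CodeAt P (o + l.length) l' := fun k c hk => by
  have := h (l.length + k) c (by rw [List.getElem?_append_right (by omega)]; simpa using hk)
  rwa [← add_assoc] at this

theorem CodeAt.head {P : List Instr} {o : ℕ} {c : Instr} {l : List Instr}
    (h : CodeAt P o (c :: l)) : P[o]? = some c := h 0 c rfl

theorem CodeAt.tail {P : List Instr} {o : ℕ} {c : Instr} {l : List Instr}
    (h : CodeAt P o (c :: l)) : CodeAt P (o + 1) l := fun k c' hk => by
  have := h (k + 1) c' (by simpa using hk)
  rwa [add_comm k 1, ← add_assoc] at this

/-- The memory address of an array cell. -/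
def addr (N : ℕ) (q : Arr) (i j k : ℕ) : ℕ := ((i * N + j) * N + k) * 16 + q.code

theorem mul_add_inj {N a b c d : ℕ} (hb : b < N) (hd : d < N) (h : a * N + b = c * N + d) :
    a = c ∧ b = d := by
  have hN : 0 < N := by omega
  have h1 := congrArg (· / N) h
  have h2 := congrArg (· % N) h
  simp only [Nat.mul_add_mod_self_right, Nat.mod_eq_of_lt hb, Nat.mod_eq_of_lt hd] at h2
  rw [mul_comm a, mul_comm c] at h1
  simp only [Nat.mul_add_div hN, Nat.div_eq_of_lt hb, Nat.div_eq_of_lt hd] at h1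
  exact ⟨by simpa using h1, h2⟩

/-- An address is a mixed-radix numeral with digits `i`, `j`, `k` and the number of the array. The
leading digit `i` needs no bound. -/
theorem addr_inj {N : ℕ} {q q' : Arr} {i j k i' j' k' : ℕ} (hj : j < N) (hk : k < N)
    (hj' : j' < N) (hk' : k' < N) (h : addr N q i j k = addr N q' i' j' k') :
    q = q' ∧ i = i' ∧ j = j' ∧ k = k' := by
  obtain ⟨h1, h2⟩ := mul_add_inj q.code_lt q'.code_lt h
  obtain ⟨h3, h4⟩ := mul_add_inj hk hk' h1
  obtain ⟨h5, h6⟩ := mul_add_inj hj hj' h3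
  exact ⟨Arr.code_injective h2, h5, h6, h4⟩

/-- The machine configuration represents the state of the loop program. -/
structure Rel (N : ℕ) (s : St D) (g : Config D) : Prop where
  size : g.reg 0 = N
  var : ∀ x : Var, g.reg x.code = s.var x
  mem : ∀ q i j k, i < N → j < N → k < N → g.mem (addr N q i j k) = s.arr q i j k
  mat : g.mat = s.mat

/-- Registers from `64` on are scratch registers about which the representation says nothing. -/
theorem Rel.setReg {N : ℕ} {s : St D} {g : Config D} (h : Rel N s g) {r : ℕ} (hr : 64 ≤ r)
    (v : ℕ) : Rel N s (g.setReg r v) where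
  size := by simpa [Config.setReg, Function.update_of_ne (show 0 ≠ r by omega)] using h.size
  var x := by
    have := x.code_lt
    simpa [Config.setReg, Function.update_of_ne (show x.code ≠ r by omega)] using h.var x
  mem := h.mem
  mat := h.mat

theorem Rel.setVar {N : ℕ} {s : St D} {g : Config D} (h : Rel N s g) (x : Var) (v : ℕ) :
    Rel N (s.setVar x v) (g.setReg x.code v) where
  size := by
    simpa [Config.setReg, Function.update_of_ne x.code_pos.ne] using h.size
  var y := by
    by_cases hy : y = x
    · subst hy; simp [Config.setReg, St.setVar]
    · simpa [Config.setReg, St.setVar, Function.update_of_ne hy,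
        Function.update_of_ne (Var.code_injective.ne hy)] using h.var y
  mem := h.mem
  mat := h.mat

theorem Rel.setPc {N : ℕ} {s : St D} {g : Config D} (h : Rel N s g) (u : ℕ) :
    Rel N s { g with pc := u } := ⟨h.size, h.var, h.mem, h.mat⟩

theorem Rel.setMem {N : ℕ} {s : St D} {g : Config D} (h : Rel N s g) (q : Arr) {i j k : ℕ}
    (hj : j < N) (hk : k < N) (v : ℕ) :
    Rel N (s.setArr q i j k v) (g.setMem (addr N q i j k) v) where
  size := h.size
  var := h.var
  mem q' i' j' k' hi' hj' hk' := by
    by_cases he : addr N q' i' j' k' = addr N q i j k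
    · obtain ⟨rfl, rfl, rfl, rfl⟩ := addr_inj hj' hk' hj hk he
      simp [Config.setMem, St.setArr, update3]
    · have : (s.setArr q i j k v).arr q' i' j' k' = s.arr q' i' j' k' := by
        by_cases hq : q' = q
        · subst hq
          simp only [St.setArr, Function.update_self, update3]
          rw [if_neg]
          rintro ⟨rfl, rfl, rfl⟩
          exact he rfl
        · simp [St.setArr, Function.update_of_ne hq]
      rw [this, ← h.mem _ _ _ _ hi' hj' hk']
      simp [Config.setMem, Function.update_of_ne he]
  mat := h.mat

theorem Rel.setMat {N : ℕ} {s : St D} {g : Config D} (h : Rel N s g) (m : ℕ) (X : Mat D) :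
    Rel N (s.setMat m X) (g.setMat m X) where
  size := h.size
  var := h.var
  mem := h.mem
  mat := by simp [Config.setMat, St.setMat, h.mat]

/-- The assumptions about the bounds. -/
structure Env.Ok (E : Env) : Prop where
  inp : ∀ q a, E.inp q a < E.W
  le : E.N ≤ E.W
  large : 16 ≤ E.W

theorem entry_lt {W : ℕ} (hW : 0 < W) (X : Mat D) (h : ∀ i j, encode (X i j) < W) (i j : ℕ) :
    entry X i j < W := by
  unfold entry
  split
  · exact h ..
  · exact hW

theorem add_le_mul_of_two_le {a b : ℕ} (ha : 2 ≤ a) (hb : 2 ≤ b) : a + b ≤ a * b := by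
  nlinarith

namespace Expr

theorem sz_pos (e : Expr) : 0 < e.sz := by
  induction e <;> simp_all [sz]

/-- Sizes add where values are combined, so the bounds multiply. As both bounds are at least 2,
their product dominates their sum as well, which covers the operations other than multiplication. -/
theorem eval_lt {E : Env} (hE : E.Ok) {s : St D} (hs : Bounded E.W s) (e : Expr) :
    e.eval E s < E.W ^ e.sz := by
  have h16 := hE.large
  have hle : ∀ a : ℕ, 0 < a → E.W ≤ E.W ^ a := fun a ha => Nat.le_self_pow ha.ne' _
  induction e with
  | lit v =>
    exact lt_of_lt_of_le (Nat.lt_pow_self (by omega : 1 < E.W))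
      (Nat.pow_le_pow_right (by omega) (by simp [sz, eval]))
  | var x => simpa [sz, eval] using hs.var x
  | op o a b iha ihb =>
    have h1 := hle a.sz a.sz_pos
    have h2 := hle b.sz b.sz_pos
    simp only [sz, eval, pow_add]
    set x := a.eval E s
    set y := b.eval E s
    set X := E.W ^ a.sz
    set Y := E.W ^ b.sz
    have h3 : X + Y ≤ X * Y := add_le_mul_of_two_le (by omega) (by omega)
    have hd := Nat.div_le_self x y
    have hm := Nat.mod_le x y
    cases o <;> simp only [BinOp.eval]
    · omega
    · omega
    · exact Nat.mul_lt_mul'' iha ihb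
    · omega
    · omega
  | get q i j k =>
    exact lt_of_lt_of_le (hs.arr ..) (hle _ (by simp [sz]))
  | inp q i => exact lt_of_lt_of_le (hE.inp ..) (hle _ (by simp [sz]))
  | mget h i j _ _ _ =>
    exact lt_of_lt_of_le (entry_lt (by omega) _ (fun _ _ => hs.mat ..) _ _)
      (hle _ (by have := h.sz_pos; simp [sz]; omega))

end Expr

theorem addr_bounds {N i j k : ℕ} (q : Arr) (hi : i < N) (hj : j < N) (hk : k < N) :
    i * N < N ^ 3 * 16 ∧ i * N + j < N ^ 3 * 16 ∧ (i * N + j) * N < N ^ 3 * 16 ∧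
    (i * N + j) * N + k < N ^ 3 * 16 ∧ ((i * N + j) * N + k) * 16 < N ^ 3 * 16 ∧
    ((i * N + j) * N + k) * 16 + q.code < N ^ 3 * 16 := by
  have hq := q.code_lt
  have h1 : i * N + j < N * N := by nlinarith
  have h2 : (i * N + j) * N + k < N * N * N := by nlinarith
  have h3 : i * N + j ≤ (i * N + j) * N := Nat.le_mul_of_pos_right _ (by omega)
  have h4 : N ^ 3 = N * N * N := by ring
  rw [h4]
  omega

/-- The address computation shared by reading and writing array cells. -/
theorem reaches_addr {B : ℕ} {inp : ℕ → ℕ → ℕ} {P : List Instr} {N t i j k : ℕ} {s : St D}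
    (q : Arr) (ht : 64 ≤ t) {g : Config D} {l : List Instr} (hg : Rel N s g)
    (hB : N ^ 3 * 16 ≤ B) (h16 : 16 < B)
    (hi : i < N) (hj : j < N) (hk : k < N) (gi : g.reg t = i) (gj : g.reg (t + 1) = j)
    (gk : g.reg (t + 2) = k)
    (hc : CodeAt P g.pc ([.arith .mul t t 0, .arith .add t t (t + 1), .arith .mul t t 0,
      .arith .add t t (t + 2), .const (t + 1) 16, .arith .mul t t (t + 1),
      .const (t + 1) q.code, .arith .add t t (t + 1)] ++ l)) :
    ∃ g', Reaches B inp P 8 g g' ∧ Rel N s g' ∧ g'.pc = g.pc + 8 ∧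
      g'.reg t = addr N q i j k ∧ ∀ r, r ≠ t → r ≠ t + 1 → g'.reg r = g.reg r := by
  obtain ⟨b1, b2, b3, b4, b5, b6⟩ := addr_bounds q hi hj hk
  have hq := q.code_lt
  have h0 := hg.size
  have t0 : 0 ≠ t := by omega
  have t00 : 0 ≠ t + 1 := by omega
  simp only [List.cons_append, List.nil_append] at hc
  have key : ∀ {g : Config D} {o : BinOp} {dst a b : ℕ} (z : ℕ),
      P[g.pc]? = some (.arith o dst a b) → o.eval (g.reg a) (g.reg b) = z → z < B →
      Reaches B inp P 1 g (g.setReg dst z) := by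
    rintro g o dst a b z h rfl hz
    exact reaches_arith h hz
  have k1 := key (i * N) hc.head (by simp [BinOp.eval, h0, gi]) (by omega)
  have k2 := key (g := g.setReg t (i * N)) (i * N + j) hc.tail.head
    (by simp [Config.setReg, BinOp.eval, gj]) (by omega)
  have k3 := key (g := (g.setReg t (i * N)).setReg t (i * N + j)) ((i * N + j) * N)
    hc.tail.tail.head (by simp [Config.setReg, Config.next, BinOp.eval, t0, h0]) (by omega)
  have k4 := key (g := ((g.setReg t (i * N)).setReg t (i * N + j)).setReg t ((i * N + j) * N))
    ((i * N + j) * N + k) hc.tail.tail.tail.head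
    (by simp [Config.setReg, Config.next, BinOp.eval, gk]) (by omega)
  have r4 := ((k1.trans k2).trans k3).trans k4
  have rel4 := ((((hg.setReg ht (i * N)).setReg ht (i * N + j)).setReg ht
    ((i * N + j) * N)).setReg ht ((i * N + j) * N + k))
  have f4 : ∀ r, r ≠ t → ((((g.setReg t (i * N)).setReg t (i * N + j)).setReg t
      ((i * N + j) * N)).setReg t ((i * N + j) * N + k)).reg r = g.reg r := by
    intro r hr
    simp [Config.setReg, Config.next, Function.update_of_ne hr]
  have v4 : ((((g.setReg t (i * N)).setReg t (i * N + j)).setReg t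
      ((i * N + j) * N)).setReg t ((i * N + j) * N + k)).reg t = (i * N + j) * N + k := by
    simp [Config.setReg]
  have hc4 := hc.tail.tail.tail.tail
  change CodeAt P ((((g.setReg t (i * N)).setReg t (i * N + j)).setReg t
      ((i * N + j) * N)).setReg t ((i * N + j) * N + k)).pc _ at hc4
  have pc4 : ((((g.setReg t (i * N)).setReg t (i * N + j)).setReg t
      ((i * N + j) * N)).setReg t ((i * N + j) * N + k)).pc = g.pc + 4 := rfl
  -- The configuration after four of the eight instructions is made opaque, which keeps the terms in
  -- the second half small.
  generalize ((((g.setReg t (i * N)).setReg t (i * N + j)).setReg t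
      ((i * N + j) * N)).setReg t ((i * N + j) * N + k)) = g4 at *
  have k5 := reaches_const (inp := inp) hc4.head h16
  have k6 := key (g := g4.setReg (t + 1) 16) (((i * N + j) * N + k) * 16) hc4.tail.head
    (by simp [Config.setReg, BinOp.eval, v4]) (by omega)
  have k7 := reaches_const (B := B) (inp := inp) (s := (g4.setReg (t + 1) 16).setReg t
    (((i * N + j) * N + k) * 16)) hc4.tail.tail.head (by omega)
  have k8 := key (g := ((g4.setReg (t + 1) 16).setReg t (((i * N + j) * N + k) * 16)).setReg
    (t + 1) q.code) (((i * N + j) * N + k) * 16 + q.code) hc4.tail.tail.tail.head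
    (by simp [Config.setReg, Config.next, BinOp.eval]) (by omega)
  refine ⟨_, r4.trans (((k5.trans k6).trans k7).trans k8), ?_, ?_, ?_, ?_⟩
  · exact (((rel4.setReg (by omega) _).setReg ht _).setReg (by omega) _).setReg ht _
  · simp [Config.setReg, Config.next, pc4]
  · simp [Config.setReg, addr]
  · intro r h1 h2
    simp [Config.setReg, Config.next, Function.update_of_ne h1, Function.update_of_ne h2, f4 r h1]

theorem Env.Ok.cube_le {E : Env} (hE : E.Ok) : E.N ^ 3 * 16 ≤ E.W ^ 4 := by
  have := Nat.pow_le_pow_left hE.le 3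
  have h := hE.large
  calc E.N ^ 3 * 16 ≤ E.W ^ 3 * E.W := Nat.mul_le_mul this h
    _ = E.W ^ 4 := by ring

theorem pow_le_of_le {W a b B : ℕ} (hW : 0 < W) (h : W ^ b ≤ B) (hab : a ≤ b) : W ^ a ≤ B :=
  (Nat.pow_le_pow_right hW hab).trans h

/-- The clause that registers below `t` are unchanged is what makes the induction work: operands
already evaluated survive the evaluation of later ones. The assumption on `B` passes to
subexpressions because their sizes are smaller. -/
theorem Expr.comp_correct {E : Env} (hE : E.Ok) {B : ℕ} {P : List Instr} {s : St D}
    (hs : Bounded E.W s) (e : Expr) (he : e.safe E s) (hB : E.W ^ e.sz ≤ B) :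
    ∀ (t : ℕ) (g : Config D), 64 ≤ t → CodeAt P g.pc (e.comp t) → Rel E.N s g →
      ∃ g', Reaches B E.inp P e.len g g' ∧ Rel E.N s g' ∧ g'.pc = g.pc + e.len ∧
        g'.reg t = e.eval E s ∧ ∀ r, r < t → g'.reg r = g.reg r := by
  have h16 := hE.large
  have hB' : ∀ a, a ≤ e.sz → E.W ^ a ≤ B := fun a => pow_le_of_le (by omega) hB
  have hval := (eval_lt hE hs e).trans_le hB
  induction e with
  | lit v =>
    intro t g ht hc hg
    refine ⟨_, reaches_const hc.head hval, hg.setReg ht _, rfl, by simp [Config.setReg, eval], ?_⟩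
    intro r hr
    simp [Config.setReg, Function.update_of_ne hr.ne]
  | var x =>
    intro t g ht hc hg
    have hx := hg.var x
    have hxt := x.code_lt
    refine ⟨_, (reaches_const hc.head (by omega)).trans (reaches_arith hc.tail.head ?_),
      (hg.setReg ht _).setReg ht _, rfl, ?_, ?_⟩
    · simp only [eval] at hval
      simpa [Config.setReg, BinOp.eval, Function.update_of_ne (show x.code ≠ t by omega), hx]
        using hval
    · simp [Config.setReg, Config.next, eval, BinOp.eval,
        Function.update_of_ne (show x.code ≠ t by omega), hx]
    · intro r hr
      simp [Config.setReg, Config.next, Function.update_of_ne hr.ne]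
  | op o a b iha ihb =>
    intro t g ht hc hg
    simp only [sz] at hB'
    simp only [comp] at hc
    have ha := hB' a.sz (by omega)
    have hb := hB' b.sz (by omega)
    obtain ⟨g1, r1, rel1, pc1, v1, f1⟩ := iha he.1 ha
      (fun c hc => hB' c (by omega)) ((eval_lt hE hs a).trans_le ha) t g ht hc.left hg
    have hc := hc.right
    rw [length_comp, ← pc1] at hc
    obtain ⟨g2, r2, rel2, pc2, v2, f2⟩ := ihb he.2 hb
      (fun c hc => hB' c (by omega)) ((eval_lt hE hs b).trans_le hb) (t + 1) g1 (by omega)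
      hc.left rel1
    have hc := hc.right
    rw [length_comp, ← pc2] at hc
    have e1 : g2.reg t = a.eval E s := by rw [f2 t (by omega), v1]
    refine ⟨_, (r1.trans r2).trans (reaches_arith hc.head ?_), rel2.setReg ht _, ?_, ?_, ?_⟩
    · rw [e1, v2]; exact hval
    · simp [Config.setReg, Config.next, pc2, pc1, len]; omega
    · simp [Config.setReg, e1, v2, eval]
    · intro r hr
      simp [Config.setReg, Function.update_of_ne hr.ne, f2 r (by omega), f1 r hr]
  | get q i j k ihi ihj ihk =>
    intro t g ht hc hg
    simp only [sz] at hB'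
    simp only [comp] at hc
    have hi := hB' i.sz (by omega)
    have hj := hB' j.sz (by omega)
    have hk := hB' k.sz (by omega)
    obtain ⟨si, sj, sk, ni, nj, nk⟩ := he
    obtain ⟨g1, r1, rel1, pc1, v1, f1⟩ := ihi si hi
      (fun c hc => hB' c (by omega)) ((eval_lt hE hs i).trans_le hi) t g ht hc.left hg
    have hc := hc.right
    rw [length_comp, ← pc1] at hc
    obtain ⟨g2, r2, rel2, pc2, v2, f2⟩ := ihj sj hj
      (fun c hc => hB' c (by omega)) ((eval_lt hE hs j).trans_le hj) (t + 1) g1 (by omega)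
      hc.left rel1
    have hc := hc.right
    rw [length_comp, ← pc2] at hc
    obtain ⟨g3, r3, rel3, pc3, v3, f3⟩ := ihk sk hk
      (fun c hc => hB' c (by omega)) ((eval_lt hE hs k).trans_le hk) (t + 2) g2 (by omega)
      hc.left rel2
    have hc := hc.right
    rw [length_comp, ← pc3] at hc
    have h4 := hB' 4 (by omega)
    have h41 : E.W < E.W ^ 4 := by
      calc E.W = E.W ^ 1 := by ring
        _ < E.W ^ 4 := Nat.pow_lt_pow_right (by omega) (by omega)
    obtain ⟨g4, r4, rel4, pc4, v4, f4⟩ := reaches_addr (inp := E.inp) q ht rel3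
      (hE.cube_le.trans h4) (by omega) ni nj nk
      (by rw [f3 t (by omega), f2 t (by omega), v1]) (by rw [f3 _ (by omega), v2]) v3
      (l := [.load t t]) hc
    have hc := hc.right (l := [.arith .mul t t 0, .arith .add t t (t + 1), .arith .mul t t 0,
      .arith .add t t (t + 2), .const (t + 1) 16, .arith .mul t t (t + 1),
      .const (t + 1) q.code, .arith .add t t (t + 1)]) (l' := [.load t t])
    change CodeAt P (g3.pc + 8) _ at hc
    rw [← pc4] at hc
    refine ⟨_, (((r1.trans r2).trans r3).trans (r4.trans (reaches_load hc.head))),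
      rel4.setReg ht _, ?_, ?_, ?_⟩
    · simp [Config.setReg, Config.next, pc4, pc3, pc2, pc1, len]; omega
    · simp [Config.setReg, v4, eval, rel4.mem q _ _ _ ni nj nk]
    · intro r hr
      simp [Config.setReg, Function.update_of_ne hr.ne, f4 r (by omega) (by omega),
        f3 r (by omega), f2 r (by omega), f1 r hr]
  | inp q i ih =>
    intro t g ht hc hg
    simp only [sz] at hB'
    simp only [comp] at hc
    have hi := hB' i.sz (by omega)
    obtain ⟨g1, r1, rel1, pc1, v1, f1⟩ := ih he hi
      (fun c hc => hB' c (by omega)) ((eval_lt hE hs i).trans_le hi) t g ht hc.left hg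
    have hc := hc.right
    rw [length_comp, ← pc1] at hc
    refine ⟨_, r1.trans (reaches_read hc.head ?_), rel1.setReg ht _, ?_, ?_, ?_⟩
    · rw [v1]; exact hval
    · simp [Config.setReg, Config.next, pc1, len]; omega
    · simp [Config.setReg, v1, eval]
    · intro r hr
      simp [Config.setReg, Function.update_of_ne hr.ne, f1 r hr]
  | mget h i j ihh ihi ihj =>
    intro t g ht hc hg
    simp only [sz] at hB'
    simp only [comp] at hc
    have hh := hB' h.sz (by omega)
    have hi := hB' i.sz (by omega)
    have hj := hB' j.sz (by omega)
    obtain ⟨sh, si, sj, ni, nj⟩ := he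
    obtain ⟨g1, r1, rel1, pc1, v1, f1⟩ := ihh sh hh
      (fun c hc => hB' c (by omega)) ((eval_lt hE hs h).trans_le hh) t g ht hc.left hg
    have hc := hc.right
    rw [length_comp, ← pc1] at hc
    obtain ⟨g2, r2, rel2, pc2, v2, f2⟩ := ihi si hi
      (fun c hc => hB' c (by omega)) ((eval_lt hE hs i).trans_le hi) (t + 1) g1 (by omega)
      hc.left rel1
    have hc := hc.right
    rw [length_comp, ← pc2] at hc
    obtain ⟨g3, r3, rel3, pc3, v3, f3⟩ := ihj sj hj
      (fun c hc => hB' c (by omega)) ((eval_lt hE hs j).trans_le hj) (t + 2) g2 (by omega)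
      hc.left rel2
    have hc := hc.right
    rw [length_comp, ← pc3] at hc
    have e1 : g3.reg t = h.eval E s := by rw [f3 t (by omega), f2 t (by omega), v1]
    have e2 : g3.reg (t + 1) = i.eval E s := by rw [f3 _ (by omega), v2]
    refine ⟨_, ((r1.trans r2).trans r3).trans (reaches_matGet hc.head ?_ ?_ ?_),
      rel3.setReg ht _, ?_, ?_, ?_⟩
    · rw [e2]; exact ni
    · rw [v3]; exact nj
    · rw [e1, e2, v3, rel3.mat]; exact hval
    · simp [Config.setReg, Config.next, pc3, pc2, pc1, len]; omega
    · simp [Config.setReg, e1, e2, v3, rel3.mat, eval]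
    · intro r hr
      simp [Config.setReg, Function.update_of_ne hr.ne, f3 r (by omega), f2 r (by omega), f1 r hr]

end TED.Loop

/-! ### Correctness of compiled commands -/

namespace TED.Loop

variable {D : ℕ}

theorem Cmd.comp_correct {E : Env} (hE : E.Ok) {B : ℕ} (hB4 : E.W ^ 4 ≤ B) {P : List Instr}
    (c : Cmd) (hw : c.wf) (hB : E.W ^ c.sz ≤ B) :
    ∀ (s : St D) (g : Config D), Bounded E.W s → c.safe E s → CodeAt P g.pc (c.comp g.pc) →
      Rel E.N s g →
      ∃ g', Reaches B E.inp P (c.cost E s) g g' ∧ Rel E.N (c.run E s) g' ∧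
        g'.pc = g.pc + c.clen := by
  have h16 := hE.large
  have hB' : ∀ a, a ≤ c.sz → E.W ^ a ≤ B := fun a => pow_le_of_le (by omega) hB
  have h41 : E.W < E.W ^ 4 := by
    calc E.W = E.W ^ 1 := by ring
      _ < E.W ^ 4 := Nat.pow_lt_pow_right (by omega) (by omega)
  induction c with
  | skip => intro s g _ _ _ hg; exact ⟨g, .refl g, hg, rfl⟩
  | assign x e =>
    intro s g hs hsafe hc hg
    simp only [comp] at hc
    obtain ⟨g1, r1, rel1, pc1, v1, -⟩ :=
      e.comp_correct hE hs hsafe.1 hB 64 g le_rfl hc.left hg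
    have hc := hc.right
    rw [Expr.length_comp, ← pc1] at hc
    have hv := hsafe.2
    refine ⟨_, r1.trans ((reaches_const hc.head (by omega)).trans (reaches_arith hc.tail.head ?_)),
      ?_, ?_⟩
    · simp [Config.setReg, BinOp.eval, v1]; omega
    · have := (rel1.setReg (r := 65) (by omega) 0).setVar x (e.eval E s)
      simpa [Config.setReg, BinOp.eval, v1, run] using this
    · simp [Config.setReg, Config.next, pc1, clen]; omega
  | store q i j k e =>
    intro s g hs hsafe hc hg
    simp only [comp] at hc
    simp only [sz] at hB'
    obtain ⟨si, sj, sk, se, ni, nj, nk, -⟩ := hsafe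
    obtain ⟨g1, r1, rel1, pc1, v1, f1⟩ :=
      i.comp_correct hE hs si (hB' _ (by omega)) 64 g le_rfl hc.left hg
    have hc := hc.right
    rw [Expr.length_comp, ← pc1] at hc
    obtain ⟨g2, r2, rel2, pc2, v2, f2⟩ :=
      j.comp_correct hE hs sj (hB' _ (by omega)) 65 g1 (by omega) hc.left rel1
    have hc := hc.right
    rw [Expr.length_comp, ← pc2] at hc
    obtain ⟨g3, r3, rel3, pc3, v3, f3⟩ :=
      k.comp_correct hE hs sk (hB' _ (by omega)) 66 g2 (by omega) hc.left rel2
    have hc := hc.right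
    rw [Expr.length_comp, ← pc3] at hc
    obtain ⟨g4, r4, rel4, pc4, v4, f4⟩ :=
      e.comp_correct hE hs se (hB' _ (by omega)) 67 g3 (by omega) hc.left rel3
    have hc := hc.right
    rw [Expr.length_comp, ← pc4] at hc
    obtain ⟨g5, r5, rel5, pc5, v5, f5⟩ := reaches_addr (inp := E.inp) q (t := 64) le_rfl rel4
      (hE.cube_le.trans hB4) (by omega) ni nj nk
      (by rw [f4 _ (by omega), f3 _ (by omega), f2 _ (by omega), v1])
      (by rw [f4 _ (by omega), f3 _ (by omega), v2]) (by rw [f4 _ (by omega), v3])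
      (l := [.store 64 67]) hc
    have hc := hc.right (l := [.arith .mul 64 64 0, .arith .add 64 64 65, .arith .mul 64 64 0,
      .arith .add 64 64 66, .const 65 16, .arith .mul 64 64 65, .const 65 q.code,
      .arith .add 64 64 65]) (l' := [.store 64 67])
    change CodeAt P (g4.pc + 8) _ at hc
    rw [← pc5] at hc
    have v6 : g5.reg 67 = e.eval E s := by rw [f5 _ (by omega) (by omega), v4]
    have := (((r1.trans r2).trans r3).trans r4).trans (r5.trans (reaches_store hc.head))
    refine ⟨_, this, ?_, ?_⟩
    · rw [v5, v6]
      exact rel5.setMem q nj nk _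
    · simp [Config.setMem, Config.next, pc5, pc4, pc3, pc2, pc1, clen]; omega
  | rmax h i j e =>
    intro s g hs hsafe hc hg
    simp only [comp] at hc
    simp only [sz] at hB'
    obtain ⟨sh, si, sj, se, ni, nj, -⟩ := hsafe
    obtain ⟨g1, r1, rel1, pc1, v1, f1⟩ :=
      h.comp_correct hE hs sh (hB' _ (by omega)) 64 g le_rfl hc.left hg
    have hc := hc.right
    rw [Expr.length_comp, ← pc1] at hc
    obtain ⟨g2, r2, rel2, pc2, v2, f2⟩ :=
      i.comp_correct hE hs si (hB' _ (by omega)) 65 g1 (by omega) hc.left rel1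
    have hc := hc.right
    rw [Expr.length_comp, ← pc2] at hc
    obtain ⟨g3, r3, rel3, pc3, v3, f3⟩ :=
      j.comp_correct hE hs sj (hB' _ (by omega)) 66 g2 (by omega) hc.left rel2
    have hc := hc.right
    rw [Expr.length_comp, ← pc3] at hc
    obtain ⟨g4, r4, rel4, pc4, v4, f4⟩ :=
      e.comp_correct hE hs se (hB' _ (by omega)) 67 g3 (by omega) hc.left rel3
    have hc := hc.right
    rw [Expr.length_comp, ← pc4] at hc
    have e1 : g4.reg 64 = h.eval E s := by
      rw [f4 _ (by omega), f3 _ (by omega), f2 _ (by omega), v1]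
    have e2 : g4.reg 65 = i.eval E s := by rw [f4 _ (by omega), f3 _ (by omega), v2]
    have e3 : g4.reg 66 = j.eval E s := by rw [f4 _ (by omega), v3]
    refine ⟨_, (((r1.trans r2).trans r3).trans r4).trans
      (reaches_matRangeMax hc.head (by rw [e2]; exact ni) (by rw [e3]; exact nj)), ?_, ?_⟩
    · rw [e1, e2, e3, v4, rel4.mat]
      exact rel4.setMat _ _
    · simp [Config.setMat, Config.next, pc4, pc3, pc2, pc1, clen]; omega
  | seq c d ihc ihd =>
    intro s g hs hsafe hc hg
    simp only [comp] at hc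
    simp only [sz] at hB'
    obtain ⟨g1, r1, rel1, pc1⟩ := ihc hw.1 (hB' _ (by omega)) (fun a ha => hB' _ (by omega))
      s g hs hsafe.1 hc.left hg
    have hc := hc.right
    rw [length_comp, ← pc1] at hc
    obtain ⟨g2, r2, rel2, pc2⟩ := ihd hw.2 (hB' _ (by omega)) (fun a ha => hB' _ (by omega))
      _ g1 (bounded_run E c hw.1 s hs hsafe.1) hsafe.2 hc rel1
    exact ⟨g2, r1.trans r2, rel2, by simp only [clen]; omega⟩
  | ite a b c d ihc ihd =>
    intro s g hs hsafe hc hg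
    simp only [comp] at hc
    simp only [sz] at hB'
    obtain ⟨sa, sb, sc, sd⟩ := hsafe
    obtain ⟨g1, r1, rel1, pc1, v1, f1⟩ :=
      a.comp_correct hE hs sa (hB' _ (by omega)) 64 g le_rfl hc.left hg
    have hc := hc.right
    rw [Expr.length_comp, ← pc1] at hc
    obtain ⟨g2, r2, rel2, pc2, v2, f2⟩ :=
      b.comp_correct hE hs sb (hB' _ (by omega)) 65 g1 (by omega) hc.left rel1
    have hc := hc.right
    rw [Expr.length_comp, ← pc2] at hc
    have e1 : g2.reg 64 = a.eval E s := by rw [f2 _ (by omega), v1]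
    have r3 := reaches_jumpLt (B := B) (inp := E.inp) hc.head
    rw [e1, v2] at r3
    have hd := hc.tail.left
    have hc' := hc.tail.right
    rw [length_comp] at hc'
    have hj := hc'.head
    have hc' := hc'.tail
    simp only [cost, run, clen]
    split
    · rename_i hlt
      rw [if_pos hlt] at r3
      obtain ⟨g3, r4, rel4, pc4⟩ := ihc hw.1 (hB' _ (by omega)) (fun a ha => hB' _ (by omega))
        s { g2 with pc := g2.pc + d.clen + 2 } hs (sc hlt)
        (by
          have : g2.pc + 1 + d.clen + 1 = g2.pc + d.clen + 2 := by omega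
          rw [this] at hc'
          exact hc')
        (rel2.setPc _)
      refine ⟨g3, ?_, rel4, by simp only [pc4, pc2, pc1]; omega⟩
      -- This branch stands last and falls through to the end, so it takes one step fewer than
      -- allowed for.
      have := ((r1.trans r2).trans r3).trans r4
      intro post t ht
      exact haltsWithin_mono (by omega) (this post t ht)
    · rename_i hlt
      rw [if_neg hlt] at r3
      obtain ⟨g3, r4, rel4, pc4⟩ := ihd hw.2 (hB' _ (by omega)) (fun a ha => hB' _ (by omega))
        s g2.next hs (sd hlt)
        hd
        ⟨rel2.size, rel2.var, rel2.mem, rel2.mat⟩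
      have pc4' : g3.pc = g2.pc + 1 + d.clen := pc4
      rw [← pc4'] at hj
      have := (((r1.trans r2).trans r3).trans r4).trans (reaches_jump hj)
      refine ⟨{ g3 with pc := g2.pc + d.clen + c.clen + 2 }, ?_, rel4.setPc _, by
        simp only [pc2, pc1]; omega⟩
      intro post t ht
      exact haltsWithin_mono (by omega) (this post t ht)
  | loop i n c ih =>
    intro s g hs hsafe hc hg
    simp only [comp] at hc
    simp only [sz] at hB'
    obtain ⟨hw, hi, hn, hin⟩ := hw
    have hnW := hs.var n
    have h0 := reaches_const (B := B) (inp := E.inp) hc.head (by omega)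
    have hlt := hc.tail.head
    have hend := hc.tail.tail.head
    have hbody := hc.tail.tail.tail.left
    have hinc := hc.tail.tail.tail.right
    rw [length_comp] at hinc
    -- After `t` iterations the machine stands at the loop test, the second instruction of the loop.
    -- The four extra steps per iteration are the test, the loading of 1, the increment and the jump
    -- back. The initialisation and the two jumps that leave the loop account for the final three.
    have key : ∀ t ≤ s.var n, Bounded E.W (iter E i c s t) ∧
        ∃ g', Reaches B E.inp P (∑ t ∈ Finset.range t, (c.cost E (iter E i c s t) + 4) + 1) g g' ∧
          Rel E.N (iter E i c s t) g' ∧ g'.pc = g.pc + 1 := by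
      intro t
      induction t with
      | zero =>
        intro _
        exact ⟨hs.setVar i (by omega), _, by simpa using h0, hg.setVar i 0, rfl⟩
      | succ t iht =>
        intro ht
        obtain ⟨hb, g', r', rel', pc'⟩ := iht (by omega)
        have vi := rel'.var i
        have vn := rel'.var n
        rw [iter_var] at vi
        rw [iter_var_of_ne E i n c hn (Ne.symm hin)] at vn
        refine ⟨(bounded_run E c hw _ hb (hsafe t (by omega))).setVar i (by omega), ?_⟩
        rw [← pc'] at hlt
        have r1 := reaches_jumpLt (B := B) (inp := E.inp) hlt
        rw [vi, vn, if_pos (by omega)] at r1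
        obtain ⟨g2, r2, rel2, pc2⟩ := ih hw (hB' _ (by omega)) (fun a ha => hB' _ (by omega))
          (iter E i c s t) { g' with pc := g.pc + 3 } hb (hsafe t (by omega)) hbody
          (rel'.setPc _)
        simp only at pc2
        have hinc' : CodeAt P g2.pc [.const 64 1, .arith .add i.code i.code 64,
          .jump (g.pc + 1)] := by
          have : g.pc + 1 + 1 + 1 + c.clen = g2.pc := by omega
          rw [this] at hinc
          exact hinc
        have vi2 : g2.reg i.code = t := by
          rw [rel2.var, run_var E c i hi, iter_var]
        have hicode := i.code_lt
        have h64 : i.code ≠ 64 := by omega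
        have r3 := reaches_const (B := B) (inp := E.inp) hinc'.head (by omega)
        have r4 := reaches_arith (B := B) (inp := E.inp) (s := g2.setReg 64 1) hinc'.tail.head
          (by simp [Config.setReg, BinOp.eval, Function.update_of_ne h64, vi2]; omega)
        have e4 : BinOp.add.eval ((g2.setReg 64 1).reg i.code) ((g2.setReg 64 1).reg 64) =
            t + 1 := by
          simp [Config.setReg, BinOp.eval, Function.update_of_ne h64, vi2]
        rw [e4] at r4
        have r5 := reaches_jump (B := B) (inp := E.inp)
          (s := (g2.setReg 64 1).setReg i.code (t + 1)) hinc'.tail.tail.head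
        refine ⟨_, ?_, ((rel2.setReg (r := 64) le_rfl 1).setVar i (t + 1)).setPc (g.pc + 1), rfl⟩
        have := ((((r'.trans r1).trans r2).trans r3).trans r4).trans r5
        rw [Finset.sum_range_succ]
        convert this using 1
        omega
    obtain ⟨-, g', r', rel', pc'⟩ := key _ le_rfl
    have vi := rel'.var i
    have vn := rel'.var n
    rw [iter_var] at vi
    rw [iter_var_of_ne E i n c hn (Ne.symm hin)] at vn
    rw [← pc'] at hlt hend
    have r1 := reaches_jumpLt (B := B) (inp := E.inp) hlt
    rw [vi, vn, if_neg (by omega)] at r1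
    have r2 := reaches_jump (B := B) (inp := E.inp) (s := g'.next) hend
    refine ⟨_, (r'.trans r1).trans r2, ?_, ?_⟩
    · rw [run_loop]
      exact Rel.setPc ⟨rel'.size, rel'.var, rel'.mem, rel'.mat⟩ _
    · simp only [clen]; omega

/-! ### Specifications of commands -/

/-- Started in `s`, the command is safe, takes time at most `T`, and reaches a state in `Q`. -/
def Spec (E : Env) (c : Cmd) (s : St D) (T : ℕ) (Q : St D → Prop) : Prop :=
  c.safe E s ∧ c.cost E s ≤ T ∧ Q (c.run E s)

variable {E : Env}

theorem Spec.mono {c : Cmd} {s : St D} {T T' : ℕ} {Q Q' : St D → Prop} (h : Spec E c s T Q)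
    (hT : T ≤ T') (hQ : ∀ s', Q s' → Q' s') : Spec E c s T' Q' :=
  ⟨h.1, h.2.1.trans hT, hQ _ h.2.2⟩

theorem Spec.skip {s : St D} {Q : St D → Prop} (h : Q s) : Spec E .skip s 0 Q :=
  ⟨trivial, le_rfl, h⟩

theorem Spec.ite {a b : Expr} {c d : Cmd} {s : St D} {T : ℕ} {Q : St D → Prop}
    (ha : a.safe E s) (hb : b.safe E s)
    (hc : a.eval E s < b.eval E s → Spec E c s T Q)
    (hd : ¬ a.eval E s < b.eval E s → Spec E d s T Q) :
    Spec E (.ite a b c d) s (a.len + b.len + 2 + T) Q := by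
  by_cases h : a.eval E s < b.eval E s
  · obtain ⟨h1, h2, h3⟩ := hc h
    refine ⟨⟨ha, hb, fun _ => h1, fun h' => absurd h h'⟩, ?_, ?_⟩
    · simp only [Cmd.cost, if_pos h]; omega
    · simpa only [Cmd.run, if_pos h] using h3
  · obtain ⟨h1, h2, h3⟩ := hd h
    refine ⟨⟨ha, hb, fun h' => absurd h' h, fun _ => h1⟩, ?_, ?_⟩
    · simp only [Cmd.cost, if_neg h]; omega
    · simpa only [Cmd.run, if_neg h] using h3

namespace Cmd

/-- No loops. -/
def flat : Cmd → Prop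
  | seq c d => c.flat ∧ d.flat
  | ite _ _ c d => c.flat ∧ d.flat
  | loop .. => False
  | _ => True

/-- Code without loops executes each instruction at most once. Time bounds of concrete loop-free
commands thereby become numerical facts that `decide` settles. -/
theorem cost_le_clen (E : Env) (c : Cmd) (hc : c.flat) : ∀ s : St D, c.cost E s ≤ c.clen := by
  induction c with
  | seq c d ihc ihd =>
    intro s
    exact Nat.add_le_add (ihc hc.1 s) (ihd hc.2 _)
  | ite a b c d ihc ihd =>
    intro s
    have h1 := ihc hc.1 s
    have h2 := ihd hc.2 s
    simp only [cost, clen]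
    split <;> omega
  | loop => exact hc.elim
  | _ => intro s; exact le_rfl

end Cmd

theorem Spec.of_flat {c : Cmd} {s : St D} {Q : St D → Prop} (hc : c.flat) (h : c.safe E s)
    (hQ : Q (c.run E s)) : Spec E c s c.clen Q := ⟨h, c.cost_le_clen E hc s, hQ⟩

end TED.Loop

namespace TED.Forest

variable {α : Type}

/-! ### Forests -/

@[simp] theorem nil_append (g : Forest α) : nil ++ g = g := rfl

@[simp] theorem cons_append (a : α) (c r g : Forest α) : cons a c r ++ g = cons a c (r ++ g) := rfl

@[simp] theorem append_nil (f : Forest α) : f ++ nil = f := by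
  induction f with
  | nil => rfl
  | cons a c r _ ih => rw [cons_append, ih]

theorem append_assoc (f g h : Forest α) : f ++ g ++ h = f ++ (g ++ h) := by
  induction f with
  | nil => rfl
  | cons a c r _ ih => simp only [cons_append, ih]

@[simp] theorem size_nil : (nil : Forest α).size = 0 := rfl

@[simp] theorem size_cons (a : α) (c r : Forest α) : (cons a c r).size = c.size + r.size + 1 := rfl

theorem EditSeq.trans {k l : ℕ} {f g h : Forest α} (h1 : EditSeq k f g) (h2 : EditSeq l g h) :
    EditSeq (k + l) f h := by
  induction h1 with
  | refl => simpa using h2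
  | step e _ ih =>
    have := EditSeq.step e (ih h2)
    rwa [Nat.add_right_comm]

theorem EditSeq.kids {k : ℕ} {c c' : Forest α} (a : α) (r : Forest α) (h : EditSeq k c c') :
    EditSeq k (cons a c r) (cons a c' r) := by
  induction h with
  | refl => exact .refl _
  | step e _ ih => exact .step (.kids a r e) ih

theorem EditSeq.rest {k : ℕ} {r r' : Forest α} (a : α) (c : Forest α) (h : EditSeq k r r') :
    EditSeq k (cons a c r) (cons a c r') := by
  induction h with
  | refl => exact .refl _
  | step e _ ih => exact .step (.rest a c e) ih

theorem Edit.append_right {f f' : Forest α} (h : Edit f f') (g : Forest α) :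
    Edit (f ++ g) (f' ++ g) := by
  induction h with
  | relabel a b c r => exact .relabel ..
  | delete a c r => rw [append_assoc]; exact .delete ..
  | kids a r h _ => exact .kids _ _ h
  | rest a c _ ih => exact .rest _ _ ih

theorem Edit.append_left {f f' : Forest α} (h : Edit f f') (g : Forest α) :
    Edit (g ++ f) (g ++ f') := by
  induction g with
  | nil => exact h
  | cons a c r _ ih => exact .rest _ _ ih

/-! ### Alignments -/

section Align

variable [DecidableEq α]

/-- `Align f g n`: there is an alignment (a matching of nodes that respects the structure) of the
forests `f` and `g` of weight at least `n`. -/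
inductive Align : Forest α → Forest α → ℕ → Prop
  | nil : Align nil nil 0
  | left (a : α) (c r : Forest α) {g : Forest α} {n : ℕ} (h : Align (c ++ r) g n) :
      Align (cons a c r) g n
  | right (b : α) (c r : Forest α) {f : Forest α} {n : ℕ} (h : Align f (c ++ r) n) :
      Align f (cons b c r) n
  | pair (a b : α) {c r c' r' : Forest α} {n m k : ℕ} (h : Align c c' n) (h' : Align r r' m)
      (hk : k ≤ n + m + eta a b) : Align (cons a c r) (cons b c' r') k

theorem eta_comm (a b : α) : eta a b = eta b a := by simp [eta, eq_comm]

theorem eta_le (a b : α) : eta a b ≤ 2 := by unfold eta; split <;> omega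

theorem one_le_eta (a b : α) : 1 ≤ eta a b := by unfold eta; split <;> omega

theorem Align.symm {f g : Forest α} {n : ℕ} (h : Align f g n) : Align g f n := by
  induction h with
  | nil => exact .nil
  | left a c r _ ih => exact .right _ _ _ ih
  | right b c r _ ih => exact .left _ _ _ ih
  | pair a b _ _ hk ih ih' => exact .pair b a ih ih' (by rwa [eta_comm])

theorem Align.mono {f g : Forest α} {n m : ℕ} (h : Align f g n) (hm : m ≤ n) : Align f g m := by
  induction h with
  | nil => obtain rfl : m = 0 := by omega
           exact .nil
  | left a c r _ ih => exact .left _ _ _ (ih hm)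
  | right b c r _ ih => exact .right _ _ _ (ih hm)
  | pair a b h h' hk _ _ => exact .pair a b h h' (hm.trans hk)

theorem Align.le_left {f g : Forest α} {n : ℕ} (h : Align f g n) : n ≤ 2 * f.size := by
  induction h with
  | nil => simp
  | left a c r _ ih => rw [size_append] at ih; simp; omega
  | right b c r _ ih => exact ih
  | pair a b _ _ hk ih ih' => have := eta_le a b; simp; omega

theorem Align.le_right {f g : Forest α} {n : ℕ} (h : Align f g n) : n ≤ 2 * g.size :=
  h.symm.le_left

theorem align_nil_left (g : Forest α) : Align nil g 0 := by
  generalize hn : g.size = n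
  induction n generalizing g with
  | zero => cases g with
    | nil => exact .nil
    | cons => simp at hn
  | succ n ih => cases g with
    | nil => exact .nil
    | cons a c r => exact .right _ _ _ (ih _ (by rw [size_append]; simp at hn; omega))

theorem align_zero (f g : Forest α) : Align f g 0 := by
  generalize hn : f.size = n
  induction n generalizing f with
  | zero => cases f with
    | nil => exact align_nil_left g
    | cons => simp at hn
  | succ n ih => cases f with
    | nil => exact align_nil_left g
    | cons a c r => exact .left _ _ _ (ih _ (by rw [size_append]; simp at hn; omega))

theorem Align.append {f g f' g' : Forest α} {n m : ℕ} (h : Align f g n) (h' : Align f' g' m) :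
    Align (f ++ f') (g ++ g') (n + m) := by
  induction h with
  | nil => simpa using h'
  | left a c r _ ih => rw [append_assoc] at ih; exact .left _ _ _ ih
  | right b c r _ ih => rw [append_assoc] at ih; exact .right _ _ _ ih
  | pair a b h _ hk _ ih' => exact .pair a b h ih' (by omega)

theorem align_self (f : Forest α) : Align f f (2 * f.size) := by
  induction f with
  | nil => exact .nil
  | cons a c r ihc ihr => exact .pair a a ihc ihr (by simp [eta]; omega)

/-- Undoing an edit operation in an alignment. -/
theorem Edit.align {f f' g : Forest α} {n : ℕ} (e : Edit f f') (h : Align f' g n) :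
    ∀ k, k + f'.size + 1 ≤ n + f.size → Align f g k := by
  -- For a removal the inequality says that `k` is at most `n`, for a relabelling that it is at most
  -- `n - 1`: a removed node can stay unmatched, whereas a relabelled one may lose one unit of
  -- weight in its pair.
  induction h generalizing f with
  | nil =>
    intro k hk
    generalize hf : (Forest.nil : Forest α) = f' at e
    cases e with
    | delete a c r =>
      refine .left _ _ _ (hf ▸ ?_)
      obtain rfl : k = 0 := by
        have : (c ++ r).size = 0 := by rw [← hf]; rfl
        rw [size_append] at this
        simp at hk; omega
      exact .nil
    | _ => cases hf
  | @left a c r g n h ih =>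
    intro k hk
    generalize hf : cons a c r = f' at e
    cases e with
    | delete a' c' r' =>
      refine .left _ _ _ (hf ▸ Align.left a c r (h.mono ?_))
      have : (cons a c r).size = (c' ++ r').size := by rw [hf]
      rw [size_append] at this
      simp at hk this; omega
    | relabel b _ _ _ => cases hf; exact .left _ _ _ (h.mono (by simp at hk; omega))
    | kids _ _ e' =>
      cases hf
      exact .left _ _ _ (ih (e'.append_right _) k (by rw [size_append, size_append]; simp at hk; omega))
    | rest _ _ e' =>
      cases hf
      exact .left _ _ _ (ih (e'.append_left _) k (by rw [size_append, size_append]; simp at hk; omega))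
  | right b c r h ih => intro k hk; exact .right _ _ _ (ih e k hk)
  | @pair a b c r c' r' n m j h h' hj ih ih' =>
    intro k hk
    generalize hf : cons a c r = f' at e
    cases e with
    | delete a' c0 r0 =>
      refine .left _ _ _ (hf ▸ Align.pair a b h h' ?_)
      have : (cons a c r).size = (c0 ++ r0).size := by rw [hf]
      rw [size_append] at this
      simp at hk this; omega
    | relabel a' _ _ _ =>
      cases hf
      have h1 := eta_le a b
      have h2 := one_le_eta a' b
      exact .pair _ _ h h' (by simp at hk; omega)
    | kids _ _ e' =>
      cases hf
      rename_i c0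
      simp at hk
      -- If the loss exceeds the weight available below this pair, the empty alignment there is good
      -- enough. The case distinction guards against truncated subtraction.
      by_cases hn : c.size + 1 ≤ n + c0.size
      · exact .pair _ _ (ih e' (n + c0.size - c.size - 1) (by omega)) h' (by omega)
      · exact .pair _ _ (align_zero _ _) h' (by omega)
    | rest _ _ e' =>
      cases hf
      rename_i r0
      simp at hk
      by_cases hn : r.size + 1 ≤ m + r0.size
      · exact .pair _ _ h (ih' e' (m + r0.size - r.size - 1) (by omega)) (by omega)
      · exact .pair _ _ h (align_zero _ _) (by omega)

theorem EditSeq.align {p : ℕ} {f f' g : Forest α} {n : ℕ} (e : EditSeq p f f')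
    (h : Align f' g n) : ∀ k, k + f'.size + p ≤ n + f.size → Align f g k := by
  induction e with
  | refl => intro k hk; exact h.mono (by omega)
  | @step p f f' f'' e _ ih =>
    intro k hk
    by_cases hn : f''.size + p ≤ n + f'.size
    · exact e.align (ih h (n + f'.size - f''.size - p) (by omega)) k (by omega)
    · have : k + f'.size + 1 ≤ 0 + f.size := by omega
      exact e.align (align_zero _ _) k this

/-- Unmatched nodes are removed on their own side, and a matched pair with different labels is
repaired by one relabelling on the left. Each node counts one, so a pair of equal labels saves two
and an unequal pair saves one. -/
theorem Align.editSeq {f g : Forest α} {n : ℕ} (h : Align f g n) :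
    ∃ p q h, EditSeq p f h ∧ EditSeq q g h ∧ n + (p + q) ≤ f.size + g.size := by
  induction h with
  | nil => exact ⟨0, 0, Forest.nil, .refl _, .refl _, le_rfl⟩
  | left a c r _ ih =>
    obtain ⟨p, q, h, h1, h2, h3⟩ := ih
    rw [size_append] at h3
    exact ⟨p + 1, q, h, .step (.delete a c r) h1, h2, by simp; omega⟩
  | right a c r _ ih =>
    obtain ⟨p, q, h, h1, h2, h3⟩ := ih
    rw [size_append] at h3
    exact ⟨p, q + 1, h, h1, .step (.delete a c r) h2, by simp; omega⟩
  | @pair a b c r c' r' n m k _ _ hk ih ih' =>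
    obtain ⟨p, q, h, h1, h2, h3⟩ := ih
    obtain ⟨p', q', h', h1', h2', h3'⟩ := ih'
    have s1 := (h1.kids a r).trans (h1'.rest a h)
    have s2 := (h2.kids b r').trans (h2'.rest b h)
    by_cases hab : a = b
    · subst hab
      refine ⟨_, _, _, s1, s2, ?_⟩
      simp [eta] at hk ⊢
      omega
    · refine ⟨_, _, _, .step (.relabel a b c r) ((h1.kids b r).trans (h1'.rest b h)), s2, ?_⟩
      simp [eta, hab] at hk ⊢
      omega

/-- The bridge from edit sequences to alignments, after which edit sequences are needed only for the
effect of removing nodes. From right to left, one starts with the identity alignment of the common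
forest of an optimal pair of edit sequences and undoes the operations on both sides. -/
theorem align_iff {f g : Forest α} {n : ℕ} : Align f g n ↔ n ≤ sim f g := by
  constructor
  · intro h
    obtain ⟨p, q, h, h1, h2, h3⟩ := h.editSeq
    have : ed f g ≤ p + q := Nat.sInf_le ⟨p, q, h, h1, h2, rfl⟩
    unfold sim
    omega
  · intro hn
    have hne : {n | ∃ (p q : ℕ) (h : Forest α), EditSeq p f h ∧ EditSeq q g h ∧ n = p + q}.Nonempty :=
      ⟨_, _, _, nil, editSeq_nil _ f rfl, editSeq_nil _ g rfl, rfl⟩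
    obtain ⟨p, q, h, h1, h2, h3⟩ := Nat.sInf_mem hne
    change ed f g = p + q at h3
    have hle := ed_le f g
    unfold sim at hn
    by_cases hp : p ≤ h.size + f.size
    · have s1 := h1.align (align_self h) (h.size + f.size - p) (by omega)
      by_cases hq : q ≤ f.size + g.size - p
      · exact (h2.align s1.symm n (by omega)).symm
      · omega
    · exact (h2.align (align_zero h f) n (by omega)).symm

theorem align_sim (f g : Forest α) : Align f g (sim f g) := align_iff.2 le_rfl

theorem Align.le_sim {f g : Forest α} {n : ℕ} (h : Align f g n) : n ≤ sim f g := align_iff.1 h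

theorem sim_comm (f g : Forest α) : sim f g = sim g f :=
  le_antisymm (align_sim f g).symm.le_sim (align_sim g f).symm.le_sim

theorem sim_nil_left (g : Forest α) : sim nil g = 0 := by
  have := (align_sim nil g).le_left
  simpa using this

theorem sim_nil_right (f : Forest α) : sim f nil = 0 := by rw [sim_comm, sim_nil_left]

theorem sim_le_right (f g : Forest α) : sim f g ≤ 2 * g.size := (align_sim f g).le_right

end Align

/-- `f'` arises from `f` by removing nodes. -/
def Contains (f f' : Forest α) : Prop := ∃ k, EditSeq k f f' ∧ f.size = f'.size + k

theorem Contains.refl (f : Forest α) : Contains f f := ⟨0, .refl f, rfl⟩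

theorem Contains.trans {f g h : Forest α} (h1 : Contains f g) (h2 : Contains g h) :
    Contains f h := by
  obtain ⟨k, h1, h1'⟩ := h1
  obtain ⟨l, h2, h2'⟩ := h2
  exact ⟨k + l, h1.trans h2, by omega⟩

theorem Contains.delete (a : α) (c r : Forest α) : Contains (cons a c r) (c ++ r) :=
  ⟨1, .step (.delete a c r) (.refl _), by rw [size_append]; rfl⟩

theorem Contains.rest (a : α) (c : Forest α) {r r' : Forest α} (h : Contains r r') :
    Contains (cons a c r) (cons a c r') := by
  obtain ⟨k, h1, h2⟩ := h
  exact ⟨k, h1.rest a c, by simp; omega⟩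

/-- Each removal costs one operation and lowers the size by one, so undoing removals loses no
weight. -/
theorem Contains.align [DecidableEq α] {f f' g : Forest α} {n : ℕ} (h : Contains f f')
    (ha : Align f' g n) : Align f g n := by
  obtain ⟨k, h1, h2⟩ := h
  exact h1.align ha n (by omega)

/-! ### Suffixes of sibling lists, and slices -/

/-- If a node is entered at the traversal position `p`, the forest of this node and its right
siblings, otherwise the empty forest. -/
def suffix : Forest α → ℕ → Forest α
  | nil, _ => nil
  | cons a c r, p =>
    if p = 0 then cons a c r
    else if p ≤ 2 * c.size + 1 then c.suffix (p - 1) else r.suffix (p - (2 * c.size + 2))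

@[simp] theorem suffix_zero (f : Forest α) : f.suffix 0 = f := by cases f <;> rfl

theorem suffix_of_le (f : Forest α) : ∀ p, 2 * f.size ≤ p → f.suffix p = nil := by
  induction f with
  | nil => intro p _; rfl
  | cons a c r _ ih =>
    intro p hp
    simp at hp
    rw [suffix, if_neg (by omega), if_neg (by omega)]
    exact ih _ (by omega)

theorem suffix_size (f : Forest α) : ∀ p, p + 2 * (f.suffix p).size ≤ max p (2 * f.size) := by
  induction f with
  | nil => intro p; simp [suffix]
  | cons a c r ihc ihr =>
    intro p
    rw [suffix]
    split
    · simp; omega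
    · split
      · have := ihc (p - 1)
        simp; omega
      · have := ihr (p - (2 * c.size + 2))
        simp; omega

theorem suffix_bound {f : Forest α} {p : ℕ} {a : α} {c r : Forest α}
    (h : f.suffix p = cons a c r) : p + 2 * c.size + 2 + 2 * r.size ≤ 2 * f.size := by
  have h1 := suffix_size f p
  by_cases hp : 2 * f.size ≤ p
  · rw [suffix_of_le f p hp] at h; cases h
  · rw [h] at h1
    simp at h1
    omega

theorem suffix_kids {f : Forest α} : ∀ {p : ℕ} {a : α} {c r : Forest α},
    f.suffix p = cons a c r → f.suffix (p + 1) = c := by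
  induction f with
  | nil => intro p a c r h; cases h
  | cons a' c' r' ihc ihr =>
    intro p a c r h
    rw [suffix] at h
    rw [suffix, if_neg (by omega)]
    split at h
    · cases h
      subst_vars
      simp
    · split at h
      · have hb := suffix_bound h
        rw [if_pos (by omega), ← ihc h]
        congr 1; omega
      · rw [if_neg (by omega), ← ihr h]
        congr 1; omega

theorem suffix_rest {f : Forest α} : ∀ {p : ℕ} {a : α} {c r : Forest α},
    f.suffix p = cons a c r → f.suffix (p + 2 * c.size + 2) = r := by
  induction f with
  | nil => intro p a c r h; cases h
  | cons a' c' r' ihc ihr =>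
    intro p a c r h
    rw [suffix] at h
    rw [suffix, if_neg (by omega)]
    split at h
    · cases h
      subst_vars
      rw [if_neg (by omega)]
      simp
    · split at h
      · have hb := suffix_bound h
        rw [if_pos (by omega), ← ihc h]
        congr 1; omega
      · rw [if_neg (by omega), ← ihr h]
        congr 1; omega

/-- Nodes are nested or disjoint. -/
theorem suffix_laminar {f : Forest α} : ∀ {p p' : ℕ} {a a' : α} {c r c' r' : Forest α},
    f.suffix p = cons a c r → f.suffix p' = cons a' c' r' → p < p' →
      p' < p + 2 * c.size + 2 → p' + 2 * c'.size + 2 ≤ p + 2 * c.size + 1 := by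
  induction f with
  | nil => intro p p' a a' c r c' r' h; cases h
  | cons a0 c0 r0 ihc ihr =>
    intro p p' a a' c r c' r' h h' hlt hlt'
    rw [suffix] at h h'
    rw [if_neg (by omega)] at h'
    split at h
    · cases h
      subst_vars
      rw [if_pos (by omega)] at h'
      have := suffix_bound h'
      omega
    · split at h
      · have hb := suffix_bound h
        rw [if_pos (by omega)] at h'
        have := ihc h h' (by omega) (by omega)
        omega
      · rw [if_neg (by omega)] at h'
        have := ihr h h' (by omega) (by omega)
        omega

theorem mem_nodes {f : Forest α} {o : ℕ} {v : Node α} : v ∈ f.nodes o ↔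
    ∃ p a c r, f.suffix p = cons a c r ∧ v = ⟨o + p, ⟨a, c⟩⟩ := by
  induction f generalizing o with
  | nil => simp [nodes, suffix]
  | cons a c r ihc ihr =>
    simp only [nodes, List.mem_cons, List.mem_append, ihc, ihr]
    constructor
    · rintro (rfl | ⟨p, a', c', r', h, rfl⟩ | ⟨p, a', c', r', h, rfl⟩)
      · exact ⟨0, a, c, r, rfl, rfl⟩
      · have hb := suffix_bound h
        refine ⟨p + 1, a', c', r', ?_, by congr 1; omega⟩
        rw [suffix, if_neg (by omega), if_pos (by omega)]
        simpa using h
      · refine ⟨p + (2 * c.size + 2), a', c', r', ?_, by congr 1; omega⟩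
        rw [suffix, if_neg (by omega), if_neg (by omega)]
        simpa using h
    · rintro ⟨p, a', c', r', h, rfl⟩
      rw [suffix] at h
      split at h
      · cases h; subst_vars; exact .inl rfl
      · split at h
        · exact .inr (.inl ⟨_, _, _, _, h, by congr 1; omega⟩)
        · exact .inr (.inr ⟨_, _, _, _, h, by congr 1; omega⟩)

theorem length_partners (f : Forest α) : ∀ o, (f.partners o).length = 2 * f.size := by
  induction f with
  | nil => intro o; rfl
  | cons a c r ihc ihr => intro o; simp [partners, ihc, ihr]; omega

theorem length_labels (f : Forest α) : f.labels.length = 2 * f.size := by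
  induction f with
  | nil => rfl
  | cons a c r ihc ihr => simp [labels, ihc, ihr]; omega

theorem partners_getD_add {f : Forest α} : ∀ {o p : ℕ}, p < 2 * f.size →
    (f.partners o).getD p 0 = o + (f.partners 0).getD p 0 := by
  induction f with
  | nil => intro o p h; simp at h
  | cons a c r ihc ihr =>
    intro o p h
    simp at h
    rcases p with _ | p
    · simp [partners]; omega
    · simp only [partners, List.getD_cons_succ]
      by_cases h1 : p < 2 * c.size
      · rw [List.getD_append _ _ _ _ (by rwa [length_partners]),
          List.getD_append _ _ _ _ (by rwa [length_partners]), ihc h1, @ihc (0 + 1) _ h1]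
        omega
      · rw [List.getD_append_right _ _ _ _ (by rw [length_partners]; omega),
          List.getD_append_right _ _ _ _ (by rw [length_partners]; omega), length_partners,
          length_partners]
        rcases hq : p - 2 * c.size with _ | q
        · simp
        · rw [List.getD_cons_succ, List.getD_cons_succ, ihr (by omega),
            @ihr (0 + 2 * c.size + 2) _ (by omega)]
          omega

theorem partners_open {f : Forest α} : ∀ {p : ℕ} {a : α} {c r : Forest α},
    f.suffix p = cons a c r → (f.partners 0).getD p 0 = p + 2 * c.size + 1 := by
  induction f with
  | nil => intro p a c r h; cases h
  | cons a0 c0 r0 ihc ihr =>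
    intro p a c r h
    rw [suffix] at h
    rcases p with _ | p
    · cases h; simp [partners]
    · rw [if_neg (by omega)] at h
      simp only [partners, List.getD_cons_succ]
      split at h
      · have hb := suffix_bound h
        simp only [Nat.add_sub_cancel] at h hb
        rw [List.getD_append _ _ _ _ (by rw [length_partners]; omega),
          partners_getD_add (by omega), ihc h]
        omega
      · have hb := suffix_bound h
        rw [List.getD_append_right _ _ _ _ (by rw [length_partners]; omega), length_partners,
          show p - 2 * c0.size = (p + 1 - (2 * c0.size + 2)) + 1 by omega, List.getD_cons_succ,
          partners_getD_add (by omega), ihr h]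
        omega

/-- The partner of a closing position lies before it, that of an opening position after it. This
comparison is how the program recognises nodes. -/
theorem partners_close {f : Forest α} : ∀ {p : ℕ}, p < 2 * f.size → f.suffix p = nil →
    (f.partners 0).getD p 0 < p := by
  induction f with
  | nil => intro p hp; simp at hp
  | cons a0 c0 r0 ihc ihr =>
    intro p hp h
    simp at hp
    rw [suffix] at h
    rcases p with _ | p
    · cases h
    · rw [if_neg (by omega)] at h
      simp only [partners, List.getD_cons_succ]
      split at h
      · simp only [Nat.add_sub_cancel] at h
        by_cases hp' : p < 2 * c0.size
        · rw [List.getD_append _ _ _ _ (by rw [length_partners]; omega),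
            partners_getD_add (by omega)]
          have := ihc hp' h
          omega
        · rw [List.getD_append_right _ _ _ _ (by rw [length_partners]; omega), length_partners,
            show p - 2 * c0.size = 0 by omega]
          simp
      · rw [List.getD_append_right _ _ _ _ (by rw [length_partners]; omega), length_partners,
          show p - 2 * c0.size = (p + 1 - (2 * c0.size + 2)) + 1 by omega, List.getD_cons_succ,
          partners_getD_add (by omega)]
        have := ihr (by omega) h
        omega

theorem labels_open {f : Forest α} : ∀ {p : ℕ} {a : α} {c r : Forest α},
    f.suffix p = cons a c r → f.labels[p]? = some a := by
  induction f with
  | nil => intro p a c r h; cases h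
  | cons a0 c0 r0 ihc ihr =>
    intro p a c r h
    rw [suffix] at h
    rcases p with _ | p
    · cases h; simp [labels]
    · rw [if_neg (by omega)] at h
      simp only [labels, List.getElem?_cons_succ]
      split at h
      · have hb := suffix_bound h
        simp only [Nat.add_sub_cancel] at h hb
        rw [List.getElem?_append_left (by rw [length_labels]; omega), ihc h]
      · have hb := suffix_bound h
        rw [List.getElem?_append_right (by rw [length_labels]; omega), length_labels,
          show p - 2 * c0.size = (p + 1 - (2 * c0.size + 2)) + 1 by omega,
          List.getElem?_cons_succ, ihr h]

end TED.Forest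

/-! ### Slices, and how alignments split along them -/

namespace TED.Forest

variable {α : Type}

theorem keep_eq_self (f : Forest α) : ∀ {i j o : ℕ}, i ≤ o → o + 2 * f.size ≤ j →
    f.keep i j o = f := by
  induction f with
  | nil => intro i j o _ _; rfl
  | cons a c r ihc ihr =>
    intro i j o hi hj
    simp at hj
    rw [keep, if_pos (by omega), ihc (by omega) (by omega), ihr (by omega) (by omega)]

theorem keep_eq_nil_left (f : Forest α) : ∀ {i j o : ℕ}, o + 2 * f.size ≤ i → f.keep i j o = nil := by
  induction f with
  | nil => intro i j o _; rfl
  | cons a c r ihc ihr =>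
    intro i j o h
    simp at h
    rw [keep, if_neg (by omega), ihc (by omega), ihr (by omega)]
    rfl

theorem keep_eq_nil_of_le (f : Forest α) : ∀ {i j o : ℕ}, j ≤ i → f.keep i j o = nil := by
  induction f with
  | nil => intro i j o _; rfl
  | cons a c r ihc ihr =>
    intro i j o h
    rw [keep, if_neg (by omega), ihc h, ihr h]
    rfl

theorem keep_congr (f : Forest α) : ∀ {i i' j o : ℕ}, i ≤ o → i' ≤ o →
    f.keep i j o = f.keep i' j o := by
  induction f with
  | nil => intro i i' j o _ _; rfl
  | cons a c r ihc ihr =>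
    intro i i' j o h h'
    simp only [keep, h, h', true_and, ihc (show i ≤ o + 1 by omega) (show i' ≤ o + 1 by omega),
      ihr (show i ≤ o + 2 * c.size + 2 by omega) (show i' ≤ o + 2 * c.size + 2 by omega)]

/-- The recursion for slices in their left end. If a node is entered at `i` and closes in time, its
entire tree comes first; otherwise the position `i` contributes nothing. Most facts about slices
below follow from these two rules and laminarity. -/
theorem keep_step (f : Forest α) : ∀ {i j o : ℕ}, o ≤ i →
    (∀ a c r, f.suffix (i - o) = cons a c r → i + 2 * c.size + 2 ≤ j →
      f.keep i j o = cons a c (f.keep (i + 2 * c.size + 2) j o)) ∧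
    ((∀ a c r, f.suffix (i - o) = cons a c r → j < i + 2 * c.size + 2) →
      f.keep i j o = f.keep (i + 1) j o) := by
  induction f with
  | nil => intro i j o _; exact ⟨fun a c r h => (by cases h), fun _ => rfl⟩
  | cons a0 c0 r0 ihc ihr =>
    intro i j o hi
    simp only [suffix]
    rcases Nat.lt_or_ge o i with h | h
    · rw [if_neg (by omega)]
      have key : ∀ i', o < i' → (cons a0 c0 r0).keep i' j o =
          c0.keep i' j (o + 1) ++ r0.keep i' j (o + 2 * c0.size + 2) := fun i' hi' => by
        rw [keep, if_neg (by omega)]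
      split
      · obtain ⟨h1, h2⟩ := ihc (i := i) (j := j) (o := o + 1) (by omega)
        rw [show i - (o + 1) = i - o - 1 by omega] at h1 h2
        constructor
        · intro a c r hs hj
          have hb := suffix_bound hs
          rw [key _ h, key _ (by omega), h1 a c r hs hj, cons_append,
            keep_congr r0 (i' := i + 2 * c.size + 2) (by omega) (by omega)]
        · intro hs
          rw [key _ h, key _ (by omega), h2 hs, keep_congr r0 (i' := i + 1) (by omega) (by omega)]
      · obtain ⟨h1, h2⟩ := ihr (i := i) (j := j) (o := o + 2 * c0.size + 2) (by omega)
        rw [show i - (o + 2 * c0.size + 2) = i - o - (2 * c0.size + 2) by omega] at h1 h2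
        have hn : ∀ i', i ≤ i' → c0.keep i' j (o + 1) = nil := fun i' hi' =>
          keep_eq_nil_left _ (by omega)
        constructor
        · intro a c r hs hj
          rw [key _ h, key _ (by omega), h1 a c r hs hj, hn _ le_rfl, hn _ (by omega)]
          rfl
        · intro hs
          rw [key _ h, key _ (by omega), h2 hs, hn _ le_rfl, hn _ (by omega)]
    · obtain rfl : i = o := by omega
      rw [if_pos (by omega)]
      constructor
      · intro a c r hs hj
        cases hs
        rw [keep, if_pos (by omega), keep_eq_self c0 (by omega) (by omega), keep,
          if_neg (by omega), keep_eq_nil_left c0 (by omega), nil_append,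
          keep_congr r0 (i' := i + 2 * c0.size + 2) (by omega) (by omega)]
      · intro hs
        have := hs _ _ _ rfl
        rw [keep, if_neg (by omega), keep, if_neg (by omega),
          keep_congr c0 (i' := i + 1) (by omega) (by omega),
          keep_congr r0 (i' := i + 1) (by omega) (by omega)]

variable {F : Forest α} {i j : ℕ}

theorem slice_of_le (h : j ≤ i) : F.slice i j = nil := keep_eq_nil_of_le _ h

theorem slice_node {a : α} {c r : Forest α} (h : F.suffix i = cons a c r)
    (hj : i + 2 * c.size + 2 ≤ j) :
    F.slice i j = cons a c (F.slice (i + 2 * c.size + 2) j) :=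
  (keep_step F (Nat.zero_le i)).1 a c r h hj

theorem slice_skip (h : ∀ a c r, F.suffix i = cons a c r → j < i + 2 * c.size + 2) :
    F.slice i j = F.slice (i + 1) j :=
  (keep_step F (Nat.zero_le i)).2 h

theorem slice_prefix (f : Forest α) : ∀ {i : ℕ} {g : Forest α}, F.suffix i = f ++ g →
    i + 2 * f.size ≤ j → F.slice i j = f ++ F.slice (i + 2 * f.size) j := by
  induction f with
  | nil => intro i g _ _; simp
  | cons a c r _ ih =>
    intro i g h hj
    simp at hj
    rw [slice_node h (by omega), ih (suffix_rest h) (by omega)]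
    simp only [cons_append, size_cons]
    congr 3
    omega

theorem slice_kids {a : α} {c r : Forest α} (h : F.suffix i = cons a c r) :
    F.slice (i + 1) (i + 1 + 2 * c.size) = c := by
  rw [slice_prefix c (g := nil) (by rw [suffix_kids h, append_nil]) le_rfl, slice_of_le le_rfl,
    append_nil]

/-- Removing the first root of a slice amounts to moving the left end past its opening position.
Hence slices are closed under the steps of an alignment and suffice as subproblems. -/
theorem slice_kids_append {a : α} {c r : Forest α} (h : F.suffix i = cons a c r)
    (hj : i + 2 * c.size + 2 ≤ j) :
    F.slice (i + 1) j = c ++ F.slice (i + 2 * c.size + 2) j := by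
  have hs : ∀ a' c' r', F.suffix (i + 1 + 2 * c.size) = cons a' c' r' →
      j < i + 1 + 2 * c.size + 2 * c'.size + 2 := by
    intro a' c' r' h'
    have := suffix_laminar h h' (by omega) (by omega)
    omega
  rw [slice_prefix c (g := nil) (by rw [suffix_kids h, append_nil]) (by omega), slice_skip hs]
  congr 2
  omega

theorem slice_suffix : F.slice i (i + 2 * (F.suffix i).size) = F.suffix i := by
  rw [slice_prefix (F.suffix i) (g := nil) (by rw [append_nil]) le_rfl, slice_of_le le_rfl,
    append_nil]

theorem slice_tree {a : α} {c r : Forest α} (h : F.suffix i = cons a c r) :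
    F.slice i (i + 2 * c.size + 2) = cons a c nil := by
  rw [slice_node h le_rfl, slice_of_le le_rfl]

/-- This locates the first tree of a slice in the ambient forest, so that inductions over alignments
can continue with slices that start further right. -/
theorem slice_cons_inv {a : α} {c r : Forest α} (h : F.slice i j = cons a c r) :
    ∃ p r0, i ≤ p ∧ F.suffix p = cons a c r0 ∧ p + 2 * c.size + 2 ≤ j ∧
      r = F.slice (p + 2 * c.size + 2) j ∧ F.slice (p + 1) j = c ++ r := by
  generalize hn : j - i = n
  induction n generalizing i with
  | zero => rw [slice_of_le (by omega)] at h; cases h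
  | succ n ih =>
    by_cases hs : ∀ a c r, F.suffix i = cons a c r → j < i + 2 * c.size + 2
    · rw [slice_skip hs] at h
      obtain ⟨p, r0, hp, h'⟩ := ih h (by omega)
      exact ⟨p, r0, by omega, h'⟩
    · push Not at hs
      obtain ⟨a', c', r', h1, h2⟩ := hs
      rw [slice_node h1 h2] at h
      cases h
      exact ⟨i, r', le_rfl, h1, h2, rfl, slice_kids_append h1 h2⟩

/-- Cutting at `k` loses exactly the nodes that are open at `k`. -/
theorem slice_contains_append {k : ℕ} (hik : i ≤ k) (hkj : k ≤ j) :
    Contains (F.slice i j) (F.slice i k ++ F.slice k j) := by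
  generalize hn : k - i = n
  induction n using Nat.strong_induction_on generalizing i with
  | _ n ih =>
    rcases Nat.eq_zero_or_pos n with rfl | hpos
    · obtain rfl : i = k := by omega
      rw [slice_of_le le_rfl]
      exact .refl _
    · by_cases hs : ∀ a c r, F.suffix i = cons a c r → j < i + 2 * c.size + 2
      · rw [slice_skip hs, slice_skip (j := k) fun a c r h => by have := hs a c r h; omega]
        exact ih (n - 1) (by omega) (by omega) (by omega)
      · push Not at hs
        obtain ⟨a, c, r, h1, h2⟩ := hs
        by_cases hk : i + 2 * c.size + 2 ≤ k
        · rw [slice_node h1 h2, slice_node h1 hk]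
          exact (ih (n - (2 * c.size + 2)) (by omega) hk (by omega)).rest a c
        · have h3 : Contains (F.slice i j) (F.slice (i + 1) j) := by
            rw [slice_node h1 h2, slice_kids_append h1 h2]
            exact .delete ..
          rw [slice_skip (j := k) (F := F) (i := i) fun a' c' r' h => by
            rw [h1] at h; cases h; omega]
          exact h3.trans (ih (n - 1) (by omega) (by omega) (by omega))

/-- Inside the children of a node, slices split at the end of these children. -/
theorem slice_append_of_kids {p q : ℕ} {a : α} {c r : Forest α} (h : F.suffix p = cons a c r)
    (h1 : p < i) (h2 : i ≤ p + 1 + 2 * c.size) (hq : q = p + 2 * c.size + 2) (hj : q ≤ j) :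
    F.slice i j = F.slice i (p + 1 + 2 * c.size) ++ F.slice q j := by
  generalize hn : p + 1 + 2 * c.size - i = n
  induction n using Nat.strong_induction_on generalizing i with
  | _ n ih =>
    by_cases hs : ∀ a' c' r', F.suffix i = cons a' c' r' → j < i + 2 * c'.size + 2
    · by_cases hi : i = p + 1 + 2 * c.size
      · rw [slice_skip hs, slice_of_le (j := p + 1 + 2 * c.size) (by omega), nil_append]
        congr 1; omega
      · rw [slice_skip hs, slice_skip (j := p + 1 + 2 * c.size) fun a c r h => by
          have := hs a c r h; omega]
        exact ih (n - 1) (by omega) (by omega) (by omega) (by omega)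
    · push Not at hs
      obtain ⟨a', c', r', h3, h4⟩ := hs
      have hl := suffix_laminar h h3 h1 (by omega)
      rw [slice_node h3 h4, slice_node h3 (by omega), cons_append,
        ih (n - (2 * c'.size + 2)) (by omega) (by omega) (by omega) (by omega)]

section Align

variable [DecidableEq α]

theorem align_slice_append {k n m : ℕ} {g g' : Forest α} (hik : i ≤ k) (hkj : k ≤ j)
    (h : Align (F.slice i k) g n) (h' : Align (F.slice k j) g' m) :
    Align (F.slice i j) (g ++ g') (n + m) :=
  (slice_contains_append hik hkj).align (h.append h')

theorem Align.slice_mono {i' j' n : ℕ} {g : Forest α} (h : Align (F.slice i j) g n)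
    (hi : i' ≤ i) (hj : j ≤ j') : Align (F.slice i' j') g n := by
  by_cases hij : i ≤ j
  · have h1 := align_slice_append hi hij (align_zero _ Forest.nil) h
    have h2 := align_slice_append (hi.trans hij) hj h1 (align_zero _ Forest.nil)
    simpa using h2
  · rw [slice_of_le (by omega)] at h
    have := h.le_left
    obtain rfl : n = 0 := by simpa using this
    exact align_zero _ _

/-- An alignment of a slice with a concatenation splits the slice. -/
theorem Align.slice_split {n : ℕ} {g g' : Forest α} (h : Align (F.slice i j) (g ++ g') n)
    (hij : i ≤ j) : ∃ k n1 n2, i ≤ k ∧ k ≤ j ∧ n ≤ n1 + n2 ∧ Align (F.slice i k) g n1 ∧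
      Align (F.slice k j) g' n2 := by
  generalize hf : F.slice i j = f at h
  generalize hg : g ++ g' = g0 at h
  -- Once the first forest is used up, the cut is made at the current left end. Until then each step
  -- of the alignment moves the left end to the right or consumes a node of the first forest.
  have triv : ∀ {g'' : Forest α} {n}, Align f g'' n → Forest.nil ++ g' = g'' →
      ∃ k n1 n2, i ≤ k ∧ k ≤ j ∧ n ≤ n1 + n2 ∧ Align (F.slice i k) (Forest.nil : Forest α) n1 ∧
      Align (F.slice k j) g' n2 := by
    intro g'' n h he
    obtain rfl : g' = g'' := he
    exact ⟨i, 0, n, le_rfl, hij, by omega, align_zero _ _, hf ▸ h⟩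
  induction h generalizing i g with
  | nil =>
    cases g with
    | nil => exact triv .nil hg
    | cons => cases hg
  | left a c r h ih =>
    obtain ⟨p, r0, h1, h2, h3, h4, h5⟩ := slice_cons_inv hf
    obtain ⟨k, n1, n2, k1, k2, k3, k4, k5⟩ := ih (i := p + 1) (by omega) h5 hg
      (fun {g''} {n} h he => ⟨p + 1, 0, n, le_rfl, by omega, by omega, align_zero _ _, by
        obtain rfl : g' = g'' := he
        rw [h5]; exact h⟩)
    exact ⟨k, n1, n2, by omega, k2, k3, k4.slice_mono (by omega) le_rfl, k5⟩
  | right b c r h ih =>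
    cases g with
    | nil => exact triv (.right b c r h) hg
    | cons b' c' r' =>
      cases hg
      obtain ⟨k, n1, n2, k1, k2, k3, k4, k5⟩ := ih (g := c ++ r') hij hf
        (by rw [append_assoc]; rfl) triv
      exact ⟨k, n1, n2, k1, k2, k3, .right _ _ _ k4, k5⟩
  | @pair a b c r c' r' n m k' h h' hk ih ih' =>
    cases g with
    | nil => exact triv (.pair a b h h' hk) hg
    | cons b' c'' r'' =>
      cases hg
      obtain ⟨p, r0, h1, h2, h3, h4, h5⟩ := slice_cons_inv hf
      obtain ⟨k, n1, n2, k1, k2, k3, k4, k5⟩ := ih' (i := p + 2 * c.size + 2) (g := r'') h3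
        h4.symm rfl (fun {g''} {n} h he => ⟨p + 2 * c.size + 2, 0, n, le_rfl, h3, by omega,
          align_zero _ _, by
          obtain rfl : g' = g'' := he
          rw [← h4]; exact h⟩)
      refine ⟨k, n + n1 + eta a b, n2, by omega, k2, by omega, ?_, k5⟩
      refine Align.slice_mono (i := p) (j := k) ?_ h1 le_rfl
      rw [slice_node h2 k1]
      exact .pair a b h k4 le_rfl

/-- In an alignment of a slice with a tree, the root of the tree is removed or matched. -/
theorem Align.slice_root {n : ℕ} {b : α} {c' : Forest α}
    (h : Align (F.slice i j) (cons b c' Forest.nil) n) : Align (F.slice i j) c' n ∨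
      ∃ p a c r, i ≤ p ∧ F.suffix p = cons a c r ∧ p + 2 * c.size + 2 ≤ j ∧
        n ≤ sim c c' + eta a b := by
  generalize hf : F.slice i j = f at h
  generalize hg : cons b c' Forest.nil = g at h
  induction h generalizing i with
  | nil => cases hg
  | left a c r h ih =>
    obtain ⟨p, r0, h1, h2, h3, h4, h5⟩ := slice_cons_inv hf
    rcases ih h5 hg with h | ⟨p', a', c', r', q1, q2, q3, q4⟩
    · exact .inl (.left _ _ _ h)
    · exact .inr ⟨p', a', c', r', by omega, q2, q3, q4⟩
  | right b c r h ih =>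
    cases hg
    exact .inl (by simpa using h)
  | @pair a b c r c' r' n m k' h h' hk ih ih' =>
    cases hg
    obtain ⟨p, r0, h1, h2, h3, h4, h5⟩ := slice_cons_inv hf
    have := h'.le_right
    have := h.le_sim
    simp at *
    exact .inr ⟨p, h1, a, c, ⟨r0, h2⟩, h3, by omega⟩

/-- The recursion for the alignments of two slices, from the left. -/
theorem align_slice_left_iff {T : Forest α} {i' j' d : ℕ} :
    Align (F.slice i j) (T.slice i' j') d ↔
      Align (F.slice (i + 1) j) (T.slice i' j') d ∨ Align (F.slice i j) (T.slice (i' + 1) j') d ∨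
      ∃ a c r a' c' r' n, F.suffix i = cons a c r ∧ T.suffix i' = cons a' c' r' ∧
        i + 2 * c.size + 2 ≤ j ∧ i' + 2 * c'.size + 2 ≤ j' ∧
        Align (F.slice (i + 2 * c.size + 2) j) (T.slice (i' + 2 * c'.size + 2) j') n ∧
        d ≤ sim c c' + n + eta a a' := by
  constructor
  · intro h
    by_cases hs : ∀ a c r, F.suffix i = cons a c r → j < i + 2 * c.size + 2
    · rw [slice_skip hs] at h; exact .inl h
    by_cases hs' : ∀ a c r, T.suffix i' = cons a c r → j' < i' + 2 * c.size + 2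
    · rw [slice_skip hs'] at h; exact .inr (.inl h)
    push Not at hs hs'
    obtain ⟨a, c, r, h1, h2⟩ := hs
    obtain ⟨a', c', r', h1', h2'⟩ := hs'
    rw [slice_node h1 h2, slice_node h1' h2'] at h ⊢
    rw [slice_kids_append h1 h2, slice_kids_append h1' h2']
    cases h with
    | left _ _ _ h => exact .inl h
    | right _ _ _ h => exact .inr (.inl h)
    | pair _ _ h h' hk =>
      refine .inr (.inr ⟨a, c, r, a', c', r', _, h1, h1', h2, h2', h', ?_⟩)
      have := h.le_sim
      omega
  · rintro (h | h | ⟨a, c, r, a', c', r', n, h1, h1', h2, h2', h', hd⟩)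
    · exact h.slice_mono (by omega) le_rfl
    · exact (h.symm.slice_mono (by omega) le_rfl).symm
    · rw [slice_node h1 h2, slice_node h1' h2']
      exact .pair a a' (align_sim c c') h' hd

end Align

end TED.Forest

/-! ### The two sides of the block, and alignments around it -/

namespace TED

open Forest

variable {α : Type}

theorem Forest.align_slice_append_both [DecidableEq α] {F T : Forest α} {i k j i' k' j' n m : ℕ}
    (h1 : i ≤ k) (h2 : k ≤ j) (h1' : i' ≤ k') (h2' : k' ≤ j')
    (h : Align (F.slice i k) (T.slice i' k') n) (h' : Align (F.slice k j) (T.slice k' j') m) :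
    Align (F.slice i j) (T.slice i' j') (n + m) :=
  ((slice_contains_append h1' h2').align (align_slice_append h1 h2 h h').symm).symm

/-- A forest `F` with a block `inner` of consecutive siblings, entered at the position `A`, and a
node, entered at the position `top`, that has this block inside. -/
structure Hole (α : Type) where
  F : Forest α
  inner : Forest α
  after : Forest α
  A : ℕ
  top : ℕ
  label : α
  kids : Forest α
  rest : Forest α
  suffix_A : F.suffix A = inner ++ after
  suffix_top : F.suffix top = cons label kids rest
  top_lt : top < A
  end_le : A + 2 * inner.size ≤ top + 1 + 2 * kids.size
  dichotomy : ∀ p a c r, F.suffix p = cons a c r → p < A →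
    p + 2 * c.size + 2 ≤ A ∨ A + 2 * inner.size < p + 2 * c.size + 2

namespace Hole

variable (X : Hole α)

/-- The position after the block. -/
def B : ℕ := X.A + 2 * X.inner.size

/-- The first position of the children of the top node. -/
def lo : ℕ := X.top + 1

/-- The last position of the top node. -/
def hi : ℕ := X.top + 1 + 2 * X.kids.size

/-- The number of positions before the block. -/
def H : ℕ := X.A - X.lo

/-- The number of positions outside of the block. -/
def M1 : ℕ := X.H + (X.hi - X.B)

/-- The position in `F` of a compressed position, as the left end of a slice. -/
def posL (k : ℕ) : ℕ := if k < X.H then X.lo + k else X.B + (k - X.H)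

/-- The position in `F` of a compressed position, as the right end of a slice. -/
def posR (k : ℕ) : ℕ := if k ≤ X.H then X.lo + k else X.B + (k - X.H)

/-- The compressed position of a position of `F`. -/
def pack (r : ℕ) : ℕ := if r < X.A then r - X.lo else X.H + (r - X.B)

theorem lo_le_A : X.lo ≤ X.A := X.top_lt

theorem lo_add_H : X.lo + X.H = X.A := by have := X.lo_le_A; unfold H; omega

theorem B_le_hi : X.B ≤ X.hi := X.end_le

theorem A_le_B : X.A ≤ X.B := by unfold B; omega

theorem B_add : X.B + (X.M1 - X.H) = X.hi := by
  have := X.B_le_hi; unfold M1; omega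

theorem H_le_M1 : X.H ≤ X.M1 := by unfold M1; omega

theorem posL_lt {k : ℕ} (h : k < X.H) : X.posL k = X.lo + k := if_pos h

theorem posL_ge {k : ℕ} (h : X.H ≤ k) : X.posL k = X.B + (k - X.H) := if_neg (by omega)

theorem posR_le {k : ℕ} (h : k ≤ X.H) : X.posR k = X.lo + k := if_pos h

theorem posR_gt {k : ℕ} (h : X.H < k) : X.posR k = X.B + (k - X.H) := if_neg (by omega)

/-- The two readings of a compressed position differ only at `k = H`, where the block sits: as a
right end it is the start of the block, as a left end the position after the block. Every other `k`
has one meaning. -/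
theorem posR_le_posL (k : ℕ) : X.posR k ≤ X.posL k := by
  have := X.lo_add_H
  have := X.A_le_B
  unfold posR posL
  split <;> split <;> omega

theorem posL_mono {k l : ℕ} (h : k ≤ l) : X.posL k ≤ X.posL l := by
  have := X.lo_add_H
  have := X.A_le_B
  unfold posL
  split <;> split <;> omega

theorem posR_mono {k l : ℕ} (h : k ≤ l) : X.posR k ≤ X.posR l := by
  have := X.lo_add_H
  have := X.A_le_B
  unfold posR
  split <;> split <;> omega

theorem posL_lt_posR {k l : ℕ} (h : k < l) : X.posL k < X.posR l := by
  have := X.lo_add_H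
  have := X.A_le_B
  unfold posR posL
  split <;> split <;> omega

theorem posL_zero (h : 0 < X.H) : X.posL 0 = X.lo := by rw [X.posL_lt h]; rfl

theorem posL_lt_hi {k : ℕ} (h : k < X.M1) : X.posL k < X.hi := by
  have := X.lo_add_H
  have := X.A_le_B
  have := X.B_add
  have := X.B_le_hi
  unfold posL
  split <;> omega

theorem lo_le_posL (k : ℕ) : X.lo ≤ X.posL k := by
  have := X.lo_add_H
  have := X.A_le_B
  unfold posL
  split <;> omega

/-- The nodes below the top node end inside of it. -/
theorem node_le_hi {p : ℕ} {a : α} {c r : Forest α} (h : X.F.suffix p = cons a c r)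
    (h1 : X.lo ≤ p) (h2 : p < X.hi) : p + 2 * c.size + 2 ≤ X.hi := by
  unfold lo at h1
  unfold hi at h2 ⊢
  have := suffix_laminar X.suffix_top h (by omega) (by omega)
  omega

/-- A node whose children contain the block. -/
def IsSpine (p : ℕ) (c : Forest α) : Prop := p < X.A ∧ X.B < p + 2 * c.size + 2

theorem slice_A {j : ℕ} (h : X.B ≤ j) : X.F.slice X.A j = X.inner ++ X.F.slice X.B j :=
  slice_prefix X.inner X.suffix_A h

variable [DecidableEq α]

/-- In an alignment of a slice that contains the block, either no ancestor of the block is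
matched, or there is an outermost one that is matched. -/
theorem decompose {T : Forest α} {s e i j n : ℕ} (hs : s ≤ X.A) (he : X.B ≤ e) (hij : i ≤ j)
    (h : Align (X.F.slice s e) (T.slice i j) n) :
    (∃ a b n1 n2 n3, i ≤ a ∧ a ≤ b ∧ b ≤ j ∧ n ≤ n1 + n2 + n3 ∧
      Align (X.F.slice s X.A) (T.slice i a) n1 ∧ Align X.inner (T.slice a b) n2 ∧
      Align (X.F.slice X.B e) (T.slice b j) n3) ∨
    ∃ p a c r pw aw cw rw n1 n3, s ≤ p ∧ X.F.suffix p = cons a c r ∧ X.IsSpine p c ∧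
      p + 2 * c.size + 2 ≤ e ∧
      i ≤ pw ∧ T.suffix pw = cons aw cw rw ∧ pw + 2 * cw.size + 2 ≤ j ∧
      n ≤ n1 + (sim c cw + eta a aw) + n3 ∧
      Align (X.F.slice s p) (T.slice i pw) n1 ∧
      Align (X.F.slice (p + 2 * c.size + 2) e) (T.slice (pw + 2 * cw.size + 2) j) n3 := by
  generalize hm : X.A - s = m
  induction m using Nat.strong_induction_on generalizing s i n with
  | _ m ih =>
    have hAB := X.A_le_B
    rcases Nat.eq_zero_or_pos m with rfl | hpos
    -- The block has been reached without a matched ancestor. It now stands at the front of the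
    -- slice and is split off.
    · obtain rfl : s = X.A := by omega
      rw [X.slice_A he] at h
      obtain ⟨k, n1, n2, k1, k2, k3, k4, k5⟩ := h.symm.slice_split hij
      exact .inl ⟨i, k, 0, n1, n2, le_rfl, k1, k2, by omega, align_zero _ _, k4.symm, k5.symm⟩
    · by_cases hk : ∀ a c r, X.F.suffix s = cons a c r → e < s + 2 * c.size + 2
      · rw [slice_skip hk] at h
        rcases ih (m - 1) (by omega) (s := s + 1) (by omega) hij h (by omega) with
          ⟨a, b, n1, n2, n3, h1, h2, h3, h4, h5, h6, h7⟩ |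
          ⟨p, a, c, r, pw, aw, cw, rw, n1, n3, h1, h2, h3, h4, h5, h6, h7, h8, h9, h10⟩
        · exact .inl ⟨a, b, n1, n2, n3, h1, h2, h3, h4, h5.slice_mono (by omega) le_rfl, h6, h7⟩
        · exact .inr ⟨p, a, c, r, pw, aw, cw, rw, n1, n3, by omega, h2, h3, h4, h5, h6, h7, h8,
            h9.slice_mono (by omega) le_rfl, h10⟩
      · push Not at hk
        obtain ⟨a0, c0, r0, hs1, hs2⟩ := hk
        have h' := h
        rw [slice_node hs1 hs2] at h'
        obtain ⟨k, m1, m2, k1, k2, k3, k4, k5⟩ :=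
          Align.slice_split (g := cons a0 c0 Forest.nil)
            (g' := X.F.slice (s + 2 * c0.size + 2) e) h'.symm hij
        -- A node that closes before the block has its whole tree aligned with `T[i, k)` and joins
        -- the left part; otherwise the node is an ancestor of the block.
        rcases X.dichotomy s a0 c0 r0 hs1 (by omega) with hd | hd
        · have htree : Align (X.F.slice s (s + 2 * c0.size + 2)) (T.slice i k) m1 := by
            rw [slice_tree hs1]; exact k4.symm
          rcases ih (m - (2 * c0.size + 2)) (by omega) (s := s + 2 * c0.size + 2) hd k2 k5.symm
            (by omega) with
            ⟨a, b, n1, n2, n3, h1, h2, h3, h4, h5, h6, h7⟩ |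
            ⟨p, a, c, r, pw, aw, cw, rw, n1, n3, h1, h2, h3, h4, h5, h6, h7, h8, h9, h10⟩
          · exact .inl ⟨a, b, m1 + n1, n2, n3, by omega, h2, h3, by omega,
              align_slice_append_both (by omega) hd k1 h1 htree h5, h6, h7⟩
          · exact .inr ⟨p, a, c, r, pw, aw, cw, rw, m1 + n1, n3, by omega, h2, h3, h4, by omega,
              h6, h7, by omega, align_slice_append_both (by omega) h1 k1 h5 htree h9, h10⟩
        -- If the ancestor is unmatched it is removed and the search continues among its children.
        -- If it is matched it is the outermost one, since all ancestors met before were removed.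
        · rcases k4.slice_root with h0 | ⟨pw, aw, cw, rw, q1, q2, q3, q4⟩
          · have h1 := (h0.symm.append k5.symm)
            rw [← slice_kids_append hs1 hs2] at h1
            have h2 := ((slice_contains_append k1 k2).align h1.symm).symm
            rcases ih (m - 1) (by omega) (s := s + 1) (by omega) hij h2 (by omega) with
              ⟨a, b, n1, n2, n3, h1, h2, h3, h4, h5, h6, h7⟩ |
              ⟨p, a, c, r, pw, aw, cw, rw, n1, n3, h1, h2, h3, h4, h5, h6, h7, h8, h9, h10⟩
            · exact .inl ⟨a, b, n1, n2, n3, h1, h2, h3, by omega,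
                h5.slice_mono (by omega) le_rfl, h6, h7⟩
            · exact .inr ⟨p, a, c, r, pw, aw, cw, rw, n1, n3, by omega, h2, h3, h4, h5, h6, h7,
                by omega, h9.slice_mono (by omega) le_rfl, h10⟩
          · refine .inr ⟨s, a0, c0, r0, pw, aw, cw, rw, 0, m2, le_rfl, hs1, ⟨by omega, hd⟩, hs2, q1,
              q2, by omega, ?_, align_zero _ _, (k5.slice_mono (by omega) le_rfl).symm⟩
            rw [sim_comm c0, eta_comm a0]
            omega

end Hole

/-! ### The table of the alignments with a matched ancestor of the block -/

/-- The data that determine the table. -/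
structure Data (α : Type) where
  T : Forest α
  M1 : ℕ
  C : ℕ → ℕ
  S : ℕ → ℕ
  sv : ℕ → ℕ → ℕ
  et : ℕ → ℕ → ℕ

namespace Data

variable (d : Data α) (V : ℕ → ℕ → ℕ → ℕ)

/-- The value of matching the node `k` with the node `p` of `T`. -/
def nodeVal (p k : ℕ) : ℕ := if d.S k = 0 then V (p + 1) (k + 1) (d.C k) + d.et k p else d.sv k p

/-- The table for the tree at position `p` of `T`. -/
def treeVal (p i j : ℕ) : ℕ :=
  max (V (p + 1) i j)
    ((Finset.Ico i j).sup fun k => if k < d.C k ∧ d.C k < j then d.nodeVal V p k else 0)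

/-- The table satisfies its recursion from the position `b` of `T` on. -/
def Rec (b : ℕ) : Prop := ∀ p, b ≤ p →
  (∀ a c r, d.T.suffix p = cons a c r → ∀ i j, i ≤ j → j ≤ d.M1 →
    V p i j = (Finset.Icc i j).sup fun k =>
      d.treeVal V p i k + V (p + 2 * c.size + 2) k j) ∧
  (d.T.suffix p = nil → ∀ i j, V p i j = 0)

variable {d V}

theorem treeVal_mono {p : ℕ} (h : ∀ i i' j j', i' ≤ i → i ≤ j → j ≤ j' → j' ≤ d.M1 →
      V (p + 1) i j ≤ V (p + 1) i' j') {i i' j j' : ℕ} (hi : i' ≤ i) (hij : i ≤ j) (hj : j ≤ j')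
    (hM : j' ≤ d.M1) : d.treeVal V p i j ≤ d.treeVal V p i' j' := by
  unfold treeVal
  refine max_le_max (h i i' j j' hi hij hj hM) (Finset.sup_le fun k hk => ?_)
  rw [Finset.mem_Ico] at hk
  split
  · rename_i hC
    refine le_trans ?_ (Finset.le_sup (Finset.mem_Ico.2 ⟨hi.trans hk.1, hk.2.trans_le hj⟩))
    rw [if_pos ⟨hC.1, by omega⟩]
  · exact Nat.zero_le _

/-- The table is monotone. -/
theorem Rec.mono {b : ℕ} (h : d.Rec V b) : ∀ p, b ≤ p → ∀ i i' j j', i' ≤ i → i ≤ j → j ≤ j' →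
    j' ≤ d.M1 → V p i j ≤ V p i' j' := by
  intro p
  generalize hn : 2 * d.T.size - p = n
  -- Row `p` refers only to the rows of the children of the first tree and of the trees to its
  -- right. Both start at later positions of `T`, so the number of remaining positions decreases.
  induction n using Nat.strong_induction_on generalizing p with
  | _ n ih =>
    intro hb i i' j j' hi hij hj hM
    obtain ⟨h1, h2⟩ := h p hb
    cases hs : d.T.suffix p with
    | nil => rw [h2 hs, h2 hs]
    | cons a c r =>
      have hsz := suffix_bound hs
      rw [h1 a c r hs i j hij (by omega), h1 a c r hs i' j' (by omega) hM]
      refine Finset.sup_le fun k hk => ?_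
      rw [Finset.mem_Icc] at hk
      refine le_trans ?_ (Finset.le_sup (b := k) (Finset.mem_Icc.2 ⟨by omega, by omega⟩))
      refine Nat.add_le_add (treeVal_mono (ih _ (by omega) (p + 1) rfl (by omega)) hi hk.1 le_rfl
        (by omega)) (ih _ (by omega) _ rfl (by omega) _ _ _ _ le_rfl hk.2 hj hM)

theorem Rec.treeVal_mono {b : ℕ} (h : d.Rec V b) {p : ℕ} (hp : b ≤ p + 1) {i i' j j' : ℕ}
    (hi : i' ≤ i) (hij : i ≤ j) (hj : j ≤ j') (hM : j' ≤ d.M1) :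
    d.treeVal V p i j ≤ d.treeVal V p i' j' :=
  Data.treeVal_mono (fun i i' j j' => h.mono (p + 1) hp i i' j j') hi hij hj hM

/-- The bound depends only on the tree in `T`. It limits the number of different values in a row and
hence the length of the lists of records. -/
theorem treeVal_le {p : ℕ} {a : α} {c r : Forest α} (hs : d.T.suffix p = cons a c r)
    (het : ∀ k p, d.et k p ≤ 2)
    (hsv : ∀ k p a c r, d.T.suffix p = cons a c r → d.sv k p ≤ 2 * c.size + 2)
    (hV : ∀ i j, i ≤ j → j ≤ d.M1 → V (p + 1) i j ≤ 2 * c.size) {i j : ℕ} (hij : i ≤ j)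
    (hj : j ≤ d.M1) : d.treeVal V p i j ≤ 2 * c.size + 2 := by
  unfold treeVal
  refine max_le ((hV i j hij hj).trans (by omega)) (Finset.sup_le fun k hk => ?_)
  rw [Finset.mem_Ico] at hk
  split
  · unfold nodeVal
    split
    · have := hV (k + 1) (d.C k) (by omega) (by omega)
      have := het k p
      omega
    · exact hsv k p a c r hs
  · omega

/-- The table is bounded by the sizes of the forests. -/
theorem Rec.le {b : ℕ} (h : d.Rec V b) (het : ∀ k p, d.et k p ≤ 2)
    (hsv : ∀ k p a c r, d.T.suffix p = cons a c r → d.sv k p ≤ 2 * c.size + 2) :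
    ∀ p, b ≤ p → ∀ i j, i ≤ j → j ≤ d.M1 → V p i j ≤ 2 * (d.T.suffix p).size := by
  intro p
  generalize hn : 2 * d.T.size - p = n
  induction n using Nat.strong_induction_on generalizing p with
  | _ n ih =>
    intro hb i j hij hj
    obtain ⟨h1, h2⟩ := h p hb
    cases hs : d.T.suffix p with
    | nil => rw [h2 hs]; omega
    | cons a c r =>
      have hsz := suffix_bound hs
      rw [h1 a c r hs i j hij (by omega)]
      refine Finset.sup_le fun k hk => ?_
      rw [Finset.mem_Icc] at hk
      have hc := ih _ (by omega) (p + 1) rfl (by omega)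
      rw [suffix_kids hs] at hc
      have ht := treeVal_le hs het hsv hc hk.1 (by omega)
      have hr := ih _ (by omega) (p + 2 * c.size + 2) rfl (by omega) k j hk.2 hj
      rw [suffix_rest hs] at hr
      simp
      omega

end Data

end TED

/-! ### Soundness and completeness of the table -/

namespace TED

open Forest

variable {α : Type} [DecidableEq α]

/-- The data describe the forest with a hole. -/
structure Fits (X : Hole α) (d : Data α) : Prop where
  M1 : d.M1 = X.M1
  C_open : ∀ k < X.M1, ∀ a c r, X.F.suffix (X.posL k) = cons a c r →
    d.C k = X.pack (X.posL k + 2 * c.size + 1)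
  C_close : ∀ k < X.M1, X.F.suffix (X.posL k) = nil → d.C k ≤ k
  S_iff : ∀ k < X.M1, ∀ a c r, X.F.suffix (X.posL k) = cons a c r →
    (d.S k ≠ 0 ↔ X.IsSpine (X.posL k) c)
  et : ∀ k < X.M1, ∀ a c r, X.F.suffix (X.posL k) = cons a c r →
    ∀ p b c' r', d.T.suffix p = cons b c' r' → d.et k p = eta a b
  sv_ge : ∀ k < X.M1, ∀ a c r, X.F.suffix (X.posL k) = cons a c r → X.IsSpine (X.posL k) c →
    ∀ p b c' r', d.T.suffix p = cons b c' r' → ∀ pw aw cw rw, p ≤ pw →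
      d.T.suffix pw = cons aw cw rw → pw + 2 * cw.size + 2 ≤ p + 2 * c'.size + 2 →
      sim c cw + eta a aw ≤ d.sv k p
  sv_ex : ∀ k < X.M1, ∀ a c r, X.F.suffix (X.posL k) = cons a c r → X.IsSpine (X.posL k) c →
    ∀ p b c' r', d.T.suffix p = cons b c' r' → ∃ pw aw cw rw, p ≤ pw ∧
      d.T.suffix pw = cons aw cw rw ∧ pw + 2 * cw.size + 2 ≤ p + 2 * c'.size + 2 ∧
      d.sv k p = sim c cw + eta a aw

/-- A cut of a slice on one side of the block is a compressed position. -/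
theorem Hole.split_side (X : Hole α) {i j n : ℕ} {g g' : Forest α} (hside : j ≤ X.H ∨ X.H ≤ i) (hij : i ≤ j)
    (hj : j ≤ X.M1) (h : Align (X.F.slice (X.posL i) (X.posR j)) (g ++ g') n) :
    ∃ k n1 n2, i ≤ k ∧ k ≤ j ∧ n ≤ n1 + n2 ∧ Align (X.F.slice (X.posL i) (X.posR k)) g n1 ∧
      Align (X.F.slice (X.posL k) (X.posR j)) g' n2 := by
  have h3 := X.lo_add_H
  have h4 := X.A_le_B
  have h5 := X.B_add
  have h6 := X.H_le_M1
  rcases hij.eq_or_lt with rfl | hlt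
  · rw [slice_of_le (X.posR_le_posL i)] at h
    have h0 := h.le_left
    exact ⟨i, 0, 0, le_rfl, le_rfl, by simp at h0; omega, align_zero _ _, align_zero _ _⟩
  obtain ⟨k, n1, n2, k1, k2, k3, k4, k5⟩ := h.slice_split (X.posL_lt_posR hlt).le
  rcases hside with hside | hside
  · rw [X.posL_lt (by omega)] at k1
    rw [X.posR_le hside] at k2
    have hr : X.posR (k - X.lo) = k := by rw [X.posR_le (by omega)]; omega
    refine ⟨k - X.lo, n1, n2, by omega, by omega, k3, by rwa [hr], ?_⟩
    -- The cut may be the start of the block, whose compressed position `H` reads as the position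
    -- after the block when it is a left end. The piece to its right is empty in that case.
    by_cases hk : k - X.lo < X.H
    · rw [X.posL_lt hk, show X.lo + (k - X.lo) = k by omega]; exact k5
    · rw [X.posR_le hside, slice_of_le (by omega)] at k5
      have := k5.le_left
      obtain rfl : n2 = 0 := by simpa using this
      exact align_zero _ _
  · rw [X.posL_ge hside] at k1
    rw [X.posR_gt (by omega)] at k2
    have hl : X.posL (X.H + (k - X.B)) = k := by rw [X.posL_ge (by omega)]; omega
    refine ⟨X.H + (k - X.B), n1, n2, by omega, by omega, k3, ?_, by rwa [hl]⟩
    -- The mirror case: a cut directly after the block leaves an empty piece to its left.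
    by_cases hk : X.B < k
    · rw [X.posR_gt (by omega), show X.B + (X.H + (k - X.B) - X.H) = k by omega]; exact k4
    · rw [X.posL_ge hside, slice_of_le (by omega)] at k4
      have := k4.le_left
      obtain rfl : n1 = 0 := by simpa using this
      exact align_zero _ _

namespace Fits

variable {X : Hole α} {d : Data α} (hX : Fits X d)

include hX

/-- A node that does not surround the block opens and closes on the same side of it, so compression
is a mere shift on its positions. -/
theorem plain {k : ℕ} (hk : k < X.M1) {a : α} {c r : Forest α}
    (hs : X.F.suffix (X.posL k) = cons a c r) (hn : ¬ X.IsSpine (X.posL k) c) :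
    k < d.C k ∧ d.C k < X.M1 ∧ X.posL (k + 1) = X.posL k + 1 ∧
      X.posR (d.C k) = X.posL k + 1 + 2 * c.size ∧
      X.posR (d.C k + 1) = X.posL k + 2 * c.size + 2 ∧
      (k < X.H → d.C k < X.H ∧ d.C k + X.lo = X.posL k + 2 * c.size + 1) ∧
      (X.H ≤ k → d.C k + X.B = X.H + (X.posL k + 2 * c.size + 1)) := by
  have h1 := X.node_le_hi hs (X.lo_le_posL k) (X.posL_lt_hi hk)
  have h2 := X.dichotomy _ _ _ _ hs
  have h3 := X.lo_add_H
  have h4 := X.A_le_B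
  have h5 := X.B_add
  have h6 := X.H_le_M1
  have hC := hX.C_open k hk a c r hs
  by_cases hH : k < X.H
  · rw [X.posL_lt hH] at *
    have h7 : X.lo + k + 2 * c.size + 2 ≤ X.A := by
      rcases h2 (by omega) with h | h
      · exact h
      · exact absurd ⟨by omega, h⟩ hn
    rw [Hole.pack, if_pos (by omega)] at hC
    have h8 : k + 1 < X.H := by omega
    rw [X.posL_lt h8, X.posR_le (by omega), X.posR_le (by omega)]
    omega
  · rw [X.posL_ge (by omega)] at *
    rw [Hole.pack, if_neg (by omega)] at hC
    rw [X.posL_ge (by omega), X.posR_gt (by omega), X.posR_gt (by omega)]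
    omega

/-- An ancestor of the block opens to its left and closes to its right. The position after the node
lies strictly beyond `H`, so it has the same meaning as a left and as a right end. -/
theorem spine {k : ℕ} (hk : k < X.M1) {a : α} {c r : Forest α}
    (hs : X.F.suffix (X.posL k) = cons a c r) (hn : X.IsSpine (X.posL k) c) :
    k < X.H ∧ X.H ≤ d.C k ∧ d.C k < X.M1 ∧ X.posL (d.C k + 1) = X.posL k + 2 * c.size + 2 ∧
      X.posR (d.C k + 1) = X.posL k + 2 * c.size + 2 := by
  have h1 := X.node_le_hi hs (X.lo_le_posL k) (X.posL_lt_hi hk)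
  obtain ⟨h2, h2'⟩ := hn
  have h3 := X.lo_add_H
  have h4 := X.A_le_B
  have h5 := X.B_add
  have h6 := X.H_le_M1
  have hC := hX.C_open k hk a c r hs
  have hH : k < X.H := by
    by_contra hH
    rw [X.posL_ge (by omega)] at h2
    omega
  rw [X.posL_lt hH] at *
  rw [Hole.pack, if_neg (by omega)] at hC
  rw [X.posL_ge (by omega), X.posR_gt (by omega)]
  omega

/-- The value of a spine node is attained by matching it with some node inside the tree at `p`, not
necessarily its root, and this is still an alignment with the tree. Any other node is paired with
the root itself. -/
theorem treeVal_sound {V : ℕ → ℕ → ℕ → ℕ} {p : ℕ} {a : α} {c r : Forest α}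
    (hs : d.T.suffix p = cons a c r)
    (ih : ∀ i j, i ≤ j → j ≤ d.M1 →
      V (p + 1) i j ≤ sim (X.F.slice (X.posL i) (X.posR j)) c) {i j : ℕ} (hij : i ≤ j)
    (hj : j ≤ d.M1) :
    d.treeVal V p i j ≤ sim (X.F.slice (X.posL i) (X.posR j)) (cons a c nil) := by
  have hM := hX.M1
  refine max_le ((ih i j hij hj).trans ?_) (Finset.sup_le fun k hk => ?_)
  · exact (Align.right a c nil (by simpa using align_sim _ c)).le_sim
  rw [Finset.mem_Ico] at hk
  split
  · rename_i hC
    cases hn : X.F.suffix (X.posL k) with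
    | nil => have := hX.C_close k (by omega) hn; omega
    | cons b c' r' =>
      have key : ∀ n, n ≤ sim (cons b c' nil) (cons a c nil) →
          X.posR (d.C k + 1) = X.posL k + 2 * c'.size + 2 →
          n ≤ sim (X.F.slice (X.posL i) (X.posR j)) (cons a c nil) := by
        intro n h1 h2
        have h3 := X.posR_mono (show d.C k + 1 ≤ j by omega)
        rw [← slice_tree hn] at h1
        exact ((align_iff.2 h1).slice_mono (X.posL_mono hk.1) (by omega)).le_sim
      have hS := hX.S_iff k (by omega) b c' r' hn
      by_cases hsp : X.IsSpine (X.posL k) c'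
      · have hq := hX.spine (by omega) hn hsp
        have hS' := hS.2 hsp
        refine key _ ?_ hq.2.2.2.2
        rw [Data.nodeVal, if_neg hS']
        obtain ⟨pw, aw, cw, rw', q1, q2, q3, q4⟩ :=
          hX.sv_ex k (by omega) b c' r' hn hsp p a c r hs
        rw [q4]
        have h1 : Align (cons b c' nil) (cons aw cw nil) (sim c' cw + eta b aw) :=
          .pair b aw (align_sim c' cw) (align_zero _ _) le_rfl
        rw [← slice_tree q2] at h1
        have h2 := (h1.symm.slice_mono q1 q3).symm
        rw [slice_tree hs] at h2
        exact h2.le_sim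
      · have hq := hX.plain (by omega) hn hsp
        have hS' : d.S k = 0 := by by_contra h; exact hsp (hS.1 h)
        refine key _ ?_ hq.2.2.2.2.1
        rw [Data.nodeVal, if_pos hS']
        have h1 := ih (k + 1) (d.C k) (by omega) (by omega)
        rw [hq.2.2.1, hq.2.2.2.1, slice_kids hn] at h1
        have h2 := hX.et k (by omega) b c' r' hn p a c r hs
        refine (Align.pair b a (align_sim c' c) (align_zero nil nil) ?_).le_sim
        omega
  · omega

/-- The table contains only weights of alignments. -/
theorem sound {V : ℕ → ℕ → ℕ → ℕ} (hV : d.Rec V 0) : ∀ p i j, i ≤ j → j ≤ d.M1 →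
    V p i j ≤ sim (X.F.slice (X.posL i) (X.posR j)) (d.T.suffix p) := by
  intro p
  generalize hn : 2 * d.T.size - p = n
  induction n using Nat.strong_induction_on generalizing p with
  | _ n ih =>
    intro i j hij hj
    obtain ⟨h1, h2⟩ := hV p (Nat.zero_le _)
    cases hs : d.T.suffix p with
    | nil => rw [h2 hs]; omega
    | cons a c r =>
      have hsz := suffix_bound hs
      rw [h1 a c r hs i j hij hj]
      refine Finset.sup_le fun k hk => ?_
      rw [Finset.mem_Icc] at hk
      have hc := ih _ (by omega) (p + 1) rfl
      rw [suffix_kids hs] at hc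
      have ht := hX.treeVal_sound hs hc hk.1 (by omega)
      have hr := ih _ (by omega) (p + 2 * c.size + 2) rfl k j hk.2 hj
      rw [suffix_rest hs] at hr
      have h3 := (align_iff.2 ht).append (align_iff.2 hr)
      rw [cons_append, nil_append] at h3
      -- For `i = j` the left end can exceed the right end (by the length of the block). The slice
      -- is then empty and the claimed weight is zero, so no gluing is required.
      rcases hij.eq_or_lt with rfl | hlt
      · obtain rfl : i = k := by omega
        rw [slice_of_le (X.posR_le_posL i)] at h3
        have h4 := h3.le_left
        simp at h4
        omega
      · have h4 : Align (X.F.slice (X.posL i) (X.posR j))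
            (cons a c Forest.nil ++ r) (d.treeVal V p i k + V (p + 2 * c.size + 2) k j) := by
          rcases hk.1.eq_or_lt with rfl | hik
          · refine align_slice_append le_rfl (X.posL_lt_posR hlt).le ?_ (align_iff.2 hr)
            have h5 := align_iff.2 ht
            rw [slice_of_le (X.posR_le_posL i)] at h5
            rw [slice_of_le le_rfl]
            exact h5
          · exact align_slice_append (X.posL_lt_posR hik).le (X.posR_mono hk.2) (align_iff.2 ht)
              ((align_iff.2 hr).slice_mono (X.posR_le_posL k) le_rfl)
        exact h4.le_sim

/-- A slice on one side of the block contains no ancestor of the block. So the root of the tree is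
either removed or matched with an ordinary node, and both options occur in `treeVal`. -/
theorem treeVal_complete {V : ℕ → ℕ → ℕ → ℕ} {p : ℕ} {a : α} {c r : Forest α}
    (hs : d.T.suffix p = cons a c r)
    (ih : ∀ i j, i ≤ j → j ≤ X.M1 → j ≤ X.H ∨ X.H ≤ i →
      sim (X.F.slice (X.posL i) (X.posR j)) c ≤ V (p + 1) i j) {i j : ℕ} (hij : i ≤ j)
    (hj : j ≤ X.M1) (hside : j ≤ X.H ∨ X.H ≤ i) :
    sim (X.F.slice (X.posL i) (X.posR j)) (cons a c nil) ≤ d.treeVal V p i j := by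
  rcases (align_sim (X.F.slice (X.posL i) (X.posR j)) (cons a c nil)).slice_root with
    h | ⟨P, a', c', r', h1, h2, h3, h4⟩
  · exact (h.le_sim.trans (ih i j hij hj hside)).trans (le_max_left _ _)
  · have g3 := X.lo_add_H
    have g4 := X.A_le_B
    obtain ⟨k, rfl, k1, k2, hns⟩ : ∃ k, P = X.posL k ∧ i ≤ k ∧ k < j ∧
        ¬ X.IsSpine (X.posL k) c' := by
      rcases hside with hside | hside
      · rw [X.posR_le hside] at h3
        by_cases hi : i < X.H
        · rw [X.posL_lt hi] at h1
          have : X.posL (P - X.lo) = P := by rw [X.posL_lt (by omega)]; omega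
          refine ⟨P - X.lo, this.symm, by omega, by omega, fun h => ?_⟩
          have := h.2
          omega
        · rw [X.posL_ge (by omega)] at h1
          omega
      · rw [X.posL_ge hside] at h1
        by_cases hjH : X.H < j
        · rw [X.posR_gt hjH] at h3
          have : X.posL (X.H + (P - X.B)) = P := by rw [X.posL_ge (by omega)]; omega
          refine ⟨X.H + (P - X.B), this.symm, by omega, by omega, fun h => ?_⟩
          have := h.1
          omega
        · rw [X.posR_le (by omega)] at h3
          omega
    have hp := hX.plain (by omega) h2 hns
    have hS : d.S k = 0 := by by_contra h; exact hns ((hX.S_iff k (by omega) _ _ _ h2).1 h)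
    have hC : d.C k < j := by
      by_contra h
      have := X.posR_mono (show j ≤ d.C k by omega)
      omega
    have h5 := ih (k + 1) (d.C k) (by omega) (by omega) (by omega)
    rw [hp.2.2.1, hp.2.2.2.1, slice_kids h2] at h5
    have h6 : d.nodeVal V p k ≤ d.treeVal V p i j := by
      refine le_trans ?_ (le_max_right _ _)
      refine le_trans ?_ (Finset.le_sup (Finset.mem_Ico.2 ⟨k1, k2⟩))
      rw [if_pos ⟨hp.1, hC⟩]
    rw [Data.nodeVal, if_pos hS, hX.et k (by omega) _ _ _ h2 _ _ _ _ hs] at h6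
    omega

/-- On slices on one side of the block the table is the similarity. -/
theorem complete_side {V : ℕ → ℕ → ℕ → ℕ} (hV : d.Rec V 0) : ∀ p i j, i ≤ j → j ≤ X.M1 →
    j ≤ X.H ∨ X.H ≤ i → sim (X.F.slice (X.posL i) (X.posR j)) (d.T.suffix p) ≤ V p i j := by
  intro p
  generalize hn : 2 * d.T.size - p = n
  induction n using Nat.strong_induction_on generalizing p with
  | _ n ih =>
    intro i j hij hj hside
    obtain ⟨h1, h2⟩ := hV p (Nat.zero_le _)
    cases hs : d.T.suffix p with
    | nil => rw [sim_nil_right]; exact Nat.zero_le _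
    | cons a c r =>
      have hsz := suffix_bound hs
      have hM := hX.M1
      rw [h1 a c r hs i j hij (by omega)]
      obtain ⟨k, n1, n2, k1, k2, k3, k4, k5⟩ := X.split_side (g := cons a c Forest.nil) (g' := r)
        hside hij hj (align_sim _ (cons a c r))
      have hc := ih _ (by omega) (p + 1) rfl
      rw [suffix_kids hs] at hc
      have hr := ih _ (by omega) (p + 2 * c.size + 2) rfl k j k2 hj (by omega)
      rw [suffix_rest hs] at hr
      have ht := hX.treeVal_complete hs hc k1 (by omega) (by omega)
      have h3 := k4.le_sim
      have h4 := k5.le_sim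
      refine le_trans ?_ (Finset.le_sup (b := k) (Finset.mem_Icc.2 ⟨k1, k2⟩))
      omega

/-- The table contains the alignments with a matched ancestor of the block. -/
theorem spine_le {V : ℕ → ℕ → ℕ → ℕ} (hV : d.Rec V 0) {k : ℕ} (hk : k < X.M1) {a' : α}
    {c' r' : Forest α} (hs' : X.F.suffix (X.posL k) = cons a' c' r')
    (hsp : X.IsSpine (X.posL k) c') {pw : ℕ} {aw : α} {cw rw : Forest α}
    (hw : d.T.suffix pw = cons aw cw rw) : ∀ p, p ≤ pw →
    pw + 2 * cw.size + 2 ≤ p + 2 * (d.T.suffix p).size → ∀ i j n1 n3, i ≤ k → d.C k < j →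
    j ≤ X.M1 → Align (X.F.slice (X.posL i) (X.posR k)) (d.T.slice p pw) n1 →
    Align (X.F.slice (X.posL (d.C k + 1)) (X.posR j))
      (d.T.slice (pw + 2 * cw.size + 2) (p + 2 * (d.T.suffix p).size)) n3 →
    n1 + (sim c' cw + eta a' aw) + n3 ≤ V p i j := by
  intro p
  generalize hn : 2 * d.T.size - p = n
  have hq := hX.spine hk hs' hsp
  have hM := hX.M1
  induction n using Nat.strong_induction_on generalizing p with
  | _ n ih =>
    intro hp he i j n1 n3 hi hC hj ha1 ha3
    cases hs : d.T.suffix p with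
    | nil => rw [hs] at he; simp at he; omega
    | cons b c r =>
      have hsz := suffix_bound hs
      rw [hs] at he ha3
      simp only [size_cons] at he ha3
      have hrec : ∀ s, i ≤ s → s ≤ j →
          d.treeVal V p i s + V (p + 2 * c.size + 2) s j ≤ V p i j := by
        intro s h1 h2
        rw [(hV p (Nat.zero_le _)).1 b c r hs i j (by omega) (by omega)]
        exact Finset.le_sup (f := fun s => d.treeVal V p i s + V (p + 2 * c.size + 2) s j)
          (Finset.mem_Icc.2 ⟨h1, h2⟩)
      have hE : p + 2 * (c.size + r.size + 1) = p + 2 * c.size + 2 + 2 * r.size := by omega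
      have hr := suffix_rest hs
      have hrs : d.T.slice (p + 2 * c.size + 2) (p + 2 * c.size + 2 + 2 * r.size) = r := by
        have := slice_suffix (F := d.T) (i := p + 2 * c.size + 2)
        rwa [hr] at this
      rw [hE] at ha3
      -- The partner of the spine node is the first root. The cut is made directly after the spine
      -- node; nothing is left of `T` for the part before it, so `n1` vanishes.
      rcases hp.eq_or_lt with rfl | hlt
      · rw [hs] at hw
        injection hw with e1 e2 e3
        subst e1 e2 e3
        rw [slice_of_le le_rfl] at ha1
        have h0 := ha1.le_right
        rw [hrs] at ha3
        have h1 := hX.complete_side hV (p + 2 * c.size + 2) (d.C k + 1) j hC hj (by omega)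
        rw [hr] at h1
        have h2 := ha3.le_sim
        have h3 := hrec (d.C k + 1) (by omega) hC
        have h4 : d.nodeVal V p k ≤ d.treeVal V p i (d.C k + 1) := by
          refine le_trans ?_ (le_max_right _ _)
          refine le_trans ?_ (Finset.le_sup (Finset.mem_Ico.2 ⟨hi, by omega⟩))
          rw [if_pos ⟨by omega, by omega⟩]
        have hS : d.S k ≠ 0 := (hX.S_iff k hk _ _ _ hs').2 hsp
        rw [Data.nodeVal, if_neg hS] at h4
        have h5 := hX.sv_ge k hk _ _ _ hs' hsp p _ _ _ hs p _ _ _ le_rfl hs le_rfl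
        simp only [size_nil] at h0
        omega
      -- The partner lies strictly inside the first tree, whose root is given up. What follows the
      -- partner is cut at the end of this tree, and the first piece goes into the recursive call.
      · by_cases hin : pw < p + 2 * c.size + 2
        · have hl := suffix_laminar hs hw hlt (by omega)
          rw [slice_skip (F := d.T) (fun a1 c1 r1 h => by rw [hs] at h; cases h; omega)] at ha1
          rw [slice_append_of_kids hs (by omega) (by omega) rfl (by omega)] at ha3
          obtain ⟨s, m1, m2, s1, s2, s3, s4, s5⟩ := X.split_side (by omega) hC hj ha3
          have h1 := ih _ (by omega) (p + 1) rfl (by omega)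
            (by rw [suffix_kids hs]; omega) i s n1 m1 hi (by omega) (by omega) ha1
            (by rw [suffix_kids hs]; exact s4)
          rw [hrs] at s5
          have h2 := hX.complete_side hV (p + 2 * c.size + 2) s j s2 hj (by omega)
          rw [hr] at h2
          have h3 := s5.le_sim
          have h4 := hrec s (by omega) s2
          have h5 : V (p + 1) i s ≤ d.treeVal V p i s := le_max_left _ _
          omega
        -- The partner lies in a later tree. Now the part before the spine node is cut, and its
        -- first piece is aligned with the first tree.
        · rw [slice_node hs (by omega)] at ha1
          obtain ⟨s, m1, m2, s1, s2, s3, s4, s5⟩ := X.split_side (g := cons b c Forest.nil)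
            (g' := d.T.slice (p + 2 * c.size + 2) pw) (.inl hq.1.le) hi (by omega) ha1
          have h1 := ih _ (by omega) (p + 2 * c.size + 2) rfl (by omega)
            (by rw [hr]; omega) s j m2 n3 s2 hC hj s5 (by rw [hr]; exact ha3)
          have hc := hX.complete_side hV (p + 1)
          rw [suffix_kids hs] at hc
          have h2 := hX.treeVal_complete hs hc s1 (by omega) (by omega)
          have h3 := s4.le_sim
          have h4 := hrec s s1 (by omega)
          omega

theorem table_le {V : ℕ → ℕ → ℕ → ℕ} (hV : d.Rec V 0) {p : ℕ} {b : α} {c r : Forest α}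
    (hs : d.T.suffix p = cons b c r) : V (p + 1) 0 d.M1 ≤ sim X.kids c := by
  have h := hX.sound hV (p + 1) 0 d.M1 (Nat.zero_le _) le_rfl
  rw [suffix_kids hs] at h
  refine h.trans ?_
  -- Only an inclusion holds: if one side of the block is empty, the full compressed range skips the
  -- block.
  have h1 := (align_sim (X.F.slice (X.posL 0) (X.posR d.M1)) c).slice_mono (X.lo_le_posL 0)
    (j' := X.hi) (by
      have := X.lo_add_H
      have := X.A_le_B
      have := X.B_add
      have := X.B_le_hi
      rw [hX.M1]
      unfold Hole.posR
      split <;> omega)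
  rw [Hole.lo, Hole.hi, slice_kids X.suffix_top] at h1
  exact h1.le_sim

/-- The similarity of the children of the top node is either given by the table, or by an
alignment in which no ancestor of the block is matched. -/
theorem sim_kids {V : ℕ → ℕ → ℕ → ℕ} (hV : d.Rec V 0) {p : ℕ} {b : α} {c r : Forest α}
    (hs : d.T.suffix p = cons b c r) : sim X.kids c ≤ V (p + 1) 0 d.M1 ∨
      ∃ i j n1 n2 n3, p + 1 ≤ i ∧ i ≤ j ∧ j ≤ p + 1 + 2 * c.size ∧ sim X.kids c ≤ n1 + n2 + n3 ∧
      Align (X.F.slice X.lo X.A) (d.T.slice (p + 1) i) n1 ∧ Align X.inner (d.T.slice i j) n2 ∧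
      Align (X.F.slice X.B X.hi) (d.T.slice j (p + 1 + 2 * c.size)) n3 := by
  have h1 := align_sim X.kids c
  have h2 : X.F.slice X.lo X.hi = X.kids := slice_kids X.suffix_top
  rw [← h2] at h1
  nth_rw 1 [← slice_kids hs] at h1
  rcases X.decompose X.lo_le_A X.B_le_hi (by omega) h1 with
    ⟨i, j, n1, n2, n3, h⟩ | ⟨P, a', c', r', pw, aw, cw, rw', n1, n3, g1, g2, g3, g4, g5, g6, g7, g8,
      g9, g10⟩
  · exact .inr ⟨i, j, n1, n2, n3, h2 ▸ h⟩
  -- The ancestor opens left of the block, so its position is compressed by subtracting `lo`, and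
  -- the table dominates this alignment on the full range.
  · left
    rw [← h2]
    have e1 := X.lo_add_H
    have e2 := X.H_le_M1
    have e3 := g3.1
    have e4 := X.B_add
    have hP : X.posL (P - X.lo) = P := by rw [X.posL_lt (by omega)]; omega
    rw [← hP] at g2 g3
    have hk : P - X.lo < X.M1 := by omega
    have hq := hX.spine hk g2 g3
    have hlo : X.posL 0 = X.lo := X.posL_zero (by omega)
    have hM := hX.M1
    refine g8.trans (hX.spine_le hV hk g2 g3 g6 (p + 1) g5 ?_ 0 d.M1 n1 n3 (Nat.zero_le _) ?_ ?_ ?_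
      ?_)
    · rw [suffix_kids hs]; exact g7
    · omega
    · omega
    · rw [hlo, X.posR_le (by omega), show X.lo + (P - X.lo) = P by omega]
      exact g9
    · rw [suffix_kids hs, hq.2.2.2.1, hP, hM, X.posR_gt (by omega), e4]
      exact g10

omit hX in
-- The converse of the block case: alignments of the left part, the block and the right part with
-- consecutive slices can be glued, leaving all ancestors of the block unmatched.
theorem le_sim_kids {T : Forest α} {p i j n1 n2 n3 : ℕ} {b : α} {c r : Forest α}
    (hs : T.suffix p = cons b c r) (h1 : p + 1 ≤ i) (h2 : i ≤ j) (h3 : j ≤ p + 1 + 2 * c.size)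
    (h4 : Align (X.F.slice X.lo X.A) (T.slice (p + 1) i) n1)
    (h5 : Align X.inner (T.slice i j) n2)
    (h6 : Align (X.F.slice X.B X.hi) (T.slice j (p + 1 + 2 * c.size)) n3) :
    n1 + n2 + n3 ≤ sim X.kids c := by
  have e1 := X.lo_le_A
  have e2 := X.A_le_B
  have e3 := X.B_le_hi
  have hA : X.F.slice X.A X.B = X.inner := by
    rw [X.slice_A le_rfl, slice_of_le le_rfl, append_nil]
  rw [← hA] at h5
  have h7 := align_slice_append_both (by omega) (by omega) (by omega) h3
    (align_slice_append_both e1 e2 h1 h2 h4 h5) h6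
  rw [slice_kids hs, Hole.lo, Hole.hi, slice_kids X.suffix_top] at h7
  exact h7.le_sim

end Fits

end TED

/-! ### Least ends in `T` for the zones beside the block -/

namespace TED

open Forest

variable {α : Type}

/-- Every node of a slice occupies two positions in it. It follows that weights on one side of the
block are at most `M1`, the range of the tables indexed by weights. -/
theorem Forest.two_mul_slice_size_le {F : Forest α} {i j : ℕ} (h : i ≤ j) :
    2 * (F.slice i j).size ≤ j - i := by
  generalize hn : j - i = n
  induction n using Nat.strong_induction_on generalizing i with
  | _ n ih =>
    rcases h.eq_or_lt with rfl | hlt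
    · rw [slice_of_le le_rfl]; simp
    · by_cases hk : ∀ a c r, F.suffix i = cons a c r → j < i + 2 * c.size + 2
      · rw [slice_skip hk]
        have := ih (n - 1) (by omega) (i := i + 1) (by omega) (by omega)
        omega
      · push Not at hk
        obtain ⟨a, c, r, h1, h2⟩ := hk
        rw [slice_node h1 h2]
        have := ih (n - (2 * c.size + 2)) (by omega) (i := i + 2 * c.size + 2) h2 (by omega)
        simp
        omega

namespace Hole

variable (X : Hole α)

/-- The position in `F` of a position of one of the two zones beside the block: those of the left
zone are numbered `0, …, H`, those of the right zone are numbered `H + 1, …, M1 + 1`. -/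
def zonePos (l : ℕ) : ℕ := if l ≤ X.H then X.lo + l else X.B + (l - 1 - X.H)

/-- The end of the zone. -/
def zoneEnd (l : ℕ) : ℕ := if l ≤ X.H then X.A else X.hi

end Hole

namespace Data

variable (d : Data α) (H : ℕ) (V L : ℕ → ℕ → ℕ → ℕ)

/-- The candidate for the least end that matches the first node of the zone. -/
def matchEnd (k l i s : ℕ) (c : Forest α) : ℕ :=
  if d.S k = 0 ∧ k < d.C k then
    if s ≤ V (i + 1) (k + 1) (d.C k) + d.et k i then i + 2 * c.size + 2
    else L (l + (d.C k + 1 - k)) (i + 2 * c.size + 2)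
      (s - (V (i + 1) (k + 1) (d.C k) + d.et k i))
  else 2 * d.T.size + 1

/-- The recursion for the least ends of the slices of `T` with a given similarity to the zones. -/
def EndRec : Prop := ∀ l ≤ d.M1 + 1, ∀ i ≤ 2 * d.T.size, ∀ s ≤ d.M1,
  (s = 0 → L l i s = i) ∧
  (s ≠ 0 → L l i s = min (if i = 2 * d.T.size then 2 * d.T.size + 1 else L l (i + 1) s)
    (if l = H ∨ l = d.M1 + 1 then 2 * d.T.size + 1 else min (L (l + 1) i s)
      (match d.T.suffix i with
        | .nil => 2 * d.T.size + 1
        | .cons _ c _ => d.matchEnd V L (if l ≤ H then l else l - 1) l i s c)))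

end Data

variable [DecidableEq α]

namespace Fits

variable {X : Hole α} {d : Data α} (hX : Fits X d)

include hX

/-- The children of an ordinary node lie on one side of the block, where the table is both sound and
complete. So the table supplies the exact similarities needed for the least ends. -/
theorem table_kids {V : ℕ → ℕ → ℕ → ℕ} (hV : d.Rec V 0) {k : ℕ} (hk : k < X.M1) {a : α}
    {c r : Forest α} (hs : X.F.suffix (X.posL k) = cons a c r) (hn : ¬ X.IsSpine (X.posL k) c)
    {p : ℕ} {b : α} {c' r' : Forest α} (hp : d.T.suffix p = cons b c' r') :
    V (p + 1) (k + 1) (d.C k) = sim c c' := by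
  have hq := hX.plain hk hs hn
  have hM := hX.M1
  have h1 := hX.sound hV (p + 1) (k + 1) (d.C k) (by omega) (by omega)
  have h2 := hX.complete_side hV (p + 1) (k + 1) (d.C k) (by omega) (by omega) (by omega)
  rw [hq.2.2.1, hq.2.2.2.1, slice_kids hs, suffix_kids hp] at h1 h2
  omega

-- `L` is the threshold of a property that is monotone in the end `e`; the value `2 * d.T.size + 1`
-- plays the role of infinity. The proof is a double induction, over the rest of the zone and over
-- the rest of `T`, and matches the recursion term by term with `align_slice_left_iff`: a minimum of
-- thresholds corresponds to a disjunction.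
set_option maxHeartbeats 800000 in
theorem end_iff {V L : ℕ → ℕ → ℕ → ℕ} (hV : d.Rec V 0) (hL : d.EndRec X.H V L) :
    ∀ l ≤ X.M1 + 1, ∀ i ≤ 2 * d.T.size, ∀ s ≤ X.M1, i ≤ L l i s ∧
      ∀ e ≤ 2 * d.T.size, i ≤ e → (L l i s ≤ e ↔
        Align (X.F.slice (X.zonePos l) (X.zoneEnd l)) (d.T.slice i e) s) := by
  intro l
  have e1 := X.lo_add_H
  have e2 := X.H_le_M1
  have e3 := X.B_add
  have e4 := X.B_le_hi
  have e5 := X.A_le_B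
  have hM := hX.M1
  generalize hn : X.M1 + 1 - l = n
  induction n using Nat.strong_induction_on generalizing l with
  | _ n ihl =>
    intro hl i
    generalize hm : 2 * d.T.size - i = m
    induction m using Nat.strong_induction_on generalizing i with
    | _ m ihi =>
      intro hi s hs
      obtain ⟨hz, hp⟩ := hL l (by omega) i hi s (by omega)
      rcases Nat.eq_zero_or_pos s with rfl | hpos
      · rw [hz rfl]
        exact ⟨le_rfl, fun e _ he => ⟨fun _ => align_zero _ _, fun _ => he⟩⟩
      rw [hp hpos.ne']
      clear hp hz
      -- Here `u` accounts for dropping the position `i` of `T`, and `v` for dropping the first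
      -- position of the zone or matching the two nodes entered there.
      set u := if i = 2 * d.T.size then 2 * d.T.size + 1 else L l (i + 1) s with hu
      set v := if l = X.H ∨ l = d.M1 + 1 then 2 * d.T.size + 1 else min (L (l + 1) i s)
        (match d.T.suffix i with
          | .nil => 2 * d.T.size + 1
          | .cons _ c _ => d.matchEnd V L (if l ≤ X.H then l else l - 1) l i s c) with hv
      have Hu : i ≤ u ∧ ∀ e ≤ 2 * d.T.size, i ≤ e → (u ≤ e ↔
          Align (X.F.slice (X.zonePos l) (X.zoneEnd l)) (d.T.slice (i + 1) e) s) := by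
        rw [hu]
        split
        · refine ⟨by omega, fun e he hie => ⟨fun h => by omega, fun h => ?_⟩⟩
          rw [slice_of_le (F := d.T) (by omega)] at h
          have := h.le_right
          simp at this
          omega
        · obtain ⟨g1, g2⟩ := ihi (2 * d.T.size - (i + 1)) (by omega) (i + 1) rfl (by omega) s hs
          refine ⟨by omega, fun e he hie => ?_⟩
          rcases hie.eq_or_lt with rfl | hlt
          · refine ⟨fun h => by omega, fun h => ?_⟩
            rw [slice_of_le (F := d.T) (by omega)] at h
            have := h.le_right
            simp at this
            omega
          · exact g2 e he hlt
      have Hv : i ≤ v ∧ ∀ e ≤ 2 * d.T.size, i ≤ e → (v ≤ e ↔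
          Align (X.F.slice (X.zonePos l + 1) (X.zoneEnd l)) (d.T.slice i e) s ∨
          ∃ a c r a' c' r' n, X.F.suffix (X.zonePos l) = cons a c r ∧
            d.T.suffix i = cons a' c' r' ∧
            X.zonePos l + 2 * c.size + 2 ≤ X.zoneEnd l ∧ i + 2 * c'.size + 2 ≤ e ∧
            Align (X.F.slice (X.zonePos l + 2 * c.size + 2) (X.zoneEnd l))
              (d.T.slice (i + 2 * c'.size + 2) e) n ∧ s ≤ sim c c' + n + eta a a') := by
        rw [hv]
        split
        · rename_i hend
          have hz : X.zoneEnd l ≤ X.zonePos l := by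
            unfold Hole.zoneEnd Hole.zonePos
            split <;> omega
          refine ⟨by omega, fun e he hie => ⟨fun h => by omega, ?_⟩⟩
          rintro (h | ⟨a, c, r, a', c', r', n, -, -, h, -⟩)
          · rw [slice_of_le (F := X.F) (by omega)] at h
            have := h.le_left
            simp at this
            omega
          · omega
        · rename_i hend
          have hz : X.zonePos (l + 1) = X.zonePos l + 1 ∧ X.zoneEnd (l + 1) = X.zoneEnd l := by
            unfold Hole.zoneEnd Hole.zonePos
            split <;> split <;> omega
          obtain ⟨g1, g2⟩ := ihl (X.M1 + 1 - (l + 1)) (by omega) (l + 1) rfl (by omega) i hi s hs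
          rw [hz.1, hz.2] at g2
          -- Each zone has its end as an additional position. The numbers of the right zone
          -- therefore exceed the compressed positions by one.
          set k := if l ≤ X.H then l else l - 1 with hk
          have hkM : k < X.M1 := by rw [hk]; split <;> omega
          have hzk : X.posL k = X.zonePos l := by
            rw [hk]
            unfold Hole.posL Hole.zonePos
            split <;> split <;> omega
          -- A node entered in a zone fits into the zone exactly when it does not surround the
          -- block, and then the position after it is reached by a shift within the zone.
          have hze : ∀ a c r, X.F.suffix (X.posL k) = cons a c r → (¬ X.IsSpine (X.posL k) c ↔
              X.zonePos l + 2 * c.size + 2 ≤ X.zoneEnd l) ∧ (¬ X.IsSpine (X.posL k) c →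
              X.zonePos (l + (d.C k + 1 - k)) = X.zonePos l + 2 * c.size + 2 ∧
              X.zoneEnd (l + (d.C k + 1 - k)) = X.zoneEnd l ∧ l + (d.C k + 1 - k) ≤ X.M1 + 1 ∧
                k < d.C k) := by
            intro a c r h
            by_cases hsp : X.IsSpine (X.posL k) c
            · refine ⟨⟨fun h' => absurd hsp h', fun h' => ?_⟩, fun h' => absurd hsp h'⟩
              have h1 := hsp.1
              have h2 := hsp.2
              rw [hzk] at h1 h2
              unfold Hole.zonePos at h1
              unfold Hole.zoneEnd at h'
              split at h' <;> rename_i hlH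
              · omega
              · rw [if_neg hlH] at h1; omega
            · have hq := hX.plain hkM h hsp
              have h1 := X.node_le_hi h (X.lo_le_posL k) (X.posL_lt_hi hkM)
              rw [hzk] at hq h1
              have h6 := hq.2.2.2.2.2.1
              have h7 := hq.2.2.2.2.2.2
              have hfin : (X.zonePos l + 2 * c.size + 2 ≤ X.zoneEnd l) ∧
                  (X.zonePos (l + (d.C k + 1 - k)) = X.zonePos l + 2 * c.size + 2 ∧
                  X.zoneEnd (l + (d.C k + 1 - k)) = X.zoneEnd l ∧
                    l + (d.C k + 1 - k) ≤ X.M1 + 1 ∧ k < d.C k) := by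
                by_cases hlH : l ≤ X.H
                · rw [if_pos hlH] at hk
                  have h6 := h6 (by omega)
                  unfold Hole.zonePos Hole.zoneEnd at *
                  rw [if_pos hlH] at *
                  rw [if_pos hlH, if_pos (by omega), if_pos (by omega)]
                  omega
                · rw [if_neg hlH] at hk
                  have h7 := h7 (by omega)
                  unfold Hole.zonePos Hole.zoneEnd at *
                  rw [if_neg hlH] at *
                  rw [if_neg hlH, if_neg (by omega), if_neg (by omega)]
                  omega
              exact ⟨⟨fun _ => hfin.1, fun _ => hsp⟩, fun _ => hfin.2⟩
          have Hm : ∀ w, w = (match d.T.suffix i with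
              | .nil => 2 * d.T.size + 1
              | .cons _ c _ => d.matchEnd V L k l i s c) → i ≤ w ∧
              ∀ e ≤ 2 * d.T.size, i ≤ e → (w ≤ e ↔
                ∃ a c r a' c' r' n, X.F.suffix (X.zonePos l) = cons a c r ∧
                d.T.suffix i = cons a' c' r' ∧
                X.zonePos l + 2 * c.size + 2 ≤ X.zoneEnd l ∧ i + 2 * c'.size + 2 ≤ e ∧
                Align (X.F.slice (X.zonePos l + 2 * c.size + 2) (X.zoneEnd l))
                  (d.T.slice (i + 2 * c'.size + 2) e) n ∧ s ≤ sim c c' + n + eta a a') := by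
            intro w hw
            cases hT : d.T.suffix i with
            | nil =>
              rw [hT] at hw
              refine ⟨by simp at hw; omega, fun e he hie => ⟨fun h => by simp at hw; omega, ?_⟩⟩
              rintro ⟨a, c, r, a', c', r', n, -, h, -⟩
              cases h
            | cons a' c' r' =>
              rw [hT] at hw
              replace hw : w = d.matchEnd V L k l i s c' := hw
              have hbT := suffix_bound hT
              rw [← hzk]
              cases hF : X.F.suffix (X.posL k) with
              | nil =>
                have := hX.C_close k hkM hF
                rw [Data.matchEnd, if_neg (by omega)] at hw
                refine ⟨by omega, fun e he hie => ⟨fun h => by omega, ?_⟩⟩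
                rintro ⟨a, c, r, a', c', r', n, h, -⟩
                cases h
              | cons a c r =>
                obtain ⟨z1, z2⟩ := hze a c r hF
                by_cases hsp : X.IsSpine (X.posL k) c
                · have hS := (hX.S_iff k hkM _ _ _ hF).2 hsp
                  rw [Data.matchEnd, if_neg (by omega)] at hw
                  refine ⟨by omega, fun e he hie => ⟨fun h => by omega, ?_⟩⟩
                  rintro ⟨a, c, r, a', c', r', n, h, -, h', -⟩
                  cases h
                  rw [hzk] at h'
                  exact absurd hsp (z1.2 h')
                · have hS : d.S k = 0 := by
                    by_contra h; exact hsp ((hX.S_iff k hkM _ _ _ hF).1 h)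
                  obtain ⟨z3, z4, z5, z6⟩ := z2 hsp
                  have z7 := z1.1 hsp
                  rw [Data.matchEnd, if_pos ⟨hS, z6⟩, hX.table_kids hV hkM hF hsp hT,
                    hX.et k hkM _ _ _ hF _ _ _ _ hT] at hw
                  -- If the matched pair of nodes with their subtrees already has weight `s`, the
                  -- least end comes directly after the tree. Otherwise the rest of the zone must
                  -- supply the difference.
                  split at hw
                  · refine ⟨by omega, fun e he hie => ⟨fun h => ?_, ?_⟩⟩
                    · exact ⟨a, c, r, a', c', r', 0, rfl, rfl, by omega, by omega,
                        align_zero _ _, by omega⟩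
                    · rintro ⟨a, c, r, a', c', r', n, h, h', -, h'', -⟩
                      cases h'
                      omega
                  · obtain ⟨y1, y2⟩ := ihl (X.M1 + 1 - (l + (d.C k + 1 - k))) (by omega)
                      (l + (d.C k + 1 - k)) rfl z5 (i + 2 * c'.size + 2) (by omega)
                      (s - (sim c c' + eta a a')) (by omega)
                    rw [z3, z4, ← hw] at y2
                    rw [← hw] at y1
                    refine ⟨by omega, fun e he hie => ⟨fun h => ?_, ?_⟩⟩
                    · refine ⟨a, c, r, a', c', r', s - (sim c c' + eta a a'), rfl, rfl, by omega,
                        by omega, ?_, by omega⟩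
                      rw [hzk]
                      exact (y2 e he (by omega)).1 h
                    · rintro ⟨a0, c0, r0, a1, c1, r1, n, h, h', -, h'', h3, h4⟩
                      cases h'
                      cases h
                      rw [hzk] at h3
                      exact (y2 e he (by omega)).2 (h3.mono (by omega))
          obtain ⟨m1, m2⟩ := Hm _ rfl
          refine ⟨le_min g1 m1, fun e he hie => ?_⟩
          rw [min_le_iff, g2 e he hie, m2 e he hie]
      refine ⟨le_min Hu.1 Hv.1, fun e he hie => ?_⟩
      rw [min_le_iff, Hu.2 e he hie, Hv.2 e he hie, 
        align_slice_left_iff (i := X.zonePos l) (i' := i)]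
      exact or_left_comm

/-- What the last phase computes for a node of `T`. -/
theorem best_eq {V L R : ℕ → ℕ → ℕ → ℕ} (hV : d.Rec V 0) (hL : d.EndRec X.H V L)
    (hR : ∀ j ≤ 2 * d.T.size, ∀ s ≤ d.M1,
      (∀ i ≤ 2 * d.T.size, L (X.H + 1) i s ≤ j → i < R j s 0) ∧
      (R j s 0 = 0 ∨ ∃ i ≤ 2 * d.T.size, R j s 0 = i + 1 ∧ L (X.H + 1) i s ≤ j))
    {p : ℕ} {b : α} {c r : Forest α} (hs : d.T.suffix p = cons b c r) {best : ℕ}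
    (h1 : V (p + 1) 0 d.M1 ≤ best)
    (h2 : ∀ s1 ≤ d.M1, ∀ s2 ≤ d.M1, L 0 (p + 1) s1 < R (p + 1 + 2 * c.size) s2 0 →
      s1 + s2 + sim X.inner (d.T.slice (L 0 (p + 1) s1) (R (p + 1 + 2 * c.size) s2 0 - 1)) ≤ best)
    (h3 : best = V (p + 1) 0 d.M1 ∨ ∃ s1 ≤ d.M1, ∃ s2 ≤ d.M1,
      L 0 (p + 1) s1 < R (p + 1 + 2 * c.size) s2 0 ∧ best =
      s1 + s2 + sim X.inner (d.T.slice (L 0 (p + 1) s1) (R (p + 1 + 2 * c.size) s2 0 - 1))) :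
    best = sim X.kids c := by
  have hb := suffix_bound hs
  have hM := hX.M1
  have e1 := X.lo_add_H
  have e2 := X.H_le_M1
  have e3 := X.B_add
  have e4 := X.B_le_hi
  have hl : X.zonePos 0 = X.lo ∧ X.zoneEnd 0 = X.A := by simp [Hole.zonePos, Hole.zoneEnd]
  have hr : X.zonePos (X.H + 1) = X.B ∧ X.zoneEnd (X.H + 1) = X.hi := by
    simp [Hole.zonePos, Hole.zoneEnd]
  have E1 := hX.end_iff hV hL 0 (by omega) (p + 1) (by omega)
  have E2 := hX.end_iff hV hL (X.H + 1) (by omega)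
  rw [hl.1, hl.2] at E1
  rw [hr.1, hr.2] at E2
  apply le_antisymm
  · rcases h3 with h | ⟨s1, g1, s2, g2, h, rfl⟩
    · rw [h]; exact hX.table_le hV hs
    · obtain ⟨-, h4⟩ := hR (p + 1 + 2 * c.size) (by omega) s2 g2
      rcases h4 with h4 | ⟨i, i1, i2, i3⟩
      · omega
      · rw [i2] at h ⊢
        obtain ⟨a1, a2⟩ := E1 s1 (by omega)
        obtain ⟨b1, b2⟩ := E2 i i1 s2 (by omega)
        have := le_sim_kids hs a1 (by omega) (by omega)
          ((a2 _ (by omega) a1).1 le_rfl)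
          (align_sim X.inner (d.T.slice (L 0 (p + 1) s1) i)) ((b2 _ (by omega) (by omega)).1 i3)
        simp only [Nat.add_sub_cancel]
        omega
  · rcases hX.sim_kids hV hs with h | ⟨i, j, n1, n2, n3, g1, g2, g3, g4, g5, g6, g7⟩
    · omega
    · have k1 := g5.le_left
      have k3 := g7.le_left
      have l1 := two_mul_slice_size_le (F := X.F) X.lo_le_A
      have l3 := two_mul_slice_size_le (F := X.F) X.B_le_hi
      have m1 := ((E1 n1 (by omega)).2 i (by omega) g1).2 g5
      have m3 := ((E2 j (by omega) n3 (by omega)).2 _ (by omega) g3).2 g7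
      have m4 := (hR (p + 1 + 2 * c.size) (by omega) n3 (by omega)).1 j (by omega) m3
      -- Replacing `i` by the least end and `j` by the greatest start only widens the slice for the
      -- block, so its similarity does not decrease. The stored start is one too large, which
      -- explains the `- 1`.
      have m5 := h2 n1 (by omega) n3 (by omega) (by omega)
      have m6 := (g6.symm.slice_mono (i' := L 0 (p + 1) n1)
        (j' := R (p + 1 + 2 * c.size) n3 0 - 1) m1 (by omega)).symm.le_sim
      omega

end Fits

end TED

/-! ### The total work of the merges -/

namespace TED

open Forest

variable {α : Type}

namespace Forest

theorem suffix_append_right (f g : Forest α) (q : ℕ) :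
    (f ++ g).suffix (2 * f.size + q) = g.suffix q := by
  induction f with
  | nil => simp
  | cons a c r _ ih =>
    rw [cons_append, suffix, if_neg (by simp only [size_cons]; omega),
      if_neg (by simp only [size_cons]; omega), ← ih]
    congr 1
    simp
    omega

theorem suffix_append_left {f g : Forest α} : ∀ {p : ℕ} {a : α} {c r : Forest α},
    (f ++ g).suffix p = cons a c r → p < 2 * f.size → ∃ r', f.suffix p = cons a c r' := by
  induction f with
  | nil => intro p a c r _ h; simp at h
  | cons a0 c0 r0 _ ih =>
    intro p a c r h hp
    rw [cons_append, suffix] at h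
    rw [suffix]
    simp only [size_cons] at hp
    split at h
    · cases h; rw [if_pos (by assumption)]; exact ⟨_, rfl⟩
    · rw [if_neg (by assumption)]
      split at h
      · rw [if_pos (by assumption)]; exact ⟨_, h⟩
      · rw [if_neg (by assumption)]; exact ih h (by omega)

theorem suffix_cons_succ {a : α} {c r : Forest α} {q : ℕ} (h : q ≤ 2 * c.size) :
    (cons a c r).suffix (q + 1) = c.suffix q := by
  rw [suffix, if_neg (by omega), if_pos (by omega)]; rfl

/-- The work of the merges, if a tree and the forest to its right are merged in a time
proportional to the smaller size. -/
def mergeWork : Forest α → ℕ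
  | nil => 0
  | cons _ c r => c.mergeWork + r.mergeWork + min (c.size + 1) r.size

/-- The small-to-large argument: for `a ≤ b` the sum `a + b` is at least `2 * a`, so the logarithm
grows by at least one for each of the `a` nodes on the smaller side, which pays for the merge. -/
theorem mergeWork_le (f : Forest α) : f.mergeWork ≤ f.size * Nat.log 2 f.size := by
  have key : ∀ a b, a ≤ b →
      a * Nat.log 2 a + b * Nat.log 2 b + a ≤ (a + b) * Nat.log 2 (a + b) := by
    intro a b hab
    rcases Nat.eq_zero_or_pos a with rfl | ha
    · simp
    · have h1 : Nat.log 2 a + 1 ≤ Nat.log 2 (a + b) := by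
        rw [← Nat.log_mul_base (by omega) (by omega)]
        exact Nat.log_mono_right (by omega)
      have h2 : Nat.log 2 b ≤ Nat.log 2 (a + b) := Nat.log_mono_right (by omega)
      have h3 := Nat.mul_le_mul_left a h1
      have h4 := Nat.mul_le_mul_left b h2
      rw [add_mul]
      rw [mul_add] at h3
      omega
  induction f with
  | nil => simp [mergeWork]
  | cons a c r ihc ihr =>
    simp only [mergeWork, size_cons]
    have h1 : c.size * Nat.log 2 c.size ≤ (c.size + 1) * Nat.log 2 (c.size + 1) :=
      Nat.mul_le_mul (by omega) (Nat.log_mono_right (by omega))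
    rcases le_total (c.size + 1) r.size with h | h
    · rw [min_eq_left h]
      have := key _ _ h
      rw [show c.size + r.size + 1 = c.size + 1 + r.size by omega]
      omega
    · rw [min_eq_right h]
      have := key _ _ h
      rw [show c.size + r.size + 1 = r.size + (c.size + 1) by omega]
      omega

/-- The work of the merge at a position. -/
def mergeAt (f : Forest α) (p : ℕ) : ℕ :=
  match f.suffix p with
  | nil => 0
  | cons _ c r => min (c.size + 1) r.size

/-- The program runs through all positions of `T`; closing positions contribute nothing. -/
theorem sum_mergeAt (f : Forest α) : ∑ p ∈ Finset.range (2 * f.size), f.mergeAt p = f.mergeWork := by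
  induction f with
  | nil => rfl
  | cons a c r ihc ihr =>
    have h1 : 2 * (cons a c r).size = 2 * c.size + 1 + 1 + 2 * r.size := by simp; omega
    rw [h1, Finset.sum_range_add, Finset.sum_range_succ', Finset.sum_range_succ, mergeWork, ← ihc,
      ← ihr]
    have h2 : ∀ q ≤ 2 * c.size, (cons a c r).mergeAt (q + 1) = c.mergeAt q := by
      intro q hq
      unfold mergeAt
      rw [suffix_cons_succ hq]
    rw [h2 _ le_rfl, Finset.sum_congr rfl fun q hq => h2 q (Finset.mem_range.1 hq).le]
    have h3 : c.mergeAt (2 * c.size) = 0 := by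
      unfold mergeAt
      rw [suffix_of_le _ _ le_rfl]
    have h4 : ∀ q, (cons a c r).mergeAt (2 * c.size + 1 + 1 + q) = r.mergeAt q := by
      intro q
      unfold mergeAt
      rw [suffix, if_neg (by omega), if_neg (by omega)]
      congr 2
      omega
    have h5 : (cons a c r).mergeAt 0 = min (c.size + 1) r.size := by simp [mergeAt, suffix]
    rw [h3, h5]
    simp only [h4]
    have h6 : (Finset.range (2 * c.size)).sum c.mergeAt =
      ∑ p ∈ Finset.range (2 * c.size), c.mergeAt p := rfl
    rw [h6]
    omega

end Forest

/-! ### The spine of a synchronous subforest -/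

theorem spinePos_shift (fs : List (Frame α)) : ∀ o y : ℕ,
    (spinePos o fs)[y]? = ((spinePos 0 fs)[y]?).map (o + ·) := by
  induction fs with
  | nil => intro o y; rfl
  | cons fr s ih =>
    intro o y
    cases y with
    | zero => simp [spinePos]
    | succ y =>
      simp only [spinePos, List.getElem?_cons_succ]
      rw [ih, ih (0 + 2 * fr.left.size + 1)]
      simp [Function.comp_def, add_assoc]

theorem holePos_shift (fs : List (Frame α)) : ∀ o : ℕ, holePos o fs = o + holePos 0 fs := by
  induction fs with
  | nil => intro o; rfl
  | cons fr s ih =>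
    intro o
    simp only [holePos]
    rw [ih, ih (0 + 2 * fr.left.size + 1)]
    omega

theorem length_spinePos (fs : List (Frame α)) : ∀ o : ℕ, (spinePos o fs).length = fs.length := by
  induction fs with
  | nil => intro o; rfl
  | cons fr s ih => intro o; simp [spinePos, ih]

theorem length_spineTrees (fs : List (Frame α)) (X : Forest α) :
    (spineTrees fs X).length = fs.length := by
  induction fs with
  | nil => rfl
  | cons fr s ih => simp [spineTrees, ih]

theorem holePos_add_le (fs : List (Frame α)) (X : Forest α) :
    holePos 0 fs + 2 * X.size ≤ 2 * (plug fs X).size := by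
  induction fs with
  | nil => simp [holePos, plug]
  | cons fr s ih =>
    simp only [holePos, plug, size_append, size_cons]
    rw [holePos_shift]
    omega

theorem suffix_holePos (fs : List (Frame α)) (X : Forest α) : ∀ q ≤ 2 * X.size,
    (plug fs X).suffix (holePos 0 fs + q) = X.suffix q := by
  induction fs with
  | nil => intro q _; simp [holePos, plug]
  | cons fr s ih =>
    intro q hq
    have h := holePos_add_le s X
    simp only [holePos, plug]
    rw [holePos_shift, show 0 + 2 * fr.left.size + 1 + holePos 0 s + q =
      2 * fr.left.size + (holePos 0 s + q + 1) by omega, suffix_append_right,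
      suffix_cons_succ (by omega), ih q hq]

/-- The last conclusion counts the opening positions of the spine nodes from index `y` on, all of
which precede the hole. It bounds the number of spine nodes by the number of positions before the
block. -/
theorem suffix_spinePos (fs : List (Frame α)) (X : Forest α) : ∀ (y p : ℕ) (T : OTree α),
    (spinePos 0 fs)[y]? = some p → (spineTrees fs X)[y]? = some T →
    (∃ r, (plug fs X).suffix p = cons T.label T.kids r) ∧
      holePos 0 fs + 2 * X.size ≤ p + 1 + 2 * T.kids.size ∧ p + (fs.length - y) ≤ holePos 0 fs := by
  induction fs with
  | nil => intro y p T h; simp [spinePos] at h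
  | cons fr s ih =>
    intro y p T hp hT
    simp only [holePos, plug]
    rw [holePos_shift]
    have hsz := holePos_add_le s X
    cases y with
    | zero =>
      simp [spinePos] at hp
      simp [spineTrees] at hT
      subst hp hT
      have h1 := suffix_append_right fr.left (cons fr.label (plug s X) fr.right) 0
      rw [Nat.add_zero] at h1
      refine ⟨⟨fr.right, by rw [h1]; rfl⟩, by simp only; omega, ?_⟩
      have h2 : s.length ≤ holePos 0 s := by
        cases s with
        | nil => simp
        | cons fr' s' =>
          have := (ih 0 _ _ rfl rfl).2.2
          simp at this ⊢
          omega
      simp only [List.length_cons]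
      omega
    | succ y =>
      simp only [spinePos, List.getElem?_cons_succ] at hp
      rw [spinePos_shift] at hp
      simp only [spineTrees, List.getElem?_cons_succ] at hT
      obtain ⟨q, hq, rfl⟩ := Option.map_eq_some_iff.1 hp
      obtain ⟨⟨r, h1⟩, h2, h3⟩ := ih y q T hq hT
      have hqs : q ≤ 2 * (plug s X).size := by
        by_contra h
        rw [suffix_of_le _ _ (by omega)] at h1
        cases h1
      refine ⟨⟨r, ?_⟩, by omega, by simp only [List.length_cons]; omega⟩
      rw [show 0 + 2 * fr.left.size + 1 + q = 2 * fr.left.size + (q + 1) by omega,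
        suffix_append_right, suffix_cons_succ hqs, h1]

theorem spinePos_lt (fs : List (Frame α)) : ∀ y y' p p' : ℕ, y < y' →
    (spinePos 0 fs)[y]? = some p → (spinePos 0 fs)[y']? = some p' → p < p' := by
  induction fs with
  | nil => intro y y' p p' _ h; simp [spinePos] at h
  | cons fr s ih =>
    intro y y' p p' hy hp hp'
    cases y' with
    | zero => omega
    | succ y' =>
      simp only [spinePos, List.getElem?_cons_succ] at hp'
      rw [spinePos_shift] at hp'
      obtain ⟨q', hq', rfl⟩ := Option.map_eq_some_iff.1 hp'
      cases y with
      | zero =>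
        simp [spinePos] at hp
        omega
      | succ y =>
        simp only [spinePos, List.getElem?_cons_succ] at hp
        rw [spinePos_shift] at hp
        obtain ⟨q, hq, rfl⟩ := Option.map_eq_some_iff.1 hp
        have := ih y y' q q' (by omega) hq hq'
        omega

namespace SyncPair

variable (I : SyncPair α)

theorem innerStart_le : I.innerStart + 2 * I.inner.size ≤ holePos 0 I.frames + 2 * I.bottom.size := by
  simp only [innerStart, bottom, size_append]
  omega

theorem suffix_innerStart : I.whole.suffix I.innerStart = I.inner ++ I.right := by
  have h1 := suffix_append_right I.left (I.inner ++ I.right) 0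
  rw [Nat.add_zero] at h1
  rw [whole, innerStart, suffix_holePos _ _ _ (by simp [bottom, size_append]), bottom, h1]
  cases I.inner ++ I.right <;> rfl

/-- Outside of the spine, a node entered before the block belongs to a left sibling forest of some
level and closes there. The induction descends along the frames. -/
theorem node_dichotomy : ∀ (p : ℕ) (a : α) (c r : Forest α), I.whole.suffix p = cons a c r → p < I.innerStart →
    p + 2 * c.size + 2 ≤ I.innerStart ∨
    ∃ y : ℕ, (spinePos 0 I.frames)[y]? = some p ∧ (spineTrees I.frames I.bottom)[y]? = some (⟨a, c⟩ : OTree α) := by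
  obtain ⟨fs, left, inner, right⟩ := I
  simp only [whole, innerStart, bottom]
  generalize inner ++ right = g
  induction fs with
  | nil =>
    intro p a c r h hp
    simp only [holePos, plug, zero_add] at *
    obtain ⟨r', h'⟩ := suffix_append_left h hp
    have := suffix_bound h'
    omega
  | cons fr s ih =>
    intro p a c r h hp
    have hsz := holePos_add_le s (left ++ g)
    simp only [size_append] at hsz
    simp only [holePos, plug] at *
    rw [holePos_shift] at *
    by_cases hl : p < 2 * fr.left.size
    · obtain ⟨r', h'⟩ := suffix_append_left h hl
      have := suffix_bound h'
      omega
    · obtain ⟨q, rfl⟩ : ∃ q, p = 2 * fr.left.size + q := ⟨p - 2 * fr.left.size, by omega⟩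
      rw [suffix_append_right] at h
      cases q with
      | zero =>
        rw [suffix, if_pos rfl] at h
        cases h
        exact .inr ⟨0, by simp [spinePos], by simp [spineTrees]⟩
      | succ q =>
        rw [suffix_cons_succ (by omega)] at h
        rcases ih q a c r h (by omega) with h1 | ⟨y, h1, h2⟩
        · left; omega
        · refine .inr ⟨y + 1, ?_, ?_⟩
          · simp only [spinePos, List.getElem?_cons_succ]
            rw [spinePos_shift, h1]
            simp
            omega
          · simpa [spineTrees] using h2

end SyncPair

/-! ### The restricted similarity matrix -/

section Restricted

variable [DecidableEq α] {T₂ : OTree α} {T : OTree α} {i j : Fin (matDim T₂)}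

theorem le_restrictedSimMat {p : ℕ} {a : α} {c r : Forest α}
    (h : T₂.toForest.suffix p = cons a c r) (hi : (i : ℕ) ≤ p)
    (hj : p + 2 * c.size + 2 ≤ (j : ℕ)) :
    ((sim T.kids c + eta T.label a : ℕ) : WithBot ℕ) ≤ restrictedSimMat T₂ T i j := by
  refine List.le_maximum_of_mem' (List.mem_map.2 ⟨⟨p, ⟨a, c⟩⟩, List.mem_filter.2 ⟨?_, ?_⟩, rfl⟩)
  · exact mem_nodes.2 ⟨p, a, c, r, h, by simp⟩
  · simp [Node.r, hi, hj]

theorem restrictedSimMat_eq : restrictedSimMat T₂ T i j = ⊥ ∨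
    ∃ p a c r, T₂.toForest.suffix p = cons a c r ∧ (i : ℕ) ≤ p ∧ p + 2 * c.size + 2 ≤ (j : ℕ) ∧
      restrictedSimMat T₂ T i j = ((sim T.kids c + eta T.label a : ℕ) : WithBot ℕ) := by
  cases h : restrictedSimMat T₂ T i j using WithBot.recBotCoe with
  | bot => exact .inl rfl
  | coe v =>
    have h1 := List.maximum_mem h
    obtain ⟨w, h2, rfl⟩ := List.mem_map.1 h1
    obtain ⟨h3, h4⟩ := List.mem_filter.1 h2
    obtain ⟨p, a, c, r, h5, rfl⟩ := mem_nodes.1 h3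
    simp [Node.r] at h4
    exact .inr ⟨p, a, c, r, h5, h4.1, h4.2, rfl⟩

/-- A maximum is characterised by being an upper bound that is attained. These two properties are
preserved by each range-maximum operation of the last phase. -/
theorem eq_restrictedSimMat {A : Mat (matDim T₂)}
    (h1 : ∀ p a c r, T₂.toForest.suffix p = cons a c r → ∀ i j : Fin (matDim T₂), (i : ℕ) ≤ p →
      p + 2 * c.size + 2 ≤ (j : ℕ) → ((sim T.kids c + eta T.label a : ℕ) : WithBot ℕ) ≤ A i j)
    (h2 : ∀ i j, A i j = ⊥ ∨ ∃ p a c r, T₂.toForest.suffix p = cons a c r ∧ (i : ℕ) ≤ p ∧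
      p + 2 * c.size + 2 ≤ (j : ℕ) ∧ A i j = ((sim T.kids c + eta T.label a : ℕ) : WithBot ℕ)) :
    A = restrictedSimMat T₂ T := by
  funext i j
  apply le_antisymm
  · rcases h2 i j with h | ⟨p, a, c, r, h3, h4, h5, h6⟩
    · rw [h]; exact bot_le
    · rw [h6]; exact le_restrictedSimMat h3 h4 h5
  · rcases restrictedSimMat_eq (T₂ := T₂) (T := T) (i := i) (j := j) with
      h | ⟨p, a, c, r, h3, h4, h5, h6⟩
    · rw [h]; exact bot_le
    · rw [h6]; exact h1 p a c r h3 i j h4 h5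

end Restricted

end TED

/-! ### From an instance of the problem to a forest with a hole -/

namespace TED

open Forest

variable {α : Type}

theorem encode_coe (v : ℕ) : encode (v : WithBot ℕ) = v + 1 := rfl

theorem encode_bot : encode ⊥ = 0 := rfl

theorem encode_le_encode {v w : WithBot ℕ} (h : v ≤ w) : encode v ≤ encode w := by
  have := Loop.encode_max v w
  rw [max_eq_right h] at this
  omega

/-- The top node is `u_x`. Below it, the nodes that surround the block are exactly the later spine
nodes, those for which the restricted matrices are known. -/
theorem SyncPair.exists_hole (I : SyncPair α) {x : ℕ} {U : OTree α} (h : I.sub? x = some U) :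
    ∃ X : Hole α, X.F = I.whole ∧ X.inner = I.inner ∧ X.A = I.innerStart ∧
      X.top = (spinePos 0 I.frames).getD (x - 1) 0 ∧ X.label = U.label ∧ X.kids = U.kids ∧
      1 ≤ x ∧ x ≤ I.frames.length ∧ I.frames.length - x ≤ X.H ∧
      X.M1 + 2 ≤ 2 * (I.whole.size - I.inner.size) ∧
      (∀ p a c r, X.F.suffix p = cons a c r → X.lo ≤ p → X.IsSpine p c →
        ∃ y, x < y ∧ y ≤ I.frames.length ∧ (spinePos 0 I.frames).getD (y - 1) 0 = p ∧
          I.sub? y = some ⟨a, c⟩) ∧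
      (∀ y, x < y → y ≤ I.frames.length → ∃ T r, I.sub? y = some T ∧
        X.F.suffix ((spinePos 0 I.frames).getD (y - 1) 0) = cons T.label T.kids r ∧
        X.lo ≤ (spinePos 0 I.frames).getD (y - 1) 0 ∧
        X.IsSpine ((spinePos 0 I.frames).getD (y - 1) 0) T.kids) := by
  obtain ⟨y, rfl⟩ : ∃ y, x = y + 1 := by
    cases x with
    | zero => cases h
    | succ y => exact ⟨y, rfl⟩
  change (spineTrees I.frames I.bottom)[y]? = some U at h
  have hy : y < I.frames.length := by
    rw [← length_spineTrees I.frames I.bottom]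
    exact (List.getElem?_eq_some_iff.1 h).1
  have get : ∀ y, y < I.frames.length → (spinePos 0 I.frames)[y]? =
      some ((spinePos 0 I.frames).getD y 0) := by
    intro y hy
    rw [List.getElem?_eq_getElem (by rw [length_spinePos]; exact hy), List.getD_eq_getElem]
  have key := suffix_spinePos I.frames I.bottom
  have hIn := I.innerStart_le
  have hst : holePos 0 I.frames ≤ I.innerStart := by simp [SyncPair.innerStart]
  obtain ⟨⟨r, h1⟩, h2, h3⟩ := key y _ U (get y hy) h
  have hb := suffix_bound h1
  -- A surrounding node is some spine node; its index exceeds that of the top node because opening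
  -- positions increase along the spine.
  have nodes : ∀ p a c r, I.whole.suffix p = cons a c r →
      (spinePos 0 I.frames).getD y 0 < p → p < I.innerStart →
      I.innerStart + 2 * I.inner.size < p + 2 * c.size + 2 →
      ∃ y', y + 1 < y' ∧ y' ≤ I.frames.length ∧ (spinePos 0 I.frames).getD (y' - 1) 0 = p ∧
          I.sub? y' = some ⟨a, c⟩ := by
    intro p a c r hs hp hp' he
    rcases I.node_dichotomy p a c r hs hp' with h' | ⟨y', g1, g2⟩
    · omega
    · have hy' : y' < I.frames.length := by
        rw [← length_spineTrees I.frames I.bottom]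
        exact (List.getElem?_eq_some_iff.1 g2).1
      have g3 := get y' hy'
      rw [g1] at g3
      have g4 : (spinePos 0 I.frames).getD y' 0 = p := by injection g3 with g3; exact g3.symm
      refine ⟨y' + 1, ?_, hy', by simpa using g4, g2⟩
      by_contra hle
      rcases (show y' ≤ y by omega).eq_or_lt with rfl | hlt
      · omega
      · have := spinePos_lt I.frames y' y _ _ hlt g1 (get y hy)
        omega
  let X : Hole α :=
    { F := I.whole
      inner := I.inner
      after := I.right
      A := I.innerStart
      top := (spinePos 0 I.frames).getD y 0
      label := U.label
      kids := U.kids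
      rest := r
      suffix_A := I.suffix_innerStart
      suffix_top := h1
      top_lt := by omega
      end_le := by omega
      dichotomy := by
        intro p a c r hs hp
        rcases I.node_dichotomy p a c r hs hp with h' | ⟨y', g1, g2⟩
        · exact .inl h'
        · have := (key y' p _ g1 g2).2.1
          simp only at this
          right; omega }
  have hH : I.frames.length - (y + 1) ≤ X.H := by
    have := X.lo_add_H
    change (spinePos 0 I.frames).getD y 0 + 1 + X.H = I.innerStart at this
    omega
  -- The positions outside the block that are counted by `M1` belong to nodes below the top node;
  -- the two additional ones are those of the top node itself.
  have hM : X.M1 + 2 ≤ 2 * (I.whole.size - I.inner.size) := by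
    have e1 := X.lo_add_H
    have e2 := X.B_add
    have e3 := X.H_le_M1
    have e4 := X.B_le_hi
    change (spinePos 0 I.frames).getD y 0 + 1 + X.H = I.innerStart at e1
    change I.innerStart + 2 * I.inner.size + (X.M1 - X.H) =
      (spinePos 0 I.frames).getD y 0 + 1 + 2 * U.kids.size at e2
    change _ + 2 * U.kids.size + 2 + 2 * r.size ≤ 2 * I.whole.size at hb
    omega
  refine ⟨X, rfl, rfl, rfl, rfl, rfl, rfl, by omega, by omega, hH, hM, ?_, ?_⟩
  · intro p a c r' hs hlo hsp
    exact nodes p a c r' hs hlo hsp.1 hsp.2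
  · intro y' h4 h5
    have h6 : y' - 1 < (spineTrees I.frames I.bottom).length := by
      rw [length_spineTrees]; omega
    have h7 : (spineTrees I.frames I.bottom)[y' - 1]? = some _ := List.getElem?_eq_getElem h6
    have h8 := get (y' - 1) (by omega)
    obtain ⟨⟨r', h9⟩, h10, h11⟩ := key _ _ _ h8 h7
    refine ⟨_, r', ?_, h9, ?_, ?_, ?_⟩
    · cases y' with
      | zero => omega
      | succ y' => exact h7
    · exact spinePos_lt I.frames y (y' - 1) _ _ (by omega) (get y hy) h8
    · change _ < I.innerStart
      omega
    · change I.innerStart + 2 * I.inner.size < _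
      omega

section Mats

variable {σ : ℕ} {I : SyncPair (Fin σ)} {T₂ : OTree (Fin σ)} {x : ℕ}

theorem entry_eq {D : ℕ} {A : Mat D} {i j : ℕ} (hi : i < D) (hj : j < D) :
    Loop.entry A i j = encode (A ⟨i, hi⟩ ⟨j, hj⟩) := dif_pos ⟨hi, hj⟩

theorem knownMats_zero {i j : ℕ} (hij : i ≤ j) (hj : j ≤ 2 * T₂.toForest.size) :
    Loop.entry (knownMats I T₂ x 0) i j = sim I.inner (T₂.toForest.slice i j) + 1 := by
  have hD : matDim T₂ = 2 * T₂.toForest.size + 1 := rfl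
  rw [entry_eq (by omega) (by omega), knownMats, if_pos rfl, simMat, if_pos (by exact hij),
    encode_coe]

/-- The bound is stated for all names of matrices, because `sv` is defined at every position; where
no spine node opens, the name is `0` and an irrelevant entry of `S(F')` appears. -/
theorem knownMats_le (h : ℕ) {p : ℕ} {b : Fin σ} {c r : Forest (Fin σ)}
    (hs : T₂.toForest.suffix p = cons b c r) :
    Loop.entry (knownMats I T₂ x h) p (p + 2 * c.size + 2) - 1 ≤ 2 * c.size + 2 := by
  have hD : matDim T₂ = 2 * T₂.toForest.size + 1 := rfl
  have hb := suffix_bound hs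
  unfold knownMats
  split
  · have := knownMats_zero (I := I) (T₂ := T₂) (x := x) (i := p) (j := p + 2 * c.size + 2)
      (by omega) (by omega)
    rw [knownMats, if_pos rfl] at this
    rw [this, slice_tree hs]
    have := sim_le_right I.inner (cons b c nil)
    simp at this
    omega
  · have hbot : Loop.entry (Mat.bot (matDim T₂)) p (p + 2 * c.size + 2) - 1 ≤ 2 * c.size + 2 := by
      rw [entry_eq (by omega) (by omega)]
      simp [Mat.bot, encode_bot]
    split
    · split
      · rename_i T _
        rw [entry_eq (by omega) (by omega)]
        rcases restrictedSimMat_eq (T₂ := T₂) (T := T) (i := ⟨p, by omega⟩)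
          (j := ⟨p + 2 * c.size + 2, by omega⟩) with h | ⟨pw, aw, cw, rw', -, h2, h3, h4⟩
        · rw [h, encode_bot]; omega
        · rw [h4, encode_coe]
          have := sim_le_right T.kids cw
          have := eta_le T.label aw
          simp only at h2 h3
          omega
      · exact hbot
    · exact hbot

end Mats

/-- The data read from the input describe the forest. -/
theorem fits_of_inputs {σ : ℕ} {I : SyncPair (Fin σ)} {T₂ : OTree (Fin σ)} {x : ℕ}
    {X : Hole (Fin σ)} (hF : X.F = I.whole)
    (hsp : ∀ p a c r, X.F.suffix p = cons a c r → X.lo ≤ p → X.IsSpine p c →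
        ∃ y, x < y ∧ y ≤ I.frames.length ∧ (spinePos 0 I.frames).getD (y - 1) 0 = p ∧
          I.sub? y = some ⟨a, c⟩)
    (hsp' : ∀ y, x < y → y ≤ I.frames.length → ∃ T r, I.sub? y = some T ∧
        X.F.suffix ((spinePos 0 I.frames).getD (y - 1) 0) = cons T.label T.kids r ∧
        X.lo ≤ (spinePos 0 I.frames).getD (y - 1) 0 ∧
        X.IsSpine ((spinePos 0 I.frames).getD (y - 1) 0) T.kids)
    {d : Data (Fin σ)} (hT : d.T = T₂.toForest) (hM : d.M1 = X.M1)
    (hC : ∀ k < X.M1, d.C k = X.pack (inputs I T₂ x 2 (X.posL k)))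
    (hS1 : ∀ y, x < y → y ≤ I.frames.length → d.S (inputs I T₂ x 1 (y - 1) - X.lo) = y)
    (hS2 : ∀ k, d.S k ≠ 0 → ∃ y, x < y ∧ y ≤ I.frames.length ∧
      k = inputs I T₂ x 1 (y - 1) - X.lo)
    (hsv : ∀ k p b c r, T₂.toForest.suffix p = cons b c r →
      d.sv k p = Loop.entry (knownMats I T₂ x (d.S k)) p (p + 2 * c.size + 2) - 1)
    (het : ∀ k < X.M1, ∀ p, d.et k p =
      if inputs I T₂ x 3 (X.posL k) = inputs I T₂ x 5 p then 2 else 1) : Fits X d := by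
  have e1 := X.lo_add_H
  have e2 := X.H_le_M1
  have e3 := X.B_add
  have e4 := X.B_le_hi
  have e5 := X.A_le_B
  have hD : matDim T₂ = 2 * T₂.toForest.size + 1 := rfl
  have hkH : ∀ k, X.posL k < X.A → k < X.H := by
    intro k h
    by_contra h'
    rw [X.posL_ge (by omega)] at h
    omega
  have spine_S : ∀ k < X.M1, ∀ a c r, X.F.suffix (X.posL k) = cons a c r →
      X.IsSpine (X.posL k) c → d.S k ≠ 0 ∧ x < d.S k ∧ I.sub? (d.S k) = some ⟨a, c⟩ := by
    intro k hk a c r hs h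
    obtain ⟨y, h1, h2, h3, h4⟩ := hsp _ a c r hs (X.lo_le_posL k) h
    have h5 := hS1 y h1 h2
    change d.S ((spinePos 0 I.frames).getD (y - 1) 0 - X.lo) = y at h5
    have h6 := hkH k h.1
    rw [h3, X.posL_lt h6, Nat.add_sub_cancel_left] at h5
    exact ⟨by omega, by omega, by rw [h5]; exact h4⟩
  refine ⟨hM, ?_, ?_, ?_, ?_, ?_, ?_⟩
  · intro k hk a c r hs
    rw [hC k hk]
    rw [hF] at hs
    change X.pack ((I.whole.partners 0).getD (X.posL k) 0) = _
    rw [partners_open hs]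
  · intro k hk hs
    rw [hC k hk]
    rw [hF] at hs
    have h1 := suffix_bound X.suffix_top
    have h2 := X.posL_lt_hi hk
    have h3 : X.hi = X.top + 1 + 2 * X.kids.size := rfl
    rw [hF] at h1
    have h4 : inputs I T₂ x 2 (X.posL k) < X.posL k := partners_close (by omega) hs
    generalize inputs I T₂ x 2 (X.posL k) = e at h4 ⊢
    unfold Hole.pack
    unfold Hole.posL at h4
    split at h4 <;> split <;> omega
  · intro k hk a c r hs
    refine ⟨fun h => ?_, fun h => (spine_S k hk a c r hs h).1⟩
    obtain ⟨y, h1, h2, h3⟩ := hS2 k h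
    change k = (spinePos 0 I.frames).getD (y - 1) 0 - X.lo at h3
    obtain ⟨T, r', h4, h5, h6, h7⟩ := hsp' y h1 h2
    have h8 := h7.1
    have h9 : X.posL k = (spinePos 0 I.frames).getD (y - 1) 0 := by
      rw [X.posL_lt (by omega)]; omega
    rw [← h9] at h5 h7
    rw [hs] at h5
    cases h5
    exact h7
  · intro k hk a c r hs p b c' r' hp
    rw [het k hk p, eta]
    rw [hF] at hs
    rw [hT] at hp
    have h1 : inputs I T₂ x 3 (X.posL k) = a := by
      simp [inputs, List.getD_eq_getElem?_getD, labels_open hs]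
    have h2 : inputs I T₂ x 5 p = b := by
      simp [inputs, List.getD_eq_getElem?_getD, labels_open hp]
    rw [h1, h2]
    simp only [Fin.val_inj]
  · intro k hk a c r hs h p b c' r' hp pw aw cw rw' h1 h2 h3
    obtain ⟨h4, h5, h6⟩ := spine_S k hk a c r hs h
    rw [hT] at hp h2
    have hb := suffix_bound hp
    rw [hsv k p b c' r' hp, entry_eq (by omega) (by omega), knownMats, if_neg h4, if_pos h5, h6]
    have h7 := encode_le_encode (le_restrictedSimMat (T₂ := T₂) (T := ⟨a, c⟩) (i := ⟨p, by omega⟩)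
      (j := ⟨p + 2 * c'.size + 2, by omega⟩) h2 h1 h3)
    rw [encode_coe] at h7
    simp only at h7 ⊢
    omega
  · intro k hk a c r hs h p b c' r' hp
    obtain ⟨h4, h5, h6⟩ := spine_S k hk a c r hs h
    rw [hT] at hp ⊢
    have hb := suffix_bound hp
    rw [hsv k p b c' r' hp, entry_eq (by omega) (by omega), knownMats, if_neg h4, if_pos h5, h6]
    rcases restrictedSimMat_eq (T₂ := T₂) (T := ⟨a, c⟩) (i := ⟨p, by omega⟩)
          (j := ⟨p + 2 * c'.size + 2, by omega⟩) with h' | ⟨pw, aw, cw, rw', h1, h2, h3, h7⟩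
    -- The slice is a whole tree and contains at least its root, so the entry is not `-∞` and a
    -- maximiser exists.
    · have h7 := le_restrictedSimMat (T₂ := T₂) (T := ⟨a, c⟩) (i := ⟨p, by omega⟩)
        (j := ⟨p + 2 * c'.size + 2, by omega⟩) hp le_rfl le_rfl
      rw [h'] at h7
      exact absurd h7 (by simp)
    · exact ⟨pw, aw, cw, rw', h2, h1, h3, by simp only [h7, encode_coe, Nat.add_sub_cancel]⟩

end TED

namespace TED.Loop

variable {D : ℕ}

/-! ### Rules for the verification of commands -/

namespace St

variable (s : St D)

@[simp] theorem setVar_var (x y : Var) (v : ℕ) :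
    (s.setVar x v).var y = if y = x then v else s.var y := by
  simp [setVar, Function.update_apply]

@[simp] theorem setVar_arr (x : Var) (v : ℕ) : (s.setVar x v).arr = s.arr := rfl

@[simp] theorem setVar_mat (x : Var) (v : ℕ) : (s.setVar x v).mat = s.mat := rfl

@[simp] theorem setArr_var (q : Arr) (i j k v : ℕ) : (s.setArr q i j k v).var = s.var := rfl

@[simp] theorem setArr_mat (q : Arr) (i j k v : ℕ) : (s.setArr q i j k v).mat = s.mat := rfl

@[simp] theorem setArr_arr (q q' : Arr) (i j k v : ℕ) : (s.setArr q i j k v).arr q' =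
    if q' = q then update3 (s.arr q') i j k v else s.arr q' := by
  by_cases h : q' = q
  · subst h; simp [setArr]
  · simp [setArr, h]

@[simp] theorem setMat_var (h : ℕ) (A : Mat D) : (s.setMat h A).var = s.var := rfl

@[simp] theorem setMat_arr (h : ℕ) (A : Mat D) : (s.setMat h A).arr = s.arr := rfl

end St

namespace Expr

abbrev v (x : Var) : Expr := .var x

instance : Add Expr := ⟨.op .add⟩
instance : Sub Expr := ⟨.op .sub⟩
instance : Mul Expr := ⟨.op .mul⟩

variable (E : Env) (s : St D) (a b : Expr)

@[simp] theorem eval_lit (n : ℕ) : (lit n).eval E s = n := rfl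
@[simp] theorem eval_var (x : Var) : (var x).eval E s = s.var x := rfl
@[simp] theorem eval_add : (a + b).eval E s = a.eval E s + b.eval E s := rfl
@[simp] theorem eval_sub : (a - b).eval E s = a.eval E s - b.eval E s := rfl
@[simp] theorem eval_mul : (a * b).eval E s = a.eval E s * b.eval E s := rfl
@[simp] theorem eval_get (q : Arr) (i j k : Expr) :
    (get q i j k).eval E s = s.arr q (i.eval E s) (j.eval E s) (k.eval E s) := rfl
@[simp] theorem eval_inp (q : ℕ) (i : Expr) : (inp q i).eval E s = E.inp q (i.eval E s) := rfl
@[simp] theorem eval_mget (h i j : Expr) :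
    (mget h i j).eval E s = entry (s.mat (h.eval E s)) (i.eval E s) (j.eval E s) := rfl

@[simp] theorem safe_lit (n : ℕ) : (lit n).safe E s := trivial
@[simp] theorem safe_var (x : Var) : (var x).safe E s := trivial
@[simp] theorem safe_add : (a + b).safe E s ↔ a.safe E s ∧ b.safe E s := Iff.rfl
@[simp] theorem safe_sub : (a - b).safe E s ↔ a.safe E s ∧ b.safe E s := Iff.rfl
@[simp] theorem safe_mul : (a * b).safe E s ↔ a.safe E s ∧ b.safe E s := Iff.rfl
@[simp] theorem safe_get (q : Arr) (i j k : Expr) : (get q i j k).safe E s ↔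
    i.safe E s ∧ j.safe E s ∧ k.safe E s ∧
      i.eval E s < E.N ∧ j.eval E s < E.N ∧ k.eval E s < E.N := Iff.rfl
@[simp] theorem safe_inp (q : ℕ) (i : Expr) : (inp q i).safe E s ↔ i.safe E s := Iff.rfl
@[simp] theorem safe_mget (h i j : Expr) : (mget h i j).safe E s ↔
    h.safe E s ∧ i.safe E s ∧ j.safe E s ∧ i.eval E s < D ∧ j.eval E s < D := Iff.rfl

/-- The maximum of two expressions. -/
def mx (a b : Expr) : Expr := a + (b - a)

/-- The minimum of two expressions. -/
def mn (a b : Expr) : Expr := a - (a - b)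

/-- The value `2` for equal expressions and `1` for different ones. -/
def etaOf (a b : Expr) : Expr := lit 1 + (lit 1 - ((a - b) + (b - a)))

@[simp] theorem eval_mx : (mx a b).eval E s = max (a.eval E s) (b.eval E s) := by
  simp only [mx, eval_add, eval_sub]; omega

@[simp] theorem eval_mn : (mn a b).eval E s = min (a.eval E s) (b.eval E s) := by
  simp only [mn, eval_sub]; omega

@[simp] theorem eval_etaOf : (etaOf a b).eval E s = if a.eval E s = b.eval E s then 2 else 1 := by
  simp only [etaOf, eval_add, eval_sub, eval_lit]; split <;> omega

@[simp] theorem safe_mx : (mx a b).safe E s ↔ a.safe E s ∧ b.safe E s := by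
  simp only [mx, safe_add, safe_sub]; tauto

@[simp] theorem safe_mn : (mn a b).safe E s ↔ a.safe E s ∧ b.safe E s := by
  simp only [mn, safe_sub]; tauto

@[simp] theorem safe_etaOf : (etaOf a b).safe E s ↔ a.safe E s ∧ b.safe E s := by
  simp only [etaOf, safe_add, safe_sub, safe_lit]; tauto

end Expr

/-- The command changes only what it is allowed to. -/
structure Frame (c : Cmd) (s s' : St D) : Prop where
  var : ∀ y, y ∉ c.mods → s'.var y = s.var y
  arr : ∀ q, q ∉ c.amods → s'.arr q = s.arr q
  mat : c.hasRmax = false → s'.mat = s.mat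

variable {E : Env}

theorem Spec.frame {c : Cmd} {s : St D} {T : ℕ} {Q : St D → Prop} (h : Spec E c s T Q) :
    Spec E c s T (fun s' => Frame c s s' ∧ Q s') :=
  ⟨h.1, h.2.1, ⟨fun y hy => Cmd.run_var E c y hy s, fun q hq => Cmd.run_arr E c q hq s,
    fun hc => by rw [Cmd.run_mat E c hc s]⟩, h.2.2⟩

theorem Cmd.frame_iter (i n : Var) (c : Cmd) (s : St D) (t : ℕ) :
    Frame (.loop i n c) s (Cmd.iter E i c s t) := by
  induction t with
  | zero =>
    refine ⟨fun y hy => ?_, fun _ _ => rfl, fun _ => rfl⟩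
    simp only [Cmd.mods, List.mem_cons, not_or] at hy
    simp [Cmd.iter, hy.1]
  | succ t ih =>
    refine ⟨fun y hy => ?_, fun q hq => ?_, fun h => ?_⟩
    · have h := ih.var y hy
      simp only [Cmd.mods, List.mem_cons, not_or] at hy
      simp [Cmd.iter, hy.1, Cmd.run_var E c y hy.2, h]
    · simp only [Cmd.iter, St.setVar_arr]
      rw [Cmd.run_arr E c q hq, ih.arr q hq]
    · simp only [Cmd.iter, St.setVar_mat]
      rw [Cmd.run_mat E c h, ih.mat h]

/-- The rule for loops, with the frame. -/
theorem Spec.loop_frame_sum {i n : Var} {c : Cmd} {s : St D} {m : ℕ} (hm : s.var n = m)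
    (I : ℕ → St D → Prop) (T : ℕ → ℕ) (h0 : I 0 (s.setVar i 0))
    (hstep : ∀ t s', t < m → s'.var i = t → Frame (.loop i n c) s s' → I t s' →
      Spec E c s' (T t) (fun s'' => I (t + 1) (s''.setVar i (t + 1)))) :
    Spec E (.loop i n c) s (∑ t ∈ Finset.range m, (T t + 4) + 3) (I m) := by
  subst hm
  have key : ∀ t ≤ s.var n, I t (Cmd.iter E i c s t) := by
    intro t
    induction t with
    | zero => intro _; exact h0
    | succ t ih =>
      intro ht
      exact (hstep t _ (by omega) (Cmd.iter_var ..) (Cmd.frame_iter ..) (ih (by omega))).2.2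
  have hs := fun t (ht : t < s.var n) =>
    hstep t _ ht (Cmd.iter_var ..) (Cmd.frame_iter ..) (key t ht.le)
  refine ⟨fun t ht => (hs t ht).1, ?_, ?_⟩
  · simp only [Cmd.cost]
    gcongr with t ht
    exact (hs t (Finset.mem_range.1 ht)).2.1
  · rw [Cmd.run_loop]
    exact key _ le_rfl

theorem Spec.loop_frame {i n : Var} {c : Cmd} {s : St D} {m : ℕ} (hm : s.var n = m)
    (I : ℕ → St D → Prop) (T : ℕ) (h0 : I 0 (s.setVar i 0))
    (hstep : ∀ t s', t < m → s'.var i = t → Frame (.loop i n c) s s' → I t s' →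
      Spec E c s' T (fun s'' => I (t + 1) (s''.setVar i (t + 1)))) :
    Spec E (.loop i n c) s (m * (T + 4) + 3) (I m) := by
  have := Spec.loop_frame_sum hm I (fun _ => T) h0 hstep
  simpa using this

/-- The weakest precondition of a command without loops. -/
def Cmd.wp (E : Env) : Cmd → (St D → Prop) → St D → Prop
  | skip, Q, s => Q s
  | assign x e, Q, s => e.safe E s ∧ e.eval E s < E.W ∧ Q (s.setVar x (e.eval E s))
  | store q i j k e, Q, s => i.safe E s ∧ j.safe E s ∧ k.safe E s ∧ e.safe E s ∧
      i.eval E s < E.N ∧ j.eval E s < E.N ∧ k.eval E s < E.N ∧ e.eval E s < E.W ∧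
      Q (s.setArr q (i.eval E s) (j.eval E s) (k.eval E s) (e.eval E s))
  | rmax h i j e, Q, s => h.safe E s ∧ i.safe E s ∧ j.safe E s ∧ e.safe E s ∧
      i.eval E s < D ∧ j.eval E s < D ∧ e.eval E s < E.W ∧
      Q (s.setMat (h.eval E s)
        (rangeMaxN (s.mat (h.eval E s)) (i.eval E s) (j.eval E s) (e.eval E s)))
  | seq c d, Q, s => c.wp E (fun s' => d.wp E Q s') s
  | ite a b c d, Q, s => a.safe E s ∧ b.safe E s ∧
      (a.eval E s < b.eval E s → c.wp E Q s) ∧ (¬ a.eval E s < b.eval E s → d.wp E Q s)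
  | loop .., _, _ => False

theorem Cmd.wp_sound (c : Cmd) : ∀ {Q : St D → Prop} {s : St D}, c.wp E Q s →
    c.safe E s ∧ c.cost E s ≤ c.clen ∧ Q (c.run E s) := by
  induction c with
  | skip => intro Q s h; exact ⟨trivial, le_rfl, h⟩
  | assign x e => intro Q s h; exact ⟨⟨h.1, h.2.1⟩, le_rfl, h.2.2⟩
  | store q i j k e =>
    intro Q s ⟨h1, h2, h3, h4, h5, h6, h7, h8, h9⟩
    exact ⟨⟨h1, h2, h3, h4, h5, h6, h7, h8⟩, le_rfl, h9⟩
  | rmax h i j e =>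
    intro Q s ⟨h1, h2, h3, h4, h5, h6, h7, h8⟩
    exact ⟨⟨h1, h2, h3, h4, h5, h6, h7⟩, le_rfl, h8⟩
  | seq c d ihc ihd =>
    intro Q s h
    obtain ⟨h1, h2, h3⟩ := ihc (Q := fun s' => d.wp E Q s') h
    obtain ⟨h4, h5, h6⟩ := ihd h3
    exact ⟨⟨h1, h4⟩, Nat.add_le_add h2 h5, h6⟩
  | ite a b c d ihc ihd =>
    intro Q s ⟨h1, h2, h3, h4⟩
    by_cases h : a.eval E s < b.eval E s
    · obtain ⟨g1, g2, g3⟩ := ihc (h3 h)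
      refine ⟨⟨h1, h2, fun _ => g1, fun h' => absurd h h'⟩, ?_, ?_⟩
      · simp only [cost, clen, if_pos h]; omega
      · simpa only [run, if_pos h] using g3
    · obtain ⟨g1, g2, g3⟩ := ihd (h4 h)
      refine ⟨⟨h1, h2, fun h' => absurd h' h, fun _ => g1⟩, ?_, ?_⟩
      · simp only [cost, clen, if_neg h]; omega
      · simpa only [run, if_neg h] using g3
  | loop => intro Q s h; exact h.elim

theorem Spec.of_wp {c : Cmd} {s : St D} {Q : St D → Prop} (h : c.wp E Q s) :
    Spec E c s c.clen Q := c.wp_sound h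

/-- A specification without a bound for the time. -/
def Sat (E : Env) (c : Cmd) (s : St D) (Q : St D → Prop) : Prop := c.safe E s ∧ Q (c.run E s)

theorem Spec.sat {c : Cmd} {s : St D} {T : ℕ} {Q : St D → Prop} (h : Spec E c s T Q) :
    Sat E c s Q := ⟨h.1, h.2.2⟩

/-- For commands without loops the time bound comes for free, so their parts can be verified without
any bookkeeping of time. -/
theorem Spec.of_sat {c : Cmd} {s : St D} {Q : St D → Prop} (hc : c.flat) (h : Sat E c s Q) :
    Spec E c s c.clen Q := Spec.of_flat hc h.1 h.2

theorem Sat.of_wp {c : Cmd} {s : St D} {Q : St D → Prop} (h : c.wp E Q s) : Sat E c s Q :=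
  (Spec.of_wp h).sat

theorem Sat.mono {c : Cmd} {s : St D} {Q Q' : St D → Prop} (h : Sat E c s Q)
    (hQ : ∀ s', Frame c s s' → Q s' → Q' s') : Sat E c s Q' :=
  ⟨h.1, hQ _ (Spec.frame ⟨h.1, le_rfl, h.2⟩).2.2.1 h.2⟩

theorem Sat.bind {c d : Cmd} {s : St D} {Q Q' : St D → Prop} (h : Sat E c s Q)
    (h' : ∀ s', Frame c s s' → Q s' → Sat E d s' Q') : Sat E (.seq c d) s Q' := by
  obtain ⟨h1, h2⟩ := h.mono (fun s' f q => And.intro f q)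
  obtain ⟨h3, h4⟩ := h' _ h2.1 h2.2
  exact ⟨⟨h1, h3⟩, h4⟩

theorem Sat.ite {a b : Expr} {c d : Cmd} {s : St D} {Q : St D → Prop}
    (ha : a.safe E s) (hb : b.safe E s) (hc : a.eval E s < b.eval E s → Sat E c s Q)
    (hd : ¬ a.eval E s < b.eval E s → Sat E d s Q) : Sat E (.ite a b c d) s Q := by
  by_cases h : a.eval E s < b.eval E s
  · obtain ⟨h1, h2⟩ := hc h
    exact ⟨⟨ha, hb, fun _ => h1, fun h' => absurd h h'⟩, by simpa only [Cmd.run, if_pos h] using h2⟩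
  · obtain ⟨h1, h2⟩ := hd h
    exact ⟨⟨ha, hb, fun h' => absurd h' h, fun _ => h1⟩, by simpa only [Cmd.run, if_neg h] using h2⟩

/-- The rule for sequential composition, with the frame. -/
theorem Spec.bind {c d : Cmd} {s : St D} {T T' : ℕ} {Q Q' : St D → Prop} (h : Spec E c s T Q)
    (h' : ∀ s', Frame c s s' → Q s' → Spec E d s' T' Q') : Spec E (.seq c d) s (T + T') Q' := by
  obtain ⟨h1, h2, h3, h4⟩ := h.frame
  obtain ⟨h5, h6, h7⟩ := h' _ h3 h4
  exact ⟨⟨h1, h5⟩, Nat.add_le_add h2 h6, h7⟩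

/-! ### The program -/

open TED.Loop.Expr TED.Loop.Cmd

/-- Sequential composition. -/
def Cmd.block : List Cmd → Cmd
  | [] => skip
  | [c] => c
  | c :: d :: l => seq c (Cmd.block (d :: l))

/-- A one-dimensional array. -/
def Expr.get1 (q : Arr) (i : Expr) : Expr := get q i (lit 0) (lit 0)

namespace Prog

/-- Parameters. -/
def params : Cmd := block [
  assign .n2 (inp 0 (lit 1) * lit 2),
  assign .D (v .n2 + lit 1),
  assign .x (inp 0 (lit 3)),
  assign .K (inp 0 (lit 2) - v .x),
  assign .A (inp 0 (lit 4)),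
  assign .B (inp 0 (lit 5)),
  assign .lo (inp 1 (v .x - lit 1) + lit 1),
  assign .hi (inp 2 (v .lo - lit 1)),
  assign .H (v .A - v .lo),
  assign .M1 (v .H + (v .hi - v .B)),
  assign .M (v .M1 + lit 1),
  assign .sd (v .M1 + lit 2)]

/-- The compressed positions of the partners, and the labels. -/
def outline : Cmd := loop .t .M1 (block [
  ite (v .t) (v .H) (assign .q (v .lo + v .t)) (assign .q (v .B + (v .t - v .H))),
  assign .e (inp 2 (v .q)),
  ite (v .e) (v .A) (store .C (v .t) (lit 0) (lit 0) (v .e - v .lo))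
    (store .C (v .t) (lit 0) (lit 0) (v .H + (v .e - v .B))),
  store .Lb (v .t) (lit 0) (lit 0) (inp 3 (v .q))])

/-- The names of the spine nodes. -/
def spine : Cmd := loop .t .K
  (store .S (inp 1 (v .x + v .t) - v .lo) (lit 0) (lit 0) (v .x + v .t + lit 1))

/-- Append a position to a list of records if the value at this position is a new record. -/
def record (b row pos : Expr) : Cmd := ite (v .prev) (v .val + lit 1) (block [
  store .BP b row (v .cnt) pos,
  assign .cnt (v .cnt + lit 1),
  assign .prev (v .val + lit 1)]) skip

/-- The value of matching a node `al` with the node `p`. -/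
def nodeVal : Cmd := ite (get1 .S (v .al)) (lit 1)
  (assign .e (get .V (v .p + lit 1) (v .al + lit 1) (get1 .C (v .al)) +
    etaOf (get1 .Lb (v .al)) (inp 5 (v .p))))
  (assign .e (mget (get1 .S (v .al)) (v .p) (v .q) - lit 1))

/-- The larger one of the current value and the value of matching the node `al`, if this node
is inside the slice. -/
def maxNodeVal : Cmd := ite (v .al) (get1 .C (v .al)) (ite (get1 .C (v .al)) (v .be)
    (seq nodeVal (assign .val (mx (v .val) (v .e)))) skip) skip

/-- An entry of the table of the tree at `p`. -/
def treeEntry : Cmd := seq (block [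
    assign .be (v .al + v .k),
    assign .val (get .V (v .p + lit 1) (v .al) (v .be)),
    ite (v .al) (v .be) (assign .val (mx (v .val) (get .T (v .al + lit 1) (v .be) (lit 0)))) skip])
  (seq maxNodeVal (seq (store .T (v .al) (v .be) (lit 0) (v .val))
    (record (lit 0) (v .al) (v .be))))

/-- Start a row of the table of the tree. -/
def treeInit : Cmd := block [
  assign .al (v .M1 - v .u),
  assign .m (v .u + lit 1),
  assign .cnt (lit 0),
  assign .prev (lit 0)]

/-- The table of the tree at `p`. -/
def treeTable : Cmd := loop .u .M (seq treeInit (seq (loop .k .m treeEntry)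
  (store .CN (lit 0) (v .al) (lit 0) (v .cnt))))

/-- Start a list of records of the table of the forest at `q`. -/
def restInit : Cmd := block [
  assign .m (v .u + lit 1),
  assign .cnt (lit 0),
  assign .prev (lit 0)]

/-- Read an entry of the table of the forest at `q`. -/
def restEntry : Cmd := seq (block [
    assign .ga (v .u - v .k),
    assign .val (get .V (v .q) (v .ga) (v .u))])
  (record (lit 1) (v .u) (v .ga))

/-- The records of the table of the forest at `q`. -/
def restTable : Cmd := loop .u .M (seq restInit (seq (loop .k .m restEntry)
  (store .CN (lit 1) (v .u) (lit 0) (v .cnt))))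

/-- The candidate for an entry given by a record. -/
def mergeStep : Cmd := block [
  assign .ga (get .BP (v .b) (v .ix) (v .i)),
  ite (v .ga) (v .u) skip (ite (v .be) (v .ga) skip
    (assign .best (mx (v .best) (get .T (v .u) (v .ga) (lit 0) +
      get .V (v .q) (v .ga) (v .be)))))]

/-- Choose the shorter list of records. -/
def mergeInit : Cmd := block [
  assign .be (v .u + v .k),
  assign .best (lit 0),
  ite (get .CN (lit 0) (v .u) (lit 0)) (get .CN (lit 1) (v .be) (lit 0))
    (block [assign .b (lit 0), assign .ix (v .u), assign .cnt (get .CN (lit 0) (v .u) (lit 0))])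
    (block [assign .b (lit 1), assign .ix (v .be), assign .cnt (get .CN (lit 1) (v .be) (lit 0))])]

/-- An entry of the table of the forest at `p`. -/
def mergeEntry : Cmd := seq mergeInit (seq (loop .i .cnt mergeStep)
  (store .V (v .p) (v .u) (v .be) (v .best)))

/-- The table of the forest at `p`. -/
def mergeTable : Cmd := loop .u .M (seq (assign .m (v .M - v .u)) (loop .k .m mergeEntry))

/-- The table of the alignments with a matched ancestor of the block. -/
def table : Cmd := loop .t .n2 (seq (assign .p (v .n2 - lit 1 - v .t))
  (ite (v .p) (inp 4 (v .p)) (seq (assign .q (inp 4 (v .p) + lit 1))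
    (seq treeTable (seq restTable mergeTable))) skip))

/-- The candidate for a least end with the first node of the zone matched. -/
def matchEnd : Cmd := ite (v .i) (inp 4 (v .i)) (ite (get1 .S (v .pp)) (lit 1)
  (ite (v .pp) (get1 .C (v .pp)) (block [
    assign .e (get .V (v .i + lit 1) (v .pp + lit 1) (get1 .C (v .pp)) +
      etaOf (get1 .Lb (v .pp)) (inp 5 (v .i))),
    ite (v .e) (v .d)
      (assign .best (mn (v .best) (get .LA (v .ix + (get1 .C (v .pp) + lit 1 - v .pp))
        (inp 4 (v .i) + lit 1) (v .d - v .e))))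
      (assign .best (mn (v .best) (inp 4 (v .i) + lit 1)))]) skip) skip) skip

/-- A least end. -/
def endEntry : Cmd := ite (lit 0) (v .d)
  (seq (ite (v .i) (v .n2) (assign .best (get .LA (v .ix) (v .i + lit 1) (v .d)))
    (assign .best (v .D)))
  (seq (ite (lit 0) ((v .ix - v .H) + (v .H - v .ix)) (ite (v .ix) (v .M)
    (seq (assign .best (mn (v .best) (get .LA (v .ix + lit 1) (v .i) (v .d)))) matchEnd) skip) skip)
  (store .LA (v .ix) (v .i) (v .d) (v .best))))
  (store .LA (v .ix) (v .i) (lit 0) (v .i))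

/-- The table of the least ends. -/
def ends : Cmd := loop .t .sd (seq (block [
    assign .ix (v .M - v .t),
    ite (v .H) (v .ix) (assign .pp (v .ix - lit 1)) (assign .pp (v .ix))])
  (loop .u .D (seq (assign .i (v .n2 - v .u)) (loop .d .M endEntry))))

/-- Note a start for a least end. -/
def startEntry : Cmd := block [
  assign .a (get .LA (v .H + lit 1) (v .i) (v .d)),
  ite (v .a) (v .D) (store .RB (v .a) (v .d) (lit 0) (v .i + lit 1)) skip]

/-- A greatest start. -/
def startMax : Cmd := store .RB (v .i + lit 1) (v .d) (lit 0)
  (mx (get .RB (v .i + lit 1) (v .d) (lit 0)) (get .RB (v .i) (v .d) (lit 0)))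

/-- The table of the greatest starts. -/
def starts : Cmd := loop .d .M (seq (loop .i .D startEntry) (loop .i .n2 startMax))

/-- The candidate for an answer given by two numbers. -/
def answerStep : Cmd := block [
  assign .a (get .LA (lit 0) (v .t + lit 1) (v .al)),
  assign .b (get .RB (v .c) (v .be) (lit 0)),
  ite (v .a) (v .b) (assign .best (mx (v .best)
    (v .al + v .be + (mget (lit 0) (v .a) (v .b - lit 1) - lit 1)))) skip]

/-- The answer for a node of the tree. -/
def answerNode : Cmd := seq (assign .best (get .V (v .t + lit 1) (lit 0) (v .M1)))
  (seq (loop .al .M (loop .be .M answerStep))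
    (rmax (v .x) (v .t) (v .c + lit 1)
      (v .best + etaOf (inp 3 (v .lo - lit 1)) (inp 5 (v .t)) + lit 1)))

/-- The answer. -/
def answer : Cmd := loop .t .n2 (seq (assign .c (inp 4 (v .t)))
  (ite (v .t) (v .c) answerNode skip))

/-- The whole program. -/
def main : Cmd := seq params (seq outline (seq spine (seq table (seq ends (seq starts answer)))))

theorem main_wf : main.wf := by
  simp [main, params, outline, spine, table, ends, starts, answer, block, wf, treeTable, treeInit,
    restTable, restInit, restEntry, mergeTable, mergeInit, mergeEntry, mergeStep, treeEntry,
    maxNodeVal, nodeVal, record, matchEnd, endEntry, startEntry, startMax, answerNode, answerStep,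
    mods]

end Prog

end TED.Loop

/-! ### Single entries of the tables, and lists of records -/

namespace TED

open Forest

namespace Data

variable {α : Type} {d : Data α} {V : ℕ → ℕ → ℕ → ℕ}

/-- The recursion from `b` on reads only rows from `b` on, so writing an earlier row does not
disturb it. -/
theorem Rec.congr {V' : ℕ → ℕ → ℕ → ℕ} {b : ℕ} (h : d.Rec V b) (hV : ∀ p, b ≤ p → V' p = V p) :
    d.Rec V' b := by
  intro p hp
  obtain ⟨h1, h2⟩ := h p hp
  rw [hV p hp]
  refine ⟨fun a c r hs i j hij hj => ?_, h2⟩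
  rw [h1 a c r hs i j hij hj]
  unfold treeVal nodeVal
  rw [hV (p + 1) (by omega), hV (p + 2 * c.size + 2) (by omega)]

theorem nodeVal_le {p : ℕ} {a : α} {c r : Forest α} (h : d.Rec V (p + 1))
    (hs : d.T.suffix p = cons a c r) (het : ∀ k p, d.et k p ≤ 2)
    (hsv : ∀ k p a c r, d.T.suffix p = cons a c r → d.sv k p ≤ 2 * c.size + 2) {k : ℕ}
    (hk : k < d.C k) (hC : d.C k ≤ d.M1) : d.nodeVal V p k ≤ 2 * c.size + 2 := by
  unfold nodeVal
  split
  · have h1 := h.le het hsv (p + 1) le_rfl (k + 1) (d.C k) (by omega) hC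
    rw [suffix_kids hs] at h1
    have := het k p
    omega
  · exact hsv k p a c r hs

theorem Rec.treeVal_le {p : ℕ} {a : α} {c r : Forest α} (h : d.Rec V (p + 1))
    (hs : d.T.suffix p = cons a c r) (het : ∀ k p, d.et k p ≤ 2)
    (hsv : ∀ k p a c r, d.T.suffix p = cons a c r → d.sv k p ≤ 2 * c.size + 2) {i j : ℕ}
    (hij : i ≤ j) (hj : j ≤ d.M1) : d.treeVal V p i j ≤ 2 * c.size + 2 := by
  refine Data.treeVal_le hs het hsv (fun i j hij hj => ?_) hij hj
  have h1 := h.le het hsv (p + 1) le_rfl i j hij hj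
  rwa [suffix_kids hs] at h1

/-- An entry of the table of a tree takes constant time: nodes entered after `al` are covered by the
neighbouring entry for `al + 1`. The term of `V` contained in that entry is absorbed by
monotonicity. -/
theorem treeVal_step {p al be : ℕ} (h : ∀ i i' j j', i' ≤ i → i ≤ j → j ≤ j' → j' ≤ d.M1 →
      V (p + 1) i j ≤ V (p + 1) i' j') (h1 : al ≤ be) (h2 : be ≤ d.M1) :
    d.treeVal V p al be = max (max (V (p + 1) al be)
      (if al < be then d.treeVal V p (al + 1) be else 0))
      (if al < d.C al ∧ d.C al < be then d.nodeVal V p al else 0) := by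
  unfold treeVal
  rcases h1.eq_or_lt with rfl | hlt
  · rw [if_neg (by omega), if_neg (by omega)]
    simp
  · rw [if_pos hlt, ← Finset.insert_Ico_add_one_left_eq_Ico hlt, Finset.sup_insert]
    have := h (al + 1) al be be (by omega) hlt le_rfl h2
    rw [← max_assoc (V _ _ _) (V _ _ _), max_eq_left this, max_assoc]
    congr 1
    exact max_comm _ _

end Data

namespace Loop

variable {D : ℕ} {α : Type}

/-- A list of the positions with a new record of a function. -/
structure Records (L pos f : ℕ → ℕ) (t cnt prev : ℕ) : Prop where
  mem : ∀ u < cnt, ∃ k < t, L u = pos k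
  cover : ∀ k < t, ∃ k' ≤ k, ∃ u < cnt, L u = pos k' ∧ f k ≤ f k'
  cnt_le : cnt ≤ prev
  cnt_le' : cnt ≤ t
  last : prev = 0 ∨ ∃ k < t, ∃ u < cnt, L u = pos k ∧ prev = f k + 1

theorem Records.zero (L pos f : ℕ → ℕ) : Records L pos f 0 0 0 :=
  ⟨by simp, by simp, le_rfl, le_rfl, .inl rfl⟩

theorem Records.push {L L' pos f : ℕ → ℕ} {t cnt prev : ℕ} (h : Records L pos f t cnt prev)
    (hlt : prev < f t + 1) (h1 : L' cnt = pos t) (h2 : ∀ u < cnt, L' u = L u) :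
    Records L' pos f (t + 1) (cnt + 1) (f t + 1) where
  mem u hu := by
    rcases (show u ≤ cnt by omega).eq_or_lt with rfl | hu
    · exact ⟨t, by omega, h1⟩
    · obtain ⟨k, hk, hL⟩ := h.mem u hu
      exact ⟨k, by omega, by rw [h2 u hu, hL]⟩
  cover k hk := by
    rcases (show k ≤ t by omega).eq_or_lt with rfl | hk
    · exact ⟨k, le_rfl, cnt, by omega, h1, le_rfl⟩
    · obtain ⟨k', hk', u, hu, hL, hf⟩ := h.cover k hk
      exact ⟨k', hk', u, by omega, by rw [h2 u hu, hL], hf⟩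
  cnt_le := by have := h.cnt_le; omega
  cnt_le' := by have := h.cnt_le'; omega
  last := .inr ⟨t, by omega, cnt, by omega, h1, rfl⟩

theorem Records.keep {L pos f : ℕ → ℕ} {t cnt prev : ℕ} (h : Records L pos f t cnt prev)
    (hlt : ¬ prev < f t + 1) : Records L pos f (t + 1) cnt prev where
  mem u hu := by
    obtain ⟨k, hk, hL⟩ := h.mem u hu
    exact ⟨k, by omega, hL⟩
  cover k hk := by
    rcases (show k ≤ t by omega).eq_or_lt with rfl | hk
    · rcases h.last with h0 | ⟨k', hk', u, hu, hL, hf⟩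
      · omega
      · exact ⟨k', by omega, u, hu, hL, by omega⟩
    · exact h.cover k hk
  cnt_le := h.cnt_le
  cnt_le' := by have := h.cnt_le'; omega
  last := by
    rcases h.last with h0 | ⟨k', hk', h1⟩
    · exact .inl h0
    · exact .inr ⟨k', by omega, h1⟩

/-- Every record raises the maximum, so there are at most as many records as possible values. Since
`prev` stores the maximum plus one, a value of zero can be a record too. -/
theorem Records.cnt_le_max {L pos f : ℕ → ℕ} {t cnt prev b : ℕ} (h : Records L pos f t cnt prev)
    (hf : ∀ k < t, f k ≤ b) : cnt ≤ b + 1 := by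
  have h1 := h.cnt_le
  rcases h.last with h0 | ⟨k', hk', u, hu, hL, h2⟩
  · omega
  · have := hf k' hk'
    omega

/-- The properties of the input and of the bounds that the main phases use. -/
structure Ctx (E : Env) (D : ℕ) (d : Data α) (H : ℕ) : Prop where
  dim : D = 2 * d.T.size + 1
  open_ : ∀ p a c r, d.T.suffix p = cons a c r → E.inp 4 p = p + 2 * c.size + 1
  close : ∀ p, d.T.suffix p = nil → E.inp 4 p ≤ p
  et : ∀ k p, d.et k p ≤ 2
  sv : ∀ k p a c r, d.T.suffix p = cons a c r → d.sv k p ≤ 2 * c.size + 2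
  H_le : H ≤ d.M1
  N : 4 * d.T.size + 4 * d.M1 + 10 ≤ E.N
  C : ∀ k, d.C k + d.M1 + 3 ≤ E.N
  C_le : ∀ k < d.M1, d.C k ≤ d.M1
  NW : E.N ≤ E.W
  inp : ∀ q a, E.inp q a < E.W

/-- The part of the state that the main phases only read. -/
structure Pre (E : Env) (d : Data α) (H : ℕ) (s : St D) : Prop where
  n2 : s.var .n2 = 2 * d.T.size
  dim : s.var .D = 2 * d.T.size + 1
  M1 : s.var .M1 = d.M1
  M : s.var .M = d.M1 + 1
  sd : s.var .sd = d.M1 + 2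
  H : s.var .H = H
  C : ∀ k, s.arr .C k 0 0 = d.C k
  S : ∀ k, s.arr .S k 0 0 = d.S k
  sv : ∀ k p a c r, d.T.suffix p = cons a c r →
    d.sv k p = entry (s.mat (d.S k)) p (p + 2 * c.size + 2) - 1
  et : ∀ k p, d.et k p = if s.arr .Lb k 0 0 = E.inp 5 p then 2 else 1

theorem Pre.of_frame {E : Env} {d : Data α} {H : ℕ} {c : Cmd} {s s' : St D} (h : Pre E d H s)
    (hf : Frame c s s') (h1 : ∀ y ∈ [Var.n2, .D, .M1, .M, .sd, .H], y ∉ c.mods)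
    (h2 : ∀ q ∈ [Arr.C, .S, .Lb], q ∉ c.amods) (h3 : c.hasRmax = false) : Pre E d H s' := by
  simp only [List.mem_cons, List.not_mem_nil, or_false, forall_eq_or_imp, forall_eq] at h1 h2
  obtain ⟨g1, g2, g3, g4, g5, g6⟩ := h1
  obtain ⟨g7, g8, g9⟩ := h2
  constructor
  · rw [hf.var _ g1, h.n2]
  · rw [hf.var _ g2, h.dim]
  · rw [hf.var _ g3, h.M1]
  · rw [hf.var _ g4, h.M]
  · rw [hf.var _ g5, h.sd]
  · rw [hf.var _ g6, h.H]
  · rw [hf.arr _ g7]; exact h.C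
  · rw [hf.arr _ g8]; exact h.S
  · rw [hf.mat h3]; exact h.sv
  · rw [hf.arr _ g9]; exact h.et

open TED.Loop.Expr TED.Loop.Cmd

variable {E : Env} {d : Data α} {H : ℕ}

/-- The state while the tables for the node at `p` are computed. -/
structure AtNode (E : Env) (d : Data α) (H : ℕ) (V : ℕ → ℕ → ℕ → ℕ) (p : ℕ) (a : α)
    (c r : Forest α) (s : St D) : Prop where
  pre : Pre E d H s
  var_p : s.var .p = p
  var_q : s.var .q = p + 2 * c.size + 2
  suffix : d.T.suffix p = cons a c r
  arr_V : s.arr .V = V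
  recV : d.Rec V (p + 1)

theorem AtNode.of_frame {V : ℕ → ℕ → ℕ → ℕ} {p : ℕ} {a : α} {c' r : Forest α} {c : Cmd}
    {s s' : St D} (h : AtNode E d H V p a c' r s)
    (hf : Frame c s s') (h1 : ∀ y ∈ [Var.n2, .D, .M1, .M, .sd, .H, .p, .q], y ∉ c.mods)
    (h2 : ∀ q ∈ [Arr.C, .S, .Lb, .V], q ∉ c.amods) (h3 : c.hasRmax = false) :
    AtNode E d H V p a c' r s' where
  pre := h.pre.of_frame hf (fun y hy => h1 y (by simp at hy ⊢; tauto))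
    (fun y hy => h2 y (by simp at hy ⊢; tauto)) h3
  var_p := by rw [hf.var _ (h1 _ (by simp)), h.var_p]
  var_q := by rw [hf.var _ (h1 _ (by simp)), h.var_q]
  suffix := h.suffix
  arr_V := by rw [hf.arr _ (h2 _ (by simp)), h.arr_V]
  recV := h.recV

theorem maxNodeVal_spec (ctx : Ctx E D d H) {V : ℕ → ℕ → ℕ → ℕ} {p : ℕ} {a : α} {c r : Forest α}
    {s : St D} (h : AtNode E d H V p a c r s) {al be : ℕ} (hal : s.var .al = al)
    (hbe : s.var .be = be) (hab : al ≤ be) (hM : be ≤ d.M1) (hval : s.var .val < E.W) :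
    Spec E Prog.maxNodeVal s Prog.maxNodeVal.clen (fun s' => s'.var .val = max (s.var .val)
      (if al < d.C al ∧ d.C al < be then d.nodeVal V p al else 0)) := by
  have hb := suffix_bound h.suffix
  have c1 := ctx.dim
  have c2 := ctx.N
  have c3 := ctx.NW
  have c4 := ctx.C al
  have hle := fun h1 h2 => Data.nodeVal_le h.recV h.suffix ctx.et ctx.sv (k := al) h1 h2
  have hsv := h.pre.sv al p a c r h.suffix
  apply Spec.of_wp
  simp only [Prog.maxNodeVal, Prog.nodeVal, wp, safe_var, true_and, and_true, safe_etaOf,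
    eval_etaOf, St.setVar_var, hal, hbe, h.var_p, h.var_q, h.arr_V, eval_get,
    eval_lit, eval_add, eval_var, safe_add, eval_sub, eval_mget, safe_mget, safe_sub, safe_inp,
    eval_inp, safe_lit, safe_get, get1, h.pre.C, h.pre.S, if_true, reduceCtorEq, if_false, eval_mx,
    safe_mx, ← h.pre.et, ← hsv]
  refine ⟨by omega, fun h1 => ⟨by omega, fun h2 => ?_, fun h2 => ?_⟩, fun h1 => ?_⟩
  · have hle := hle h1 (by omega)
    rw [if_pos ⟨h1, h2⟩]
    unfold Data.nodeVal at *
    refine ⟨by omega, fun h3 => ?_, fun h3 => ?_⟩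
    · rw [if_pos (by omega)] at *
      refine ⟨by omega, by omega, by omega, rfl⟩
    · rw [if_neg (by omega)] at *
      refine ⟨by omega, by omega, by omega, rfl⟩
  · rw [if_neg (by tauto)]; omega
  · rw [if_neg (by tauto)]; omega

theorem record_spec (ctx : Ctx E D d H) {s : St D} {b row pos : Expr} (hb : b.safe E s)
    (hrow : row.safe E s) (hpos : pos.safe E s) {L pos' f : ℕ → ℕ} {t : ℕ} (hbN : b.eval E s < E.N)
    (hrN : row.eval E s < E.N) (hpW : pos.eval E s < E.W)
    (hL : s.arr .BP (b.eval E s) (row.eval E s) = L) (hp : pos.eval E s = pos' t)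
    (hf : s.var .val = f t) (hfW : f t + 1 < E.W) (htN : t + 1 < E.N)
    (hR : Records L pos' f t (s.var .cnt) (s.var .prev)) :
    Spec E (Prog.record b row pos) s (Prog.record b row pos).clen (fun s' =>
      Records (s'.arr .BP (b.eval E s) (row.eval E s)) pos' f (t + 1) (s'.var .cnt) (s'.var .prev) ∧
      ∀ b' row' u, ¬ (b' = b.eval E s ∧ row' = row.eval E s) →
        s'.arr .BP b' row' u = s.arr .BP b' row' u) := by
  have c3 := ctx.NW
  have hcnt := hR.cnt_le'
  apply Spec.of_wp
  simp only [Prog.record, block, wp, safe_var, eval_var, safe_add, safe_lit, eval_add, eval_lit,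
    true_and, and_true, St.setVar_var, St.setVar_arr, St.setArr_var, reduceCtorEq, if_false,
    if_true, St.setArr_arr, hb, hrow, hpos, hf]
  refine ⟨fun h => ⟨by omega, by omega, by omega, by omega, by omega, by omega, ?_, ?_⟩, fun h => ?_⟩
  · refine hR.push h ?_ ?_
    · simp [update3, hp]
    · intro u hu
      simp [update3, ← hL, hu.ne]
  · intro b' row' u h'
    simp only [update3]
    rw [if_neg (by tauto)]
  · rw [hL]
    exact ⟨hR.keep h, fun _ _ _ _ => trivial⟩

theorem treeEntry_spec (ctx : Ctx E D d H) {V : ℕ → ℕ → ℕ → ℕ} {p : ℕ} {a : α} {c r : Forest α}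
    {s : St D} (h : AtNode E d H V p a c r s) {al t : ℕ} (hal : s.var .al = al)
    (hk : s.var .k = t) (ht : al + t ≤ d.M1)
    (hT : al < al + t → s.arr .T (al + 1) (al + t) 0 = d.treeVal V p (al + 1) (al + t))
    (hR : Records (s.arr .BP 0 al) (al + ·) (fun k => d.treeVal V p al (al + k)) t (s.var .cnt)
      (s.var .prev)) :
    Spec E Prog.treeEntry s Prog.treeEntry.clen (fun s' =>
      s'.arr .T = update3 (s.arr .T) al (al + t) 0 (d.treeVal V p al (al + t)) ∧
      Records (s'.arr .BP 0 al) (al + ·) (fun k => d.treeVal V p al (al + k)) (t + 1)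
        (s'.var .cnt) (s'.var .prev) ∧
      ∀ b row u, ¬ (b = 0 ∧ row = al) → s'.arr .BP b row u = s.arr .BP b row u) := by
  have hb := suffix_bound h.suffix
  have c1 := ctx.dim
  have c2 := ctx.N
  have c3 := ctx.NW
  have c4 := ctx.C al
  have hstep := d.treeVal_step (V := V) (p := p) (al := al) (be := al + t)
    (h.recV.mono (p + 1) le_rfl) (by omega) ht
  have hV := h.recV.le ctx.et ctx.sv (p + 1) le_rfl al (al + t) (by omega) ht
  rw [suffix_kids h.suffix] at hV
  have hle := h.recV.treeVal_le h.suffix ctx.et ctx.sv (i := al) (j := al + t) (by omega) ht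
  refine Spec.of_sat (by
    simp [Prog.treeEntry, flat, block, Prog.maxNodeVal, Prog.nodeVal, Prog.record]) ?_
  refine Sat.bind (Q := fun s' => s'.var .be = al + t ∧ s'.var .val =
    max (V (p + 1) al (al + t)) (if al < al + t then d.treeVal V p (al + 1) (al + t) else 0))
    (Sat.of_wp ?_) fun s1 f1 h1 => ?_
  · simp only [block, wp, eval_add, eval_var, safe_var, safe_add, true_and, and_true,
      St.setVar_var, St.setVar_arr, hal, hk, h.var_p, h.arr_V, eval_get, eval_lit, safe_lit,
      safe_get, if_true, reduceCtorEq, if_false, eval_mx, safe_mx]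
    refine ⟨by omega, by omega, by omega, fun h1 => ?_, fun h1 => ?_⟩
    · rw [hT h1, if_pos h1]
      rw [if_pos h1] at hstep
      exact ⟨by omega, by omega, rfl⟩
    · rw [if_neg h1]; omega
  refine Sat.bind (Spec.sat <| maxNodeVal_spec ctx (h.of_frame f1 (by decide) (by decide) rfl)
    ((f1.var _ (by decide)).trans hal) h1.1 (by omega) ht (by omega)) fun s2 f2 h2 => ?_
  have hal2 : s2.var .al = al := by
    rw [f2.var _ (by decide), f1.var _ (by decide), hal]
  have hbe2 : s2.var .be = al + t := by rw [f2.var _ (by decide), h1.1]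
  rw [h1.2, ← hstep] at h2
  refine Sat.bind (Q := fun s' => s'.arr .T = update3 (s.arr .T) al (al + t) 0
    (d.treeVal V p al (al + t))) (Sat.of_wp ?_) fun s3 f3 h3 => ?_
  · simp only [wp, eval_var, safe_var, true_and, eval_lit, safe_lit, hal2, hbe2, h2]
    refine ⟨by omega, by omega, by omega, by omega, ?_⟩
    simp only [St.setArr_arr, if_true]
    rw [f2.arr _ (by decide), f1.arr _ (by decide)]
  have hal3 : (v .al).eval E s3 = al := by rw [eval_var, f3.var _ (by decide), hal2]
  have hbe3 : (v .be).eval E s3 = al + t := by rw [eval_var, f3.var _ (by decide), hbe2]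
  have hBP : s3.arr .BP = s.arr .BP := by
    rw [f3.arr _ (by decide), f2.arr _ (by decide), f1.arr _ (by decide)]
  have hR3 := hR
  rw [← hBP, ← hal3] at hR3
  have hcnt3 : s3.var .cnt = s.var .cnt := by
    rw [f3.var _ (by decide), f2.var _ (by decide), f1.var _ (by decide)]
  have hprev3 : s3.var .prev = s.var .prev := by
    rw [f3.var _ (by decide), f2.var _ (by decide), f1.var _ (by decide)]
  refine Sat.mono (Spec.sat <| record_spec ctx (pos' := (al + ·))
    (f := fun k => d.treeVal V p al (al + k)) (t := t)
    (safe_lit ..) (safe_var ..) (safe_var ..) (by rw [eval_lit]; omega)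
    (hal3.trans_lt (by omega)) (hbe3.trans_lt (by omega)) rfl hbe3
    (by rw [f3.var _ (by decide), h2]) (by omega) (by omega)
    (by rw [hcnt3, hprev3, eval_lit, hal3, hBP]; exact hR)) fun s' f4 ⟨h4, h5⟩ => ?_
  rw [hal3, eval_lit] at h4 h5
  rw [hBP] at h5
  exact ⟨by rw [f4.arr _ (by decide), h3], h4, h5⟩

end Loop

end TED

/-! ### The table of a single tree with its records -/

namespace TED.Loop

open Forest TED.Loop.Expr TED.Loop.Cmd

variable {D : ℕ} {α : Type} {E : Env} {d : Data α} {H : ℕ}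

/-- The table of the tree at `p` and its records in the rows `al ≥ l`. -/
structure TreeRows (d : Data α) (V : ℕ → ℕ → ℕ → ℕ) (p : ℕ) (c : Forest α) (l : ℕ)
    (T BP CN : ℕ → ℕ → ℕ → ℕ) : Prop where
  val : ∀ al be, l ≤ al → al ≤ be → be ≤ d.M1 → T al be 0 = d.treeVal V p al be
  cnt : ∀ al, l ≤ al → al ≤ d.M1 → CN 0 al 0 ≤ 2 * c.size + 3
  mem : ∀ al, l ≤ al → al ≤ d.M1 → ∀ u < CN 0 al 0, al ≤ BP 0 al u ∧ BP 0 al u ≤ d.M1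
  cover : ∀ al be, l ≤ al → al ≤ be → be ≤ d.M1 → ∃ u < CN 0 al 0, BP 0 al u ≤ be ∧
    d.treeVal V p al be ≤ d.treeVal V p al (BP 0 al u)
  cnt_le : ∀ al, l ≤ al → al ≤ d.M1 → CN 0 al 0 ≤ d.M1 + 1

/-- Rows are filled by decreasing left end, as `treeVal_step` requires. Within a row the right end
increases and so do the values, so the records are the least right ends of each value. -/
theorem treeTable_spec (ctx : Ctx E D d H) {V : ℕ → ℕ → ℕ → ℕ} {p : ℕ} {a : α} {c r : Forest α}
    {s : St D} (h : AtNode E d H V p a c r s) :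
    Spec E Prog.treeTable s (4000 * ((d.M1 + 1) * (d.M1 + 1))) (fun s' =>
      TreeRows d V p c 0 (s'.arr .T) (s'.arr .BP) (s'.arr .CN)) := by
  have hb := suffix_bound h.suffix
  have c1 := ctx.dim
  have c2 := ctx.N
  have c3 := ctx.NW
  -- Here and below, 1000 is a generous bound for the time of a loop-free command; that it suffices
  -- is checked by computing the length of the code.
  refine (Spec.loop_frame h.pre.M (fun t s' => TreeRows d V p c (d.M1 + 1 - t) (s'.arr .T)
    (s'.arr .BP) (s'.arr .CN)) (1000 + ((d.M1 + 1) * (1000 + 4) + 3 + 1000)) ?_ ?_).mono ?_ ?_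
  · constructor <;> intros <;> omega
  · intro t s' ht hu f I
    have h0 := h.of_frame f (by decide) (by decide) rfl
    refine Spec.bind (Q := fun s1 => s1.var .al = d.M1 - t ∧ s1.var .m = t + 1 ∧
      s1.var .cnt = 0 ∧ s1.var .prev = 0) ((Spec.of_wp ?_).mono (by decide) fun _ h => h)
      fun s1 f1 h1 => ?_
    · simp only [Prog.treeInit, block, wp, safe_var, safe_sub, safe_add, safe_lit, eval_sub,
        eval_add, eval_lit, eval_var, St.setVar_var, true_and, and_true, hu, h0.pre.M1,
        reduceCtorEq, if_false, if_true]
      omega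
    have h01 := h0.of_frame f1 (by decide) (by decide) rfl
    refine Spec.bind (Q := fun s2 => (∀ k ≤ t, s2.arr .T (d.M1 - t) (d.M1 - t + k) 0 =
        d.treeVal V p (d.M1 - t) (d.M1 - t + k)) ∧
      (∀ al be k, al ≠ d.M1 - t → s2.arr .T al be k = s'.arr .T al be k) ∧
      Records (s2.arr .BP 0 (d.M1 - t)) (d.M1 - t + ·)
        (fun k => d.treeVal V p (d.M1 - t) (d.M1 - t + k)) (t + 1) (s2.var .cnt) (s2.var .prev) ∧
      ∀ b row u, ¬ (b = 0 ∧ row = d.M1 - t) → s2.arr .BP b row u = s'.arr .BP b row u)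
      ((Spec.loop_frame (m := t + 1) h1.2.1 (fun t' s2 => (∀ k < t', s2.arr .T (d.M1 - t) (d.M1 - t + k) 0 =
        d.treeVal V p (d.M1 - t) (d.M1 - t + k)) ∧
      (∀ al be k, al ≠ d.M1 - t → s2.arr .T al be k = s'.arr .T al be k) ∧
      Records (s2.arr .BP 0 (d.M1 - t)) (d.M1 - t + ·)
        (fun k => d.treeVal V p (d.M1 - t) (d.M1 - t + k)) t' (s2.var .cnt) (s2.var .prev) ∧
      ∀ b row u, ¬ (b = 0 ∧ row = d.M1 - t) → s2.arr .BP b row u = s'.arr .BP b row u)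
      1000 ?_ ?_).mono (T' := (d.M1 + 1) * (1000 + 4) + 3) ?_ ?_) fun s2 f2 h2 => ?_
    · refine ⟨fun k hk => absurd hk (by omega), fun al be k _ => ?_, ?_, fun b row u _ => ?_⟩
      · rw [St.setVar_arr, f1.arr _ (by decide)]
      · simp only [St.setVar_var, reduceCtorEq, if_false, h1.2.2.1, h1.2.2.2]
        exact Records.zero _ _ _
      · rw [St.setVar_arr, f1.arr _ (by decide)]
    · intro t' s2 ht' hk f2 ⟨g1, g2, g3, g4⟩
      have h02 := h01.of_frame f2 (by decide) (by decide) rfl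
      refine (treeEntry_spec ctx h02 (al := d.M1 - t) (t := t') ?_ hk (by omega) ?_ g3).mono
        (by decide) fun s3 ⟨k1, k2, k3⟩ => ?_
      · rw [f2.var _ (by decide), h1.1]
      · intro hlt
        rw [g2 _ _ _ (by omega), I.val _ _ (by omega) (by omega) (by omega)]
      · simp only [St.setVar_arr, St.setVar_var, reduceCtorEq, if_false]
        refine ⟨fun k hk => ?_, fun al be k hal => ?_, k2, fun b row u h => ?_⟩
        · rw [k1]
          simp only [update3, true_and, and_true]
          by_cases hkt : k = t'
          · rw [hkt, if_pos rfl]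
          · rw [if_neg (by omega), g1 k (by omega)]
        · rw [k1]
          simp only [update3]
          rw [if_neg (by omega), g2 _ _ _ hal]
        · rw [k3 _ _ _ h, g4 _ _ _ h]
    · gcongr; omega
    · intro s2 ⟨g1, g2⟩
      exact ⟨fun k hk => g1 k (by omega), g2⟩
    · obtain ⟨g1, g2, g3, g4⟩ := h2
      have hal2 : s2.var .al = d.M1 - t := by rw [f2.var _ (by decide), h1.1]
      have hcnt := g3.cnt_le'
      -- The number of records of a row is bounded by the size of the tree in `T`, independently of
      -- `F`.
      have hcnt2 := g3.cnt_le_max (b := 2 * c.size + 2) fun k hk =>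
        h.recV.treeVal_le h.suffix ctx.et ctx.sv (by omega) (by omega)
      refine (Spec.of_wp ?_).mono (by decide) fun _ h => h
      simp only [wp, safe_lit, safe_var, eval_lit, eval_var, true_and, hal2, St.setVar_arr,
        St.setArr_arr, reduceCtorEq, if_false, if_true]
      refine ⟨by omega, by omega, by omega, by omega, ?_⟩
      have hCN : s2.arr .CN = s'.arr .CN := by
        rw [f2.arr _ (by decide), f1.arr _ (by decide)]
      have upd : ∀ al, update3 (s2.arr .CN) 0 (d.M1 - t) 0 (s2.var .cnt) 0 al 0 =
          if al = d.M1 - t then s2.var .cnt else s'.arr .CN 0 al 0 := by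
        intro al
        simp only [update3, true_and, and_true, hCN]
      constructor
      · intro al be h3 h4 h5
        by_cases hal : al = d.M1 - t
        · have := g1 (be - al) (by omega)
          rw [← hal, show al + (be - al) = be by omega] at this
          exact this
        · rw [g2 _ _ _ hal, I.val _ _ (by omega) h4 h5]
      · intro al h3 h4
        rw [upd]
        split
        · omega
        · exact I.cnt al (by omega) h4
      · intro al h3 h4 u
        rw [upd]
        split
        · rename_i hal
          intro hu
          obtain ⟨k, hk, hL⟩ := g3.mem u hu
          rw [hal, hL]
          omega
        · rename_i hal
          rw [g4 _ _ _ (by tauto)]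
          exact I.mem al (by omega) h4 u
      · intro al be h3 h4 h5
        rw [upd]
        split
        · rename_i hal
          obtain ⟨k', hk', u, hu, hL, hf⟩ := g3.cover (be - al) (by omega)
          refine ⟨u, hu, ?_⟩
          rw [hal, hL]
          rw [show d.M1 - t + (be - al) = be by omega] at hf
          exact ⟨by omega, hf⟩
        · rename_i hal
          obtain ⟨u, hu, k1⟩ := I.cover al be (by omega) h4 h5
          exact ⟨u, hu, by rw [g4 _ _ _ (by tauto)]; exact k1⟩
      · intro al h3 h4
        rw [upd]
        split
        · omega
        · exact I.cnt_le al (by omega) h4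
  · generalize d.M1 = m
    nlinarith
  · intro s' h'
    rwa [Nat.sub_self] at h'

end TED.Loop

/-! ### Merging a tree with the forest to its right -/

namespace TED.Loop

open Forest TED.Loop.Expr TED.Loop.Cmd

variable {D : ℕ} {α : Type} {E : Env} {d : Data α} {H : ℕ}

/-- The records of the table of the forest at `q` in the columns `be < l`. -/
structure RestRows (d : Data α) (V : ℕ → ℕ → ℕ → ℕ) (q : ℕ) (r : Forest α) (l : ℕ)
    (BP CN : ℕ → ℕ → ℕ → ℕ) : Prop where
  cnt : ∀ be < l, be ≤ d.M1 → CN 1 be 0 ≤ 2 * r.size + 1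
  mem : ∀ be < l, be ≤ d.M1 → ∀ u < CN 1 be 0, BP 1 be u ≤ be
  cover : ∀ be < l, be ≤ d.M1 → ∀ ga ≤ be, ∃ u < CN 1 be 0, ga ≤ BP 1 be u ∧
    V q ga be ≤ V q (BP 1 be u) be
  cnt_le : ∀ be < l, be ≤ d.M1 → CN 1 be 0 ≤ d.M1 + 1

/-- The mirror image of the records of a tree: the right end is fixed and the left end decreases, so
the values increase and the records are the greatest left ends of each value. -/
theorem restTable_spec (ctx : Ctx E D d H) {V : ℕ → ℕ → ℕ → ℕ} {p : ℕ} {a : α} {c r : Forest α}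
    {s : St D} (h : AtNode E d H V p a c r s) :
    Spec E Prog.restTable s (4000 * ((d.M1 + 1) * (d.M1 + 1))) (fun s' =>
      RestRows d V (p + 2 * c.size + 2) r (d.M1 + 1) (s'.arr .BP) (s'.arr .CN) ∧
      s'.arr .BP 0 = s.arr .BP 0 ∧ s'.arr .CN 0 = s.arr .CN 0) := by
  have hb := suffix_bound h.suffix
  have c1 := ctx.dim
  have c2 := ctx.N
  have c3 := ctx.NW
  refine (Spec.loop_frame h.pre.M (fun t s' => RestRows d V (p + 2 * c.size + 2) r t (s'.arr .BP)
    (s'.arr .CN) ∧ s'.arr .BP 0 = s.arr .BP 0 ∧ s'.arr .CN 0 = s.arr .CN 0)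
    (1000 + ((d.M1 + 1) * (1000 + 4) + 3 + 1000)) ?_ ?_).mono ?_ (fun _ h => h)
  · refine ⟨?_, rfl, rfl⟩
    constructor <;> intros <;> omega
  · intro t s' ht hu f ⟨I, I0, I1⟩
    have h0 := h.of_frame f (by decide) (by decide) rfl
    have hV : ∀ k < t + 1, V (p + 2 * c.size + 2) (t - k) t ≤ 2 * r.size := by
      intro k _
      have := h.recV.le ctx.et ctx.sv (p + 2 * c.size + 2) (by omega) (t - k) t (by omega)
        (by omega)
      rwa [suffix_rest h.suffix] at this
    refine Spec.bind (Q := fun s1 => s1.var .m = t + 1 ∧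
      s1.var .cnt = 0 ∧ s1.var .prev = 0) ((Spec.of_wp ?_).mono (by decide) fun _ h => h)
      fun s1 f1 h1 => ?_
    · simp only [Prog.restInit, block, wp, safe_var, safe_add, safe_lit,
        eval_add, eval_lit, eval_var, St.setVar_var, true_and, and_true, hu,
        reduceCtorEq, if_false, if_true]
      omega
    have h01 := h0.of_frame f1 (by decide) (by decide) rfl
    have hu1 : s1.var .u = t := by rw [f1.var _ (by decide), hu]
    refine Spec.bind (Q := fun s2 => Records (s2.arr .BP 1 t) (t - ·)
        (fun k => V (p + 2 * c.size + 2) (t - k) t) (t + 1) (s2.var .cnt) (s2.var .prev) ∧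
      ∀ b row u, ¬ (b = 1 ∧ row = t) → s2.arr .BP b row u = s'.arr .BP b row u)
      ((Spec.loop_frame (m := t + 1) h1.1 (fun t' s2 => Records (s2.arr .BP 1 t) (t - ·)
        (fun k => V (p + 2 * c.size + 2) (t - k) t) t' (s2.var .cnt) (s2.var .prev) ∧
      ∀ b row u, ¬ (b = 1 ∧ row = t) → s2.arr .BP b row u = s'.arr .BP b row u)
      1000 ?_ ?_).mono (T' := (d.M1 + 1) * (1000 + 4) + 3) ?_ fun _ h => h) fun s2 f2 h2 => ?_
    · refine ⟨?_, fun b row u _ => ?_⟩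
      · simp only [St.setVar_var, reduceCtorEq, if_false, h1.2.1, h1.2.2]
        exact Records.zero _ _ _
      · rw [St.setVar_arr, f1.arr _ (by decide)]
    · intro t' s2 ht' hk f2 ⟨g1, g2⟩
      have h02 := h01.of_frame f2 (by decide) (by decide) rfl
      have hu2 : s2.var .u = t := by rw [f2.var _ (by decide), hu1]
      have hV' := hV t' ht'
      refine (Spec.of_sat (by simp [flat, block, Prog.record])
        (Sat.bind (Q := fun s3 => s3.var .ga = t - t' ∧
          s3.var .val = V (p + 2 * c.size + 2) (t - t') t) (Sat.of_wp ?_) fun s3 f3 h3 => ?_)).mono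
        (by decide) fun _ h => h
      · simp only [block, wp, safe_var, safe_sub, safe_get, eval_sub, eval_get, eval_var, true_and,
          and_true, St.setVar_var, St.setVar_arr, reduceCtorEq, if_false, if_true, hu2, hk,
          h02.var_q, h02.arr_V]
        omega
      · have hga3 : (v .ga).eval E s3 = t - t' := by rw [eval_var, h3.1]
        have hu3 : (v .u).eval E s3 = t := by rw [eval_var, f3.var _ (by decide), hu2]
        have hcnt3 : s3.var .cnt = s2.var .cnt := by rw [f3.var _ (by decide)]
        have hprev3 : s3.var .prev = s2.var .prev := by rw [f3.var _ (by decide)]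
        have hBP : s3.arr .BP = s2.arr .BP := by rw [f3.arr _ (by decide)]
        refine Sat.mono (Spec.sat <| record_spec ctx (pos' := (t - ·))
          (f := fun k => V (p + 2 * c.size + 2) (t - k) t) (t := t')
          (safe_lit ..) (safe_var ..) (safe_var ..) (by rw [eval_lit]; omega)
          (hu3.trans_lt (by omega)) (hga3.trans_lt (by omega)) rfl hga3
          h3.2 (by omega) (by omega)
          (by rw [hcnt3, hprev3, eval_lit, hu3, hBP]; exact g1)) fun s4 f4 ⟨k1, k2⟩ => ?_
        rw [hu3, eval_lit] at k1 k2
        simp only [St.setVar_arr, St.setVar_var, reduceCtorEq, if_false]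
        exact ⟨k1, fun b row u h => by rw [k2 _ _ _ h, hBP, g2 _ _ _ h]⟩
    · gcongr; omega
    · obtain ⟨g1, g2⟩ := h2
      have hu2 : s2.var .u = t := by rw [f2.var _ (by decide), hu1]
      have hcnt := g1.cnt_le'
      have hcnt2 := g1.cnt_le_max (b := 2 * r.size) hV
      refine (Spec.of_wp ?_).mono (by decide) fun _ h => h
      simp only [wp, safe_lit, safe_var, eval_lit, eval_var, true_and, hu2, St.setVar_arr,
        St.setArr_arr, reduceCtorEq, if_false, if_true]
      have hCN : s2.arr .CN = s'.arr .CN := by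
        rw [f2.arr _ (by decide), f1.arr _ (by decide)]
      refine ⟨by omega, by omega, by omega, by omega, ?_, ?_, ?_⟩
      · have upd : ∀ be, update3 (s2.arr .CN) 1 t 0 (s2.var .cnt) 1 be 0 =
            if be = t then s2.var .cnt else s'.arr .CN 1 be 0 := by
          intro be
          simp only [update3, true_and, and_true, hCN]
        constructor
        · intro be h3 h4
          rw [upd]
          split
          · omega
          · exact I.cnt be (by omega) h4
        · intro be h3 h4 u
          rw [upd]
          split
          · rename_i hbe
            intro hu
            obtain ⟨k, hk, hL⟩ := g1.mem u hu
            rw [hbe, hL]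
            exact Nat.sub_le _ _
          · rename_i hbe
            rw [g2 _ _ _ (by tauto)]
            exact I.mem be (by omega) h4 u
        · intro be h3 h4 ga hga
          rw [upd]
          split
          · rename_i hbe
            obtain ⟨k', hk', u, hu, hL, hf⟩ := g1.cover (be - ga) (by omega)
            refine ⟨u, hu, ?_⟩
            rw [hbe, hL]
            rw [show t - (be - ga) = ga by omega] at hf
            exact ⟨by omega, hf⟩
          · rename_i hbe
            obtain ⟨u, hu, k1⟩ := I.cover be (by omega) h4 ga hga
            exact ⟨u, hu, by rw [g2 _ _ _ (by tauto)]; exact k1⟩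
        · intro be h3 h4
          rw [upd]
          split
          · omega
          · exact I.cnt_le be (by omega) h4
      · rw [← I0]
        funext row u
        exact g2 _ _ _ (by omega)
      · rw [← I1, ← hCN]
        funext row u
        simp [update3]
  · generalize d.M1 = m
    nlinarith

/-- The value of an entry of the table. -/
def mergeVal (d : Data α) (V : ℕ → ℕ → ℕ → ℕ) (p q i j : ℕ) : ℕ :=
  (Finset.Icc i j).sup fun k => d.treeVal V p i k + V q k j

/-- The data for the merge of the tables at the node `p`. -/
structure Merge (V : ℕ → ℕ → ℕ → ℕ) (d : Data α) (p : ℕ) (c r : Forest α) (s : St D) : Prop where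
  tree : TreeRows d V p c 0 (s.arr .T) (s.arr .BP) (s.arr .CN)
  rest : RestRows d V (p + 2 * c.size + 2) r (d.M1 + 1) (s.arr .BP) (s.arr .CN)
  var_p : s.var .p = p
  var_q : s.var .q = p + 2 * c.size + 2
  arr_V : ∀ p', p < p' → s.arr .V p' = V p'

theorem Merge.of_frame {V : ℕ → ℕ → ℕ → ℕ} {p : ℕ} {c' r : Forest α} {c : Cmd}
    {s s' : St D} (h : Merge V d p c' r s)
    (hf : Frame c s s') (h1 : ∀ y ∈ [Var.p, .q], y ∉ c.mods)
    (h2 : ∀ q ∈ [Arr.T, .BP, .CN], q ∉ c.amods) (h3 : ∀ p', p < p' → s'.arr .V p' = V p') :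
    Merge V d p c' r s' where
  tree := by
    rw [hf.arr _ (h2 _ (by simp)), hf.arr _ (h2 _ (by simp)), hf.arr _ (h2 _ (by simp))]
    exact h.tree
  rest := by
    rw [hf.arr _ (h2 _ (by simp)), hf.arr _ (h2 _ (by simp))]
    exact h.rest
  var_p := by rw [hf.var _ (h1 _ (by simp)), h.var_p]
  var_q := by rw [hf.var _ (h1 _ (by simp)), h.var_q]
  arr_V := h3

/-- The saving on which the running time rests: an optimal cut can be found in either list of
records, so the shorter one is searched. -/
theorem mergeEntry_spec (ctx : Ctx E D d H) {V : ℕ → ℕ → ℕ → ℕ} {p : ℕ} {a : α} {c r : Forest α}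
    (hs : d.T.suffix p = cons a c r) (hV : d.Rec V (p + 1)) {s : St D} (h : Merge V d p c r s)
    {al t : ℕ} (hu : s.var .u = al) (hk : s.var .k = t) (ht : al + t ≤ d.M1) :
    Spec E Prog.mergeEntry s (7000 * (d.T.mergeAt p + 1)) (fun s' =>
      s'.arr .V = update3 (s.arr .V) p al (al + t)
        (mergeVal d V p (p + 2 * c.size + 2) al (al + t))) := by
  have hb := suffix_bound hs
  have c1 := ctx.dim
  have c2 := ctx.N
  have c3 := ctx.NW
  have t1 := h.tree.cnt al (by omega) (by omega)
  have t2 := h.tree.cnt_le al (by omega) (by omega)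
  have t3 := h.tree.mem al (by omega) (by omega)
  have t4 := h.tree.cover al
  have r1 := h.rest.cnt (al + t) (by omega) (by omega)
  have r2 := h.rest.cnt_le (al + t) (by omega) (by omega)
  have r3 := h.rest.mem (al + t) (by omega) (by omega)
  have r4 := h.rest.cover (al + t) (by omega) (by omega)
  have hmw : d.T.mergeAt p = min (c.size + 1) r.size := by rw [mergeAt, hs]
  set q := p + 2 * c.size + 2 with hq
  have hval : ∀ ga, al ≤ ga → ga ≤ al + t → d.treeVal V p al ga + V q ga (al + t) ≤
      2 * c.size + 2 + 2 * r.size := by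
    intro ga h1 h2
    have h3 := hV.treeVal_le hs ctx.et ctx.sv h1 (by omega)
    have h4 := hV.le ctx.et ctx.sv q (by omega) ga (al + t) h2 ht
    rw [suffix_rest hs] at h4
    omega
  -- The lists have at most `2 * c.size + 3` and `2 * r.size + 1` records. The last clause says that
  -- any cut may be replaced by a listed one without loss.
  refine (Spec.bind (T' := (2 * d.T.mergeAt p + 3) * (1000 + 4) + 3 + 1000) (Q := fun s1 =>
    s1.var .be = al + t ∧ s1.var .best = 0 ∧ s1.var .b < 2 ∧ s1.var .ix ≤ d.M1 ∧
    s1.var .cnt ≤ 2 * d.T.mergeAt p + 3 ∧ s1.var .cnt ≤ d.M1 + 1 ∧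
    (∀ u < s1.var .cnt, s.arr .BP (s1.var .b) (s1.var .ix) u ≤ d.M1) ∧
    ∀ ga, al ≤ ga → ga ≤ al + t → ∃ u < s1.var .cnt,
      al ≤ s.arr .BP (s1.var .b) (s1.var .ix) u ∧ s.arr .BP (s1.var .b) (s1.var .ix) u ≤ al + t ∧
      d.treeVal V p al ga + V q ga (al + t) ≤
        d.treeVal V p al (s.arr .BP (s1.var .b) (s1.var .ix) u) +
          V q (s.arr .BP (s1.var .b) (s1.var .ix) u) (al + t))
    ((Spec.of_wp ?_).mono (by decide) fun _ h => h) fun s1 f1 h1 => ?_).mono (T := 1000 + _) ?_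
      fun _ h => h
  · simp only [Prog.mergeInit, block, wp, safe_var, safe_add, safe_lit, safe_get, eval_get,
        eval_add, eval_lit, eval_var, St.setVar_var, St.setVar_arr, true_and, and_true, hu, hk,
        reduceCtorEq, if_false, if_true]
    refine ⟨by omega, by omega, by omega, by omega, fun hlt => ⟨by omega, by omega, by omega,
      by omega, by omega, by omega, by omega, by omega, fun u hu => (t3 u hu).2, ?_⟩,
      fun hlt => ⟨by omega, by omega, by omega,
      by omega, by omega, by omega, by omega, by omega, fun u hu => (r3 u hu).trans (by omega), ?_⟩⟩
    · intro ga g1 g2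
      obtain ⟨u, k1, k2, k3⟩ := t4 ga (by omega) g1 (by omega)
      have k4 := t3 u k1
      -- Moving the cut to the left, to a record that keeps the value of the tree, enlarges the
      -- range left for the other trees.
      have k5 := hV.mono q (by omega) ga (s.arr .BP 0 al u) (al + t) (al + t) k2 g2 le_rfl ht
      exact ⟨u, k1, k4.1, by omega, by omega⟩
    · intro ga g1 g2
      obtain ⟨u, k1, k2, k3⟩ := r4 ga g2
      have k4 := r3 u k1
      -- Dually, moving the cut to the right, to a record that keeps the value of the other trees,
      -- enlarges the range for the first tree.
      have k5 := hV.treeVal_mono (p := p) le_rfl (le_refl al) g1 k2 (by omega)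
      exact ⟨u, k1, by omega, k4, by omega⟩
  · obtain ⟨e1, e2, e3, e4, e5, e6, e7, e8⟩ := h1
    have hm1 := h.of_frame f1 (by decide) (by decide) (by
      rw [f1.arr _ (by decide)]; exact h.arr_V)
    have hBP : s1.arr .BP = s.arr .BP := f1.arr _ (by decide)
    have hu1 : s1.var .u = al := by rw [f1.var _ (by decide), hu]
    refine Spec.bind (T := (2 * d.T.mergeAt p + 3) * (1000 + 4) + 3) (Q := fun s2 =>
      s2.var .best = mergeVal d V p q al (al + t)) ((Spec.loop_frame (m := s1.var .cnt) rfl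
        (fun t' s2 => s2.var .best ≤ mergeVal d V p q al (al + t) ∧ ∀ u < t',
          al ≤ s.arr .BP (s1.var .b) (s1.var .ix) u →
          s.arr .BP (s1.var .b) (s1.var .ix) u ≤ al + t →
          d.treeVal V p al (s.arr .BP (s1.var .b) (s1.var .ix) u) +
            V q (s.arr .BP (s1.var .b) (s1.var .ix) u) (al + t) ≤ s2.var .best)
        1000 ?_ ?_).mono ?_ ?_) fun s2 f2 h2 => ?_
    · refine ⟨by simp [e2], by simp⟩
    · intro t' s2 ht' hi f2 ⟨g1, g2⟩
      have hm2 := hm1.of_frame f2 (by decide) (by decide) (by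
        rw [f2.arr _ (by decide)]; exact hm1.arr_V)
      have hga := e7 t' ht'
      refine (Spec.of_wp ?_).mono (by decide) fun _ h => h
      have v1 : s2.var .b = s1.var .b := f2.var _ (by decide)
      have v2 : s2.var .ix = s1.var .ix := f2.var _ (by decide)
      have v3 : s2.var .u = al := (f2.var _ (by decide)).trans hu1
      have v4 : s2.var .be = al + t := (f2.var _ (by decide)).trans e1
      have v5 : s2.arr .BP = s.arr .BP := (f2.arr _ (by decide)).trans hBP
      have hVq : s2.arr .V (p + 2 * c.size + 2) = V q := hm2.arr_V _ (by omega)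
      set ga := s.arr .BP (s1.var .b) (s1.var .ix) t' with hgadef
      simp only [Prog.mergeStep, block, wp, safe_var, safe_get, safe_add, safe_mx, eval_get,
        eval_mx, eval_add, eval_var, St.setVar_var, St.setVar_arr, true_and, v1, v2, v3,
        v4, v5, hi, reduceCtorEq, if_false, if_true, hm2.var_q, hVq, ← hgadef,
        safe_lit, eval_lit]
      -- A row of records serves all opposite ends at once, so records outside the current range
      -- must be skipped.
      refine ⟨by omega, by omega, fun h3 => ⟨g1, ?_⟩, fun h3 => ⟨fun h4 => ⟨g1, ?_⟩,
        fun h4 => ?_⟩⟩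
      · intro u hu k1 k2
        rcases (show u ≤ t' by omega).eq_or_lt with rfl | hu
        · omega
        · exact g2 u hu k1 k2
      · intro u hu k1 k2
        rcases (show u ≤ t' by omega).eq_or_lt with rfl | hu
        · omega
        · exact g2 u hu k1 k2
      · have k0 := hval ga (by omega) (by omega)
        have k1 := hm2.tree.val al ga (by omega) (by omega) (by omega)
        have k2 : d.treeVal V p al ga + V q ga (al + t) ≤ mergeVal d V p q al (al + t) :=
          Finset.le_sup (f := fun k => d.treeVal V p al k + V q k (al + t))
            (Finset.mem_Icc.2 ⟨by omega, by omega⟩)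
        have k3 : mergeVal d V p q al (al + t) ≤ 2 * c.size + 2 + 2 * r.size := by
          refine Finset.sup_le fun k hk => ?_
          rw [Finset.mem_Icc] at hk
          exact hval k hk.1 hk.2
        rw [k1]
        refine ⟨⟨by omega, by omega⟩, by omega, by omega, ?_⟩
        intro u hu k5 k6
        rcases (show u ≤ t' by omega).eq_or_lt with rfl | hu
        · exact le_max_right _ _
        · exact (g2 u hu k5 k6).trans (le_max_left _ _)
    · gcongr
    · intro s2 ⟨g1, g2⟩
      refine le_antisymm g1 (Finset.sup_le fun ga hga => ?_)
      rw [Finset.mem_Icc] at hga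
      obtain ⟨u, k1, k2, k3, k4⟩ := e8 ga hga.1 hga.2
      exact k4.trans (g2 u k1 k2 k3)
    · have k3 : mergeVal d V p q al (al + t) ≤ 2 * c.size + 2 + 2 * r.size := by
        refine Finset.sup_le fun k hk => ?_
        rw [Finset.mem_Icc] at hk
        exact hval k hk.1 hk.2
      have hbe2 : s2.var .be = al + t := (f2.var _ (by decide)).trans e1
      have hu2 : s2.var .u = al := (f2.var _ (by decide)).trans hu1
      have hp2 : s2.var .p = p := (f2.var _ (by decide)).trans hm1.var_p
      have hV2 : s2.arr .V = s.arr .V := (f2.arr _ (by decide)).trans (f1.arr _ (by decide))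
      refine (Spec.of_wp ?_).mono (by decide) fun _ h => h
      simp only [wp, safe_var, eval_var, true_and, hbe2, hu2, hp2, h2, hV2, St.setArr_arr, if_true,
        and_true]
      omega
  · omega

theorem mergeTable_spec (ctx : Ctx E D d H) {V : ℕ → ℕ → ℕ → ℕ} {p : ℕ} {a : α} {c r : Forest α}
    (hs : d.T.suffix p = cons a c r) (hV : d.Rec V (p + 1)) {s : St D} (h : Merge V d p c r s)
    (hpre : Pre E d H s) :
    Spec E Prog.mergeTable s (9000 * ((d.M1 + 1) * (d.M1 + 1) * (d.T.mergeAt p + 1))) (fun s' =>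
      (∀ p', p' ≠ p → s'.arr .V p' = s.arr .V p') ∧
      ∀ i j, i ≤ j → j ≤ d.M1 → s'.arr .V p i j = mergeVal d V p (p + 2 * c.size + 2) i j) := by
  have c2 := ctx.N
  have c3 := ctx.NW
  refine (Spec.loop_frame hpre.M (fun t s' => (∀ p', p' ≠ p → s'.arr .V p' = s.arr .V p') ∧
      ∀ i j, i < t → i ≤ j → j ≤ d.M1 → s'.arr .V p i j = mergeVal d V p (p + 2 * c.size + 2) i j)
    (1000 + ((d.M1 + 1) * (7000 * (d.T.mergeAt p + 1) + 4) + 3)) ?_ ?_).mono ?_ ?_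
  · exact ⟨fun _ _ => rfl, fun i j h => absurd h (by omega)⟩
  · intro t s1 ht hu f1 ⟨g1, g2⟩
    have hpre1 := hpre.of_frame f1 (by decide) (by decide) rfl
    refine Spec.bind (Q := fun s2 => s2.var .m = d.M1 + 1 - t)
      ((Spec.of_wp ?_).mono (by decide) fun _ h => h) fun s2 f2 h2 => ?_
    · simp only [wp, safe_sub, safe_var, true_and, eval_sub, eval_var, hu, hpre1.M, St.setVar_var,
        if_true, and_true]
      omega
    refine (Spec.loop_frame h2 (fun t' s3 => (∀ p', p' ≠ p → s3.arr .V p' = s.arr .V p') ∧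
      ∀ i j, i ≤ t → (i = t → j < t + t') → i ≤ j → j ≤ d.M1 →
        s3.arr .V p i j = mergeVal d V p (p + 2 * c.size + 2) i j)
      (7000 * (d.T.mergeAt p + 1)) ?_ ?_).mono ?_ ?_
    · rw [St.setVar_arr, f2.arr _ (by decide)]
      exact ⟨g1, fun i j h1 h3 h4 h5 => g2 i j (by omega) h4 h5⟩
    · intro t' s3 ht' hk f3 ⟨k1, k2⟩
      have hm1 := h.of_frame f1 (by decide) (by decide) (fun p' hp' => by
        rw [g1 p' (by omega), h.arr_V p' hp'])
      have hm2 := hm1.of_frame f2 (by decide) (by decide) (fun p' hp' => by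
        rw [f2.arr _ (by decide)]; exact hm1.arr_V p' hp')
      have hm3 := hm2.of_frame f3 (by decide) (by decide) (fun p' hp' => by
        rw [k1 p' (by omega), h.arr_V p' hp'])
      have hu3 : s3.var .u = t := by rw [f3.var _ (by decide), f2.var _ (by decide), hu]
      refine (mergeEntry_spec ctx hs hV hm3 hu3 hk (by omega)).mono le_rfl fun s4 h4 => ?_
      rw [St.setVar_arr, h4]
      refine ⟨fun p' hp' => ?_, fun i j h5 h6 h7 h8 => ?_⟩
      · rw [← k1 p' hp']
        funext i j
        simp [update3, hp']
      · simp only [update3, true_and]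
        split
        · rename_i he
          rw [he.1, he.2]
        · rename_i he
          exact k2 i j h5 (fun hi => by have := h6 hi; omega) h7 h8
    · gcongr; omega
    · intro s3 ⟨k1, k2⟩
      rw [St.setVar_arr]
      exact ⟨k1, fun i j h1 h3 h4 => k2 i j (by omega) (by omega) h3 h4⟩
  · generalize d.M1 = m
    generalize d.T.mergeAt p = w
    nlinarith [Nat.zero_le (m * m * w), Nat.zero_le (m * w), Nat.zero_le (m * m)]
  · intro s' ⟨g1, g2⟩
    exact ⟨g1, fun i j h1 h2 => g2 i j (by omega) h1 h2⟩

end TED.Loop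

/-! ### The complete table and the least ends -/

namespace TED.Loop

open Forest TED.Loop.Expr TED.Loop.Cmd

variable {D : ℕ} {α : Type} {E : Env} {d : Data α} {H : ℕ}

/-- The positions of `T` are treated from right to left, so the rows for the children and for the
trees further right are already present. The time is summed with the individual merge costs, since a
uniform bound per position would be too large. -/
theorem table_spec (ctx : Ctx E D d H) {s : St D} (h : Pre E d H s)
    (hV0 : ∀ p i j, s.arr .V p i j = 0) :
    Spec E Prog.table s
      (30000 * ((d.M1 + 1) * (d.M1 + 1) * (d.T.mergeWork + 2 * d.T.size)) + 3)
      (fun s' => d.Rec (s'.arr .V) 0) := by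
  have c2 := ctx.N
  have c3 := ctx.NW
  refine (Spec.loop_frame_sum h.n2 (fun t s' => d.Rec (s'.arr .V) (2 * d.T.size - t) ∧
    ∀ p < 2 * d.T.size - t, ∀ i j, s'.arr .V p i j = 0)
    (fun t => 29000 * ((d.M1 + 1) * (d.M1 + 1) * (d.T.mergeAt (2 * d.T.size - 1 - t) + 1)))
    ?_ ?_).mono ?_ ?_
  · refine ⟨fun p hp => ⟨fun a c r hs => ?_, fun _ => hV0 p⟩, fun p _ => hV0 p⟩
    have := suffix_bound hs
    omega
  · intro t s1 ht hu f1 ⟨g1, g2⟩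
    have hp1 := h.of_frame f1 (by decide) (by decide) rfl
    set p := 2 * d.T.size - 1 - t with hp
    have hpt : 2 * d.T.size - t = p + 1 := by omega
    have hpt' : 2 * d.T.size - (t + 1) = p := by omega
    rw [hpt] at g1 g2
    rw [hpt']
    refine (Spec.bind (T' := 1000 + (1000 + (4000 * ((d.M1 + 1) * (d.M1 + 1)) +
        (4000 * ((d.M1 + 1) * (d.M1 + 1)) + 9000 * ((d.M1 + 1) * (d.M1 + 1) *
          (d.T.mergeAt p + 1))))))
      (Q := fun s2 => s2.var .p = p) ((Spec.of_wp ?_).mono (T' := 1000) (by decide) fun _ h => h)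
      fun s2 f2 h2 => (Spec.ite (safe_var ..) (by simp) (fun hlt => ?_)
        (fun hlt => ?_)).mono (Nat.add_le_add_right (m := 1000) (by decide) _)
          fun _ h => h).mono ?_ fun _ h => h
    · simp only [wp, safe_sub, safe_var, safe_lit, eval_sub, eval_var, eval_lit, hu, hp1.n2,
        St.setVar_var, if_true, true_and, and_true]
      omega
    · simp only [eval_var, eval_inp, h2] at hlt
      have hp2 := hp1.of_frame f2 (by decide) (by decide) rfl
      cases hs : d.T.suffix p with
      | nil => have := ctx.close p hs; omega
      | cons a c r =>
        have hb := suffix_bound hs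
        have hin := ctx.open_ p a c r hs
        have hV2 : s2.arr .V = s1.arr .V := f2.arr _ (by decide)
        refine Spec.bind (Q := fun s3 => s3.var .q = p + 2 * c.size + 2)
          ((Spec.of_wp ?_).mono (T' := 1000) (by decide) fun _ h => h) fun s3 f3 h3 => ?_
        · simp only [wp, safe_add, safe_inp, safe_var, safe_lit, eval_add, eval_inp, eval_var,
            eval_lit, h2, hin, St.setVar_var, if_true, true_and, and_true]
          omega
        have hV3 : s3.arr .V = s1.arr .V := (f3.arr _ (by decide)).trans hV2
        have hn3 : AtNode E d H (s1.arr .V) p a c r s3 :=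
          ⟨hp2.of_frame f3 (by decide) (by decide) rfl, by rw [f3.var _ (by decide), h2], h3, hs,
            hV3, g1⟩
        refine Spec.bind (treeTable_spec ctx hn3) fun s4 f4 h4 => ?_
        have hn4 := hn3.of_frame f4 (by decide) (by decide) rfl
        refine Spec.bind (restTable_spec ctx hn4) fun s5 f5 ⟨h5, h6, h7⟩ => ?_
        have hn5 := hn4.of_frame f5 (by decide) (by decide) rfl
        have hT5 : s5.arr .T = s4.arr .T := f5.arr _ (by decide)
        have hm : Merge (s1.arr .V) d p c r s5 := by
          refine ⟨?_, h5, hn5.var_p, hn5.var_q, fun p' _ => by rw [hn5.arr_V]⟩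
          constructor
          · rw [hT5]; exact h4.val
          · rw [h7]; exact h4.cnt
          · rw [h7, h6]; exact h4.mem
          · rw [h7, h6]; exact h4.cover
          · rw [h7]; exact h4.cnt_le
        refine (mergeTable_spec ctx hs g1 hm hn5.pre).mono le_rfl fun s6 ⟨k1, k2⟩ => ?_
        rw [St.setVar_arr]
        rw [hn5.arr_V] at k1
        refine ⟨fun p' hp' => ?_, fun p' hp' i j => ?_⟩
        · rcases hp'.eq_or_lt with rfl | hlt'
          · refine ⟨fun a' c' r' hs' i j hij hj => ?_, fun hs' => by rw [hs] at hs'; cases hs'⟩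
            rw [hs] at hs'
            cases hs'
            rw [k2 i j hij hj, mergeVal]
            unfold Data.treeVal Data.nodeVal
            rw [k1 (p + 1) (by omega), k1 (p + 2 * c.size + 2) (by omega)]
          · exact (g1.congr fun p'' hp'' => k1 p'' (by omega)) p' hlt'
        · rw [k1 p' (by omega)]
          exact g2 p' (by omega) i j
    -- No node is entered at `p`, and the row keeps its initial value zero, as the recursion
    -- demands.
    · simp only [eval_var, eval_inp, h2] at hlt
      refine (Spec.skip ?_).mono (Nat.zero_le _) fun _ h => h
      rw [St.setVar_arr, f2.arr _ (by decide)]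
      refine ⟨fun p' hp' => ?_, fun p' hp' => g2 p' (by omega)⟩
      rcases hp'.eq_or_lt with rfl | hlt'
      · refine ⟨fun a' c' r' hs' => ?_, fun _ => g2 p (by omega)⟩
        have := ctx.open_ p a' c' r' hs'
        omega
      · exact g1 p' hlt'
    · generalize d.M1 = m
      generalize d.T.mergeAt p = w
      nlinarith [Nat.zero_le (m * m * w), Nat.zero_le (m * w), Nat.zero_le (m * m)]
  · have h1 : ∀ t ∈ Finset.range (2 * d.T.size),
        29000 * ((d.M1 + 1) * (d.M1 + 1) * (d.T.mergeAt (2 * d.T.size - 1 - t) + 1)) + 4 ≤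
        30000 * ((d.M1 + 1) * (d.M1 + 1) * (d.T.mergeAt (2 * d.T.size - 1 - t) + 1)) := by
      intro t _
      generalize d.T.mergeAt (2 * d.T.size - 1 - t) = w
      generalize d.M1 = m
      nlinarith [Nat.zero_le (m * m * w), Nat.zero_le (m * w), Nat.zero_le (m * m)]
    refine Nat.add_le_add_right ((Finset.sum_le_sum h1).trans ?_) _
    -- The loop counter runs against the positions, so the sum is reversed before it is recognised
    -- as the total merge work.
    rw [← Finset.mul_sum, ← Finset.mul_sum, Finset.sum_range_reflect (fun p => d.T.mergeAt p + 1),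
      Finset.sum_add_distrib, sum_mergeAt]
    simp
  · intro s' h'
    rw [Nat.sub_self] at h'
    exact h'.1

/-- The recursion for a least end. -/
def endVal (d : Data α) (H : ℕ) (V L : ℕ → ℕ → ℕ → ℕ) (l i s : ℕ) : ℕ :=
  if s = 0 then i else
    min (if i = 2 * d.T.size then 2 * d.T.size + 1 else L l (i + 1) s)
    (if l = H ∨ l = d.M1 + 1 then 2 * d.T.size + 1 else min (L (l + 1) i s)
      (match d.T.suffix i with
        | .nil => 2 * d.T.size + 1
        | .cons _ c _ => d.matchEnd V L (if l ≤ H then l else l - 1) l i s c))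

/-- The recursion for `(l, i)` reads entries with at least these indices and with one of them
larger. Writes with a smaller index, or to the pair `(l, i)` itself, are therefore invisible to it.
-/
theorem endVal_update (V L : ℕ → ℕ → ℕ → ℕ) {l i s l' i' s' v : ℕ}
    (h : l' < l ∨ i' < i ∨ l = l' ∧ i = i') :
    endVal d H V (update3 L l' i' s' v) l i s = endVal d H V L l i s := by
  have key : ∀ l1 i1 s1, l ≤ l1 → i ≤ i1 → (l = l1 → i < i1) →
      update3 L l' i' s' v l1 i1 s1 = L l1 i1 s1 ∨ (i = i1 ∧ l' = l1) := by
    intro l1 i1 s1 h1 h2 h3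
    unfold update3
    rw [if_neg]
    · exact .inl rfl
    · omega
  have k1 : ∀ l1 i1 s1, l ≤ l1 → i < i1 → update3 L l' i' s' v l1 i1 s1 = L l1 i1 s1 := by
    intro l1 i1 s1 h1 h2
    unfold update3
    rw [if_neg]
    omega
  have k2 : update3 L l' i' s' v (l + 1) i s = L (l + 1) i s := by
    unfold update3
    rw [if_neg]
    omega
  unfold endVal Data.matchEnd
  rw [k1 l (i + 1) s le_rfl (by omega), k2]
  cases d.T.suffix i with
  | nil => rfl
  | cons a c r => simp only [k1 _ (i + 2 * c.size + 2) _ (Nat.le_add_right _ _) (by omega)]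

/-- An entry of the table of the least ends is correct. -/
def EndOk (d : Data α) (H : ℕ) (V L : ℕ → ℕ → ℕ → ℕ) (l i s : ℕ) : Prop :=
  L l i s = endVal d H V L l i s ∧ L l i s ≤ 2 * d.T.size + 1

theorem EndOk.update {V L : ℕ → ℕ → ℕ → ℕ} {l i s l' i' s' v : ℕ} (h : EndOk d H V L l i s)
    (h' : l' < l ∨ i' < i ∨ l = l' ∧ i = i' ∧ s ≠ s') :
    EndOk d H V (update3 L l' i' s' v) l i s := by
  have h1 : update3 L l' i' s' v l i s = L l i s := by
    unfold update3
    rw [if_neg]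
    omega
  unfold EndOk
  rw [h1, endVal_update V L (by omega)]
  exact h

theorem EndOk.new {V L : ℕ → ℕ → ℕ → ℕ} {l i s v : ℕ} (h : v = endVal d H V L l i s)
    (hv : v ≤ 2 * d.T.size + 1) : EndOk d H V (update3 L l i s v) l i s := by
  have h1 : update3 L l i s v l i s = v := by simp [update3]
  unfold EndOk
  rw [h1, endVal_update V L (by omega)]
  exact ⟨h, hv⟩

theorem endEntry_spec (ctx : Ctx E D d H) {V L : ℕ → ℕ → ℕ → ℕ} (hV : d.Rec V 0) {s : St D}
    (h : Pre E d H s) (hAV : s.arr .V = V) (hAL : s.arr .LA = L) {l i t : ℕ}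
    (hl : s.var .ix = l) (hi : s.var .i = i) (ht : s.var .d = t)
    (hpp : s.var .pp = if l ≤ H then l else l - 1) (hl' : l ≤ d.M1 + 1) (hi' : i ≤ 2 * d.T.size)
    (ht' : t ≤ d.M1) (hL : i < 2 * d.T.size → L l (i + 1) t ≤ 2 * d.T.size + 1) :
    Spec E Prog.endEntry s 1000 (fun s' => ∃ v, s'.arr .LA = update3 L l i t v ∧
      v = endVal d H V L l i t ∧ v ≤ 2 * d.T.size + 1) := by
  have c2 := ctx.N
  have c3 := ctx.NW
  have c4 := ctx.H_le
  refine (Spec.of_sat (by simp [Prog.endEntry, flat, block, Prog.matchEnd]) ?_).mono (by decide)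
    fun _ h => h
  refine Sat.ite (safe_lit ..) (safe_var ..) (fun hpos => ?_) (fun hpos => ?_)
  · rw [eval_lit, eval_var, ht] at hpos
    set u := if i = 2 * d.T.size then 2 * d.T.size + 1 else L l (i + 1) t with hu
    have huB : u ≤ 2 * d.T.size + 1 := by
      rw [hu]; split
      · exact le_rfl
      · exact hL (by omega)
    refine Sat.bind (Q := fun s1 => s1.var .best = u) (Sat.of_wp ?_) fun s1 f1 h1 => ?_
    · simp only [wp, safe_var, safe_get, safe_add, safe_lit, eval_get, eval_var, eval_add, eval_lit,
        hi, hl, ht, hAL, h.n2, h.dim, St.setVar_var, if_true, true_and, and_true]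
      refine ⟨fun h2 => ?_, fun h2 => ?_⟩
      · rw [if_neg (by omega)] at hu
        rw [← hu]
        exact ⟨by omega, by omega, rfl⟩
      · rw [if_pos (by omega)] at hu
        omega
    have hp1 := h.of_frame f1 (by decide) (by decide) rfl
    have v1 : s1.var .ix = l := by rw [f1.var _ (by decide), hl]
    have v2 : s1.var .i = i := by rw [f1.var _ (by decide), hi]
    have v3 : s1.var .d = t := by rw [f1.var _ (by decide), ht]
    have v4 : s1.var .pp = if l ≤ H then l else l - 1 := by rw [f1.var _ (by decide), hpp]
    have v5 : s1.arr .V = V := by rw [f1.arr _ (by decide), hAV]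
    have v6 : s1.arr .LA = L := by rw [f1.arr _ (by decide), hAL]
    refine Sat.bind (Q := fun s2 => s2.var .best = endVal d H V L l i t) (Sat.of_wp ?_)
      fun s2 f2 h2 => Sat.of_wp ?_
    · simp only [wp, safe_var, safe_get, safe_add, safe_sub, safe_lit, safe_mn, eval_get, eval_var,
        eval_add, eval_sub, eval_lit, eval_mn, v1, v2, v3, v6, hp1.H, hp1.M, h1, true_and]
      have hend : endVal d H V L l i t = min u
          (if l = H ∨ l = d.M1 + 1 then 2 * d.T.size + 1 else min (L (l + 1) i t)
            (match d.T.suffix i with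
            | .nil => 2 * d.T.size + 1
            | .cons _ c _ => d.matchEnd V L (if l ≤ H then l else l - 1) l i t c)) := by
        rw [endVal, if_neg (by omega)]
      -- The sum of the two truncated differences is positive exactly if `l ≠ H`; the second test
      -- excludes the end of the right zone.
      refine ⟨fun h2 => ⟨fun h3 => ⟨by omega, by omega, ?_⟩, fun h3 => ?_⟩, fun h2 => ?_⟩
      · rw [if_neg (by omega)] at hend
        set k := if l ≤ H then l else l - 1 with hk
        have hkM : k < d.M1 := by rw [hk]; split <;> omega
        have hkl : k ≤ l ∧ l ≤ k + 1 := by rw [hk]; split <;> omega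
        have hC := ctx.C k
        have hC' := ctx.C_le k hkM
        simp only [Prog.matchEnd, block, wp, safe_var, safe_inp, safe_lit, safe_get, get1, safe_add,
          safe_etaOf, safe_mn, safe_sub, eval_mn, eval_sub, eval_var, eval_inp, eval_lit, eval_get,
          eval_add, eval_etaOf, St.setVar_var, St.setVar_arr, if_true, reduceCtorEq, if_false, v1,
          v2, v3, v4, v5, v6, hp1.C, hp1.S, ← hp1.et, true_and]
        refine ⟨fun h4 => ⟨by omega, fun h5 => ⟨by omega, fun h6 => ?_, fun h6 => ?_⟩,
          fun h5 => ?_⟩, fun h4 => ?_⟩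
        · cases hs : d.T.suffix i with
          | nil => have := ctx.close i hs; omega
          | cons a c r =>
            have hb := suffix_bound hs
            have hin := ctx.open_ i a c r hs
            have het := ctx.et k i
            have hVle := hV.le ctx.et ctx.sv (i + 1) (Nat.zero_le _) (k + 1) (d.C k) (by omega) hC'
            rw [suffix_kids hs] at hVle
            rw [hs] at hend
            simp only [Data.matchEnd] at hend
            rw [if_pos (by omega)] at hend
            rw [hin]
            have hend' : endVal d H V L l i t ≤ u := by rw [hend]; exact min_le_left _ _
            refine ⟨by simp only [and_true]; omega, by omega, fun h7 => ?_, fun h7 => ?_⟩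
            · rw [if_neg (by omega), ← min_assoc] at hend
              rw [show i + 2 * c.size + 1 + 1 = i + 2 * c.size + 2 from rfl, ← hend]
              exact ⟨by simp only [and_true]; omega, by omega, rfl⟩
            · rw [if_pos (by omega), ← min_assoc] at hend
              rw [show i + 2 * c.size + 1 + 1 = i + 2 * c.size + 2 from rfl, ← hend]
              exact ⟨by omega, rfl⟩
        · have : (match d.T.suffix i with
            | .nil => 2 * d.T.size + 1
            | .cons _ c _ => d.matchEnd V L k l i t c) = 2 * d.T.size + 1 := by
            cases d.T.suffix i with
            | nil => rfl
            | cons a c r => exact if_neg (by omega)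
          rw [hend, this]; omega
        · have : (match d.T.suffix i with
            | .nil => 2 * d.T.size + 1
            | .cons _ c _ => d.matchEnd V L k l i t c) = 2 * d.T.size + 1 := by
            cases d.T.suffix i with
            | nil => rfl
            | cons a c r => exact if_neg (by omega)
          rw [hend, this]; omega
        · cases hs : d.T.suffix i with
          | nil => rw [hend, hs]; simp only; omega
          | cons a c r => have := ctx.open_ i a c r hs; omega
      · rw [if_pos (by omega)] at hend
        rw [hend]; omega
      · rw [if_pos (by omega)] at hend
        rw [hend]; omega
    · have hle : endVal d H V L l i t ≤ 2 * d.T.size + 1 := by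
        rw [endVal, if_neg (by omega)]
        exact (min_le_left _ _).trans huB
      have w1 : s2.var .ix = l := by rw [f2.var _ (by decide), v1]
      have w2 : s2.var .i = i := by rw [f2.var _ (by decide), v2]
      have w3 : s2.var .d = t := by rw [f2.var _ (by decide), v3]
      have w6 : s2.arr .LA = L := by rw [f2.arr _ (by decide), v6]
      simp only [wp, safe_var, eval_var, w1, w2, w3, h2, true_and, St.setArr_arr, if_true, w6]
      exact ⟨by omega, by omega, by omega, by omega, _, rfl, rfl, hle⟩
  · rw [eval_lit, eval_var, ht] at hpos
    obtain rfl : t = 0 := by omega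
    apply Sat.of_wp
    simp only [wp, safe_var, safe_lit, eval_var, eval_lit, hi, hl, true_and, St.setArr_arr, if_true,
      hAL]
    exact ⟨by omega, by omega, by omega, by omega, i, rfl, by rw [endVal, if_pos rfl], by omega⟩

/-- Both `l` and `i` decrease, so everything an entry depends on has been computed. The order of the
weights is immaterial, because no entry depends on another one with the same `l` and `i`. -/
theorem ends_spec (ctx : Ctx E D d H) {V : ℕ → ℕ → ℕ → ℕ} (hV : d.Rec V 0) {s : St D}
    (h : Pre E d H s) (hAV : s.arr .V = V) :
    Spec E Prog.ends s (9000 * ((d.M1 + 1) * (d.M1 + 1) * (2 * d.T.size + 1))) (fun s' =>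
      d.EndRec H V (s'.arr .LA) ∧ ∀ l ≤ d.M1 + 1, ∀ i ≤ 2 * d.T.size, ∀ t ≤ d.M1,
        s'.arr .LA l i t ≤ 2 * d.T.size + 1) := by
  have c2 := ctx.N
  have c3 := ctx.NW
  have c4 := ctx.H_le
  refine (Spec.loop_frame h.sd (fun t1 s1 => ∀ l ≤ d.M1 + 1, d.M1 + 1 < l + t1 →
      ∀ i ≤ 2 * d.T.size, ∀ t ≤ d.M1, EndOk d H V (s1.arr .LA) l i t)
    (1000 + ((2 * d.T.size + 1) * (1000 + ((d.M1 + 1) * (1000 + 4) + 3) + 4) + 3)) ?_ ?_).mono ?_ ?_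
  · intro l h1 h2
    omega
  · intro t1 s1 ht1 hu1 f1 I1
    have hp1 := h.of_frame f1 (by decide) (by decide) rfl
    have hV1 : s1.arr .V = V := by rw [f1.arr _ (by decide), hAV]
    refine Spec.bind (Q := fun s2 => s2.var .ix = d.M1 + 1 - t1 ∧
      s2.var .pp = if d.M1 + 1 - t1 ≤ H then d.M1 + 1 - t1 else d.M1 + 1 - t1 - 1)
      ((Spec.of_wp ?_).mono (by decide) fun _ h => h) fun s2 f2 ⟨h2, h2'⟩ => ?_
    · simp only [block, wp, safe_sub, safe_var, safe_lit, eval_sub, eval_var, eval_lit, hu1, hp1.M,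
        hp1.H, St.setVar_var, reduceCtorEq, if_true, if_false, true_and, and_true]
      refine ⟨by omega, fun h1 => ⟨by omega, ?_⟩, fun h1 => ⟨by omega, ?_⟩⟩
      · rw [if_neg (by omega)]
      · rw [if_pos (by omega)]
    set l := d.M1 + 1 - t1 with hl
    have hp2 := hp1.of_frame f2 (by decide) (by decide) rfl
    have hV2 : s2.arr .V = V := by rw [f2.arr _ (by decide), hV1]
    refine (Spec.loop_frame hp2.dim (fun t2 s3 =>
      (∀ l' ≤ d.M1 + 1, l < l' → ∀ i ≤ 2 * d.T.size, ∀ t ≤ d.M1,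
        EndOk d H V (s3.arr .LA) l' i t) ∧
      (∀ i ≤ 2 * d.T.size, 2 * d.T.size < i + t2 → ∀ t ≤ d.M1, EndOk d H V (s3.arr .LA) l i t))
      (1000 + ((d.M1 + 1) * (1000 + 4) + 3)) ?_ ?_).mono le_rfl ?_
    · rw [St.setVar_arr, f2.arr _ (by decide)]
      exact ⟨fun l' h1 h3 => I1 l' h1 (by omega), fun i h1 h3 => absurd h3 (by omega)⟩
    · intro t2 s3 ht2 hu3 f3 ⟨I2, I3⟩
      have hp3 := hp2.of_frame f3 (by decide) (by decide) rfl
      have hV3 : s3.arr .V = V := by rw [f3.arr _ (by decide), hV2]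
      refine Spec.bind (Q := fun s4 => s4.var .i = 2 * d.T.size - t2)
        ((Spec.of_wp ?_).mono (by decide) fun _ h => h) fun s4 f4 h4 => ?_
      · simp only [wp, safe_sub, safe_var, eval_sub, eval_var, hu3, hp3.n2,
          St.setVar_var, if_true, true_and, and_true]
        omega
      set i := 2 * d.T.size - t2 with hi
      have hp4 := hp3.of_frame f4 (by decide) (by decide) rfl
      have hV4 : s4.arr .V = V := by rw [f4.arr _ (by decide), hV3]
      refine (Spec.loop_frame hp4.M (fun t3 s5 =>
        (∀ l' ≤ d.M1 + 1, l < l' → ∀ i ≤ 2 * d.T.size, ∀ t ≤ d.M1,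
          EndOk d H V (s5.arr .LA) l' i t) ∧
        (∀ i' ≤ 2 * d.T.size, i < i' → ∀ t ≤ d.M1, EndOk d H V (s5.arr .LA) l i' t) ∧
        ∀ t < t3, EndOk d H V (s5.arr .LA) l i t) 1000 ?_ ?_).mono le_rfl ?_
      · rw [St.setVar_arr, f4.arr _ (by decide)]
        exact ⟨I2, fun i' h1 h3 => I3 i' h1 (by omega), fun t h1 => absurd h1 (by omega)⟩
      · intro t3 s5 ht3 hu5 f5 ⟨J1, J2, J3⟩
        have hp5 := hp4.of_frame f5 (by decide) (by decide) rfl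
        refine (endEntry_spec ctx hV hp5 (by rw [f5.arr _ (by decide), hV4]) rfl (l := l) (i := i)
          (t := t3) ?_ ?_ hu5 ?_ (by omega) (by omega) (by omega) ?_).mono le_rfl
          fun s6 ⟨v, e1, e2, e3⟩ => ?_
        · rw [f5.var _ (by decide), f4.var _ (by decide), f3.var _ (by decide), h2]
        · rw [f5.var _ (by decide), h4]
        · rw [f5.var _ (by decide), f4.var _ (by decide), f3.var _ (by decide), h2']
        · intro hlt
          exact (J2 (i + 1) (by omega) (by omega) t3 (by omega)).2
        · rw [St.setVar_arr, e1]
          refine ⟨fun l' h1 h3 i' h5 t h6 => (J1 l' h1 h3 i' h5 t h6).update (.inl h3),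
            fun i' h1 h3 t h5 => (J2 i' h1 h3 t h5).update (.inr (.inl h3)), fun t h1 => ?_⟩
          rcases (show t ≤ t3 by omega).eq_or_lt with rfl | h3
          · exact EndOk.new e2 e3
          · exact (J3 t h3).update (.inr (.inr ⟨rfl, rfl, by omega⟩))
      · intro s5 ⟨J1, J2, J3⟩
        rw [St.setVar_arr]
        refine ⟨J1, fun i' h1 h3 t h5 => ?_⟩
        rcases (show i ≤ i' by omega).eq_or_lt with rfl | h6
        · exact J3 t (by omega)
        · exact J2 i' h1 h6 t h5
    · intro s3 ⟨I2, I3⟩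
      rw [St.setVar_arr]
      intro l' h1 h3 i h5 t h6
      rcases (show l ≤ l' by omega).eq_or_lt with h7 | h7
      · rw [← h7]; exact I3 i h5 (by omega) t h6
      · exact I2 l' h1 h7 i h5 t h6
  · generalize d.M1 = m
    generalize d.T.size = n
    nlinarith [Nat.zero_le (m * m * n), Nat.zero_le (m * n), Nat.zero_le (m * m)]
  · intro s' h'
    refine ⟨fun l hl i hi t ht => ?_, fun l hl i hi t ht => (h' l hl (by omega) i hi t ht).2⟩
    have h1 := (h' l hl (by omega) i hi t ht).1
    unfold endVal at h1
    refine ⟨fun h0 => by rwa [if_pos h0] at h1, fun h0 => by rwa [if_neg h0] at h1⟩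

end TED.Loop

/-! ### The greatest starts for the right zone -/

namespace TED.Loop

open Forest TED.Loop.Expr TED.Loop.Cmd

variable {D : ℕ} {α : Type} {E : Env} {d : Data α} {H : ℕ}

/-- The number `r` is one plus the greatest `i < t` such that `f i` is related to `j`, or `0`. -/
def IsLast (P : ℕ → Prop) (t r : ℕ) : Prop :=
  (∀ i < t, P i → i < r) ∧ (r = 0 ∨ ∃ i < t, r = i + 1 ∧ P i)

theorem IsLast.zero (P : ℕ → Prop) : IsLast P 0 0 := ⟨by simp, .inl rfl⟩

theorem IsLast.le {P : ℕ → Prop} {t r : ℕ} (h : IsLast P t r) : r ≤ t := by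
  rcases h.2 with h | ⟨i, hi, h, _⟩ <;> omega

theorem IsLast.push {P : ℕ → Prop} {t : ℕ} (h : P t) : IsLast P (t + 1) (t + 1) :=
  ⟨fun i hi _ => hi, .inr ⟨t, by omega, rfl, h⟩⟩

theorem IsLast.keep {P : ℕ → Prop} {t r : ℕ} (hr : IsLast P t r) (h : ¬ P t) :
    IsLast P (t + 1) r := by
  refine ⟨fun i hi hP => ?_, hr.2.imp_right fun ⟨i, hi, h1⟩ => ⟨i, by omega, h1⟩⟩
  rcases (show i ≤ t by omega).eq_or_lt with rfl | hi
  · exact absurd hP h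
  · exact hr.1 i hi hP

theorem IsLast.max {P P' Q : ℕ → Prop} {t r r' : ℕ} (h : IsLast P t r) (h' : IsLast P' t r')
    (hQ : ∀ i, Q i ↔ P i ∨ P' i) : IsLast Q t (max r r') := by
  refine ⟨fun i hi h1 => ?_, ?_⟩
  · rcases (hQ i).1 h1 with h1 | h1
    · exact (h.1 i hi h1).trans_le (le_max_left _ _)
    · exact (h'.1 i hi h1).trans_le (le_max_right _ _)
  · rcases max_choice r r' with h1 | h1 <;> rw [h1]
    · exact h.2.imp_right fun ⟨i, hi, h2, h3⟩ => ⟨i, hi, h2, (hQ i).2 (.inl h3)⟩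
    · exact h'.2.imp_right fun ⟨i, hi, h2, h3⟩ => ⟨i, hi, h2, (hQ i).2 (.inr h3)⟩

theorem IsLast.congr {P Q : ℕ → Prop} {t r : ℕ} (h : IsLast P t r) (hQ : ∀ i, Q i ↔ P i) :
    IsLast Q t r := by
  rwa [show Q = P from funext fun i => propext (hQ i)]

/-- For a fixed weight, each start `i` is filed under its exact least end, a later start overwriting
an earlier one. Running maxima over the ends then turn equality into `≤`. This inverts the least
ends in linear time per weight; infinite ends are not filed. -/
theorem starts_spec (ctx : Ctx E D d H) {s : St D} (h : Pre E d H s)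
    {L : ℕ → ℕ → ℕ → ℕ} (hAL : s.arr .LA = L)
    (hL : ∀ l ≤ d.M1 + 1, ∀ i ≤ 2 * d.T.size, ∀ t ≤ d.M1, L l i t ≤ 2 * d.T.size + 1)
    (hR0 : ∀ i j k, s.arr .RB i j k = 0) :
    Spec E Prog.starts s (9000 * ((d.M1 + 1) * (2 * d.T.size + 1))) (fun s' =>
      ∀ j ≤ 2 * d.T.size, ∀ t ≤ d.M1,
        IsLast (fun i => L (H + 1) i t ≤ j) (2 * d.T.size + 1) (s'.arr .RB j t 0)) := by
  have c2 := ctx.N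
  have c3 := ctx.NW
  have c4 := ctx.H_le
  refine (Spec.loop_frame h.M (fun t1 s1 => (∀ j ≤ 2 * d.T.size, ∀ t < t1,
      IsLast (fun i => L (H + 1) i t ≤ j) (2 * d.T.size + 1) (s1.arr .RB j t 0)) ∧
      ∀ j t, t1 ≤ t → s1.arr .RB j t 0 = 0)
    ((2 * d.T.size + 1) * (1000 + 4) + 3 + (2 * d.T.size * (1000 + 4) + 3)) ?_ ?_).mono ?_ ?_
  · exact ⟨fun j _ t ht => absurd ht (Nat.not_lt_zero t), fun j t _ => hR0 j t 0⟩
  · intro t s1 ht hu1 f1 ⟨I1, I2⟩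
    have hp1 := h.of_frame f1 (by decide) (by decide) rfl
    have hL1 : s1.arr .LA = L := by rw [f1.arr _ (by decide), hAL]
    refine Spec.bind (Spec.loop_frame hp1.dim (fun t2 s2 =>
      (∀ j t', t' ≠ t → s2.arr .RB j t' 0 = s1.arr .RB j t' 0) ∧
      ∀ j ≤ 2 * d.T.size, IsLast (fun i => L (H + 1) i t = j) t2 (s2.arr .RB j t 0)) 1000 ?_ ?_)
      fun s2 f2 ⟨J1, J2⟩ => ?_
    · rw [St.setVar_arr]
      refine ⟨fun _ _ _ => rfl, fun j _ => ?_⟩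
      rw [I2 j t le_rfl]
      exact IsLast.zero _
    · intro i s2 hi hu2 f2 ⟨J1, J2⟩
      have hp2 := hp1.of_frame f2 (by decide) (by decide) rfl
      have hL2 : s2.arr .LA = L := by rw [f2.arr _ (by decide), hL1]
      have hd2 : s2.var .d = t := by rw [f2.var _ (by decide), hu1]
      have hle := hL (H + 1) (by omega) i (by omega) t (by omega)
      refine (Spec.of_wp ?_).mono (by decide) fun _ h => h
      simp only [Prog.startEntry, block, wp, safe_var, safe_get, safe_add, safe_lit, eval_get,
        eval_var, eval_add, eval_lit, hp2.H, hp2.dim, hL2, hu2, hd2, St.setVar_var, St.setVar_arr,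
        St.setArr_arr, reduceCtorEq, if_true, if_false, true_and]
      refine ⟨by omega, by omega, fun h1 => ⟨by omega, by omega, by omega, by omega, ?_, ?_⟩,
        fun h1 => ⟨J1, ?_⟩⟩
      · intro j t' ht'
        rw [update3, if_neg (by tauto), J1 j t' ht']
      · intro j hj
        by_cases hj' : L (H + 1) i t = j
        · subst hj'
          simp only [update3, and_self, if_true]
          exact IsLast.push rfl
        · rw [update3, if_neg (by tauto)]
          exact (J2 j hj).keep hj'
      · intro j hj
        exact (J2 j hj).keep (by omega)
    · have hp2 := hp1.of_frame f2 (by decide) (by decide) rfl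
      have hd2 : s2.var .d = t := by rw [f2.var _ (by decide), hu1]
      refine (Spec.loop_frame hp2.n2 (fun t3 s3 =>
        (∀ j t', t' ≠ t → s3.arr .RB j t' 0 = s1.arr .RB j t' 0) ∧
        (∀ j ≤ 2 * d.T.size, t3 < j →
          IsLast (fun i => L (H + 1) i t = j) (2 * d.T.size + 1) (s3.arr .RB j t 0)) ∧
        (∀ j ≤ 2 * d.T.size, j ≤ t3 →
          IsLast (fun i => L (H + 1) i t ≤ j) (2 * d.T.size + 1) (s3.arr .RB j t 0))) 1000 ?_
            ?_).mono le_rfl ?_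
      · rw [St.setVar_arr]
        refine ⟨J1, fun j hj _ => J2 j hj, fun j hj h0 => (J2 j hj).congr fun i => by omega⟩
      · intro t3 s3 ht3 hu3 f3 ⟨K1, K2, K3⟩
        have hd3 : s3.var .d = t := by rw [f3.var _ (by decide), hd2]
        have k2 := K2 (t3 + 1) (by omega) (by omega)
        have k3 := K3 t3 (by omega) le_rfl
        have k2' := k2.le
        have k3' := k3.le
        refine (Spec.of_wp ?_).mono (by decide) fun _ h => h
        simp only [Prog.startMax, wp, safe_var, safe_get, safe_add, safe_lit, eval_get, safe_mx,
          eval_mx, eval_var, eval_add, eval_lit, hu3, hd3, St.setVar_arr, St.setArr_arr, if_true,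
          true_and]
        refine ⟨by omega, by omega, by omega, by omega, by omega, ?_, ?_, ?_⟩
        · intro j t' ht'
          rw [update3, if_neg (by tauto), K1 j t' ht']
        · intro j hj hj'
          rw [update3, if_neg (by omega)]
          exact K2 j hj (by omega)
        · intro j hj hj'
          rcases hj'.eq_or_lt with rfl | hj'
          · simp only [update3, and_self, if_true]
            exact k2.max k3 fun i => by omega
          · rw [update3, if_neg (by omega)]
            exact K3 j hj (by omega)
      · intro s3 ⟨K1, K2, K3⟩
        rw [St.setVar_arr]
        refine ⟨fun j hj t' ht' => ?_, fun j t' ht' => ?_⟩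
        · rcases (show t' ≤ t by omega).eq_or_lt with rfl | hlt
          · exact K3 j hj hj
          · rw [K1 j t' (by omega)]
            exact I1 j hj t' hlt
        · rw [K1 j t' (by omega)]
          exact I2 j t' (by omega)
  · generalize d.M1 = m
    generalize d.T.size = n
    nlinarith [Nat.zero_le (m * n)]
  · exact fun s' h' j hj t ht => h'.1 j hj t (by omega)

end TED.Loop

/-! ### The entries of the answer -/

namespace TED.Loop

open Forest TED.Loop.Expr TED.Loop.Cmd

variable {D : ℕ} {α : Type} {E : Env} {d : Data α} {H : ℕ}

/-- The number `best` is the maximum of `base` and of the values `f i j` with `P i j` for the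
pairs with `S i j`. -/
structure IsBest (M : ℕ) (P S : ℕ → ℕ → Prop) (f : ℕ → ℕ → ℕ) (base best : ℕ) : Prop where
  base_le : base ≤ best
  le : ∀ i ≤ M, ∀ j ≤ M, S i j → P i j → f i j ≤ best
  eq : best = base ∨ ∃ i ≤ M, ∃ j ≤ M, P i j ∧ best = f i j

theorem IsBest.congr {M : ℕ} {P S S' : ℕ → ℕ → Prop} {f : ℕ → ℕ → ℕ} {base best : ℕ}
    (h : IsBest M P S f base best) (hS : ∀ i ≤ M, ∀ j ≤ M, S' i j → S i j) :
    IsBest M P S' f base best :=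
  ⟨h.base_le, fun i hi j hj h1 h2 => h.le i hi j hj (hS i hi j hj h1) h2, h.eq⟩

theorem IsBest.keep {M : ℕ} {P S S' : ℕ → ℕ → Prop} {f : ℕ → ℕ → ℕ} {base best i j : ℕ}
    (h : IsBest M P S f base best) (hP : ¬ P i j)
    (hS : ∀ i' j', S' i' j' → S i' j' ∨ i' = i ∧ j' = j) : IsBest M P S' f base best :=
  ⟨h.base_le, fun i' hi j' hj h1 h2 => by
    rcases hS i' j' h1 with h3 | ⟨rfl, rfl⟩
    · exact h.le i' hi j' hj h3 h2
    · exact absurd h2 hP, h.eq⟩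

theorem IsBest.max {M : ℕ} {P S S' : ℕ → ℕ → Prop} {f : ℕ → ℕ → ℕ} {base best i j : ℕ}
    (h : IsBest M P S f base best) (hP : P i j) (hi : i ≤ M) (hj : j ≤ M)
    (hS : ∀ i' j', S' i' j' → S i' j' ∨ i' = i ∧ j' = j) :
    IsBest M P S' f base (max best (f i j)) where
  base_le := h.base_le.trans (le_max_left _ _)
  le i' hi j' hj h1 h2 := by
    rcases hS i' j' h1 with h3 | ⟨rfl, rfl⟩
    · exact (h.le i' hi j' hj h3 h2).trans (le_max_left _ _)
    · exact le_max_right _ _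
  eq := by
    rcases max_choice best (f i j) with h1 | h1 <;> rw [h1]
    · exact h.eq
    · exact .inr ⟨i, hi, j, hj, hP, rfl⟩

/-- What the last phase reads. -/
structure Final (d : Data α) (V L R : ℕ → ℕ → ℕ → ℕ) (A : Mat D) (lo x : ℕ) (s : St D) :
    Prop where
  V : s.arr .V = V
  L : s.arr .LA = L
  R : s.arr .RB = R
  lo : s.var .lo = lo
  x : s.var .x = x
  mat : s.mat 0 = A

theorem Final.of_frame {V L R : ℕ → ℕ → ℕ → ℕ} {A : Mat D} {lo x : ℕ} {c : Cmd} {s s' : St D}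
    (h : Final d V L R A lo x s) (hf : Frame c s s') (h1 : ∀ y ∈ [Var.lo, .x], y ∉ c.mods)
    (h2 : ∀ q ∈ [Arr.V, .LA, .RB], q ∉ c.amods) (h3 : s'.mat 0 = s.mat 0) :
    Final d V L R A lo x s' where
  V := by rw [hf.arr _ (h2 _ (by simp)), h.V]
  L := by rw [hf.arr _ (h2 _ (by simp)), h.L]
  R := by rw [hf.arr _ (h2 _ (by simp)), h.R]
  lo := by rw [hf.var _ (h1 _ (by simp)), h.lo]
  x := by rw [hf.var _ (h1 _ (by simp)), h.x]
  mat := h3.trans h.mat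

/-- The value of a pair of numbers of nodes to the left and to the right of the block. -/
def pairVal (L R : ℕ → ℕ → ℕ → ℕ) (A : Mat D) (i j s t : ℕ) : ℕ :=
  s + t + (entry A (L 0 i s) (R j t 0 - 1) - 1)

/-- The maximum starts with the table value, which covers alignments with a matched ancestor of the
block, and then runs over all pairs of weights for the two sides. The final `+ 1` is the shift in
the encoding of matrix entries. -/
theorem answerNode_spec (ctx : Ctx E D d H) {V L R : ℕ → ℕ → ℕ → ℕ} {A : Mat D} {lo x : ℕ}
    (hV : d.Rec V 0)
    (hL : ∀ l ≤ d.M1 + 1, ∀ i ≤ 2 * d.T.size, ∀ t ≤ d.M1, L l i t ≤ 2 * d.T.size + 1)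
    (hR : ∀ j ≤ 2 * d.T.size, ∀ t ≤ d.M1, R j t 0 ≤ 2 * d.T.size + 1)
    (hA : ∀ i j, entry A i j ≤ 2 * d.T.size + 1) {s : St D} (hM : s.var .M = d.M1 + 1)
    (hM1 : s.var .M1 = d.M1) (hF : Final d V L R A lo x s) {p : ℕ} {a : α} {c r : Forest α}
    (hs : d.T.suffix p = cons a c r) (ht : s.var .t = p) (hc : s.var .c = p + 2 * c.size + 1) :
    Spec E Prog.answerNode s (5000 * ((d.M1 + 1) * (d.M1 + 1))) (fun s' => ∃ best,
      IsBest d.M1 (fun i j => L 0 (p + 1) i < R (p + 1 + 2 * c.size) j 0) (fun _ _ => True)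
        (pairVal L R A (p + 1) (p + 1 + 2 * c.size)) (V (p + 1) 0 d.M1) best ∧
      s'.mat = Function.update s.mat x (rangeMaxN (s.mat x) p (p + 2 * c.size + 2)
        (best + (if E.inp 3 (lo - 1) = E.inp 5 p then 2 else 1) + 1))) := by
  have c1 := ctx.dim
  have c2 := ctx.N
  have c3 := ctx.NW
  have hb := suffix_bound hs
  have hVle := hV.le ctx.et ctx.sv (p + 1) (Nat.zero_le _) 0 d.M1 (by omega) le_rfl
  rw [suffix_kids hs] at hVle
  have hval : ∀ i ≤ d.M1, ∀ j ≤ d.M1,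
      pairVal L R A (p + 1) (p + 1 + 2 * c.size) i j ≤ 2 * d.M1 + 2 * d.T.size := by
    intro i hi j hj
    have := hA (L 0 (p + 1) i) (R (p + 1 + 2 * c.size) j 0 - 1)
    unfold pairVal
    omega
  have hbest : ∀ {S best}, IsBest d.M1 (fun i j => L 0 (p + 1) i < R (p + 1 + 2 * c.size) j 0) S
      (pairVal L R A (p + 1) (p + 1 + 2 * c.size)) (V (p + 1) 0 d.M1) best →
      best ≤ 2 * d.M1 + 2 * d.T.size := by
    intro S best h
    rcases h.eq with h | ⟨i, hi, j, hj, -, h⟩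
    · omega
    · rw [h]; exact hval i hi j hj
  refine (Spec.bind (Q := fun s1 => s1.var .best = V (p + 1) 0 d.M1)
    ((Spec.of_wp ?_).mono (T' := 1000) (by decide) fun _ h => h) fun s1 f1 h1 =>
    Spec.bind (T := (d.M1 + 1) * ((d.M1 + 1) * (1000 + 4) + 3 + 4) + 3)
    (T' := 1000) (Q := fun s2 => IsBest d.M1
      (fun i j => L 0 (p + 1) i < R (p + 1 + 2 * c.size) j 0) (fun i _ => i < d.M1 + 1)
      (pairVal L R A (p + 1) (p + 1 + 2 * c.size)) (V (p + 1) 0 d.M1) (s2.var .best)) ?_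
      fun s2 f2 h2 => ?_).mono ?_ fun _ h => h
  · simp only [wp, safe_var, safe_get, safe_add, safe_lit, eval_get, eval_var, eval_add, eval_lit,
      hF.V, ht, hM1, St.setVar_var, if_true, true_and, and_true]
    omega
  · have hF1 := hF.of_frame f1 (by decide) (by decide) (by rw [f1.mat rfl])
    have hM1 : s1.var .M = d.M1 + 1 := by rw [f1.var _ (by decide), hM]
    have ht1 : s1.var .t = p := by rw [f1.var _ (by decide), ht]
    have hc1 : s1.var .c = p + 2 * c.size + 1 := by rw [f1.var _ (by decide), hc]
    refine Spec.loop_frame hM1 (fun t1 s2 => IsBest d.M1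
      (fun i j => L 0 (p + 1) i < R (p + 1 + 2 * c.size) j 0) (fun i _ => i < t1)
      (pairVal L R A (p + 1) (p + 1 + 2 * c.size)) (V (p + 1) 0 d.M1) (s2.var .best)) _ ?_ ?_
    · rw [St.setVar_var, if_neg (by decide), h1]
      exact ⟨le_rfl, fun i _ j _ h => absurd h (Nat.not_lt_zero i), .inl rfl⟩
    · intro t1 s2 hlt1 hu2 f2 I2
      have hF2 := hF1.of_frame f2 (by decide) (by decide) (by rw [f2.mat rfl])
      have hM2 : s2.var .M = d.M1 + 1 := by rw [f2.var _ (by decide), hM1]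
      have ht2 : s2.var .t = p := by rw [f2.var _ (by decide), ht1]
      have hc2 : s2.var .c = p + 2 * c.size + 1 := by rw [f2.var _ (by decide), hc1]
      refine (Spec.loop_frame hM2 (fun t2 s3 => IsBest d.M1
        (fun i j => L 0 (p + 1) i < R (p + 1 + 2 * c.size) j 0)
        (fun i j => i < t1 ∨ i = t1 ∧ j < t2)
        (pairVal L R A (p + 1) (p + 1 + 2 * c.size)) (V (p + 1) 0 d.M1) (s3.var .best)) 1000
        ?_ ?_).mono le_rfl ?_
      · rw [St.setVar_var, if_neg (by decide)]
        exact I2.congr fun i hi j hj h => by omega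
      · intro t2 s3 hlt2 hu3 f3 I3
        have hF3 := hF2.of_frame f3 (by decide) (by decide) (by rw [f3.mat rfl])
        have ht3 : s3.var .t = p := by rw [f3.var _ (by decide), ht2]
        have hc3 : s3.var .c = p + 1 + 2 * c.size := by rw [f3.var _ (by decide), hc2]; omega
        have ha3 : s3.var .al = t1 := by rw [f3.var _ (by decide), hu2]
        have hb3 := hbest I3
        have hLle := hL 0 (by omega) (p + 1) (by omega) t1 (by omega)
        have hRle := hR (p + 1 + 2 * c.size) (by omega) t2 (by omega)
        have hv := hval t1 (by omega) t2 (by omega)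
        refine (Spec.of_wp ?_).mono (by decide) fun _ h => h
        simp only [Prog.answerStep, block, wp, safe_var, safe_get, safe_add, safe_lit, safe_sub,
          safe_mget, safe_mx, eval_mx, eval_mget, eval_sub, eval_get,
          eval_var, eval_add, eval_lit, hF3.L, hF3.R, hF3.mat, hu3, ht3, hc3, ha3,
          St.setVar_var, St.setVar_arr, St.setVar_mat, reduceCtorEq, if_true, if_false, true_and,
          and_true]
        refine ⟨by omega, by omega, by omega, by omega, fun h1 => ?_, fun h1 => ?_⟩
        · have h4 := I3.max (i := t1) (j := t2) (S' := fun i j => i < t1 ∨ i = t1 ∧ j < t2 + 1)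
            h1 (by omega) (by omega) (fun i' j' h => by omega)
          have h5 := hbest h4
          exact ⟨by omega, by unfold pairVal at h5; omega, h4⟩
        · exact I3.keep h1 fun i' j' h => by omega
      · intro s3 I3
        rw [St.setVar_var, if_neg (by decide)]
        exact I3.congr fun i hi j hj h => by omega
  · have hF2 := (hF.of_frame f1 (by decide) (by decide) (by rw [f1.mat rfl])).of_frame f2
      (by decide) (by decide) (by rw [f2.mat rfl])
    have ht2 : s2.var .t = p := by rw [f2.var _ (by decide), f1.var _ (by decide), ht]
    have hc2 : s2.var .c = p + 2 * c.size + 1 := by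
      rw [f2.var _ (by decide), f1.var _ (by decide), hc]
    have hm2 : s2.mat = s.mat := by rw [f2.mat rfl, f1.mat rfl]
    have hb2 := hbest h2
    refine (Spec.of_wp ?_).mono (by decide) fun _ h => h
    simp only [wp, safe_var, safe_add, safe_lit, safe_sub, safe_inp, safe_etaOf, eval_etaOf,
      eval_inp, eval_sub, eval_var, eval_add, eval_lit, hF2.x, hF2.lo, ht2, hc2, hm2, true_and]
    refine ⟨by omega, by omega, ?_, s2.var .best, h2.congr fun i hi _ _ _ => by omega, ?_⟩
    · split <;> omega
    · simp only [St.setMat, hm2]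
  · generalize d.M1 = m
    nlinarith [Nat.zero_le (m * m)]

/-- A range maximum at the two ends of a node reaches exactly the entries whose slices contain the
node. The target starts as all `-∞`, and `x ≠ 0` keeps the writes away from `S(F')`, which is still
being read. -/
theorem answer_spec (ctx : Ctx E D d H) {V L R : ℕ → ℕ → ℕ → ℕ} {A : Mat D} {lo x : ℕ}
    (hV : d.Rec V 0)
    (hL : ∀ l ≤ d.M1 + 1, ∀ i ≤ 2 * d.T.size, ∀ t ≤ d.M1, L l i t ≤ 2 * d.T.size + 1)
    (hR : ∀ j ≤ 2 * d.T.size, ∀ t ≤ d.M1, R j t 0 ≤ 2 * d.T.size + 1)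
    (hA : ∀ i j, entry A i j ≤ 2 * d.T.size + 1) (G : ℕ → ℕ)
    (hG : ∀ p a c r, d.T.suffix p = cons a c r → ∀ best,
      IsBest d.M1 (fun i j => L 0 (p + 1) i < R (p + 1 + 2 * c.size) j 0) (fun _ _ => True)
        (pairVal L R A (p + 1) (p + 1 + 2 * c.size)) (V (p + 1) 0 d.M1) best →
      best + (if E.inp 3 (lo - 1) = E.inp 5 p then 2 else 1) = G p)
    {s : St D} (hn2 : s.var .n2 = 2 * d.T.size) (hM : s.var .M = d.M1 + 1)
    (hM1 : s.var .M1 = d.M1) (hF : Final d V L R A lo x s) (hx : x ≠ 0)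
    (hX : ∀ i j, s.mat x i j = ⊥) :
    Spec E Prog.answer s (9000 * ((d.M1 + 1) * (d.M1 + 1) * (2 * d.T.size)) + 3) (fun s' =>
      (∀ p a c r, d.T.suffix p = cons a c r → ∀ i j : Fin D, (i : ℕ) ≤ p →
        p + 2 * c.size + 2 ≤ (j : ℕ) → ((G p : ℕ) : WithBot ℕ) ≤ s'.mat x i j) ∧
      ∀ i j, s'.mat x i j = ⊥ ∨ ∃ p a c r, d.T.suffix p = cons a c r ∧ (i : ℕ) ≤ p ∧
        p + 2 * c.size + 2 ≤ (j : ℕ) ∧ s'.mat x i j = (G p : ℕ)) := by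
  have c2 := ctx.N
  have c3 := ctx.NW
  refine (Spec.loop_frame hn2 (fun t s' => s'.mat 0 = s.mat 0 ∧
      (∀ p < t, ∀ a c r, d.T.suffix p = cons a c r → ∀ i j : Fin D, (i : ℕ) ≤ p →
        p + 2 * c.size + 2 ≤ (j : ℕ) → ((G p : ℕ) : WithBot ℕ) ≤ s'.mat x i j) ∧
      ∀ i j, s'.mat x i j = ⊥ ∨ ∃ p a c r, d.T.suffix p = cons a c r ∧ (i : ℕ) ≤ p ∧
        p + 2 * c.size + 2 ≤ (j : ℕ) ∧ s'.mat x i j = (G p : ℕ))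
    (1000 + (1000 + 5000 * ((d.M1 + 1) * (d.M1 + 1)))) ?_ ?_).mono ?_ ?_
  · exact ⟨rfl, fun p hp => absurd hp (Nat.not_lt_zero p), fun i j => .inl (hX i j)⟩
  · intro p s1 hp hu1 f1 ⟨I0, I1, I2⟩
    have hF1 := hF.of_frame f1 (by decide) (by decide) I0
    refine Spec.bind (Q := fun s2 => s2.var .c = E.inp 4 p)
      ((Spec.of_wp ?_).mono (by decide) fun _ h => h) fun s2 f2 h2 => ?_
    · simp only [wp, safe_var, safe_inp, eval_inp, eval_var, hu1, St.setVar_var, if_true, true_and,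
        and_true]
      exact ctx.inp ..
    have hF2 := hF1.of_frame f2 (by decide) (by decide) (by rw [f2.mat rfl])
    have hM2 : s2.var .M = d.M1 + 1 := by rw [f2.var _ (by decide), f1.var _ (by decide), hM]
    have hM12 : s2.var .M1 = d.M1 := by rw [f2.var _ (by decide), f1.var _ (by decide), hM1]
    have ht2 : s2.var .t = p := by rw [f2.var _ (by decide), hu1]
    have hm2 : s2.mat = s1.mat := f2.mat rfl
    refine (Spec.ite (safe_var ..) (safe_var ..) (fun h3 => ?_) (fun h3 => ?_)).mono
      (Nat.add_le_add_right (m := 1000) (by decide) _) fun _ h => h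
    · rw [eval_var, eval_var, ht2, h2] at h3
      cases hs : d.T.suffix p with
      | nil => have := ctx.close p hs; omega
      | cons a c r =>
        have hin := ctx.open_ p a c r hs
        refine (answerNode_spec ctx hV hL hR hA hM2 hM12 hF2 hs ht2 (by rw [h2, hin])).mono le_rfl
          fun s3 ⟨best, h4, h5⟩ => ?_
        have hg := hG p a c r hs best h4
        rw [hg, hm2] at h5
        have h6 : ∀ i j, s3.mat x i j = if (i : ℕ) ≤ p ∧ p + 2 * c.size + 2 ≤ (j : ℕ) then
            max (s1.mat x i j) (G p : ℕ) else s1.mat x i j := by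
          intro i j
          rw [h5, Function.update_self]
          rfl
        simp only [St.setVar_mat]
        refine ⟨by rw [h5, Function.update_of_ne hx.symm, I0], fun p' hp' a' c' r' hs' i j hi hj => ?_,
          fun i j => ?_⟩
        · rw [h6]
          rcases (show p' ≤ p by omega).eq_or_lt with rfl | hlt
          · rw [hs] at hs'
            cases hs'
            rw [if_pos ⟨hi, hj⟩]
            exact le_max_right _ _
          · have h7 := I1 p' hlt a' c' r' hs' i j hi hj
            split
            · exact h7.trans (le_max_left _ _)
            · exact h7
        · rw [h6]
          split
          · next h7 =>
            rcases max_choice (s1.mat x i j) ((G p : ℕ) : WithBot ℕ) with h8 | h8 <;> rw [h8]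
            · exact I2 i j
            · exact .inr ⟨p, a, c, r, hs, h7.1, h7.2, rfl⟩
          · exact I2 i j
    · rw [eval_var, eval_var, ht2, h2] at h3
      refine (Spec.skip ?_).mono (Nat.zero_le _) fun _ h => h
      simp only [St.setVar_mat, hm2]
      refine ⟨I0, fun p' hp' a' c' r' hs' i j hi hj => ?_, I2⟩
      rcases (show p' ≤ p by omega).eq_or_lt with rfl | hlt
      · have := ctx.open_ p' a' c' r' hs'
        omega
      · exact I1 p' hlt a' c' r' hs' i j hi hj
  · generalize d.M1 = m
    generalize d.T.size = n
    nlinarith [Nat.zero_le (m * m * n), Nat.zero_le (m * n)]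
  · intro s' ⟨_, h1, h2⟩
    refine ⟨fun p a c r hs => h1 p ?_ a c r hs, h2⟩
    have := suffix_bound hs
    omega

end TED.Loop

/-! ### Bounds for the input, and the phases that read it -/

namespace TED

open Forest

theorem Forest.partners_getD_le {α : Type} (f : Forest α) (p : ℕ) : (f.partners 0).getD p 0 ≤ 2 * f.size := by
  by_cases hp : p < 2 * f.size
  · cases hs : f.suffix p with
    | nil => exact (partners_close hp hs).le.trans hp.le
    | cons a c r =>
      have := suffix_bound hs
      rw [partners_open hs]
      omega
  · rw [List.getD_eq_default _ _ (by rw [length_partners]; omega)]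
    omega

theorem length_le_size_plug {α : Type} (fs : List (Frame α)) (b : Forest α) :
    fs.length ≤ (plug fs b).size := by
  induction fs with
  | nil => simp
  | cons fr s ih => simp only [plug, size_append, size_cons, List.length_cons]; omega

/-- The bound for the indices of arrays and the bound for values. -/
def loopEnv {σ : ℕ} (I : SyncPair (Fin σ)) (T₂ : OTree (Fin σ)) (x : ℕ) : Loop.Env where
  inp := inputs I T₂ x
  N := 16 * (I.whole.size + T₂.size) + 16
  W := 16 * (I.whole.size + T₂.size + σ + 2)

section

variable {σ : ℕ} {I : SyncPair (Fin σ)} {T₂ : OTree (Fin σ)} {x : ℕ}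

theorem label_lt (f : Forest (Fin σ)) (p : ℕ) : (f.labels.map Fin.val).getD p 0 ≤ σ := by
  rw [List.getD_eq_getElem?_getD, List.getElem?_map]
  cases f.labels[p]? with
  | none => simp
  | some a => simp [a.2.le]

theorem spinePos_le (a : ℕ) : (spinePos 0 I.frames).getD a 0 ≤ 2 * I.whole.size := by
  by_cases ha : a < I.frames.length
  · have ha' : a < (spineTrees I.frames I.bottom).length := by rwa [length_spineTrees]
    obtain ⟨⟨r, h1⟩, -⟩ := suffix_spinePos I.frames I.bottom a _ _
      (List.getElem?_eq_getElem (by rwa [length_spinePos])) (List.getElem?_eq_getElem ha')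
    have := suffix_bound h1
    rw [List.getD_eq_getElem _ _ (by rwa [length_spinePos])]
    change _ ≤ 2 * (plug I.frames I.bottom).size
    omega
  · rw [List.getD_eq_default _ _ (by rw [length_spinePos]; omega)]
    omega

theorem inputs_le (hx : x ≤ I.frames.length) (h4 : I.innerEnd ≤ 2 * I.whole.size) (q a : ℕ) :
    inputs I T₂ x q a ≤ 2 * I.whole.size + 2 * T₂.size + σ := by
  have h1 : I.frames.length ≤ I.whole.size := length_le_size_plug ..
  have h3 : I.innerEnd = I.innerStart + 2 * I.inner.size := rfl
  have hT : T₂.size = T₂.toForest.size := rfl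
  match q with
  | 0 =>
    simp only [inputs]
    match a with
    | 0 => simp; omega
    | 1 => simp; omega
    | 2 => simp; omega
    | 3 => simp; omega
    | 4 => simp; omega
    | 5 => simp; omega
    | a + 6 => simp
  | 1 => exact (spinePos_le a).trans (by omega)
  | 2 => exact (partners_getD_le _ _).trans (by omega)
  | 3 => exact (label_lt _ _).trans (by omega)
  | 4 => exact (partners_getD_le _ _).trans (by omega)
  | 5 => exact (label_lt _ _).trans (by omega)
  | q + 6 => exact Nat.zero_le _

/-- The forest with a hole that belongs to an instance of the problem. -/
structure Hole.Of (X : Hole (Fin σ)) (I : SyncPair (Fin σ)) (x : ℕ) (U : OTree (Fin σ)) :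
    Prop where
  F : X.F = I.whole
  inner : X.inner = I.inner
  A : X.A = I.innerStart
  top : X.top = (spinePos 0 I.frames).getD (x - 1) 0
  label : X.label = U.label
  kids : X.kids = U.kids
  one_le : 1 ≤ x
  le_length : x ≤ I.frames.length
  length_sub_le : I.frames.length - x ≤ X.H
  M1_add_two_le : X.M1 + 2 ≤ 2 * (I.whole.size - I.inner.size)
  spine : ∀ p a c r, X.F.suffix p = cons a c r → X.lo ≤ p → X.IsSpine p c →
    ∃ y, x < y ∧ y ≤ I.frames.length ∧ (spinePos 0 I.frames).getD (y - 1) 0 = p ∧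
      I.sub? y = some ⟨a, c⟩
  spine' : ∀ y, x < y → y ≤ I.frames.length → ∃ T r, I.sub? y = some T ∧
    X.F.suffix ((spinePos 0 I.frames).getD (y - 1) 0) = cons T.label T.kids r ∧
    X.lo ≤ (spinePos 0 I.frames).getD (y - 1) 0 ∧
    X.IsSpine ((spinePos 0 I.frames).getD (y - 1) 0) T.kids

namespace Hole.Of

variable {X : Hole (Fin σ)} {U : OTree (Fin σ)} (h : X.Of I x U)

include h

theorem innerEnd : I.innerEnd = X.B := by
  rw [SyncPair.innerEnd, ← h.A, ← h.inner]; rfl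

theorem hi_lt : X.hi < 2 * I.whole.size := by
  have h1 := suffix_bound X.suffix_top
  rw [h.F] at h1
  have h2 : X.hi = X.top + 1 + 2 * X.kids.size := rfl
  omega

theorem inp_lt (q a : ℕ) : (loopEnv I T₂ x).inp q a + 16 < (loopEnv I T₂ x).W := by
  have h1 := h.hi_lt
  have h2 := X.B_le_hi
  have h3 := inputs_le (T₂ := T₂) h.le_length (by rw [h.innerEnd]; omega) q a
  change inputs I T₂ x q a + 16 < 16 * (I.whole.size + T₂.size + σ + 2)
  omega

end Hole.Of

end

namespace Loop

open TED.Loop.Expr TED.Loop.Cmd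

variable {σ : ℕ} {I : SyncPair (Fin σ)} {T₂ : OTree (Fin σ)} {x : ℕ} {X : Hole (Fin σ)}
  {U : OTree (Fin σ)} {D : ℕ}

/-- The values of the parameters. -/
structure Params (I : SyncPair (Fin σ)) (T₂ : OTree (Fin σ)) (x : ℕ) (X : Hole (Fin σ))
    (s : St D) : Prop where
  n2 : s.var .n2 = 2 * T₂.toForest.size
  D : s.var .D = 2 * T₂.toForest.size + 1
  K : s.var .K = I.frames.length - x
  A : s.var .A = X.A
  B : s.var .B = X.B
  lo : s.var .lo = X.lo
  H : s.var .H = X.H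
  M1 : s.var .M1 = X.M1
  M : s.var .M = X.M1 + 1
  sd : s.var .sd = X.M1 + 2
  x : s.var .x = x

theorem params_spec (h : X.Of I x U) (s : St D) :
    Spec (loopEnv I T₂ x) Prog.params s 1000 (Params I T₂ x X) := by
  have h1 := h.hi_lt
  have h2 := X.B_le_hi
  have h3 := X.lo_add_H
  have h4 : X.M1 = X.H + (X.hi - X.B) := rfl
  have h5 := X.A_le_B
  have h6 : X.lo = X.top + 1 := rfl
  have h7 := h.one_le
  have h8 := h.le_length
  have i1 : (loopEnv I T₂ x).inp 0 1 = T₂.toForest.size := rfl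
  have i2 : (loopEnv I T₂ x).inp 0 2 = I.frames.length := rfl
  have i3 : (loopEnv I T₂ x).inp 0 3 = x := rfl
  have i4 : (loopEnv I T₂ x).inp 0 4 = X.A := h.A.symm
  have i5 : (loopEnv I T₂ x).inp 0 5 = X.B := h.innerEnd
  have i6 : (loopEnv I T₂ x).inp 1 (x - 1) = X.top := h.top.symm
  have i7 : (loopEnv I T₂ x).inp 2 X.top = X.hi := by
    change (I.whole.partners 0).getD X.top 0 = _
    have := X.suffix_top
    rw [h.F] at this
    rw [partners_open this]
    simp [Hole.hi]; omega
  have hl : I.frames.length ≤ I.whole.size := length_le_size_plug ..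
  have hW : (loopEnv I T₂ x).W = 16 * (I.whole.size + T₂.toForest.size + σ + 2) := rfl
  refine (Spec.of_wp ?_).mono (by decide) fun _ h => h
  simp only [Prog.params, block, wp, safe_mul, safe_inp, safe_lit, safe_add, safe_sub, safe_var,
    eval_mul, eval_inp, eval_lit, eval_add, eval_sub, eval_var, St.setVar_var, reduceCtorEq,
    if_true, if_false, i1, i2, i3, i4, i5, i6, true_and, Nat.add_sub_cancel, i7]
  refine ⟨by omega, by omega, by omega, by omega, by omega, by omega, by omega, by omega, by omega,
    by omega, by omega, by omega, ?_⟩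
  constructor <;> simp only [St.setVar_var, reduceCtorEq, if_true, if_false] <;> omega

theorem outline_spec (h : X.Of I x U) {s : St D} (hs : Params I T₂ x X s)
    (hC : ∀ k, s.arr .C k 0 0 = 0) :
    Spec (loopEnv I T₂ x) Prog.outline s (2000 * (X.M1 + 1)) (fun s' =>
      (∀ k < X.M1, s'.arr .C k 0 0 = X.pack (inputs I T₂ x 2 (X.posL k)) ∧
        s'.arr .Lb k 0 0 = inputs I T₂ x 3 (X.posL k)) ∧
      ∀ k, X.M1 ≤ k → s'.arr .C k 0 0 = 0) := by
  have h1 := h.hi_lt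
  have h2 := X.B_le_hi
  have h3 := X.lo_add_H
  have h4 : X.M1 = X.H + (X.hi - X.B) := rfl
  have h5 := X.A_le_B
  have hW : (loopEnv I T₂ x).W = 16 * (I.whole.size + T₂.toForest.size + σ + 2) := rfl
  have hN : (loopEnv I T₂ x).N = 16 * (I.whole.size + T₂.toForest.size) + 16 := rfl
  have hi := h.inp_lt (T₂ := T₂)
  refine (Spec.loop_frame hs.M1 (fun t s' => (∀ k < t,
      s'.arr .C k 0 0 = X.pack (inputs I T₂ x 2 (X.posL k)) ∧
        s'.arr .Lb k 0 0 = inputs I T₂ x 3 (X.posL k)) ∧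
      ∀ k, X.M1 ≤ k → s'.arr .C k 0 0 = 0) (1000 + 900) ?_ ?_).mono (by omega) fun _ h => h
  · exact ⟨fun k hk => absurd hk (Nat.not_lt_zero k), fun k _ => hC k⟩
  · intro t s1 ht hu f1 ⟨I1, I2⟩
    have hH : s1.var .H = X.H := by rw [f1.var _ (by decide), hs.H]
    have hA : s1.var .A = X.A := by rw [f1.var _ (by decide), hs.A]
    have hB : s1.var .B = X.B := by rw [f1.var _ (by decide), hs.B]
    have hlo : s1.var .lo = X.lo := by rw [f1.var _ (by decide), hs.lo]
    refine (Spec.bind (T := 900) (T' := 1000) (Q := fun s2 => s2.var .q = X.posL t)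
      ((Spec.of_wp ?_).mono (by decide) fun _ h => h) fun s2 f2 h6 =>
        (Spec.of_wp ?_).mono (by decide) fun _ h => h).mono (by omega) fun _ h => h
    · simp only [wp, safe_var, safe_add, safe_sub, eval_var, eval_add, eval_sub, hu, hH, hlo, hB,
        St.setVar_var, if_true, true_and]
      refine ⟨fun h6 => ⟨by omega, ?_⟩, fun h6 => ⟨by omega, ?_⟩⟩
      · rw [X.posL_lt h6]
      · rw [X.posL_ge (by omega)]
    · have ht2 : s2.var .t = t := by rw [f2.var _ (by decide), hu]
      have hH2 : s2.var .H = X.H := by rw [f2.var _ (by decide), hH]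
      have hA2 : s2.var .A = X.A := by rw [f2.var _ (by decide), hA]
      have hB2 : s2.var .B = X.B := by rw [f2.var _ (by decide), hB]
      have hlo2 : s2.var .lo = X.lo := by rw [f2.var _ (by decide), hlo]
      have hC2 : s2.arr .C = s1.arr .C := f2.arr _ (by decide)
      have hL2 : s2.arr .Lb = s1.arr .Lb := f2.arr _ (by decide)
      have i2 := hi 2 (X.posL t)
      have i3 := hi 3 (X.posL t)
      have key : ∀ v w, v = X.pack (inputs I T₂ x 2 (X.posL t)) →
          w = inputs I T₂ x 3 (X.posL t) →
          (∀ k < t + 1, update3 (s1.arr .C) t 0 0 v k 0 0 =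
              X.pack (inputs I T₂ x 2 (X.posL k)) ∧
            update3 (s1.arr .Lb) t 0 0 w k 0 0 = inputs I T₂ x 3 (X.posL k)) ∧
          ∀ k, X.M1 ≤ k → update3 (s1.arr .C) t 0 0 v k 0 0 = 0 := by
        intro v w hv hw
        refine ⟨fun k hk => ?_, fun k hk => ?_⟩
        · rcases (show k ≤ t by omega).eq_or_lt with rfl | hk
          · simp [update3, hv, hw]
          · simp only [update3, and_self, and_true, if_neg hk.ne]
            exact I1 k hk
        · rw [update3, if_neg (by omega)]
          exact I2 k hk
      change (loopEnv I T₂ x).inp 2 (X.posL t) + 16 < _ at i2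
      simp only [block, wp, safe_var, safe_add, safe_sub, safe_inp, safe_lit, eval_lit, eval_inp,
        eval_var, eval_add, eval_sub, ht2, hH2, hlo2, hB2, hA2, h6, hC2, hL2, St.setVar_var,
        St.setVar_arr, St.setArr_arr, St.setArr_var, reduceCtorEq, if_true, if_false, true_and]
      refine ⟨by omega, fun h7 => ⟨by omega, by omega, by omega, by omega, by omega, by omega,
        by omega, by omega, key _ _ ?_ rfl⟩, fun h7 => ⟨by omega, by omega, by omega, by omega,
        by omega, by omega, by omega, by omega, key _ _ ?_ rfl⟩⟩
      · exact (if_pos h7).symm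
      · exact (if_neg h7).symm

theorem spine_spec (h : X.Of I x U) {s : St D} (hs : Params I T₂ x X s)
    (hS : ∀ k, s.arr .S k 0 0 = 0) :
    Spec (loopEnv I T₂ x) Prog.spine s (2000 * (X.M1 + 1)) (fun s' =>
      (∀ y, x < y → y ≤ I.frames.length → s'.arr .S (inputs I T₂ x 1 (y - 1) - X.lo) 0 0 = y) ∧
      ∀ k, s'.arr .S k 0 0 ≠ 0 → ∃ y, x < y ∧ y ≤ I.frames.length ∧
        k = inputs I T₂ x 1 (y - 1) - X.lo) := by
  have h1 := h.length_sub_le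
  have h2 := X.H_le_M1
  have hl : I.frames.length ≤ I.whole.size := length_le_size_plug ..
  have hW : (loopEnv I T₂ x).W = 16 * (I.whole.size + T₂.toForest.size + σ + 2) := rfl
  have hN : (loopEnv I T₂ x).N = 16 * (I.whole.size + T₂.toForest.size) + 16 := rfl
  refine (Spec.loop_frame hs.K (fun t s' =>
      (∀ y, x < y → y ≤ x + t → s'.arr .S (inputs I T₂ x 1 (y - 1) - X.lo) 0 0 = y) ∧
      ∀ k, s'.arr .S k 0 0 ≠ 0 → ∃ y, x < y ∧ y ≤ x + t ∧
        k = inputs I T₂ x 1 (y - 1) - X.lo) 1000 ?_ ?_).mono ?_ ?_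
  · exact ⟨fun y h1 h2 => absurd h2 (by omega), fun k hk => absurd (hS k) hk⟩
  · intro t s1 ht hu f1 ⟨I1, I2⟩
    have hlo : s1.var .lo = X.lo := by rw [f1.var _ (by decide), hs.lo]
    have hx : s1.var .x = x := by rw [f1.var _ (by decide), hs.x]
    obtain ⟨T, r, -, h3, h4, -⟩ := h.spine' (x + t + 1) (by omega) (by omega)
    have h5 := suffix_bound h3
    rw [h.F] at h5
    have e1 : (loopEnv I T₂ x).inp 1 (x + t) =
        (spinePos 0 I.frames).getD (x + t + 1 - 1) 0 := rfl
    refine (Spec.of_wp ?_).mono (by decide) fun _ h => h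
    simp only [wp, safe_var, safe_add, safe_sub, safe_inp, safe_lit, eval_lit, eval_inp,
      eval_var, eval_add, eval_sub, hu, hlo, hx, St.setVar_arr, St.setArr_arr, if_true, true_and,
      e1]
    refine ⟨by omega, by omega, by omega, by omega, fun y hy hy' => ?_, fun k hk => ?_⟩
    · rcases (show y ≤ x + t + 1 by omega).eq_or_lt with rfl | hlt
      · exact if_pos ⟨rfl, rfl, rfl⟩
      · obtain ⟨-, -, -, -, h6, -⟩ := h.spine' y hy (by omega)
        -- Different spine nodes have different positions, so the new name does not overwrite an
        -- earlier one.
        have h7 := spinePos_lt I.frames (y - 1) (x + t + 1 - 1)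
          ((spinePos 0 I.frames).getD (y - 1) 0) ((spinePos 0 I.frames).getD (x + t + 1 - 1) 0)
          (by omega)
          (by rw [List.getElem?_eq_getElem (by rw [length_spinePos]; omega),
                List.getD_eq_getElem])
          (by rw [List.getElem?_eq_getElem (by rw [length_spinePos]; omega),
                List.getD_eq_getElem])
        have h8 : inputs I T₂ x 1 (y - 1) = (spinePos 0 I.frames).getD (y - 1) 0 := rfl
        rw [update3, if_neg (by omega)]
        exact I1 y hy (by omega)
    · unfold update3 at hk
      split at hk
      · next h6 => exact ⟨x + t + 1, by omega, by omega, h6.1⟩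
      · obtain ⟨y, h6, h7, h8⟩ := I2 k hk
        exact ⟨y, h6, by omega, h8⟩
  · generalize X.M1 = m at *
    nlinarith
  · intro s' ⟨h3, h4⟩
    refine ⟨fun y hy hy' => h3 y hy (by omega), fun k hk => ?_⟩
    obtain ⟨y, h5, h6, h7⟩ := h4 k hk
    exact ⟨y, h5, by have := h.le_length; omega, h7⟩

end Loop

end TED

/-! ### The whole program -/

namespace TED

open Forest

section

variable {σ : ℕ} {I : SyncPair (Fin σ)} {T₂ : OTree (Fin σ)} {x : ℕ}

/-- A similarity to a slice of `T₂` is at most twice the size of the slice, hence at most its length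
in positions. The remaining unit is the shift of the encoding. -/
theorem encode_knownMats_le (h : ℕ) (i j : Fin (matDim T₂)) :
    encode (knownMats I T₂ x h i j) ≤ 2 * T₂.toForest.size + 1 := by
  have hD : matDim T₂ = 2 * T₂.toForest.size + 1 := rfl
  have hbot : encode (Mat.bot (matDim T₂) i j) ≤ 2 * T₂.toForest.size + 1 := by
    rw [Mat.bot, encode_bot]; exact Nat.zero_le _
  have hi := i.2
  have hj := j.2
  unfold knownMats
  split
  · unfold simMat
    split
    · next hij =>
      rw [encode_coe]
      have h1 := sim_le_right I.inner (T₂.toForest.slice i j)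
      have h2 := two_mul_slice_size_le (F := T₂.toForest) (Fin.le_def.1 hij)
      omega
    · rw [encode_bot]; exact Nat.zero_le _
  · split
    · cases I.sub? h with
      | none => exact hbot
      | some T =>
        change encode (restrictedSimMat T₂ T i j) ≤ _
        rcases restrictedSimMat_eq (T₂ := T₂) (T := T) (i := i) (j := j) with
          h' | ⟨p, a, c, r, h1, h2, h3, h4⟩
        · rw [h', encode_bot]; exact Nat.zero_le _
        · rw [h4, encode_coe]
          have := sim_le_right T.kids c
          have := eta_le T.label a
          omega
    · exact hbot

end

namespace Loop

open TED.Loop.Expr TED.Loop.Cmd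

variable {σ : ℕ} {I : SyncPair (Fin σ)} {T₂ : OTree (Fin σ)} {x : ℕ} {X : Hole (Fin σ)}
  {U : OTree (Fin σ)}

theorem Params.of_frame {D : ℕ} {c : Cmd} {s s' : St D} (h : Params I T₂ x X s)
    (hf : Frame c s s') (h1 : ∀ y ∈ [Var.n2, .D, .K, .A, .B, .lo, .H, .M1, .M, .sd, .x],
      y ∉ c.mods) : Params I T₂ x X s' := by
  simp only [List.mem_cons, List.not_mem_nil, or_false, forall_eq_or_imp, forall_eq] at h1
  obtain ⟨g1, g2, g3, g4, g5, g6, g7, g8, g9, g10, g11⟩ := h1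
  exact ⟨by rw [hf.var _ g1, h.n2], by rw [hf.var _ g2, h.D], by rw [hf.var _ g3, h.K],
    by rw [hf.var _ g4, h.A], by rw [hf.var _ g5, h.B], by rw [hf.var _ g6, h.lo],
    by rw [hf.var _ g7, h.H], by rw [hf.var _ g8, h.M1], by rw [hf.var _ g9, h.M],
    by rw [hf.var _ g10, h.sd], by rw [hf.var _ g11, h.x]⟩

/-- The state at the beginning. -/
noncomputable def start (I : SyncPair (Fin σ)) (T₂ : OTree (Fin σ)) (x : ℕ) : St (matDim T₂) where
  var _ := 0
  arr _ _ _ _ := 0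
  mat := knownMats I T₂ x

/-- The time of the program. -/
def timeBound (M n w : ℕ) : ℕ :=
  1000 + (2000 * M + (2000 * M + (30000 * (M * M * (w + 2 * n)) + 3 +
    (9000 * (M * M * (2 * n + 1)) + (9000 * (M * (2 * n + 1)) + (9000 * (M * M * (2 * n)) + 3))))))

theorem timeBound_le {M n w l : ℕ} (hM : 1 ≤ M) (hn : 1 ≤ n) (hw : w ≤ n * l) :
    timeBound M n w ≤ 200000 * (n * (M * M) * (l + 1)) := by
  have h1 : M ≤ n * (M * M) := by nlinarith
  have h2 : M * M ≤ n * (M * M) := by nlinarith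
  have h3 : M * n ≤ n * (M * M) := by nlinarith
  have h4 : M * M * w ≤ n * (M * M) * l := by
    calc M * M * w ≤ M * M * (n * l) := Nat.mul_le_mul_left _ hw
      _ = n * (M * M) * l := by ring
  unfold timeBound
  generalize hX : n * (M * M) = X at *
  have h5 : M * M * n = X := by rw [← hX]; ring
  have e1 : M * M * (w + 2 * n) = M * M * w + 2 * X := by rw [← h5]; ring
  have e2 : M * M * (2 * n + 1) = 2 * X + M * M := by rw [← h5]; ring
  have e3 : M * (2 * n + 1) = 2 * (M * n) + M := by ring
  have e4 : M * M * (2 * n) = 2 * X := by rw [← h5]; ring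
  have e5 : X * (l + 1) = X * l + X := by ring
  rw [e1, e2, e3, e4, e5]
  omega

/-- The phases are chained: the arrays filled from the input define data that fit the forest with a
hole, and the tables computed from them satisfy the hypotheses of `Fits.best_eq` at every node of
`T₂`. -/
theorem main_spec (h : X.Of I x U) :
    Spec (loopEnv I T₂ x) Prog.main (start I T₂ x)
      (timeBound (X.M1 + 1) T₂.toForest.size T₂.toForest.mergeWork)
      (fun s' => s'.mat x = restrictedSimMat T₂ U) := by
  have h1lt := h.hi_lt
  have hM1 : X.M1 = X.H + (X.hi - X.B) := rfl
  have hlA := X.lo_add_H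
  have hAB := X.A_le_B
  have hBh := X.B_le_hi
  have hlo : X.lo = X.top + 1 := rfl
  refine Spec.bind (params_spec h _) fun s1 f1 p1 => ?_
  have arr1 : ∀ q i j k, s1.arr q i j k = 0 := fun q i j k => by
    rw [f1.arr q (by simp [Prog.params, amods, block])]
    rfl
  refine Spec.bind (outline_spec h p1 fun k => arr1 _ _ _ _) fun s2 f2 ⟨o1, o2⟩ => ?_
  have p2 := p1.of_frame f2 (by decide)
  refine Spec.bind (spine_spec h p2 fun k => by rw [f2.arr _ (by decide), arr1]) fun s3 f3
    ⟨q1, q2⟩ => ?_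
  have p3 := p2.of_frame f3 (by decide)
  have m3 : s3.mat = knownMats I T₂ x := by rw [f3.mat rfl, f2.mat rfl, f1.mat rfl]; rfl
  have C3 : s3.arr .C = s2.arr .C := f3.arr _ (by decide)
  have Lb3 : s3.arr .Lb = s2.arr .Lb := f3.arr _ (by decide)
  have arr3 : ∀ q ∈ [Arr.V, .RB], ∀ i j k, s3.arr q i j k = 0 := by
    intro q hq i j k
    simp only [List.mem_cons, List.not_mem_nil, or_false] at hq
    rcases hq with rfl | rfl <;> rw [f3.arr _ (by decide), f2.arr _ (by decide), arr1]
  -- The abstract data are read off the state after the input phases. A nonzero value of `S` names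
  -- the known matrix of the spine node opened there.
  let d : Data (Fin σ) :=
    { T := T₂.toForest
      M1 := X.M1
      C := fun k => s3.arr .C k 0 0
      S := fun k => s3.arr .S k 0 0
      sv := fun k p => entry (knownMats I T₂ x (s3.arr .S k 0 0)) p (inputs I T₂ x 4 p + 1) - 1
      et := fun k p => if s3.arr .Lb k 0 0 = inputs I T₂ x 5 p then 2 else 1 }
  have in4 : ∀ p a c r, T₂.toForest.suffix p = cons a c r →
      inputs I T₂ x 4 p = p + 2 * c.size + 1 := fun p a c r hs => partners_open hs
  have in5 : ∀ p a c r, T₂.toForest.suffix p = cons a c r → inputs I T₂ x 5 p = a := by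
    intro p a c r hs
    simp [inputs, List.getD_eq_getElem?_getD, labels_open hs]
  have dsv : ∀ k p a c r, T₂.toForest.suffix p = cons a c r →
      d.sv k p = entry (knownMats I T₂ x (d.S k)) p (p + 2 * c.size + 2) - 1 := by
    intro k p a c r hs
    change entry _ p (inputs I T₂ x 4 p + 1) - 1 = _
    rw [in4 p a c r hs]
  have hX : Fits X d := by
    refine fits_of_inputs (T₂ := T₂) h.F h.spine h.spine' rfl rfl (fun k hk => ?_) q1 q2 dsv
      (fun k hk p => ?_)
    · change s3.arr .C k 0 0 = _
      rw [C3]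
      exact (o1 k hk).1
    · change (if s3.arr .Lb k 0 0 = _ then 2 else 1) = _
      rw [Lb3, (o1 k hk).2]
  have hC_le : ∀ k < X.M1, d.C k ≤ X.M1 := by
    intro k hk
    cases hs : X.F.suffix (X.posL k) with
    | nil => exact (hX.C_close k hk hs).trans hk.le
    | cons a c r =>
      by_cases hn : X.IsSpine (X.posL k) c
      · exact (hX.spine hk hs hn).2.2.1.le
      · exact (hX.plain hk hs hn).2.1.le
  have hN : (loopEnv I T₂ x).N = 16 * (I.whole.size + T₂.toForest.size) + 16 := rfl
  have hW : (loopEnv I T₂ x).W = 16 * (I.whole.size + T₂.toForest.size + σ + 2) := rfl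
  have hD : matDim T₂ = 2 * T₂.toForest.size + 1 := rfl
  have dM1 : d.M1 = X.M1 := rfl
  have dT : d.T = T₂.toForest := rfl
  have ctx : Ctx (loopEnv I T₂ x) (matDim T₂) d X.H := by
    constructor
    · rfl
    · exact in4
    · intro p hs
      change (T₂.toForest.partners 0).getD p 0 ≤ p
      by_cases hp : p < 2 * T₂.toForest.size
      · exact (partners_close hp hs).le
      · rw [List.getD_eq_default _ _ (by rw [length_partners]; omega)]
        exact Nat.zero_le _
    · intro k p
      change (if _ then 2 else 1) ≤ 2
      split <;> omega
    · intro k p a c r hs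
      rw [dsv k p a c r hs]
      exact knownMats_le _ hs
    · exact X.H_le_M1
    · rw [dM1, dT, hN]; omega
    · intro k
      rw [dM1, hN]
      by_cases hk : k < X.M1
      · have := hC_le k hk
        omega
      -- The bound is demanded for every index; cells beyond `M1` are never written and keep their
      -- initial zero.
      · have : d.C k = 0 := by
          change s3.arr .C k 0 0 = 0
          rw [C3]
          exact o2 k (by omega)
        omega
    · exact hC_le
    · rw [hN, hW]; omega
    · intro q a
      have := h.inp_lt (T₂ := T₂) q a
      omega
  have pre3 : Pre (loopEnv I T₂ x) d X.H s3 :=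
    ⟨p3.n2, p3.D, p3.M1, p3.M, p3.sd, p3.H, fun _ => rfl, fun _ => rfl,
      fun k p a c r hs => by rw [m3]; exact dsv k p a c r hs, fun _ _ => rfl⟩
  refine Spec.bind (table_spec ctx pre3 (arr3 _ (by simp))) fun s4 f4 hV => ?_
  have pre4 := pre3.of_frame f4 (by decide) (by decide) rfl
  refine Spec.bind (ends_spec ctx hV pre4 rfl) fun s5 f5 ⟨hL, hLle⟩ => ?_
  have pre5 := pre4.of_frame f5 (by decide) (by decide) rfl
  refine Spec.bind (starts_spec ctx pre5 rfl hLle fun i j k => by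
    rw [f5.arr _ (by decide), f4.arr _ (by decide), arr3 _ (by simp)]) fun s6 f6 hR => ?_
  have pre6 := pre5.of_frame f6 (by decide) (by decide) rfl
  have m6 : s6.mat = knownMats I T₂ x := by rw [f6.mat rfl, f5.mat rfl, f4.mat rfl, m3]
  have hF : Final d (s4.arr .V) (s5.arr .LA) (s6.arr .RB) (knownMats I T₂ x 0) X.lo x s6 := by
    constructor
    · rw [f6.arr _ (by decide), f5.arr _ (by decide)]
    · rw [f6.arr _ (by decide)]
    · rfl
    · rw [f6.var _ (by decide), f5.var _ (by decide), f4.var _ (by decide), p3.lo]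
    · rw [f6.var _ (by decide), f5.var _ (by decide), f4.var _ (by decide), p3.x]
    · rw [m6]
  have hRle : ∀ j ≤ 2 * d.T.size, ∀ t ≤ d.M1, s6.arr .RB j t 0 ≤ 2 * d.T.size + 1 :=
    fun j hj t ht => (hR j hj t ht).le
  let G : ℕ → ℕ := fun p => match T₂.toForest.suffix p with
    | nil => 0
    | cons a c _ => sim U.kids c + eta U.label a
  have hGs : ∀ p a c r, T₂.toForest.suffix p = cons a c r →
      G p = sim U.kids c + eta U.label a := by
    intro p a c r hs
    simp only [G, hs]
  have hx1 := h.one_le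
  refine (answer_spec ctx hV hLle hRle (fun i j => ?_) G (fun p a c r hs best hb => ?_)
    pre6.n2 pre6.M pre6.M1 hF (by omega) (fun i j => ?_)).mono le_rfl fun s' ⟨r1, r2⟩ => ?_
  · unfold entry
    split
    · exact encode_knownMats_le ..
    · exact Nat.zero_le _
  · have hsim : ∀ i ≤ d.M1, ∀ j ≤ d.M1,
        s5.arr .LA 0 (p + 1) i < s6.arr .RB (p + 1 + 2 * c.size) j 0 →
        pairVal (s5.arr .LA) (s6.arr .RB) (knownMats I T₂ x 0) (p + 1) (p + 1 + 2 * c.size) i j =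
        i + j + sim X.inner (d.T.slice (s5.arr .LA 0 (p + 1) i)
          (s6.arr .RB (p + 1 + 2 * c.size) j 0 - 1)) := by
      intro i hi j hj hij
      have hb := suffix_bound hs
      have := hRle (p + 1 + 2 * c.size) (by omega) j hj
      unfold pairVal
      rw [knownMats_zero (by omega) (by rw [← dT]; omega), Nat.add_sub_cancel, h.inner]
    have hbest := hX.best_eq hV hL (R := s6.arr .RB) (fun j hj t ht => by
      have := hR j hj t ht
      simp only [IsLast, Nat.lt_succ_iff] at this
      exact this) hs hb.base_le
      (fun i hi j hj hij => by rw [← hsim i hi j hj hij]; exact hb.le i hi j hj trivial hij)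
      (by
        refine hb.eq.imp_right ?_
        rintro ⟨i, hi, j, hj, hij, he⟩
        exact ⟨i, hi, j, hj, hij, by rw [← hsim i hi j hj hij]; exact he⟩)
    rw [hbest, h.kids, hGs p a c r hs, eta]
    have htop := X.suffix_top
    rw [h.F] at htop
    have e1 : (loopEnv I T₂ x).inp 3 (X.lo - 1) = U.label := by
      rw [hlo, Nat.add_sub_cancel]
      simp [loopEnv, inputs, List.getD_eq_getElem?_getD, labels_open htop, h.label]
    have e2 : (loopEnv I T₂ x).inp 5 p = a := in5 p a c r hs
    rw [e1, e2]
    simp only [Fin.val_inj]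
  -- Only names strictly above `x` are known at the start, so the matrix named `x` is all `-∞` and
  -- can receive the answer.
  · rw [m6, knownMats, if_neg (by omega), if_neg (lt_irrefl _)]
    rfl
  · refine eq_restrictedSimMat (fun p a c r hs i j hi hj => ?_) (fun i j => ?_)
    · rw [← hGs p a c r hs]
      exact r1 p a c r hs i j hi hj
    · rcases r2 i j with h' | ⟨p, a, c, r, g1, g2, g3, g4⟩
      · exact .inl h'
      · exact .inr ⟨p, a, c, r, g1, g2, g3, by rw [g4, hGs p a c r g1]⟩

end Loop

end TED

/-! ### The compiled program and its running time -/

namespace TED.Loop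

/-- The instructions that compute the bound for the indices of arrays. -/
def prologue : List Instr := [.const 64 0, .read 64 0 64, .const 65 1, .read 65 0 65,
  .arith .add 64 64 65, .const 65 16, .arith .mul 64 64 65, .arith .add 0 64 65]

/-- The compiled program. -/
def program : List Instr := prologue ++ (Prog.main.comp 8 ++ [.halt])

theorem codeAt_program : CodeAt program 0 program := fun k c hk => by rwa [Nat.zero_add]

variable {σ : ℕ} {I : SyncPair (Fin σ)} {T₂ : OTree (Fin σ)} {x : ℕ}

theorem prologue_spec {B : ℕ} (hB : (loopEnv I T₂ x).W ≤ B) :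
    ∃ g, Reaches B (inputs I T₂ x) program 8 (initial I T₂ x) g ∧
      Rel (loopEnv I T₂ x).N (start I T₂ x) g ∧ g.pc = 8 := by
  have hW : (loopEnv I T₂ x).W = 16 * (I.whole.size + T₂.size + σ + 2) := rfl
  have hc : CodeAt program 0 (prologue ++ _) := codeAt_program
  simp only [prologue, List.cons_append] at hc
  have i0 : inputs I T₂ x 0 0 = I.whole.size := rfl
  have i1 : inputs I T₂ x 0 1 = T₂.size := rfl
  have h0 := reaches_const (s := initial I T₂ x) (B := B) (inp := inputs I T₂ x) hc.head (by omega)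
  have h1 := h0.trans (reaches_read hc.tail.head (by
    simp [Config.setReg, Config.next]; omega))
  have h2 := h1.trans (reaches_const hc.tail.tail.head (by omega))
  have h3 := h2.trans (reaches_read hc.tail.tail.tail.head (by
    simp [Config.setReg, Config.next]; omega))
  have h4 := h3.trans (reaches_arith hc.tail.tail.tail.tail.head (by
    simp [Config.setReg, Config.next, BinOp.eval]; omega))
  have h5 := h4.trans (reaches_const hc.tail.tail.tail.tail.tail.head (by omega))
  have h6 := h5.trans (reaches_arith hc.tail.tail.tail.tail.tail.tail.head (by
    simp [Config.setReg, Config.next, BinOp.eval]; omega))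
  have h7 := h6.trans (reaches_arith hc.tail.tail.tail.tail.tail.tail.tail.head (by
    simp [Config.setReg, Config.next, BinOp.eval]; omega))
  refine ⟨_, h7, ⟨?_, ?_, ?_, ?_⟩, rfl⟩
  · simp [Config.setReg, Config.next, BinOp.eval, loopEnv, i0, i1]
    omega
  · intro y
    have h0 := y.code_pos
    have h1 := y.code_lt
    simp [Config.setReg, Config.next, start, initial, h0.ne',
      show y.code ≠ 64 by omega, show y.code ≠ 65 by omega]
  · intro q i j k _ _ _
    rfl
  · rfl

theorem program_correct {U : OTree (Fin σ)} (hU : I.sub? x = some U) :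
    HaltsWithin ((I.whole.size + T₂.size + σ + 2) ^ (5 * (Prog.main.sz + 4))) (inputs I T₂ x)
      program (fun s => s.mat x = restrictedSimMat T₂ U)
      (1000000 * T₂.size * (I.whole.size - I.inner.size) ^ 2 * (Nat.log 2 T₂.size + 1) ^ 1)
      (initial I T₂ x) := by
  set b := I.whole.size + T₂.size + σ + 2 with hb
  set B := b ^ (5 * (Prog.main.sz + 4)) with hB
  obtain ⟨X, h1, h2, h3, h4, h5, h6, h7, h8, h9, h10, h11, h12⟩ := I.exists_hole hU
  have hX : X.Of I x U := ⟨h1, h2, h3, h4, h5, h6, h7, h8, h9, h10, h11, h12⟩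
  have hT : T₂.size = T₂.toForest.size := rfl
  have hn : 1 ≤ T₂.toForest.size := by simp [OTree.toForest]
  have hW : (loopEnv I T₂ x).W = 16 * b := rfl
  -- As `b` is at least 2, the factor 16 is absorbed by four more powers of `b`. The exponent of the
  -- word bound combines this 5 with the size of the program and with the power 4 needed for
  -- addresses.
  have hW5 : (loopEnv I T₂ x).W ≤ b ^ 5 := by
    have : 2 ^ 4 ≤ b ^ 4 := Nat.pow_le_pow_left (by omega) 4
    rw [hW, pow_succ b 4]
    exact Nat.mul_le_mul_right _ this
  have hpow : ∀ a ≤ Prog.main.sz + 4, (loopEnv I T₂ x).W ^ a ≤ B := by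
    intro a ha
    rw [hB, pow_mul]
    exact (Nat.pow_le_pow_left hW5 a).trans
      (Nat.pow_le_pow_right (Nat.pow_pos (by omega)) ha)
  have hOk : (loopEnv I T₂ x).Ok := by
    refine ⟨fun q a => ?_, ?_, by omega⟩
    · have := hX.inp_lt (T₂ := T₂) q a
      omega
    · rw [hW]
      change 16 * (I.whole.size + T₂.size) + 16 ≤ _
      omega
  obtain ⟨g, r1, r2, r3⟩ := prologue_spec (I := I) (T₂ := T₂) (x := x) (B := B)
    (by simpa using hpow 1 (by omega))
  obtain ⟨s1, s2, s3⟩ := main_spec (T₂ := T₂) hX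
  have hbd : Bounded (loopEnv I T₂ x).W (start I T₂ x) := by
    refine ⟨fun _ => ?_, fun _ _ _ _ => ?_, fun k i j => ?_⟩
    · change 0 < _; omega
    · change 0 < _; omega
    · have := encode_knownMats_le (I := I) (x := x) k i j
      change encode (knownMats I T₂ x k i j) < _
      omega
  have hc : CodeAt program (0 + prologue.length) (Prog.main.comp 8 ++ [.halt]) :=
    codeAt_program.right
  have hc' : CodeAt program 8 (Prog.main.comp 8 ++ [.halt]) := hc
  obtain ⟨g', r4, r5, r6⟩ := Cmd.comp_correct hOk (hpow 4 (by omega)) Prog.main Prog.main_wf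
    (hpow _ (by omega)) (start I T₂ x) g hbd s1 (by rw [r3]; exact hc'.left) r2
  have hend := hc'.right.head
  rw [Cmd.length_comp, ← r3, ← r6] at hend
  have hfin : HaltsWithin B (inputs I T₂ x) program
      (fun s => s.mat x = restrictedSimMat T₂ U) 0 g' :=
    ⟨hend, by change g'.mat x = _; rw [r5.mat]; exact s3⟩
  refine haltsWithin_mono ?_ (r1.trans r4 _ 0 hfin)
  have htime := timeBound_le (M := X.M1 + 1) (l := Nat.log 2 T₂.toForest.size) (by omega) hn
    T₂.toForest.mergeWork_le
  rw [hT]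
  generalize Nat.log 2 T₂.toForest.size = l at *
  generalize T₂.toForest.size = n at *
  generalize hm : I.whole.size - I.inner.size = m at *
  -- There are at most `2 * m - 2` positions below the top node outside the block. This gives the
  -- factor 4; the constant of the theorem then leaves room for the eight steps of the prologue.
  have hM : (X.M1 + 1) * (X.M1 + 1) ≤ 4 * m ^ 2 := by
    calc (X.M1 + 1) * (X.M1 + 1) ≤ (2 * m) * (2 * m) :=
          Nat.mul_le_mul (by omega) (by omega)
      _ = 4 * m ^ 2 := by ring
  have h13 : n * ((X.M1 + 1) * (X.M1 + 1)) * (l + 1) ≤ 4 * (n * m ^ 2 * (l + 1)) := by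
    have := Nat.mul_le_mul_right (l + 1) (Nat.mul_le_mul_left n hM)
    rw [show n * (4 * m ^ 2) * (l + 1) = 4 * (n * m ^ 2 * (l + 1)) by ring] at this
    exact this
  have h14 : 0 < n * m ^ 2 * (l + 1) := by
    have : 0 < m := by omega
    exact Nat.mul_pos (Nat.mul_pos hn (Nat.pow_pos this)) (Nat.succ_pos l)
  have h15 : 1000000 * n * m ^ 2 * (l + 1) ^ 1 = 1000000 * (n * m ^ 2 * (l + 1)) := by ring
  rw [h15]
  omega

end TED.Loop

theorem mainTheorem9 :
    ∃ (P : List Instr) (C c e : ℕ),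
      ∀ (σ : ℕ) (I : SyncPair (Fin σ)) (T₂ : OTree (Fin σ)) (x : ℕ) (U : OTree (Fin σ)),
        I.sub? x = some U →
          HaltsWithin ((I.whole.size + T₂.size + σ + 2) ^ e) (inputs I T₂ x) P
            (fun s => s.mat x = restrictedSimMat T₂ U)
            (C * T₂.size * (I.whole.size - I.inner.size) ^ 2 * (Nat.log 2 T₂.size + 1) ^ c)
            (initial I T₂ x) :=
  ⟨Loop.program, 1000000, 1, 5 * (Loop.Prog.main.sz + 4),
    fun _ _ _ _ _ hU => Loop.program_correct hU⟩
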